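/- **Theorem 3.** A *conjunctive query* is a pair $\Phi=(\mathcal S,\phi)$ of a finite relational structure $\mathcal S$ with non-empty domain $D$ and a formula $\phi=\exists z_1\cdots\exists z_r\bigwedge_i \alpha_i$ whose $\alpha_i$ are relational atoms; $\mathrm{free}(\phi)$ is its set of free variables, and $\phi(\mathcal S)$ is the set of assignments $a:\mathrm{free}(\phi)\to D$ with $(\mathcal S,a)\models\phi$. Put $$Q(\Phi)=\sum_{a\in\phi(\mathcal S)}\ \prod_{x\in\mathrm{free}(\phi)}X_{a(x)},$$ a polynomial in the variables $X_d$, $d\in D$. The size $\|\Phi\|$ is the length of $\phi$ (one for each quantifier, $1+r$ for each $r$-ary atom) plus $|D|$ plus the number of tuples in the relations of $\mathcal S$. The hypergraph of $\phi$ is $\mathcal H=(V,E)$, where $V$ is the set of variables of $\phi$ and $E$ is the set of the variable sets of its atoms. $\Phi$ is *acyclic* if $\mathcal H$ has a join tree: a finite tree $T$ and a map $\lambda$ from the nodes of $T$ onto $E$ such that for every $v\in V$ the nodes $t$ with $v\in\lambda(t)$ induce a connected (possibly empty) subgraph of $T$. Let $S=\mathrm{free}(\phi)$. The $S$-component of an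 edge $e\not\subseteq S$ consists of all edges $e'\not\subseteq S$ such that there is a path from $e\setminus S$ to $e'\setminus S$ in the induced hypergraph $\mathcal H[V\setminus S]=(V\setminus S,\{f\setminus S: f\in E,\ f\not\subseteq S\})$. The *quantified star size* of $\Phi$ is the largest $k$ such that there are $k$ distinct vertices of $S$, all lying in edges of one and the same $S$-component, no two of which lie in a common edge of $\mathcal H$ ($k=0$ if there is no $S$-component). Algorithms are programs of a random access machine with addition as its only arithmetic operation, under the uniform cost measure. An arithmetic circuit is a directed acyclic graph with a single sink (the output gate), whose gates have fan-in $0$ (labelled by a constant or a variable $X_d$) or fan-in $2$ (labelled $+$ or $\times$). 1. There are an algorithm and a constant $c$ such that, given any acyclic conjunctive query $\Phi$ of quantified star size $k$, the algorithm outputs within $\|\Phi\|^{c\cdot\max(k,1)}$ steps an arithmetic circuit, with natural numbers as constants, which over every field $\mathbb F$ computes the polynomial $Q(\Phi)$. 2. There are an algorithm and a constant $c$ such that, given any acyclic conjunctive query $\Phi$ of quantified star size $k$, the algorithm outputs the number $|\phi(\mathcal S)|$ within $\|\Phi\|^{c\cdot\max(k,1)}$ steps (that is, $\#\mathrm{ACQ}$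 is solvable in time $\|\Phi\|^{O(\max(k,1))}$). -/

import Mathlib

namespace ACQ

/-! ### Hypergraphs, join trees, star size -/

section Hypergraphs

variable {α : Type*}

/-- `(T, lam)` is a join tree of `H`: `T` is a (finite) tree, `lam` maps its nodes onto the edges of
`H`, and for every vertex `v` the nodes whose label contains `v` induce a connected subgraph of `T`
(the empty set of nodes, for a vertex in no edge, is admitted). -/
def IsJoinTree (H : Hypergraph α) {m : ℕ} (T : SimpleGraph (Fin m)) (lam : Fin m → Set α) : Prop :=
  T.IsTree ∧ (∀ t, lam t ∈ H.edgeSet) ∧ (∀ e ∈ H.edgeSet, ∃ t, lam t = e) ∧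
    ∀ v ∈ H.vertexSet, (T.induce {t | v ∈ lam t}).Preconnected

/-- A hypergraph is acyclic if it has a join tree. -/
def IsAcyclic (H : Hypergraph α) : Prop :=
  ∃ (m : ℕ) (T : SimpleGraph (Fin m)) (lam : Fin m → Set α), IsJoinTree H T lam

/-- The induced subhypergraph `H[S] = (S, {e ∩ S | e ∈ E, e ∩ S ≠ ∅})`. -/
def induceVerts (H : Hypergraph α) (S : Set α) : Hypergraph α where
  vertexSet := S
  edgeSet := {f | ∃ e ∈ H.edgeSet, f = e ∩ S ∧ f.Nonempty}
  subset_vertexSet_of_mem_edgeSet' := by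
    rintro f ⟨e, _, rfl, _⟩
    exact Set.inter_subset_right

/-- The subhypergraph `H[E'] = (⋃ E', E')` induced by a set of edges. -/
def ofEdges (E' : Set (Set α)) : Hypergraph α where
  vertexSet := ⋃₀ E'
  edgeSet := E'
  subset_vertexSet_of_mem_edgeSet' := fun _ he => Set.subset_sUnion_of_mem he

/-- There is a path between the vertices `x` and `y`: edges `e₁, …, e_k` with `x ∈ e₁`, `y ∈ e_k`
and `e_i ∩ e_{i+1} ≠ ∅`. -/
def HasPath (H : Hypergraph α) (x y : α) : Prop :=
  ∃ p : List (Set α), (∀ e ∈ p, e ∈ H.edgeSet) ∧ (∃ e ∈ p.head?, x ∈ e) ∧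
    (∃ e ∈ p.getLast?, y ∈ e) ∧ p.IsChain (fun e f => (e ∩ f).Nonempty)

/-- The `S`-component of an edge `e ⊄ S`: the subhypergraph induced by all edges `e' ⊄ S` such that
there is a path from `e - S` to `e' - S` in `H[V - S]`. -/
def sComponent (H : Hypergraph α) (S : Set α) (e : Set α) : Hypergraph α :=
  ofEdges {e' | e' ∈ H.edgeSet ∧ ¬ e' ⊆ S ∧
    ∃ x ∈ e \ S, ∃ y ∈ e' \ S, HasPath (induceVerts H (H.vertexSet \ S)) x y}

/-- There is an `S`-`k`-star in `H`: `k` vertices of `S` in one `S`-component of `H`, such that no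
edge of `H` contains more than one of them. -/
def HasStar (H : Hypergraph α) (S : Set α) (k : ℕ) : Prop :=
  ∃ e ∈ H.edgeSet, ¬ e ⊆ S ∧ ∃ Y : Finset α, Y.card = k ∧
    (Y : Set α) ⊆ (sComponent H S e).vertexSet ∩ S ∧
    ∀ f ∈ H.edgeSet, (f ∩ (Y : Set α)).Subsingleton

/-- The `S`-star size of a hypergraph with finitely many vertices: the maximum `k` such that there
is an `S`-`k`-star (`0` if there is no `S`-component at all). -/
noncomputable def starSize (H : Hypergraph α) (S : Set α) : ℕ :=
  sSup {k | HasStar H S k}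

end Hypergraphs

/-! ### Conjunctive queries -/

/-- A conjunctive query `Φ = (𝒮, φ)`: a finite relational structure `𝒮` with domain
`{0, …, nDom - 1}` (relations are presented by duplicate-free lists of tuples), and a formula
`φ = ∃ (quantified variables) ⋀ atoms` with variables `{0, …, nVar - 1}`. An atom is a relation
symbol together with a tuple of variables; every free variable occurs in some atom. -/
structure Query where
  nDom : ℕ
  nDom_pos : 0 < nDom
  nRel : ℕ
  arity : Fin nRel → ℕ
  rel : (R : Fin nRel) → List (Fin (arity R) → Fin nDom)
  rel_nodup : ∀ R, (rel R).Nodup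
  nVar : ℕ
  atoms : List (Σ R : Fin nRel, Fin (arity R) → Fin nVar)
  quantified : Finset (Fin nVar)
  free_occurs : ∀ x, x ∉ quantified → ∃ a ∈ atoms, ∃ p, a.2 p = x

namespace Query

/-- The set of free variables of the formula. -/
def free (Φ : Query) : Finset (Fin Φ.nVar) := Finset.univ \ Φ.quantified

/-- The hypergraph of the formula: the variables, and the variable sets of the atoms. -/
def hypergraph (Φ : Query) : Hypergraph (Fin Φ.nVar) where
  vertexSet := Set.univ
  edgeSet := {e | ∃ a ∈ Φ.atoms, e = Set.range a.2}
  subset_vertexSet_of_mem_edgeSet' := fun _ _ => Set.subset_univ _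

/-- The query is acyclic. -/
def IsAcyclic (Φ : Query) : Prop := ACQ.IsAcyclic Φ.hypergraph

/-- The quantified star size. -/
noncomputable def quantifiedStarSize (Φ : Query) : ℕ := starSize Φ.hypergraph Φ.free

/-- The size of the formula: one for each quantifier, and `1 + r` for each `r`-ary atom. -/
def formulaSize (Φ : Query) : ℕ :=
  Φ.quantified.card + (Φ.atoms.map fun a => 1 + Φ.arity a.1).sum

/-- The size of the structure: the number of domain elements plus the number of tuples in the
relations. -/
def structSize (Φ : Query) : ℕ := Φ.nDom + ∑ R, (Φ.rel R).length

/-- The size `‖Φ‖` of the query. -/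
def size (Φ : Query) : ℕ := Φ.formulaSize + Φ.structSize

/-- The assignment `b` of all variables satisfies all atoms. -/
def Satisfies (Φ : Query) (b : Fin Φ.nVar → Fin Φ.nDom) : Prop :=
  ∀ a ∈ Φ.atoms, (fun p => b (a.2 p)) ∈ Φ.rel a.1

open Classical in
/-- The query result `φ(𝒮)`: the assignments of the free variables that extend to an assignment
of all variables satisfying all atoms. -/
noncomputable def result (Φ : Query) : Finset (Φ.free → Fin Φ.nDom) :=
  Finset.univ.filter fun a => ∃ b : Fin Φ.nVar → Fin Φ.nDom, (∀ x : Φ.free, b x = a x) ∧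
    Φ.Satisfies b

/-- The polynomial `Q(Φ) = ∑_{a ∈ φ(𝒮)} ∏_{x free} X_{a(x)}` over `F`, in variables indexed by the
domain. -/
noncomputable def Q (F : Type*) [CommSemiring F] (Φ : Query) : MvPolynomial (Fin Φ.nDom) F :=
  ∑ a ∈ Φ.result, ∏ x : Φ.free, MvPolynomial.X (a x)

/-! The query as a word of natural numbers. -/

/-- The tuples of a relation, written one after the other. -/
def relData (Φ : Query) (R : Fin Φ.nRel) : List ℕ :=
  (Φ.rel R).flatMap fun t => List.ofFn fun p => (t p : ℕ)

/-- The tuples of the first `i` relations, written one after the other. -/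
def dataBefore (Φ : Query) (i : ℕ) : List ℕ :=
  ((List.finRange Φ.nRel).take i).flatMap Φ.relData

/-- The input word: the numbers of domain elements, of relation symbols, of variables and of atoms;
for each variable a flag telling whether it is quantified; for each relation symbol its arity, the
number of its tuples and the position of its first tuple in the data block; for each atom its
relation symbol and its variables; finally the data block, that is, the tuples of all relations. -/
def encode (Φ : Query) : List ℕ :=
  [Φ.nDom, Φ.nRel, Φ.nVar, Φ.atoms.length] ++
  (List.ofFn fun x => if x ∈ Φ.quantified then 1 else 0) ++
  ((List.finRange Φ.nRel).flatMap fun R =>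
    [Φ.arity R, (Φ.rel R).length, (Φ.dataBefore R).length]) ++
  (Φ.atoms.flatMap fun a => (a.1 : ℕ) :: List.ofFn fun p => (a.2 p : ℕ)) ++
  Φ.dataBefore Φ.nRel

end Query

/-! ### Arithmetic circuits -/

/-- A gate over `F` with variables `X_0, …, X_{n-1}`; computation gates refer to their two children
by the positions of these in the list of gates. -/
inductive Gate (F : Type*) (n : ℕ) where
  | const (c : F)
  | var (d : Fin n)
  | add (i j : ℕ)
  | mul (i j : ℕ)

namespace Gate

variable {F : Type*} {n : ℕ}

/-- The positions of the children of a gate. -/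
def children : Gate F n → List ℕ
  | const _ => []
  | var _ => []
  | add i j => [i, j]
  | mul i j => [i, j]

/-- Apply a map to the constants. -/
def map {G : Type*} (f : F → G) : Gate F n → Gate G n
  | const c => const (f c)
  | var d => var d
  | add i j => add i j
  | mul i j => mul i j

/-- The polynomial computed by a gate, given the polynomials of the earlier gates. -/
noncomputable def eval [CommSemiring F] (vs : List (MvPolynomial (Fin n) F)) :
    Gate F n → MvPolynomial (Fin n) F
  | const c => MvPolynomial.C c
  | var d => MvPolynomial.X d
  | add i j => vs.getD i 0 + vs.getD j 0
  | mul i j => vs.getD i 0 * vs.getD j 0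

/-- The code of a gate whose constants are natural numbers. -/
def encode : Gate ℕ n → List ℕ
  | const c => [0, c]
  | var d => [1, d]
  | add i j => [2, i, j]
  | mul i j => [3, i, j]

theorem children_map {G : Type*} (f : F → G) (g : Gate F n) : (g.map f).children = g.children := by
  cases g <;> rfl

end Gate

/-- An arithmetic circuit over `F` with variables `X_0, …, X_{n-1}`: a directed acyclic graph of
gates, listed in a topological order, with exactly one sink, which is the last gate. -/
structure Circuit (F : Type*) (n : ℕ) where
  gates : List (Gate F n)
  nonempty : gates ≠ []
  children_lt : ∀ i (h : i < gates.length), ∀ j ∈ (gates[i]).children, j < i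
  single_sink : ∀ j, j + 1 < gates.length → ∃ g ∈ gates, j ∈ g.children

namespace Circuit

variable {F : Type*} {n : ℕ}

/-- The polynomials computed by the gates of a list, in order. -/
noncomputable def values [CommSemiring F] (gs : List (Gate F n)) :
    List (MvPolynomial (Fin n) F) :=
  gs.foldl (fun vs g => vs ++ [g.eval vs]) []

/-- The polynomial computed by the circuit, i.e. by its output gate. -/
noncomputable def poly [CommSemiring F] (C : Circuit F n) : MvPolynomial (Fin n) F :=
  (values C.gates).getD (C.gates.length - 1) 0

/-- Apply a map to the constants of a circuit. -/
def map {G : Type*} (f : F → G) (C : Circuit F n) : Circuit G n where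
  gates := C.gates.map (Gate.map f)
  nonempty := by simpa using C.nonempty
  children_lt := by
    intro i h j hj
    have h' : i < C.gates.length := by simpa using h
    refine C.children_lt i h' j ?_
    simpa [Gate.children_map] using hj
  single_sink := by
    intro j hj
    obtain ⟨g, hg, hjg⟩ := C.single_sink j (by simpa using hj)
    exact ⟨g.map f, List.mem_map_of_mem hg, by rwa [Gate.children_map]⟩

/-- The code of a circuit whose constants are natural numbers: the codes of its gates, in order. -/
def encode (C : Circuit ℕ n) : List ℕ := C.gates.flatMap Gate.encode

end Circuit

/-! ### Random access machines -/

namespace RAM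

/-- The instructions of a random access machine whose registers `X_0, X_1, …` hold natural numbers,
with addition as the only arithmetic operation. The machine has random access to a read-only input
word and a write-only output word. -/
inductive Instr where
  /-- `X_i := c` -/
  | const (i c : ℕ)
  /-- `X_i := X_j + X_k` -/
  | add (i j k : ℕ)
  /-- `X_i := X_{X_j}` -/
  | load (i j : ℕ)
  /-- `X_{X_i} := X_j` -/
  | store (i j : ℕ)
  /-- `X_i :=` the letter at position `X_j` of the input (`0` beyond its end) -/
  | read (i j : ℕ)
  /-- append `X_i` to the output -/
  | write (i : ℕ)
  /-- if `X_i ≤ X_j`, continue with the instruction number `l` -/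
  | jle (i j l : ℕ)

/-- A program is a list of instructions, numbered from `0`. -/
abbrev Program := List Instr

/-- A configuration: program counter, contents of the registers, and output so far. -/
structure Config where
  pc : ℕ
  reg : ℕ → ℕ
  out : List ℕ

/-- The effect of one instruction on input `w`. -/
def Instr.exec (w : List ℕ) (c : Config) : Instr → Config
  | const i a => ⟨c.pc + 1, Function.update c.reg i a, c.out⟩
  | add i j k => ⟨c.pc + 1, Function.update c.reg i (c.reg j + c.reg k), c.out⟩
  | load i j => ⟨c.pc + 1, Function.update c.reg i (c.reg (c.reg j)), c.out⟩
  | store i j => ⟨c.pc + 1, Function.update c.reg (c.reg i) (c.reg j), c.out⟩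
  | read i j => ⟨c.pc + 1, Function.update c.reg i (w.getD (c.reg j) 0), c.out⟩
  | write i => ⟨c.pc + 1, c.reg, c.out ++ [c.reg i]⟩
  | jle i j l => ⟨if c.reg i ≤ c.reg j then l else c.pc + 1, c.reg, c.out⟩

/-- One step of the program `P` on input `w`; nothing happens once the program counter has left the
program. -/
def step (P : Program) (w : List ℕ) (c : Config) : Config :=
  match P[c.pc]? with
  | some I => I.exec w c
  | none => c

/-- The initial configuration: all registers are `0` and the output is empty. -/
def init : Config := ⟨0, fun _ => 0, []⟩

/-- On input `w`, the program `P` halts after at most `T` steps (each instruction counts as one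
step) with output `o`. -/
def OutputsWithin (P : Program) (w : List ℕ) (T : ℕ) (o : List ℕ) : Prop :=
  ∃ t ≤ T, P.length ≤ ((step P w)^[t] init).pc ∧ ((step P w)^[t] init).out = o

end RAM

end ACQ

/-! The algorithm keeps a family of weighted tables, at first one for each atom with all weights
equal to 1, and an extra table at position 0 without variables. It removes one table per round. A
table `i` may be merged into a table `j` if it is an ear: each variable of `i` belongs to `j` or to
no other table. A leaf of a join tree is an ear, and removing an ear never destroys the possibility
of removing the rest (`Red.erase`). So a greedy search for ears succeeds and no join tree has to be
computed (`red_of_isAcyclic`, `Ctl.exists_picked`, `Ctl.replace`).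

There are two ways to merge. If `i` and `j` share a quantified variable, the tables are joined; the
quantified variables that only `i` has are projected out, its free variables are kept. If all shared
variables are free, `i` is summed out instead: the weight of each row of `j` is multiplied by the
sum, over the compatible rows of `i` projected to the free variables, of their weights times the
monomial of the free variables that disappear with `i`. In both cases the sum over the answers of
the monomial times the weights stays the same (`Tables.JoinInto.poly_eq`, `Tables.SumInto.poly_eq`);
this works because a weight depends only on the free part of its row (`HasWeights`). When every atom
has been merged, the single row of table 0 has the weight Q(Φ). All weights are gates of a growing
circuit, so the circuit comes out along the way (`run_spec`, `exists_circuit`).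

Only joins enlarge tables, and the star size controls them. Each remaining table carries a set of
pairs of a free variable and an initial edge containing it, such that these edges together with the
initial edge of the table cover all its variables, and such that no edge of the hypergraph contains
two of the chosen variables (`Star`, kept by `Star.join` and `Star.sum`). Joins happen along
quantified variables, so the chosen variables lie in edges of one S-component: they form a star, and
there are at most k of them (`Star.card_le_starSize`). A row is determined by one initial row for
each of these at most 1 + k edges, whence at most ‖Φ‖^(1+k) rows (`Star.card_le`,
`HasStars.length_le`).

For counting, the gates are evaluated with every variable equal to 1. The machine has no
multiplication, but a product can be found by doubling in as many rounds as the second factor has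
bits; a potential argument bounds all second factors by 2 to the number of gates (`Potential`,
`mulNat_eq`).

To obtain machine programs with a running time, the algorithm is written in a small first-order
language whose only loops are folds over lists. A compiler to the random access machine is proved
correct together with a step count (`Fn.sound`, `Fn.program_correct`). If no loop has more than L
rounds, the number of steps is at most (L + 2)^wt with an exponent read off from the syntax
(`Fn.Expr.cost_le`). The row bound gives L = ‖Φ‖^(2k+8), and hence the theorem
(`outputsWithin_program`). -/

namespace ACQ

/-! ### A first-order functional language and its compilation to random access machines -/

namespace Fn

/-- The types of the language. -/
inductive Ty where
  | nat
  | prod (a b : Ty)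
  | list (a : Ty)

/-- The values of a type. -/
@[reducible] def Ty.den : Ty → Type
  | .nat => ℕ
  | .prod a b => a.den × b.den
  | .list a => List a.den

/-- The environments of a context. -/
@[reducible] def Env : List Ty → Type
  | [] => Unit
  | t :: Γ => t.den × Env Γ

/-- The variables of type `t` in a context. -/
inductive Var : List Ty → Ty → Type where
  | z {Γ : List Ty} {t : Ty} : Var (t :: Γ) t
  | s {Γ : List Ty} {t u : Ty} : Var Γ t → Var (u :: Γ) t

/-- The value of a variable. -/
@[reducible] def Var.get : {Γ : List Ty} → {t : Ty} → Var Γ t → Env Γ → t.den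
  | _, _, .z, env => env.1
  | _, _, .s x, env => x.get env.2

/-- The position of a variable in its context. -/
def Var.idx : {Γ : List Ty} → {t : Ty} → Var Γ t → ℕ
  | _, _, .z => 0
  | _, _, .s x => x.idx + 1

/-- The expressions of the language. -/
inductive Expr : List Ty → Ty → Type where
  | var {Γ : List Ty} {t : Ty} (x : Var Γ t) : Expr Γ t
  | lit {Γ : List Ty} (n : ℕ) : Expr Γ .nat
  | add {Γ : List Ty} (a b : Expr Γ .nat) : Expr Γ .nat
  | read {Γ : List Ty} (a : Expr Γ .nat) : Expr Γ .nat
  | range {Γ : List Ty} (a : Expr Γ .nat) : Expr Γ (.list .nat)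
  | ifle {Γ : List Ty} {t : Ty} (a b : Expr Γ .nat) (p q : Expr Γ t) : Expr Γ t
  | pair {Γ : List Ty} {t u : Ty} (a : Expr Γ t) (b : Expr Γ u) : Expr Γ (.prod t u)
  | fst {Γ : List Ty} {t u : Ty} (a : Expr Γ (.prod t u)) : Expr Γ t
  | snd {Γ : List Ty} {t u : Ty} (a : Expr Γ (.prod t u)) : Expr Γ u
  | nil {Γ : List Ty} {t : Ty} : Expr Γ (.list t)
  | cons {Γ : List Ty} {t : Ty} (a : Expr Γ t) (l : Expr Γ (.list t)) : Expr Γ (.list t)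
  | fold {Γ : List Ty} {t u : Ty} (l : Expr Γ (.list t)) (a : Expr Γ u)
      (f : Expr (t :: u :: Γ) u) : Expr Γ u
  | letE {Γ : List Ty} {t u : Ty} (a : Expr Γ t) (b : Expr (t :: Γ) u) : Expr Γ u
  | app {Γ : List Ty} {t u : Ty} (a : Expr Γ t) (f : Expr [t] u) : Expr Γ u

namespace Expr

/-- The value of an expression, given the input word. -/
@[simp] def eval (w : List ℕ) : {Γ : List Ty} → {t : Ty} → Expr Γ t → Env Γ → t.den
  | _, _, var x, env => x.get env
  | _, _, lit n, _ => n
  | _, _, add a b, env => (a.eval w env + b.eval w env : ℕ)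
  | _, _, read a, env => w.getD (a.eval w env) 0
  | _, _, range a, env => (List.range (a.eval w env)).reverse
  | _, _, ifle a b p q, env =>
      if (a.eval w env : ℕ) ≤ b.eval w env then p.eval w env else q.eval w env
  | _, _, pair a b, env => (a.eval w env, b.eval w env)
  | _, _, fst a, env => (a.eval w env).1
  | _, _, snd a, env => (a.eval w env).2
  | _, _, nil, _ => []
  | _, _, cons a l, env => a.eval w env :: l.eval w env
  | _, _, fold l a f, env =>
      (l.eval w env).foldl (fun acc x => f.eval w (x, acc, env)) (a.eval w env)
  | _, _, letE a b, env => b.eval w (a.eval w env, env)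
  | _, _, app a f, env => f.eval w (a.eval w env, ())

/-- The cost of a loop over a list. -/
def foldCost {α β : Type} (g : β → α → β) (k : β → α → ℕ) : List α → β → ℕ
  | [], _ => 0
  | x :: l, b => k b x + foldCost g k l (g b x)

/-- The number of steps that the compiled expression needs. -/
def cost (w : List ℕ) : {Γ : List Ty} → {t : Ty} → Expr Γ t → Env Γ → ℕ
  | _, _, var _, _ => 1
  | _, _, lit _, _ => 1
  | _, _, add a b, env => a.cost w env + b.cost w env + 1
  | _, _, read a, env => a.cost w env + 1
  | _, _, range a, env => a.cost w env + (4 + 11 * (a.eval w env : ℕ))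
  | _, _, ifle a b p q, env => a.cost w env + b.cost w env + p.cost w env + q.cost w env + 2
  | _, _, pair a b, env => a.cost w env + b.cost w env + 7
  | _, _, fst a, env => a.cost w env + 1
  | _, _, snd a, env => a.cost w env + 3
  | _, _, nil, _ => 1
  | _, _, cons a l, env => a.cost w env + l.cost w env + 7
  | _, _, fold l a f, env => l.cost w env + a.cost w env +
      foldCost (fun acc x => f.eval w (x, acc, env)) (fun acc x => f.cost w (x, acc, env) + 7)
        (l.eval w env) (a.eval w env) + 2
  | _, _, letE a b, env => a.cost w env + b.cost w (a.eval w env, env) + 1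
  | _, _, app a f, env => a.cost w env + f.cost w (a.eval w env, ()) + 1

/-- The number of registers that the compiled expression needs. -/
def need : {Γ : List Ty} → {t : Ty} → Expr Γ t → ℕ
  | _, _, var _ => 1
  | _, _, lit _ => 1
  | _, _, add a b => a.need + b.need + 2
  | _, _, read a => a.need + 1
  | _, _, range a => a.need + 4
  | _, _, ifle a b p q => a.need + b.need + p.need + q.need + 2
  | _, _, pair a b => a.need + b.need + 2
  | _, _, fst a => a.need + 1
  | _, _, snd a => a.need + 1
  | _, _, nil => 1
  | _, _, cons a l => a.need + l.need + 2
  | _, _, fold l a f => l.need + a.need + f.need + 4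
  | _, _, letE a b => a.need + b.need + 2
  | _, _, app a f => a.need + f.need + 2

open RAM

/-- Code that allocates a cell with the contents of the registers `a` and `b`, and puts its address
into the register `r`. Register `0` holds `0`, register `1` points to the free memory, and register
`2` is a scratch register. -/
def cell (a b r : ℕ) : List Instr :=
  [.store 1 a, .const 2 1, .add 2 1 2, .store 2 b, .const 2 2, .add r 1 0, .add 1 1 2]

/-- The code of an expression, to be placed at position `p` of a program: it puts the value of the
expression into register `d`, when the values of the variables are in the registers `ρ`. -/
def compile : {Γ : List Ty} → {t : Ty} → Expr Γ t → (ρ : List ℕ) → (d p : ℕ) → List Instr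
  | _, _, var x, ρ, d, _ => [.add d (ρ.getD x.idx 0) 0]
  | _, _, lit n, _, d, _ => [.const d n]
  | _, _, add a b, ρ, d, p =>
      let A := a.compile ρ d p
      let B := b.compile ρ (d + 1) (p + A.length)
      A ++ (B ++ [.add d d (d + 1)])
  | _, _, read a, ρ, d, p => a.compile ρ d p ++ [.read d d]
  | _, _, range a, ρ, d, p =>
      let A := a.compile ρ d p
      let q := p + A.length
      -- Register `d + 1` counts, register `d + 2` holds the list built so far. The loop test is at
      -- `q + 2`, the seven instructions of `cell` follow it, and the exit is at `q + 13`. The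
      -- greatest number is consed last, which is why `eval` yields the range in descending order.
      A ++ ([.const (d + 1) 0, .const (d + 2) 0] ++ ([.jle d (d + 1) (q + 13)] ++
        (cell (d + 1) (d + 2) (d + 2) ++ [.const 2 1, .add (d + 1) (d + 1) 2, .jle 0 0 (q + 2),
          .add d (d + 2) 0])))
  | _, _, ifle a b e f, ρ, d, p =>
      let A := a.compile ρ d p
      let B := b.compile ρ (d + 1) (p + A.length)
      let q := p + A.length + B.length
      let F := f.compile ρ d (q + 1)
      let E := e.compile ρ d (q + 1 + F.length + 1)
      A ++ (B ++ ([.jle d (d + 1) (q + 1 + F.length + 1)] ++ (F ++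
        ([.jle 0 0 (q + 1 + F.length + 1 + E.length)] ++ E))))
  | _, _, pair a b, ρ, d, p =>
      let A := a.compile ρ d p
      let B := b.compile ρ (d + 1) (p + A.length)
      A ++ (B ++ cell d (d + 1) d)
  | _, _, fst a, ρ, d, p => a.compile ρ d p ++ [.load d d]
  | _, _, snd a, ρ, d, p => a.compile ρ d p ++ [.const 2 1, .add d d 2, .load d d]
  | _, _, nil, _, d, _ => [.const d 0]
  | _, _, cons a b, ρ, d, p =>
      let A := a.compile ρ d p
      let B := b.compile ρ (d + 1) (p + A.length)
      A ++ (B ++ cell d (d + 1) d)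
  | _, _, fold l a f, ρ, d, p =>
      let A := l.compile ρ d p
      let B := a.compile ρ (d + 1) (p + A.length)
      let q := p + A.length + B.length
      -- Register `d` holds the rest of the list, `d + 1` the accumulator and `d + 2` the current
      -- element. The empty list is the address 0 and cells have positive addresses, so comparing
      -- `d` with register 0 detects the end.
      let F := f.compile ((d + 2) :: (d + 1) :: ρ) (d + 3) (q + 5)
      A ++ (B ++ ([.jle d 0 (q + 5 + F.length + 2), .load (d + 2) d, .const 2 1, .add d d 2,
        .load d d] ++ (F ++ [.add (d + 1) (d + 3) 0, .jle 0 0 q, .add d (d + 1) 0])))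
  | _, _, letE a b, ρ, d, p =>
      let A := a.compile ρ d p
      let B := b.compile (d :: ρ) (d + 1) (p + A.length)
      A ++ (B ++ [.add d (d + 1) 0])
  | _, _, app a f, ρ, d, p =>
      let A := a.compile ρ d p
      let B := f.compile [d] (d + 1) (p + A.length)
      A ++ (B ++ [.add d (d + 1) 0])

end Expr

open RAM

/-! Runs of programs. -/

/-- `c'` is reached from `c` within `T` steps. -/
def Reach (P : Program) (w : List ℕ) (T : ℕ) (c c' : Config) : Prop :=
  ∃ t ≤ T, (step P w)^[t] c = c'

theorem Reach.trans {P : Program} {w : List ℕ} {T U : ℕ} {a b c : Config}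
    (h : Reach P w T a b) (h' : Reach P w U b c) : Reach P w (T + U) a c := by
  obtain ⟨t, ht, rfl⟩ := h
  obtain ⟨u, hu, rfl⟩ := h'
  exact ⟨u + t, by omega, by rw [Function.iterate_add_apply]⟩

theorem Reach.mono {P : Program} {w : List ℕ} {T U : ℕ} {a b : Config}
    (h : Reach P w T a b) (hTU : T ≤ U) : Reach P w U a b := by
  obtain ⟨t, ht, h⟩ := h
  exact ⟨t, ht.trans hTU, h⟩

theorem Reach.one {P : Program} {w : List ℕ} {c : Config} {I : Instr} (h : P[c.pc]? = some I) :
    Reach P w 1 c (I.exec w c) := ⟨1, le_rfl, by simp [step, h]⟩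

/-- The code `C` stands at position `p` of the program `P`. -/
def CodeAt (P : Program) (p : ℕ) (C : List Instr) : Prop :=
  ∀ i I, C[i]? = some I → P[p + i]? = some I

theorem codeAt_append {P : Program} {p : ℕ} {A B : List Instr} :
    CodeAt P p (A ++ B) ↔ CodeAt P p A ∧ CodeAt P (p + A.length) B := by
  constructor
  · intro h
    refine ⟨fun i I hi => h i I ?_, fun i I hi => ?_⟩
    · rw [List.getElem?_append_left (by
        by_contra hc; rw [List.getElem?_eq_none (by omega)] at hi; simp at hi)]
      exact hi
    · rw [add_assoc]
      apply h
      rw [List.getElem?_append_right (by omega)]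
      simpa using hi
  · rintro ⟨h1, h2⟩ i I hi
    by_cases hl : i < A.length
    · rw [List.getElem?_append_left hl] at hi
      exact h1 i I hi
    · rw [List.getElem?_append_right (by omega)] at hi
      have := h2 _ I hi
      rwa [show p + A.length + (i - A.length) = p + i by omega] at this

theorem codeAt_cons {P : Program} {p : ℕ} {I : Instr} {B : List Instr} :
    CodeAt P p (I :: B) ↔ P[p]? = some I ∧ CodeAt P (p + 1) B := by
  rw [show I :: B = [I] ++ B from rfl, codeAt_append]
  refine and_congr ⟨fun h => h 0 I rfl, fun h i J hi => ?_⟩ Iff.rfl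
  rcases i with _ | i
  · simp only [List.getElem?_cons_zero, Option.some.injEq] at hi
    subst hi
    exact h
  · simp at hi

/-! Representation of values in memory. -/

/-- `a` represents a list, in linked cells with addresses between `K` and `hp`. -/
def ListRep {α : Type} (K hp : ℕ) (m : ℕ → ℕ) (R : α → ℕ → Prop) : List α → ℕ → Prop
  | [], a => a = 0
  | x :: l, a => K ≤ a ∧ a + 2 ≤ hp ∧ R x (m a) ∧ ListRep K hp m R l (m (a + 1))

/-- `a` represents a value. -/
def Rep (K hp : ℕ) (m : ℕ → ℕ) : (t : Ty) → t.den → ℕ → Prop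
  | .nat, v, a => a = v
  | .prod t u, v, a => K ≤ a ∧ a + 2 ≤ hp ∧ Rep K hp m t v.1 (m a) ∧ Rep K hp m u v.2 (m (a + 1))
  | .list t, v, a => ListRep K hp m (Rep K hp m t) v a

/-- The registers `ρ`, all between `3` and `d`, represent an environment. -/
def EnvRep (K hp : ℕ) (m : ℕ → ℕ) (d : ℕ) : (Γ : List Ty) → Env Γ → List ℕ → Prop
  | [], _, _ => True
  | _ :: _, _, [] => False
  | t :: Γ, env, r :: ρ => 3 ≤ r ∧ r < d ∧ Rep K hp m t env.1 (m r) ∧ EnvRep K hp m d Γ env.2 ρ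

theorem ListRep.mono {α : Type} {K hp hp' : ℕ} {m m' : ℕ → ℕ} {R R' : α → ℕ → Prop}
    (hR : ∀ v a, R v a → R' v a) (hhp : hp ≤ hp') (hm : ∀ a, K ≤ a → a < hp → m' a = m a) :
    ∀ (l : List α) (a : ℕ), ListRep K hp m R l a → ListRep K hp' m' R' l a
  | [], _, h => h
  | x :: l, a, ⟨h1, h2, h3, h4⟩ => by
    refine ⟨h1, h2.trans hhp, ?_, ?_⟩
    · rw [hm a h1 (by omega)]
      exact hR _ _ h3
    · rw [hm (a + 1) (by omega) (by omega)]
      exact ListRep.mono hR hhp hm l _ h4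

/-- Memory is persistent: cells are allocated and never overwritten. A later memory that agrees with
the earlier one below the old heap pointer therefore represents the same values at the same
addresses. -/
theorem Rep.mono {K hp hp' : ℕ} {m m' : ℕ → ℕ} (hhp : hp ≤ hp')
    (hm : ∀ a, K ≤ a → a < hp → m' a = m a) :
    ∀ (t : Ty) (v : t.den) (a : ℕ), Rep K hp m t v a → Rep K hp' m' t v a
  | .nat, _, _, h => h
  | .prod t u, v, a, ⟨h1, h2, h3, h4⟩ => by
    refine ⟨h1, h2.trans hhp, ?_, ?_⟩
    · rw [hm a h1 (by omega)]
      exact Rep.mono hhp hm t _ _ h3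
    · rw [hm (a + 1) (by omega) (by omega)]
      exact Rep.mono hhp hm u _ _ h4
  | .list t, v, a, h => ListRep.mono (fun v a => Rep.mono hhp hm t v a) hhp hm v a h

theorem EnvRep.mono {K hp hp' : ℕ} {m m' : ℕ → ℕ} {d d' : ℕ} (hhp : hp ≤ hp')
    (hm : ∀ a, K ≤ a → a < hp → m' a = m a) (hd : d ≤ d')
    (hr : ∀ r, 3 ≤ r → r < d → m' r = m r) :
    ∀ (Γ : List Ty) (env : Env Γ) (ρ : List ℕ), EnvRep K hp m d Γ env ρ →
      EnvRep K hp' m' d' Γ env ρ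
  | [], _, _, _ => trivial
  | _ :: _, _, [], h => h
  | t :: Γ, env, r :: ρ, ⟨h1, h2, h3, h4⟩ => by
    refine ⟨h1, by omega, ?_, EnvRep.mono hhp hm hd hr Γ _ ρ h4⟩
    rw [hr r h1 h2]
    exact Rep.mono hhp hm t _ _ h3

theorem EnvRep.get {K hp : ℕ} {m : ℕ → ℕ} {d : ℕ} :
    ∀ {Γ : List Ty} {t : Ty} (x : Var Γ t) (env : Env Γ) (ρ : List ℕ), EnvRep K hp m d Γ env ρ →
      Rep K hp m t (x.get env) (m (ρ.getD x.idx 0))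
  | _, _, .z, _, [], h => h.elim
  | _, _, .z, _, _ :: _, h => h.2.2.1
  | _, _, .s _, _, [], h => h.elim
  | _, _, .s x, env, _ :: ρ, h => EnvRep.get x env.2 ρ h.2.2.2

/-- The configuration `c'` at position `p` differs from `c` only in the registers from `d` on, the
two special registers, and the free memory. -/
structure Ext (K d p : ℕ) (c c' : Config) : Prop where
  pc : c'.pc = p
  out : c'.out = c.out
  low : ∀ r < d, r ≠ 1 → r ≠ 2 → c'.reg r = c.reg r
  hp : c.reg 1 ≤ c'.reg 1
  heap : ∀ a, K ≤ a → a < c.reg 1 → c'.reg a = c.reg a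

theorem Ext.trans {K d d' p p' : ℕ} {a b c : Config} (h : Ext K d p a b) (h' : Ext K d' p' b c)
    (hd : d ≤ d') : Ext K d p' a c where
  pc := h'.pc
  out := h'.out.trans h.out
  low r hr h1 h2 := (h'.low r (by omega) h1 h2).trans (h.low r hr h1 h2)
  hp := h.hp.trans h'.hp
  heap x hx hx' := (h'.heap x hx (hx'.trans_le h.hp)).trans (h.heap x hx hx')

theorem Ext.rep {K d p : ℕ} {c c' : Config} (h : Ext K d p c c') {t : Ty} {v : t.den} {a : ℕ}
    (hr : Rep K (c.reg 1) c.reg t v a) : Rep K (c'.reg 1) c'.reg t v a :=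
  Rep.mono h.hp h.heap t v a hr

theorem Ext.envRep {K d d' p : ℕ} {c c' : Config} (h : Ext K d p c c') {Γ : List Ty} {env : Env Γ}
    {ρ : List ℕ} (hr : EnvRep K (c.reg 1) c.reg d' Γ env ρ) (hd : d' ≤ d) :
    EnvRep K (c'.reg 1) c'.reg d Γ env ρ :=
  EnvRep.mono h.hp h.heap hd (fun r h3 hrd => h.low r (by omega) (by omega) (by omega)) Γ env ρ hr

/-- Writing a register. -/
def setReg (c : Config) (p r v : ℕ) : Config := ⟨p, Function.update c.reg r v, c.out⟩

theorem setReg_ext {K d : ℕ} (c : Config) (p r v : ℕ) (hK : d ≤ K) (hd : 3 ≤ d)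
    (hr : (d ≤ r ∧ r < K) ∨ r = 2) : Ext K d p c (setReg c p r v) where
  pc := rfl
  out := rfl
  low x hx h1 h2 := Function.update_of_ne (by omega) _ _
  hp := by simp only [setReg]; rw [Function.update_of_ne (by omega)]
  heap a ha _ := Function.update_of_ne (by omega) _ _

@[simp] theorem setReg_same (c : Config) (p r v : ℕ) : (setReg c p r v).reg r = v :=
  Function.update_self _ _ _

theorem setReg_ne (c : Config) (p r v x : ℕ) (h : x ≠ r) : (setReg c p r v).reg x = c.reg x :=
  Function.update_of_ne h _ _

/-- Both stores go to fresh addresses at and above the heap pointer, which is at least `K`, while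
the registers in use lie below `K`. So neither the other registers nor older cells are disturbed. -/
theorem cell_correct {P : Program} {w : List ℕ} {K d p a b r : ℕ} {c : Config}
    (hC : CodeAt P p (Expr.cell a b r)) (hpc : c.pc = p) (h0 : c.reg 0 = 0) (hhp : K ≤ c.reg 1)
    (ha : a < K) (hb : b < K) (hd : 3 ≤ d) (hdr : d ≤ r) (hrK : r < K)
    (ha3 : 3 ≤ a) (hb3 : 3 ≤ b) :
    ∃ c', Reach P w 7 c c' ∧ Ext K d (p + 7) c c' ∧ c'.reg r = c.reg 1 ∧
      c'.reg 1 = c.reg 1 + 2 ∧ c'.reg (c.reg 1) = c.reg a ∧ c'.reg (c.reg 1 + 1) = c.reg b ∧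
      ∀ x, 3 ≤ x → x < K → x ≠ r → c'.reg x = c.reg x := by
  simp only [Expr.cell, codeAt_cons] at hC
  obtain ⟨i0, i1, i2, i3, i4, i5, i6, -⟩ := hC
  set H := c.reg 1 with hH
  have e0 := Reach.one (P := P) (w := w) (c := c) (hpc ▸ i0)
  set c1 := Instr.exec w c (.store 1 a) with hc1
  have e1 := Reach.one (P := P) (w := w) (c := c1) (I := .const 2 1)
    (by rw [← i1, hc1]; simp [Instr.exec, hpc])
  set c2 := Instr.exec w c1 (.const 2 1) with hc2
  have e2 := Reach.one (P := P) (w := w) (c := c2) (I := .add 2 1 2)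
    (by rw [← i2, hc2, hc1]; simp [Instr.exec, hpc])
  set c3 := Instr.exec w c2 (.add 2 1 2) with hc3
  have e3 := Reach.one (P := P) (w := w) (c := c3) (I := .store 2 b)
    (by rw [← i3, hc3, hc2, hc1]; simp [Instr.exec, hpc])
  set c4 := Instr.exec w c3 (.store 2 b) with hc4
  have e4 := Reach.one (P := P) (w := w) (c := c4) (I := .const 2 2)
    (by rw [← i4, hc4, hc3, hc2, hc1]; simp [Instr.exec, hpc])
  set c5 := Instr.exec w c4 (.const 2 2) with hc5
  have e5 := Reach.one (P := P) (w := w) (c := c5) (I := .add r 1 0)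
    (by rw [← i5, hc5, hc4, hc3, hc2, hc1]; simp [Instr.exec, hpc])
  set c6 := Instr.exec w c5 (.add r 1 0) with hc6
  have e6 := Reach.one (P := P) (w := w) (c := c6) (I := .add 1 1 2)
    (by rw [← i6, hc6, hc5, hc4, hc3, hc2, hc1]; simp [Instr.exec, hpc])
  set c7 := Instr.exec w c6 (.add 1 1 2) with hc7
  have r1 : c1.reg = Function.update c.reg H (c.reg a) := rfl
  have r2 : c2.reg = Function.update c1.reg 2 1 := rfl
  have r3 : c3.reg = Function.update c2.reg 2 (c2.reg 1 + c2.reg 2) := rfl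
  have r4 : c4.reg = Function.update c3.reg (c3.reg 2) (c3.reg b) := rfl
  have r5 : c5.reg = Function.update c4.reg 2 2 := rfl
  have r6 : c6.reg = Function.update c5.reg r (c5.reg 1 + c5.reg 0) := rfl
  have r7 : c7.reg = Function.update c6.reg 1 (c6.reg 1 + c6.reg 2) := rfl
  have q1 : ∀ x, x ≠ H → c1.reg x = c.reg x := fun x hx => by
    rw [r1, Function.update_of_ne hx]
  have q2 : ∀ x, x ≠ 2 → c2.reg x = c1.reg x := fun x hx => by
    rw [r2, Function.update_of_ne hx]
  have v32 : c3.reg 2 = H + 1 := by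
    rw [r3, Function.update_self, q2 1 (by omega), q1 1 (by omega), r2, Function.update_self]
  have q3 : ∀ x, x ≠ 2 → c3.reg x = c2.reg x := fun x hx => by
    rw [r3, Function.update_of_ne hx]
  have q4 : ∀ x, x ≠ H + 1 → c4.reg x = c3.reg x := fun x hx => by
    rw [r4, Function.update_of_ne (by omega)]
  have q5 : ∀ x, x ≠ 2 → c5.reg x = c4.reg x := fun x hx => by
    rw [r5, Function.update_of_ne hx]
  have q6 : ∀ x, x ≠ r → c6.reg x = c5.reg x := fun x hx => by
    rw [r6, Function.update_of_ne hx]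
  have q7 : ∀ x, x ≠ 1 → c7.reg x = c6.reg x := fun x hx => by
    rw [r7, Function.update_of_ne hx]
  have v51 : c5.reg 1 = H := by
    rw [q5 1 (by omega), q4 1 (by omega), q3 1 (by omega), q2 1 (by omega), q1 1 (by omega)]
  have v50 : c5.reg 0 = 0 := by
    rw [q5 0 (by omega), q4 0 (by omega), q3 0 (by omega), q2 0 (by omega), q1 0 (by omega), h0]
  have v6r : c6.reg r = H := by rw [r6, Function.update_self, v51, v50]; rfl
  have v62 : c6.reg 2 = 2 := by rw [q6 2 (by omega), r5, Function.update_self]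
  have v7 : ∀ x, x ≠ 1 → x ≠ 2 → x ≠ r → x ≠ H → x ≠ H + 1 → c7.reg x = c.reg x := by
    intro x h1 h2 h3 h4 h5
    rw [q7 x h1, q6 x h3, q5 x h2, q4 x h5, q3 x h2, q2 x h2, q1 x h4]
  have v71 : c7.reg 1 = H + 2 := by rw [r7, Function.update_self, q6 1 (by omega), v51, v62]
  have v7H : c7.reg H = c.reg a := by
    rw [q7 H (by omega), q6 H (by omega), q5 H (by omega), q4 H (by omega), q3 H (by omega),
      q2 H (by omega), r1, Function.update_self]
  have v7H' : c7.reg (H + 1) = c.reg b := by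
    rw [q7 _ (by omega), q6 _ (by omega), q5 _ (by omega), r4, v32, Function.update_self,
      q3 b (by omega), q2 b (by omega), q1 b (by omega)]
  refine ⟨c7, ((((((e0.trans e1).trans e2).trans e3).trans e4).trans e5).trans e6), ⟨?_, rfl, ?_,
    ?_, ?_⟩,
    ?_, v71, v7H, v7H', ?_⟩
  · simp [hc7, hc6, hc5, hc4, hc3, hc2, hc1, Instr.exec, hpc]
  · intro x hx h1 h2
    exact v7 x h1 h2 (by omega) (by omega) (by omega)
  · omega
  · intro x hx hx'
    exact v7 x (by omega) (by omega) (by omega) (by omega) (by omega)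
  · rw [q7 r (by omega), v6r]
  · intro x h3 hx hxr
    exact v7 x (by omega) (by omega) hxr (by omega) (by omega)

end Fn

end ACQ

/-! ### Correctness of the compiled code. -/

namespace ACQ
namespace Fn
open RAM

theorem Ext.weaken {K d d' p : ℕ} {c c' : Config} (h : Ext K d p c c') (hd : d' ≤ d) :
    Ext K d' p c c' :=
  ⟨h.pc, h.out, fun r hr => h.low r (by omega), h.hp, h.heap⟩

theorem Reach.set {P : Program} {w : List ℕ} {c : Config} {I : Instr} {p r v : ℕ} (hpc : c.pc = p)
    (h : P[p]? = some I) (hI : I.exec w c = setReg c (c.pc + 1) r v) :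
    Reach P w 1 c (setReg c (p + 1) r v) := by
  subst hpc
  rw [← hI]
  exact Reach.one h

/-- The code of an expression computes its value. -/
def Sound (P : Program) (w : List ℕ) (K : ℕ) {Γ : List Ty} {t : Ty} (e : Expr Γ t) : Prop :=
  ∀ (env : Env Γ) (ρ : List ℕ) (d p : ℕ) (c : Config), CodeAt P p (e.compile ρ d p) → c.pc = p →
    c.reg 0 = 0 → K ≤ c.reg 1 → 3 ≤ d → d + e.need ≤ K → EnvRep K (c.reg 1) c.reg d Γ env ρ →
    ∃ c', Reach P w (e.cost w env) c c' ∧ Ext K d (p + (e.compile ρ d p).length) c c' ∧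
      Rep K (c'.reg 1) c'.reg t (e.eval w env) (c'.reg d)

theorem Expr.one_le_need : ∀ {Γ : List Ty} {t : Ty} (e : Expr Γ t), 1 ≤ e.need := by
  intro Γ t e
  cases e <;> simp only [Expr.need] <;> omega

section

variable {P : Program} {w : List ℕ} {K : ℕ} {Γ : List Ty} {t u : Ty}

/-- Evaluation of two expressions, one after the other. -/
theorem Sound.two {a : Expr Γ t} {b : Expr Γ u} (ha : Sound P w K a) (hb : Sound P w K b)
    (env : Env Γ) (ρ : List ℕ) (d p : ℕ) (c : Config) (hA : CodeAt P p (a.compile ρ d p))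
    (hB : CodeAt P (p + (a.compile ρ d p).length)
      (b.compile ρ (d + 1) (p + (a.compile ρ d p).length)))
    (hpc : c.pc = p) (h0 : c.reg 0 = 0) (h1 : K ≤ c.reg 1) (hd : 3 ≤ d)
    (hna : d + a.need ≤ K) (hnb : d + 1 + b.need ≤ K) (hE : EnvRep K (c.reg 1) c.reg d Γ env ρ) :
    ∃ c', Reach P w (a.cost w env + b.cost w env) c c' ∧
      Ext K d (p + (a.compile ρ d p).length +
        (b.compile ρ (d + 1) (p + (a.compile ρ d p).length)).length) c c' ∧
      Rep K (c'.reg 1) c'.reg t (a.eval w env) (c'.reg d) ∧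
      Rep K (c'.reg 1) c'.reg u (b.eval w env) (c'.reg (d + 1)) ∧ c'.reg 0 = 0 ∧ K ≤ c'.reg 1 := by
  obtain ⟨c1, R1, E1, V1⟩ := ha env ρ d p c hA hpc h0 h1 hd hna hE
  have z1 : c1.reg 0 = 0 := (E1.low 0 (by omega) (by omega) (by omega)).trans h0
  obtain ⟨c2, R2, E2, V2⟩ := hb env ρ (d + 1) _ c1 hB E1.pc z1 (h1.trans E1.hp) (by omega) hnb
    (EnvRep.mono (d := d) le_rfl (fun _ _ _ => rfl) (by omega) (fun _ _ _ => rfl) _ _ _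
      (E1.envRep hE le_rfl))
  refine ⟨c2, R1.trans R2, E1.trans E2 (by omega), ?_, V2,
    (E2.low 0 (by omega) (by omega) (by omega)).trans z1, (h1.trans E1.hp).trans E2.hp⟩
  rw [E2.low d (by omega) (by omega) (by omega)]
  exact E2.rep V1

theorem sound_var (x : Var Γ t) : Sound P w K (.var x) := by
  intro env ρ d p c hC hpc h0 h1 hd hn hE
  simp only [Expr.compile, codeAt_cons, Expr.need] at hC hn
  have R := Reach.set (w := w) (v := c.reg (ρ.getD x.idx 0)) (r := d) hpc hC.1
    (by simp [Instr.exec, setReg, h0])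
  have E := setReg_ext (K := K) (d := d) c (p + 1) d (c.reg (ρ.getD x.idx 0)) (by omega) hd
    (Or.inl ⟨le_rfl, by omega⟩)
  refine ⟨_, R, E, ?_⟩
  rw [setReg_same]
  exact E.rep (EnvRep.get x env ρ hE)

theorem sound_const (v : t.den) (n : ℕ) (hv : ∀ hp m, Rep K hp m t v n) {e : Expr Γ t}
    (hc : ∀ ρ d p, e.compile ρ d p = [.const d n]) (he : ∀ env, e.eval w env = v)
    (hk : ∀ env, e.cost w env = 1) : Sound P w K e := by
  intro env ρ d p c hC hpc h0 h1 hd hn hE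
  have := e.one_le_need
  rw [hc] at hC ⊢
  rw [codeAt_cons] at hC
  have R := Reach.set (w := w) (v := n) (r := d) hpc hC.1 rfl
  have E := setReg_ext (K := K) (d := d) c (p + 1) d n (by omega) hd (Or.inl ⟨le_rfl, by omega⟩)
  refine ⟨_, by rw [hk]; exact R, E, ?_⟩
  rw [setReg_same, he]
  exact hv _ _

theorem sound_add {a b : Expr Γ .nat} (ha : Sound P w K a) (hb : Sound P w K b) :
    Sound P w K (.add a b) := by
  intro env ρ d p c hC hpc h0 h1 hd hn hE
  simp only [Expr.compile, codeAt_append, codeAt_cons, Expr.need] at hC hn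
  obtain ⟨hA, hB, hI, -⟩ := hC
  obtain ⟨c1, R1, E1, V1, V2, -, -⟩ := ha.two hb env ρ d p c hA hB hpc h0 h1 hd (by omega)
    (by omega) hE
  have R := Reach.set (w := w) (v := c1.reg d + c1.reg (d + 1)) (r := d) E1.pc hI rfl
  have E := setReg_ext (K := K) (d := d) c1 (p + (a.compile ρ d p).length +
        (b.compile ρ (d + 1) (p + (a.compile ρ d p).length)).length + 1) d
        (c1.reg d + c1.reg (d + 1)) (by omega) hd (Or.inl ⟨le_rfl, by omega⟩)
  refine ⟨_, R1.trans R, ?_, ?_⟩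
  · convert E1.trans E le_rfl using 1
    simp only [Expr.compile, List.length_append, List.length_cons, List.length_nil]
    omega
  · rw [setReg_same]
    simp only [Rep] at V1 V2 ⊢
    rw [V1, V2]
    rfl

theorem sound_read {a : Expr Γ .nat} (ha : Sound P w K a) : Sound P w K (.read a) := by
  intro env ρ d p c hC hpc h0 h1 hd hn hE
  simp only [Expr.compile, codeAt_append, codeAt_cons, Expr.need] at hC hn
  obtain ⟨hA, hI, -⟩ := hC
  obtain ⟨c1, R1, E1, V1⟩ := ha env ρ d p c hA hpc h0 h1 hd (by omega) hE
  have R := Reach.set (w := w) (v := w.getD (c1.reg d) 0) (r := d) E1.pc hI rfl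
  have E := setReg_ext (K := K) (d := d) c1 (p + (a.compile ρ d p).length + 1) d
        (w.getD (c1.reg d) 0) (by omega) hd (Or.inl ⟨le_rfl, by omega⟩)
  refine ⟨_, R1.trans R, ?_, ?_⟩
  · convert E1.trans E le_rfl using 1
    simp only [Expr.compile, List.length_append, List.length_cons, List.length_nil]
    omega
  · rw [setReg_same]
    simp only [Rep] at V1 ⊢
    rw [V1]
    rfl

theorem sound_fst {a : Expr Γ (.prod t u)} (ha : Sound P w K a) : Sound P w K (.fst a) := by
  intro env ρ d p c hC hpc h0 h1 hd hn hE
  simp only [Expr.compile, codeAt_append, codeAt_cons, Expr.need] at hC hn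
  obtain ⟨hA, hI, -⟩ := hC
  obtain ⟨c1, R1, E1, V1⟩ := ha env ρ d p c hA hpc h0 h1 hd (by omega) hE
  have R := Reach.set (w := w) (v := c1.reg (c1.reg d)) (r := d) E1.pc hI rfl
  have E := setReg_ext (K := K) (d := d) c1 (p + (a.compile ρ d p).length + 1) d
        (c1.reg (c1.reg d)) (by omega) hd (Or.inl ⟨le_rfl, by omega⟩)
  refine ⟨_, R1.trans R, ?_, ?_⟩
  · convert E1.trans E le_rfl using 1
    simp only [Expr.compile, List.length_append, List.length_cons, List.length_nil]
    omega
  · rw [setReg_same]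
    exact E.rep V1.2.2.1

/-- The code that replaces the address of a cell by its second component. -/
theorem second_correct {d p : ℕ} {c : Config} (hpc : c.pc = p)
    (hi : P[p]? = some (.const 2 1)) (hj : P[p + 1]? = some (.add d d 2))
    (hk : P[p + 1 + 1]? = some (.load d d)) (hd : 3 ≤ d) (hdK : d < K) (hc : K ≤ c.reg d) :
    ∃ c', Reach P w 3 c c' ∧ Ext K d (p + 3) c c' ∧ c'.reg d = c.reg (c.reg d + 1) ∧
      ∀ x, x ≠ d → x ≠ 2 → c'.reg x = c.reg x := by
  have R1 := Reach.set (w := w) (v := 1) (r := 2) hpc hi rfl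
  have E1 := setReg_ext (K := K) (d := d) c (p + 1) 2 1 (by omega) hd (Or.inr rfl)
  set c1 := setReg c (p + 1) 2 1 with hc1
  have R2 := Reach.set (w := w) (v := c1.reg d + c1.reg 2) (r := d) E1.pc hj rfl
  have E2 := setReg_ext (K := K) (d := d) c1 (p + 1 + 1) d (c1.reg d + c1.reg 2) (by omega) hd
    (Or.inl ⟨le_rfl, by omega⟩)
  set c2 := setReg c1 (p + 1 + 1) d (c1.reg d + c1.reg 2) with hc2
  have R3 := Reach.set (w := w) (v := c2.reg (c2.reg d)) (r := d) E2.pc hk rfl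
  have E3 := setReg_ext (K := K) (d := d) c2 (p + 1 + 1 + 1) d (c2.reg (c2.reg d)) (by omega) hd
    (Or.inl ⟨le_rfl, by omega⟩)
  have v1 : c1.reg d = c.reg d := setReg_ne _ _ _ _ _ (by omega)
  have v2 : c2.reg d = c.reg d + 1 := by
    rw [hc2, setReg_same, v1, hc1, setReg_same]
  refine ⟨_, (R1.trans R2).trans R3, (E1.trans E2 le_rfl).trans E3 le_rfl, ?_, ?_⟩
  · rw [setReg_same, v2, hc2, setReg_ne _ _ _ _ _ (by omega), hc1, setReg_ne _ _ _ _ _ (by omega)]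
  · intro x hx hx2
    rw [setReg_ne _ _ _ _ _ hx, hc2, setReg_ne _ _ _ _ _ hx, hc1, setReg_ne _ _ _ _ _ hx2]

theorem sound_snd {a : Expr Γ (.prod t u)} (ha : Sound P w K a) : Sound P w K (.snd a) := by
  intro env ρ d p c hC hpc h0 h1 hd hn hE
  simp only [Expr.compile, codeAt_append, codeAt_cons, Expr.need] at hC hn
  obtain ⟨hA, hI, hJ, hL, -⟩ := hC
  obtain ⟨c1, R1, E1, V1⟩ := ha env ρ d p c hA hpc h0 h1 hd (by omega) hE
  obtain ⟨c2, R2, E2, V2, -⟩ := second_correct (w := w) (K := K) E1.pc hI hJ hL hd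
    (by omega) V1.1
  refine ⟨_, R1.trans R2, ?_, ?_⟩
  · convert E1.trans E2 le_rfl using 1
    simp only [Expr.compile, List.length_append, List.length_cons, List.length_nil]
    omega
  · rw [V2]
    exact E2.rep V1.2.2.2

theorem sound_pair {a : Expr Γ t} {b : Expr Γ u} (ha : Sound P w K a) (hb : Sound P w K b) :
    Sound P w K (.pair a b) := by
  intro env ρ d p c hC hpc h0 h1 hd hn hE
  simp only [Expr.compile, codeAt_append, Expr.need] at hC hn
  obtain ⟨hA, hB, hI⟩ := hC
  obtain ⟨c1, R1, E1, V1, V2, z1, hp1⟩ := ha.two hb env ρ d p c hA hB hpc h0 h1 hd (by omega)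
    (by omega) hE
  obtain ⟨c2, R2, E2, q1, q2, q3, q4, -⟩ := cell_correct (w := w) (d := d) hI E1.pc z1 hp1
    (by omega) (by omega) hd le_rfl (by omega) (by omega) (by omega)
  refine ⟨_, R1.trans R2, ?_, ?_⟩
  · convert E1.trans E2 le_rfl using 1
    simp only [Expr.compile, Expr.cell, List.length_append, List.length_cons, List.length_nil]
    omega
  · refine ⟨by omega, by omega, ?_, ?_⟩
    · rw [q1, q3]
      exact E2.rep V1
    · rw [q1, q4]
      exact E2.rep V2

theorem sound_cons {a : Expr Γ t} {b : Expr Γ (.list t)} (ha : Sound P w K a)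
    (hb : Sound P w K b) : Sound P w K (.cons a b) := by
  intro env ρ d p c hC hpc h0 h1 hd hn hE
  simp only [Expr.compile, codeAt_append, Expr.need] at hC hn
  obtain ⟨hA, hB, hI⟩ := hC
  obtain ⟨c1, R1, E1, V1, V2, z1, hp1⟩ := ha.two hb env ρ d p c hA hB hpc h0 h1 hd (by omega)
    (by omega) hE
  obtain ⟨c2, R2, E2, q1, q2, q3, q4, -⟩ := cell_correct (w := w) (d := d) hI E1.pc z1 hp1
    (by omega) (by omega) hd le_rfl (by omega) (by omega) (by omega)
  refine ⟨_, R1.trans R2, ?_, ?_⟩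
  · convert E1.trans E2 le_rfl using 1
    simp only [Expr.compile, Expr.cell, List.length_append, List.length_cons, List.length_nil]
    omega
  · refine ⟨by omega, by omega, ?_, ?_⟩
    · rw [q1, q3]
      exact E2.rep V1
    · rw [q1, q4]
      exact E2.rep V2

theorem sound_letE {a : Expr Γ t} {b : Expr (t :: Γ) u} (ha : Sound P w K a)
    (hb : Sound P w K b) : Sound P w K (.letE a b) := by
  intro env ρ d p c hC hpc h0 h1 hd hn hE
  simp only [Expr.compile, codeAt_append, codeAt_cons, Expr.need] at hC hn
  obtain ⟨hA, hB, hI, -⟩ := hC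
  obtain ⟨c1, R1, E1, V1⟩ := ha env ρ d p c hA hpc h0 h1 hd (by omega) hE
  have z1 : c1.reg 0 = 0 := (E1.low 0 (by omega) (by omega) (by omega)).trans h0
  obtain ⟨c2, R2, E2, V2⟩ := hb (a.eval w env, env) (d :: ρ) (d + 1) _ c1 hB E1.pc z1
    (h1.trans E1.hp) (by omega) (by omega) ⟨hd, by omega, V1,
      EnvRep.mono (d := d) le_rfl (fun _ _ _ => rfl) (by omega) (fun _ _ _ => rfl) _ _ _
      (E1.envRep hE le_rfl)⟩
  have z2 : c2.reg 0 = 0 := (E2.low 0 (by omega) (by omega) (by omega)).trans z1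
  have R3 := Reach.set (w := w) (v := c2.reg (d + 1)) (r := d) E2.pc hI
    (by simp [Instr.exec, setReg, z2])
  have E3 := setReg_ext (K := K) (d := d) c2 (p + (a.compile ρ d p).length +
        (b.compile (d :: ρ) (d + 1) (p + (a.compile ρ d p).length)).length + 1) d
        (c2.reg (d + 1)) (by omega) hd (Or.inl ⟨le_rfl, by omega⟩)
  refine ⟨_, (R1.trans R2).trans R3, ?_, ?_⟩
  · convert (E1.trans E2 (by omega)).trans E3 le_rfl using 1
    simp only [Expr.compile, List.length_append, List.length_cons, List.length_nil]
    omega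
  · rw [setReg_same]
    exact E3.rep V2

theorem sound_app {a : Expr Γ t} {b : Expr [t] u} (ha : Sound P w K a)
    (hb : Sound P w K b) : Sound P w K (.app a b) := by
  intro env ρ d p c hC hpc h0 h1 hd hn hE
  simp only [Expr.compile, codeAt_append, codeAt_cons, Expr.need] at hC hn
  obtain ⟨hA, hB, hI, -⟩ := hC
  obtain ⟨c1, R1, E1, V1⟩ := ha env ρ d p c hA hpc h0 h1 hd (by omega) hE
  have z1 : c1.reg 0 = 0 := (E1.low 0 (by omega) (by omega) (by omega)).trans h0
  obtain ⟨c2, R2, E2, V2⟩ := hb (a.eval w env, ()) [d] (d + 1) _ c1 hB E1.pc z1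
    (h1.trans E1.hp) (by omega) (by omega) ⟨hd, by omega, V1, trivial⟩
  have z2 : c2.reg 0 = 0 := (E2.low 0 (by omega) (by omega) (by omega)).trans z1
  have R3 := Reach.set (w := w) (v := c2.reg (d + 1)) (r := d) E2.pc hI
    (by simp [Instr.exec, setReg, z2])
  have E3 := setReg_ext (K := K) (d := d) c2 (p + (a.compile ρ d p).length +
        (b.compile [d] (d + 1) (p + (a.compile ρ d p).length)).length + 1) d
        (c2.reg (d + 1)) (by omega) hd (Or.inl ⟨le_rfl, by omega⟩)
  refine ⟨_, (R1.trans R2).trans R3, ?_, ?_⟩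
  · convert (E1.trans E2 (by omega)).trans E3 le_rfl using 1
    simp only [Expr.compile, List.length_append, List.length_cons, List.length_nil]
    omega
  · rw [setReg_same]
    exact E3.rep V2

/-- Moving the program counter. -/
def goto (c : Config) (p : ℕ) : Config := ⟨p, c.reg, c.out⟩

theorem goto_ext {d : ℕ} (c : Config) (p : ℕ) : Ext K d p c (goto c p) :=
  ⟨rfl, rfl, fun _ _ _ _ => rfl, le_rfl, fun _ _ _ => rfl⟩

theorem Reach.jump {c : Config} {p i j l : ℕ} (hpc : c.pc = p) (h : P[p]? = some (.jle i j l))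
    (hij : c.reg i ≤ c.reg j) : Reach P w 1 c (goto c l) := by
  subst hpc
  have := Reach.one (w := w) h
  simpa [Instr.exec, hij, goto] using this

theorem Reach.skip {c : Config} {p i j l : ℕ} (hpc : c.pc = p) (h : P[p]? = some (.jle i j l))
    (hij : ¬ c.reg i ≤ c.reg j) : Reach P w 1 c (goto c (p + 1)) := by
  subst hpc
  have := Reach.one (w := w) h
  simpa [Instr.exec, hij, goto] using this

/-- The code of the else-branch stands first and ends with a jump over the other branch; the
conditional jump skips it. Since `cost` charges for both branches, the bound holds whichever is
taken. -/
theorem sound_ifle {a b : Expr Γ .nat} {e f : Expr Γ t} (ha : Sound P w K a)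
    (hb : Sound P w K b) (he : Sound P w K e) (hf : Sound P w K f) :
    Sound P w K (.ifle a b e f) := by
  intro env ρ d p c hC hpc h0 h1 hd hn hE
  simp only [Expr.compile, codeAt_append, codeAt_cons, Expr.need, List.length_cons,
    List.length_nil, Nat.zero_add] at hC hn
  obtain ⟨hA, hB, ⟨hI, -⟩, hF, ⟨hJ, -⟩, hE'⟩ := hC
  obtain ⟨c1, R1, E1, V1, V2, z1, hp1⟩ := ha.two hb env ρ d p c hA hB hpc h0 h1 hd (by omega)
    (by omega) hE
  simp only [Rep] at V1 V2
  simp only [Expr.compile, List.length_append, List.length_cons, List.length_nil, Expr.cost,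
    Expr.eval]
  by_cases hle : (a.eval w env : ℕ) ≤ b.eval w env
  · have R2 := Reach.jump (w := w) E1.pc hI (by rw [V1, V2]; exact hle)
    have E2 := goto_ext (K := K) (d := d) c1 (p + (a.compile ρ d p).length +
        (b.compile ρ (d + 1) (p + (a.compile ρ d p).length)).length + 1 +
        (f.compile ρ d (p + (a.compile ρ d p).length +
        (b.compile ρ (d + 1) (p + (a.compile ρ d p).length)).length + 1)).length + 1)
    have E12 := E1.trans E2 le_rfl
    obtain ⟨c3, R3, E3, V3⟩ := he env ρ d _ _ hE' E2.pc z1 hp1 hd (by omega) (E12.envRep hE le_rfl)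
    refine ⟨c3, ((R1.trans R2).trans R3).mono (by omega), ?_, by rwa [if_pos hle]⟩
    convert E12.trans E3 le_rfl using 1
    omega
  · have R2 := Reach.skip (w := w) E1.pc hI (by rw [V1, V2]; exact hle)
    have E2 := goto_ext (K := K) (d := d) c1 (p + (a.compile ρ d p).length +
        (b.compile ρ (d + 1) (p + (a.compile ρ d p).length)).length + 1)
    have E12 := E1.trans E2 le_rfl
    obtain ⟨c3, R3, E3, V3⟩ := hf env ρ d _ _ hF E2.pc z1 hp1 hd (by omega) (E12.envRep hE le_rfl)
    have R4 := Reach.jump (w := w) E3.pc hJ le_rfl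
    have E4 : ∀ r s, r = s → Ext K d s c (goto c3 r) := by
      rintro r _ rfl
      exact E12.trans (E3.trans (goto_ext (K := K) (d := d) c3 r) le_rfl) le_rfl
    refine ⟨_, (((R1.trans R2).trans R3).trans R4).mono (by omega), ?_, ?_⟩
    · exact E4 _ _ (by omega)
    · rw [if_neg hle]
      exact V3

theorem sound_range {a : Expr Γ .nat} (ha : Sound P w K a) : Sound P w K (.range a) := by
  intro env ρ d p c hC hpc h0 h1 hd hn hE
  simp only [Expr.compile, codeAt_append, codeAt_cons, Expr.need, List.length_cons,
    List.length_nil, Expr.cell] at hC hn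
  set A := a.compile ρ d p with hAdef
  set q := p + A.length with hq
  obtain ⟨hA, ⟨hI0, hI1, -⟩, ⟨hJ, -⟩, hcell, hS1, hS2, hS3, hS4, -⟩ := hC
  obtain ⟨c1, R1, E1, V1⟩ := ha env ρ d p c hA hpc h0 h1 hd (by omega) hE
  simp only [Rep] at V1
  set n : ℕ := a.eval w env with hn'
  have R2 := Reach.set (w := w) (v := 0) (r := d + 1) E1.pc hI0 rfl
  set c2 := setReg c1 (q + 1) (d + 1) 0 with hc2
  have E2 := setReg_ext (K := K) (d := d + 1) c1 (q + 1) (d + 1) 0 (by omega) (by omega)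
    (Or.inl ⟨le_rfl, by omega⟩)
  have R3 := Reach.set (w := w) (v := 0) (r := d + 2) E2.pc hI1 rfl
  set c3 := setReg c2 (q + 1 + 1) (d + 2) 0 with hc3
  have E3 := setReg_ext (K := K) (d := d + 1) c2 (q + 1 + 1) (d + 2) 0 (by omega) (by omega)
    (Or.inl ⟨by omega, by omega⟩)
  have E13 := (E1.trans E2 (by omega)).trans E3 (by omega)
  have z3 : c3.reg 0 = 0 := (E13.low 0 (by omega) (by omega) (by omega)).trans h0
  -- Induction on the number `k` of rounds that are left: the counter stands at `n - k`, and the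
  -- list built so far contains exactly the numbers below it.
  have loop : ∀ k c', c'.pc = q + 2 → c'.reg 0 = 0 → K ≤ c'.reg 1 → c'.reg d = n → k ≤ n →
      c'.reg (d + 1) = n - k →
      ListRep K (c'.reg 1) c'.reg (Rep K (c'.reg 1) c'.reg .nat) (List.range (n - k)).reverse
        (c'.reg (d + 2)) →
      ∃ c'', Reach P w (11 * k + 2) c' c'' ∧ Ext K d (q + 14) c' c'' ∧
        ListRep K (c''.reg 1) c''.reg (Rep K (c''.reg 1) c''.reg .nat) (List.range n).reverse
          (c''.reg d) := by
    intro k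
    induction k with
    | zero =>
      intro c' pc' z' hp' hn1 _ hi hl
      have R1 := Reach.jump (w := w) (c := c') (p := q + 2) pc' hJ (by omega)
      have R2 := Reach.set (w := w) (c := goto c' (q + 13)) (p := q + 13) (r := d)
        (v := c'.reg (d + 2)) rfl hS4 (by simp [Instr.exec, setReg, goto, z'])
      have E2 := setReg_ext (K := K) (d := d) (goto c' (q + 13)) (q + 14) d (c'.reg (d + 2))
        (by omega) (by omega) (Or.inl ⟨by omega, by omega⟩)
      have E := (goto_ext (K := K) (d := d) c' (q + 13)).trans E2 le_rfl
      refine ⟨_, (R1.trans R2).mono (by omega), E, ?_⟩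
      rw [setReg_same]
      exact E.rep (t := .list .nat) hl
    | succ k ih =>
      intro c' pc' z' hp' hn1 hk hi hl
      have R1 := Reach.skip (w := w) (c := c') (p := q + 2) pc' hJ (by omega)
      have hcell' : CodeAt P (q + 2 + 1) (Expr.cell (d + 1) (d + 2) (d + 2)) := by
        simpa only [codeAt_cons, Expr.cell] using hcell
      obtain ⟨c4, R2, E4, s1, s2, s3, s4, s5⟩ := cell_correct (w := w) (K := K) (d := d + 2)
        (c := goto c' (q + 3)) hcell' rfl z' hp' (by omega) (by omega) (by omega) (by omega)
        (by omega) (by omega) (by omega)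
      have R3 := Reach.set (w := w) (v := 1) (r := 2) E4.pc hS1 rfl
      set c5 := setReg c4 (q + 2 + 1 + 7 + 1) 2 1 with hc5
      have E5 := setReg_ext (K := K) (d := d + 1) c4 (q + 2 + 1 + 7 + 1) 2 1 (by omega) (by omega)
        (Or.inr rfl)
      have R4 := Reach.set (w := w) (v := c5.reg (d + 1) + c5.reg 2) (r := d + 1) E5.pc hS2 rfl
      set c6 := setReg c5 (q + 2 + 1 + 7 + 1 + 1) (d + 1) (c5.reg (d + 1) + c5.reg 2) with hc6
      have E6 := setReg_ext (K := K) (d := d + 1) c5 (q + 2 + 1 + 7 + 1 + 1) (d + 1)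
        (c5.reg (d + 1) + c5.reg 2) (by omega) (by omega) (Or.inl ⟨le_rfl, by omega⟩)
      have R5 := Reach.jump (w := w) E6.pc hS3 le_rfl
      have E7 := goto_ext (K := K) (d := d + 1) c6 (q + 2)
      have E56 := (E5.trans E6 le_rfl).trans E7 le_rfl
      have EE := (((goto_ext (K := K) (d := d + 1) c' (q + 3)).trans E4 (by omega)).trans E56
        (by omega))
      have v41 : c4.reg (d + 1) = n - (k + 1) := by
        rw [s5 _ (by omega) (by omega) (by omega)]
        exact hi
      have v6 : c6.reg (d + 1) = n - k := by
        rw [hc6, setReg_same, hc5, setReg_ne _ _ _ _ _ (by omega), v41, setReg_same]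
        omega
      have v62 : c6.reg (d + 2) = c'.reg 1 := by
        rw [hc6, setReg_ne _ _ _ _ _ (by omega), hc5, setReg_ne _ _ _ _ _ (by omega), s1]
        rfl
      obtain ⟨c8, R8, E8, V8⟩ := ih (goto c6 (q + 2)) rfl
        ((EE.low 0 (by omega) (by omega) (by omega)).trans z') (hp'.trans EE.hp)
        ((EE.low d (by omega) (by omega) (by omega)).trans hn1) (by omega) v6 (by
          rw [show n - k = n - (k + 1) + 1 by omega, List.range_succ, List.reverse_append]
          simp only [List.reverse_cons, List.reverse_nil, List.nil_append, List.singleton_append]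
          have hpE : c'.reg 1 + 2 ≤ (goto c6 (q + 2)).reg 1 := by
            have := E56.hp
            have s2' : c4.reg 1 = c'.reg 1 + 2 := s2
            omega
          refine ⟨?_, ?_, ?_, ?_⟩
          · show K ≤ c6.reg (d + 2)
            omega
          · show c6.reg (d + 2) + 2 ≤ _
            omega
          · show c6.reg (c6.reg (d + 2)) = _
            have := E56.heap (c'.reg 1) hp' (by
              have s2' : c4.reg 1 = c'.reg 1 + 2 := s2
              omega)
            rw [v62]
            refine this.trans ?_
            refine s3.trans ?_
            exact hi
          · have := E56.heap (c'.reg 1 + 1) (by omega) (by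
              have s2' : c4.reg 1 = c'.reg 1 + 2 := s2
              omega)
            have h5 : (goto c6 (q + 2)).reg ((goto c6 (q + 2)).reg (d + 2) + 1)
                = c'.reg (d + 2) := by
              show c6.reg (c6.reg (d + 2) + 1) = _
              rw [v62]
              exact this.trans s4
            rw [h5]
            exact EE.rep (t := .list .nat) hl)
      refine ⟨c8, ?_, (EE.weaken (by omega)).trans E8 le_rfl, V8⟩
      exact (((((R1.trans R2).trans R3).trans R4).trans R5).trans R8).mono (by omega)
  obtain ⟨c4, R4, E4, V4⟩ := loop n c3 rfl z3 (h1.trans E13.hp) (by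
      rw [E3.low d (by omega) (by omega) (by omega), E2.low d (by omega) (by omega) (by omega)]
      exact V1) le_rfl (by
      rw [hc3, setReg_ne _ _ _ _ _ (by omega), hc2, setReg_same]; omega) (by
      rw [hc3, setReg_same]; simp [ListRep])
  refine ⟨c4, (((R1.trans R2).trans R3).trans R4).mono ?_, ?_, V4⟩
  · simp only [Expr.cost]
    omega
  · convert E13.trans E4 le_rfl using 1
    have hAl : (a.compile ρ d p).length = A.length := rfl
    simp only [Expr.compile, Expr.cell, List.length_append, List.length_cons, List.length_nil]
    omega

theorem sound_fold {l : Expr Γ (.list t)} {a : Expr Γ u} {f : Expr (t :: u :: Γ) u}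
    (hl : Sound P w K l) (ha : Sound P w K a) (hf : Sound P w K f) :
    Sound P w K (.fold l a f) := by
  intro env ρ d p c hC hpc h0 h1 hd hn hE
  simp only [Expr.compile, codeAt_append, codeAt_cons, Expr.need, List.length_cons,
    List.length_nil, Nat.zero_add] at hC hn
  obtain ⟨hA, hB, ⟨hI0, hI1, hI2, hI3, hI4, -⟩, hF, hJ0, hJ1, hJ2, -⟩ := hC
  obtain ⟨c1, R1, E1, V1, V2, z1, hp1⟩ := hl.two ha env ρ d p c hA hB hpc h0 h1 hd (by omega)
    (by omega) hE
  set q := p + (l.compile ρ d p).length +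
        (a.compile ρ (d + 1) (p + (l.compile ρ d p).length)).length with hq
  set F := f.compile ((d + 2) :: (d + 1) :: ρ) (d + 3) (q + 5) with hFdef
  -- Induction on the rest of the list. The environment survives a round because its registers lie
  -- below `d`, the rest of the list because the body only allocates above the heap pointer.
  have loop : ∀ (xs : List t.den) (acc : u.den) (c' : Config), c'.pc = q → c'.reg 0 = 0 →
      K ≤ c'.reg 1 → EnvRep K (c'.reg 1) c'.reg d Γ env ρ →
      ListRep K (c'.reg 1) c'.reg (Rep K (c'.reg 1) c'.reg t) xs (c'.reg d) →
      Rep K (c'.reg 1) c'.reg u acc (c'.reg (d + 1)) →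
      ∃ c'', Reach P w (Expr.foldCost (fun acc x => f.eval w (x, acc, env))
          (fun acc x => f.cost w (x, acc, env) + 7) xs acc + 2) c' c'' ∧
        Ext K d (q + 5 + F.length + 3) c' c'' ∧
        Rep K (c''.reg 1) c''.reg u (xs.foldl (fun acc x => f.eval w (x, acc, env)) acc)
          (c''.reg d) := by
    intro xs
    induction xs with
    | nil =>
      intro acc c' pc' z' hp' hE' hx hacc
      have hx0 : c'.reg d = 0 := hx
      have R1 := Reach.jump (w := w) (c := c') (p := q) pc' hI0 (by omega)
      have R2 := Reach.set (w := w) (c := goto c' (q + 5 + F.length + 2))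
        (p := q + 5 + F.length + 2) (r := d)
        (v := c'.reg (d + 1)) rfl hJ2 (by simp [Instr.exec, setReg, goto, z'])
      have E2 := setReg_ext (K := K) (d := d) (goto c' (q + 5 + F.length + 2))
        (q + 5 + F.length + 3) d (c'.reg (d + 1)) (by omega) (by omega)
        (Or.inl ⟨by omega, by omega⟩)
      have E := (goto_ext (K := K) (d := d) c' (q + 5 + F.length + 2)).trans E2 le_rfl
      refine ⟨_, (R1.trans R2).mono (by simp [Expr.foldCost]), E, ?_⟩
      rw [setReg_same]
      exact E.rep hacc
    | cons x xs ih =>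
      intro acc c' pc' z' hp' hE' hx hacc
      obtain ⟨hx1, hx2, hx3, hx4⟩ := hx
      have R1 := Reach.skip (w := w) (c := c') (p := q) pc' hI0 (by omega)
      have R2 := Reach.set (w := w) (c := goto c' (q + 1)) (p := q + 1) (r := d + 2)
        (v := c'.reg (c'.reg d)) rfl hI1 rfl
      set c2 := setReg (goto c' (q + 1)) (q + 1 + 1) (d + 2) (c'.reg (c'.reg d)) with hc2
      have E2 := setReg_ext (K := K) (d := d + 2) (goto c' (q + 1)) (q + 1 + 1) (d + 2)
        (c'.reg (c'.reg d)) (by omega) (by omega) (Or.inl ⟨by omega, by omega⟩)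
      have E02 := (goto_ext (K := K) (d := d + 2) c' (q + 1)).trans E2 le_rfl
      have v2d : c2.reg d = c'.reg d := E02.low d (by omega) (by omega) (by omega)
      obtain ⟨c3, R3, E3, V3, L3⟩ := second_correct (w := w) (K := K) E2.pc
        hI2 hI3 hI4 hd (by omega) (by rw [← hc2, v2d]; exact hx1)
      have E03 := (E02.weaken (show d ≤ d + 2 by omega)).trans E3 le_rfl
      have z3 : c3.reg 0 = 0 := (E03.low 0 (by omega) (by omega) (by omega)).trans z'
      have x3 : c3.reg (d + 2) = c'.reg (c'.reg d) := by
        rw [L3 _ (by omega) (by omega), setReg_same]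
      have a3 : c3.reg (d + 1) = c'.reg (d + 1) := by
        rw [L3 _ (by omega) (by omega)]
        exact E02.low _ (by omega) (by omega) (by omega)
      have t3 : c3.reg d = c'.reg (c'.reg d + 1) := by
        rw [V3, ← hc2, v2d]
        exact E02.heap _ (by omega) (by omega)
      obtain ⟨c4, R4, E4, V4⟩ := hf (x, acc, env) ((d + 2) :: (d + 1) :: ρ) (d + 3) (q + 5) c3 hF
        E03.pc z3 (hp'.trans E03.hp) (by omega) (by omega)
        ⟨by omega, by omega, by rw [x3]; exact E03.rep hx3, by omega, by omega,
          by rw [a3]; exact E03.rep hacc,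
          EnvRep.mono (d := d) le_rfl (fun _ _ _ => rfl) (by omega) (fun _ _ _ => rfl) _ _ _
            (E03.envRep hE' le_rfl)⟩
      have z4 : c4.reg 0 = 0 := (E4.low 0 (by omega) (by omega) (by omega)).trans z3
      have R5 := Reach.set (w := w) (v := c4.reg (d + 3)) (r := d + 1) E4.pc hJ0
        (by simp [Instr.exec, setReg, z4])
      set c5 := setReg c4 (q + 5 + F.length + 1) (d + 1) (c4.reg (d + 3)) with hc5
      have E5 := setReg_ext (K := K) (d := d + 1) c4 (q + 5 + F.length + 1) (d + 1)
        (c4.reg (d + 3)) (by omega) (by omega) (Or.inl ⟨le_rfl, by omega⟩)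
      have R6 := Reach.jump (w := w) E5.pc hJ1 le_rfl
      have E6 := E5.trans (goto_ext (K := K) (d := d + 1) c5 q) le_rfl
      have E06 := (E03.trans E4 (by omega)).trans E6 (by omega)
      obtain ⟨c7, R7, E7, V7⟩ := ih (f.eval w (x, acc, env)) (goto c5 q) rfl
        ((E06.low 0 (by omega) (by omega) (by omega)).trans z') (hp'.trans E06.hp)
        (E06.envRep hE' le_rfl) (by
          have : (goto c5 q).reg d = c'.reg (c'.reg d + 1) := by
            rw [E6.low d (by omega) (by omega) (by omega), E4.low d (by omega) (by omega)
              (by omega),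
              t3]
          rw [this]
          exact E06.rep (t := .list t) hx4) (by
          have : (goto c5 q).reg (d + 1) = c4.reg (d + 3) := by
            show c5.reg (d + 1) = _
            rw [hc5, setReg_same]
          rw [this]
          exact E6.rep V4)
      refine ⟨c7, ?_, E06.trans E7 le_rfl, V7⟩
      refine ((((((R1.trans R2).trans R3).trans R4).trans R5).trans R6).trans R7).mono ?_
      simp only [Expr.foldCost]
      omega
  obtain ⟨c2, R2, E2, V2'⟩ := loop _ _ c1 E1.pc z1 hp1 (E1.envRep hE le_rfl) V1 V2
  refine ⟨c2, (R1.trans R2).mono ?_, ?_, V2'⟩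
  · simp only [Expr.cost]
    omega
  · convert E1.trans E2 le_rfl using 1
    have hFl : (f.compile ((d + 2) :: (d + 1) :: ρ) (d + 3)
      (p + (l.compile ρ d p).length + (a.compile ρ (d + 1)
        (p + (l.compile ρ d p).length)).length + 5)).length = F.length := rfl
    simp only [Expr.compile, List.length_append, List.length_cons, List.length_nil]
    omega

theorem sound (P : Program) (w : List ℕ) (K : ℕ) {Γ : List Ty} {t : Ty} (e : Expr Γ t) :
    Sound P w K e := by
  induction e with
  | var x => exact sound_var x
  | lit n => refine sound_const (t := .nat) n n ?_ ?_ ?_ ?_ <;> intros <;> rfl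
  | add a b ha hb => exact sound_add ha hb
  | read a ha => exact sound_read ha
  | range a ha => exact sound_range ha
  | ifle a b e f ha hb he hf => exact sound_ifle ha hb he hf
  | pair a b ha hb => exact sound_pair ha hb
  | fst a ha => exact sound_fst ha
  | snd a ha => exact sound_snd ha
  | @nil _ t => refine sound_const (t := .list t) [] 0 ?_ ?_ ?_ ?_ <;> intros <;> rfl
  | cons a b ha hb => exact sound_cons ha hb
  | fold l a f hl ha hf => exact sound_fold hl ha hf
  | letE a b ha hb => exact sound_letE ha hb
  | app a b ha hb => exact sound_app ha hb

end

end Fn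
end ACQ

namespace ACQ
namespace Fn
open RAM

/-! Whole programs. -/

/-- The program that outputs the value of a closed expression. -/
def program (e : Expr [] (.list .nat)) : Program :=
  [.const 1 (3 + e.need)] ++ (e.compile [] 3 1 ++
    [.jle 3 0 (1 + (e.compile [] 3 1).length + 7), .load 2 3, .write 2, .const 2 1, .add 3 3 2,
      .load 3 3, .jle 0 0 (1 + (e.compile [] 3 1).length)])

/-- After the value has been computed, a last loop walks along the linked list in register 3 and
writes its elements, with seven instructions for each. -/
theorem program_correct (e : Expr [] (.list .nat)) (w : List ℕ) (T : ℕ)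
    (hT : e.cost w () + 7 * (e.eval w () : List ℕ).length + 2 ≤ T) :
    OutputsWithin (program e) w T (e.eval w ()) := by
  set P := program e with hP
  -- The temporaries occupy the registers from 3 up to `K - 1`, so the heap may begin at `K`.
  set K := 3 + e.need with hK
  set q := 1 + (e.compile [] 3 1).length with hq
  have hC : CodeAt P 0 (program e) := by
    intro i I hi
    simpa using hi
  simp only [program, codeAt_append, codeAt_cons, List.length_cons, List.length_nil,
    Nat.zero_add] at hC
  obtain ⟨⟨hI, -⟩, hE, h0, h1, h2, h3, h4, h5, h6, -⟩ := hC
  have R0 := Reach.set (P := P) (w := w) (c := init) (v := K) (r := 1) (p := 0) rfl hI rfl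
  set c0 := setReg init (0 + 1) 1 K with hc0
  obtain ⟨c1, R1, E1, V1⟩ := sound P w K e () [] 3 1 c0 hE rfl
    (by rw [hc0, setReg_ne _ _ _ _ _ (by omega)]; rfl) (by rw [hc0, setReg_same]) le_rfl le_rfl
    trivial
  have z1 : c1.reg 0 = 0 := by
    rw [E1.low 0 (by omega) (by omega) (by omega), hc0, setReg_ne _ _ _ _ _ (by omega)]; rfl
  have hp1 : K ≤ c1.reg 1 := by
    refine le_trans ?_ E1.hp
    rw [hc0, setReg_same]
  have hKn := e.one_le_need
  have loop : ∀ (l : List ℕ) (c : Config), c.pc = q → c.reg 0 = 0 → K ≤ c.reg 1 →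
      ListRep K (c.reg 1) c.reg (Rep K (c.reg 1) c.reg .nat) l (c.reg 3) →
      ∃ c', Reach P w (7 * l.length + 1) c c' ∧ c'.pc = q + 7 ∧ c'.out = c.out ++ l := by
    intro l
    induction l with
    | nil =>
      intro c pc z hp hl
      have hl0 : c.reg 3 = 0 := hl
      exact ⟨_, (Reach.jump (w := w) pc h0 (by omega)).mono (by omega), rfl, by simp [goto]⟩
    | cons x l ih =>
      intro c pc z hp hl
      obtain ⟨hx1, hx2, hx3, hx4⟩ := hl
      have S1 := Reach.skip (w := w) pc h0 (by omega)
      have S2 := Reach.set (P := P) (w := w) (c := goto c (q + 1)) (p := q + 1) (r := 2)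
        (v := c.reg (c.reg 3)) rfl h1 rfl
      set c2 := setReg (goto c (q + 1)) (q + 1 + 1) 2 (c.reg (c.reg 3)) with hc2
      have S3 : Reach P w 1 c2 ⟨q + 1 + 1 + 1, c2.reg, c2.out ++ [c2.reg 2]⟩ :=
        Reach.one (P := P) (w := w) (c := c2) (I := .write 2) h2
      set c3 : Config := ⟨q + 1 + 1 + 1, c2.reg, c2.out ++ [c2.reg 2]⟩ with hc3
      have v3 : ∀ x, x ≠ 2 → c3.reg x = c.reg x := fun x hx => by
        show c2.reg x = _
        rw [hc2, setReg_ne _ _ _ _ _ hx]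
        rfl
      obtain ⟨c4, S4, E4, V4, L4⟩ := second_correct (P := P) (w := w) (K := K) (c := c3) (d := 3)
        (p := q + 1 + 1 + 1) rfl h3 h4 h5 le_rfl (by omega) (by rw [v3 3 (by omega)]; exact hx1)
      have S5 := Reach.jump (w := w) E4.pc h6 le_rfl
      have hv1 : (goto c4 q).reg 1 = c.reg 1 := by
        show c4.reg 1 = _
        rw [L4 _ (by omega) (by omega), v3 _ (by omega)]
      have hv3 : (goto c4 q).reg 3 = c.reg (c.reg 3 + 1) := by
        show c4.reg 3 = _
        rw [V4, v3 3 (by omega), v3 _ (by omega)]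
      obtain ⟨c5, S6, pc5, out5⟩ := ih (goto c4 q) rfl (by
          show c4.reg 0 = 0
          rw [L4 _ (by omega) (by omega), v3 _ (by omega), z]) (by rw [hv1]; exact hp) (by
          rw [hv3]
          refine Rep.mono (t := .list .nat) (by rw [hv1]) ?_ _ _ hx4
          intro a ha _
          show c4.reg a = _
          rw [L4 _ (by omega) (by omega), v3 _ (by omega)])
      refine ⟨c5, ((((((S1.trans S2).trans S3).trans S4).trans S5).trans S6)).mono ?_, pc5, ?_⟩
      · simp only [List.length_cons]
        omega
      · rw [out5]
        have ho : (goto c4 q).out = c.out ++ [x] := by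
          show c4.out = _
          rw [E4.out]
          show c.out ++ [c2.reg 2] = _
          rw [hc2, setReg_same]
          have : c.reg (c.reg 3) = x := hx3
          rw [this]
        rw [ho]
        simp
  obtain ⟨c2, R2, pc2, out2⟩ := loop _ c1 E1.pc z1 hp1 V1
  obtain ⟨t, ht, htc⟩ := (R0.trans R1).trans R2
  refine ⟨t, by omega, ?_, ?_⟩
  · rw [htc, pc2, hP, program]
    simp only [List.length_append, List.length_cons, List.length_nil]
    omega
  · rw [htc, out2, E1.out]
    simp [hc0, setReg, init]

namespace Expr

/-! Bounds on the cost. -/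

/-- A property of all states of a loop over a list. -/
def foldBd {α β : Type} (g : β → α → β) (B : β → α → Prop) : List α → β → Prop
  | [], _ => True
  | x :: l, b => B b x ∧ foldBd g B l (g b x)

/-- All loops in the evaluation of an expression have at most `L` rounds. -/
def Bd (L : ℕ) (w : List ℕ) : {Γ : List Ty} → {t : Ty} → Expr Γ t → Env Γ → Prop
  | _, _, var _, _ => True
  | _, _, lit _, _ => True
  | _, _, add a b, env => a.Bd L w env ∧ b.Bd L w env
  | _, _, read a, env => a.Bd L w env
  | _, _, range a, env => a.Bd L w env ∧ (a.eval w env : ℕ) ≤ L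
  | _, _, ifle a b p q, env => a.Bd L w env ∧ b.Bd L w env ∧ p.Bd L w env ∧ q.Bd L w env
  | _, _, pair a b, env => a.Bd L w env ∧ b.Bd L w env
  | _, _, fst a, env => a.Bd L w env
  | _, _, snd a, env => a.Bd L w env
  | _, _, nil, _ => True
  | _, _, cons a l, env => a.Bd L w env ∧ l.Bd L w env
  | _, _, fold l a f, env => l.Bd L w env ∧ a.Bd L w env ∧ (l.eval w env).length ≤ L ∧
      foldBd (fun acc x => f.eval w (x, acc, env)) (fun acc x => f.Bd L w (x, acc, env))
        (l.eval w env) (a.eval w env)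
  | _, _, letE a b, env => a.Bd L w env ∧ b.Bd L w (a.eval w env, env)
  | _, _, app a f, env => a.Bd L w env ∧ f.Bd L w (a.eval w env, ())

/-- The exponent in the bound of the cost. -/
def wt : {Γ : List Ty} → {t : Ty} → Expr Γ t → ℕ
  | _, _, var _ => 0
  | _, _, lit _ => 0
  | _, _, add a b => a.wt + b.wt + 2
  | _, _, read a => a.wt + 1
  | _, _, range a => a.wt + 6
  | _, _, ifle a b p q => a.wt + b.wt + p.wt + q.wt + 5
  | _, _, pair a b => a.wt + b.wt + 5
  | _, _, fst a => a.wt + 1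
  | _, _, snd a => a.wt + 3
  | _, _, nil => 0
  | _, _, cons a l => a.wt + l.wt + 5
  | _, _, fold l a f => l.wt + a.wt + f.wt + 9
  | _, _, letE a b => a.wt + b.wt + 2
  | _, _, app a f => a.wt + f.wt + 2

/-- For positive numbers the sum is at most twice the product. Adding costs then only adds
exponents, with one unit for the factor 2, and multiplicative constants never appear. -/
theorem add_le_pow {B a b x y : ℕ} (hB : 2 ≤ B) (ha : a ≤ B ^ x) (hb : b ≤ B ^ y) :
    a + b ≤ B ^ (x + y + 1) := by
  have h1 : 1 ≤ B ^ x := Nat.one_le_pow _ _ (by omega)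
  have h2 : 1 ≤ B ^ y := Nat.one_le_pow _ _ (by omega)
  calc a + b ≤ B ^ x + B ^ y := by omega
    _ ≤ B ^ x * B ^ y * 2 := by nlinarith
    _ ≤ B ^ x * B ^ y * B := Nat.mul_le_mul_left _ hB
    _ = _ := by rw [pow_succ, pow_add]

theorem const_le_pow {B c k : ℕ} (hB : 2 ≤ B) (hc : c ≤ 2 ^ k) : c ≤ B ^ k :=
  hc.trans (Nat.pow_le_pow_left hB k)

theorem add_add_le_pow {B a b c x y k : ℕ} (hB : 2 ≤ B) (ha : a ≤ B ^ x) (hb : b ≤ B ^ y)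
    (hc : c ≤ 2 ^ k) : a + b + c ≤ B ^ (x + y + (k + 2)) :=
  (add_le_pow hB (add_le_pow hB ha hb) (const_le_pow hB hc)).trans
    (Nat.pow_le_pow_right (by omega) (by omega))

theorem foldCost_le {α β : Type} {g : β → α → β} {k : β → α → ℕ} {B : β → α → Prop} {M : ℕ}
    (h : ∀ b x, B b x → k b x ≤ M) :
    ∀ (l : List α) (b : β), foldBd g B l b → foldCost g k l b ≤ l.length * M
  | [], _, _ => by simp [foldCost]
  | x :: l, b, hb => by
    have h1 := h _ _ hb.1
    have h2 := foldCost_le h l _ hb.2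
    simp only [foldCost, List.length_cons, Nat.succ_mul]
    omega

/-- A loop multiplies the cost of its body by at most `L`, and all other constructs add costs.
Either way the exponent grows by an amount that depends on the syntax alone. This reduces every
running time below to bounding the lengths of lists and the arguments of `range`. -/
theorem cost_le (L : ℕ) (w : List ℕ) : ∀ {Γ : List Ty} {t : Ty} (e : Expr Γ t) (env : Env Γ),
    e.Bd L w env → e.cost w env ≤ (L + 2) ^ e.wt := by
  have hB : 2 ≤ L + 2 := by omega
  intro Γ t e
  induction e with
  | var x => intro env _; simp [cost, wt]
  | lit n => intro env _; simp [cost, wt]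
  | nil => intro env _; simp [cost, wt]
  | add a b ha hb =>
    intro env h
    exact add_add_le_pow (k := 0) hB (ha env h.1) (hb env h.2) (by norm_num)
  | read a ha =>
    intro env h
    exact add_le_pow hB (ha env h) (const_le_pow (k := 0) hB (by norm_num))
  | range a ha =>
    intro env h
    have key : ∀ n : ℕ, n ≤ L → 4 + 11 * n ≤ (L + 2) ^ 5 := fun n hn =>
      calc 4 + 11 * n ≤ 2 ^ 4 * (L + 2) := by omega
        _ ≤ (L + 2) ^ 4 * (L + 2) := Nat.mul_le_mul_right _ (Nat.pow_le_pow_left hB 4)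
        _ = _ := by ring
    exact add_le_pow hB (ha env h.1) (key _ h.2)
  | ifle a b p q ha hb hp hq =>
    intro env h
    exact add_le_pow hB (add_le_pow hB (add_le_pow hB (add_le_pow hB (ha env h.1)
      (hb env h.2.1)) (hp env h.2.2.1)) (hq env h.2.2.2))
      (const_le_pow (k := 1) hB (by norm_num)) |>.trans (Nat.pow_le_pow_right (by omega)
        (by simp only [wt]; omega))
  | pair a b ha hb =>
    intro env h
    exact add_add_le_pow (k := 3) hB (ha env h.1) (hb env h.2) (by norm_num)
  | fst a ha =>
    intro env h
    exact add_le_pow hB (ha env h) (const_le_pow (k := 0) hB (by norm_num))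
  | snd a ha =>
    intro env h
    exact add_le_pow hB (ha env h) (const_le_pow (k := 2) hB (by norm_num))
  | cons a b ha hb =>
    intro env h
    exact add_add_le_pow (k := 3) hB (ha env h.1) (hb env h.2) (by norm_num)
  | letE a b ha hb =>
    intro env h
    exact add_add_le_pow (k := 0) hB (ha env h.1) (hb _ h.2) (by norm_num)
  | app a b ha hb =>
    intro env h
    exact add_add_le_pow (k := 0) hB (ha env h.1) (hb _ h.2) (by norm_num)
  | fold l a f hl ha hf =>
    intro env h
    obtain ⟨h1, h2, h3, h4⟩ := h
    have hfc := foldCost_le (k := fun acc x => f.cost w (x, acc, env) + 7)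
      (M := (L + 2) ^ (f.wt + 3 + 1))
      (fun b x hbx => add_le_pow hB (hf _ hbx) (const_le_pow (k := 3) hB (by norm_num))) _ _ h4
    have hfc' := hfc.trans (Nat.mul_le_mul_right _ (h3.trans (show L ≤ L + 2 by omega)))
    rw [mul_comm, ← pow_succ] at hfc'
    exact (add_le_pow hB (add_le_pow hB (add_le_pow hB (hl env h1) (ha env h2)) hfc')
      (const_le_pow (k := 1) hB (by norm_num))).trans (Nat.pow_le_pow_right (by omega)
        (by simp only [wt]; omega))

/-- An invariant bounds a loop. -/
theorem foldBd_of_inv {α β : Type} {g : β → α → β} {B : β → α → Prop} (Inv : ℕ → β → Prop) :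
    ∀ (l : List α) (b : β) (i : ℕ), Inv i b →
      (∀ j b x, x ∈ l → j < i + l.length → Inv j b → B b x ∧ Inv (j + 1) (g b x)) → foldBd g B l b
  | [], _, _, _, _ => trivial
  | x :: l, b, i, hi, h => by
    obtain ⟨h1, h2⟩ := h i b x (by simp) (by simp) hi
    refine ⟨h1, foldBd_of_inv Inv l _ (i + 1) h2 fun j b y hy hj hb => h j b y (by simp [hy]) ?_ hb⟩
    simp only [List.length_cons]
    omega

end Expr

end Fn

end ACQ

namespace ACQ

/-! ### The algorithm, as functions on lists -/

namespace Alg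

/-- The rows of a table: a list of values with a gate. -/
abbrev TRow := List ℕ × ℕ

/-- A table: a status, a pattern of variables, and rows. -/
abbrev Factor := ℕ × (List ℕ × List TRow)

/-- The code of a gate: its type and two parameters. -/
abbrev GCode := ℕ × (ℕ × ℕ)

/-- The list of the first `n` values of a function. -/
def tab {α : Type*} (n : ℕ) (f : ℕ → α) : List α := (List.range n).map f

/-- Two rows are compatible if they agree where both are defined. -/
def Compat (N : ℕ) (r s : List ℕ) : Prop :=
  ∀ x < N, r.getD x 0 = 0 ∨ s.getD x 0 = 0 ∨ r.getD x 0 = s.getD x 0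

instance (N : ℕ) (r s : List ℕ) : Decidable (Compat N r s) :=
  inferInstanceAs (Decidable (∀ x < N, _))

/-- Two rows have equal entries. -/
def EqRow (N : ℕ) (r s : List ℕ) : Prop := ∀ x < N, r.getD x 0 = s.getD x 0

instance (N : ℕ) (r s : List ℕ) : Decidable (EqRow N r s) :=
  inferInstanceAs (Decidable (∀ x < N, _))

/-- Insert a row into a list of rows, unless it is there. -/
def ins (N : ℕ) (a : TRow) (T : List TRow) : List TRow :=
  if ∃ b ∈ T, EqRow N b.1 a.1 then T else a :: T

/-- The part of a row on the free variables. -/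
def mask (N : ℕ) (fr r : List ℕ) : List ℕ :=
  tab N fun x => if 1 ≤ fr.getD x 0 then r.getD x 0 else 0

/-- A row extended by the free part of another row. -/
def joinRow (N : ℕ) (fr r s : List ℕ) : List ℕ :=
  tab N fun x => if 1 ≤ r.getD x 0 then r.getD x 0 else if 1 ≤ fr.getD x 0 then s.getD x 0 else 0

/-- Join a row with one row. -/
def qStep (N : ℕ) (fr : List ℕ) (r : TRow) (acc : List TRow × List GCode) (s : TRow) :
    List TRow × List GCode :=
  if Compat N r.1 s.1 then
    (ins N (joinRow N fr r.1 s.1, acc.2.length) acc.1, (3, (r.2, s.2)) :: acc.2)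
  else acc

/-- Join two tables, keeping the free variables of the first one. -/
def qMerge (N : ℕ) (fr : List ℕ) (Ti Tj : List TRow) (G : List GCode) :
    List TRow × List GCode :=
  Tj.foldl (fun acc r => Ti.foldl (qStep N fr r) acc) ([], G)

/-- The projection of a table to the free variables. -/
def proj (N : ℕ) (fr : List ℕ) (Ti : List TRow) : List TRow :=
  Ti.foldl (fun T s => ins N (mask N fr s.1, s.2) T) []

/-- Multiply by the variable of one entry of a row. -/
def varStep (W s : List ℕ) (acc : ℕ × List GCode) (x : ℕ) : ℕ × List GCode :=
  if 1 ≤ s.getD x 0 then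
    if 1 ≤ W.getD x 0 then acc
    -- Two gates are appended, the variable and the product with it. Entries of rows are shifted by
    -- one, so the domain element is the entry minus 1.
    else (acc.2.length + 1, (3, (acc.1, acc.2.length)) :: (1, (s.getD x 0 - 1, 0)) :: acc.2)
  else acc

/-- Multiply the weight of a row by its variables outside `W`. -/
def monom (N : ℕ) (W : List ℕ) (s : TRow) (G : List GCode) : ℕ × List GCode :=
  (List.range N).reverse.foldl (varStep W s.1) (s.2, G)

/-- Add the weight of a row, if it is compatible. -/
def sStep (N : ℕ) (W : List ℕ) (r : TRow) (acc : ℕ × List GCode) (s : TRow) : ℕ × List GCode :=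
  if Compat N r.1 s.1 then
    ((monom N W s acc.2).2.length,
      (2, (acc.1, (monom N W s acc.2).1)) :: (monom N W s acc.2).2)
  else acc

/-- The sum of the weights of the rows compatible with `r`. -/
def sSum (N : ℕ) (W : List ℕ) (P : List TRow) (r : TRow) (G : List GCode) : ℕ × List GCode :=
  P.foldl (sStep N W r) (G.length, (0, (0, 0)) :: G)

/-- Multiply the weight of a row by the weights of the compatible rows. -/
def sRow (N : ℕ) (W : List ℕ) (P : List TRow) (acc : List TRow × List GCode) (r : TRow) :
    List TRow × List GCode :=
  ((r.1, (sSum N W P r acc.2).2.length) :: acc.1,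
    (3, (r.2, (sSum N W P r acc.2).1)) :: (sSum N W P r acc.2).2)

/-- Sum out a table. -/
def sMerge (N : ℕ) (fr W : List ℕ) (Ti Tj : List TRow) (G : List GCode) :
    List TRow × List GCode :=
  Tj.foldl (sRow N W (proj N fr Ti)) ([], G)

/-- The `i`-th table. -/
def fac (fs : List Factor) (i : ℕ) : Factor := fs.getD i (0, ([], []))

/-- The entry of the pattern of the `i`-th table at `x`. -/
def pat (fs : List Factor) (i x : ℕ) : ℕ := (fac fs i).2.1.getD x 0

/-- The table `i` can be merged into the table `j`. -/
def Good (N : ℕ) (fs : List Factor) (i j : ℕ) : Prop :=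
  -- Status 1 marks a table that still has to be merged, status 0 one that has been merged, and
  -- status 2 the table at position 0, which may only receive.
  (1 ≤ (fac fs i).1 ∧ (fac fs i).1 ≤ 1) ∧ 1 ≤ (fac fs j).1 ∧ i ≠ j ∧
    ∀ x < N, pat fs i x = 0 ∨ 1 ≤ pat fs j x ∨ ∀ l < fs.length, l = i ∨ pat fs l x = 0

instance (N : ℕ) (fs : List Factor) (i j : ℕ) : Decidable (Good N fs i j) :=
  inferInstanceAs (Decidable (_ ∧ _ ∧ _ ∧ ∀ x < N, _))

/-- Find two tables to merge. -/
def pick (N : ℕ) (fs : List Factor) : ℕ × ℕ :=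
  (List.range fs.length).reverse.foldl (fun acc i =>
    (List.range fs.length).reverse.foldl (fun acc j => if Good N fs i j then (i, j) else acc) acc)
    (0, 0)

/-- The tables `i` and `j` share a quantified variable. -/
def Linked (N : ℕ) (fr Wi Wj : List ℕ) : Prop :=
  ∃ x < N, 1 ≤ Wi.getD x 0 ∧ 1 ≤ Wj.getD x 0 ∧ fr.getD x 0 = 0

instance (N : ℕ) (fr Wi Wj : List ℕ) : Decidable (Linked N fr Wi Wj) :=
  inferInstanceAs (Decidable (∃ x < N, _))

/-- Merge a table into another one. -/
def merge (N : ℕ) (fr : List ℕ) (fi fj : Factor) (G : List GCode) : Factor × List GCode :=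
  if Linked N fr fi.2.1 fj.2.1 then
    ((fj.1, (joinRow N fr fj.2.1 fi.2.1, (qMerge N fr fi.2.2 fj.2.2 G).1)),
      (qMerge N fr fi.2.2 fj.2.2 G).2)
  else
    ((fj.1, (fj.2.1, (sMerge N fr fj.2.1 fi.2.2 fj.2.2 G).1)),
      (sMerge N fr fj.2.1 fi.2.2 fj.2.2 G).2)

/-- The row without entries. -/
def zeros (N : ℕ) : List ℕ := tab N fun _ => 0

/-- The table that is always true, with a given status. -/
def trivialFactor (N a : ℕ) : Factor := (a, (zeros N, [(zeros N, 0)]))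

/-- Replace the tables `i` and `j`. -/
def replace (N : ℕ) (fs : List Factor) (i j : ℕ) (f : Factor) : List Factor :=
  tab fs.length fun l => if l = i then trivialFactor N 0 else if l = j then f else fac fs l

/-- One round of the algorithm. -/
def step (N : ℕ) (fr : List ℕ) (st : List Factor × List GCode) : List Factor × List GCode :=
  (replace N st.1 (pick N st.1).1 (pick N st.1).2
      (merge N fr (fac st.1 (pick N st.1).1) (fac st.1 (pick N st.1).2) st.2).1,
    (merge N fr (fac st.1 (pick N st.1).1) (fac st.1 (pick N st.1).2) st.2).2)

/-! Reading the input. -/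

/-- A row of the table of an atom: variables at `p`, values at `pos`. -/
def parseRow (w : List ℕ) (N ar p pos : ℕ) : List ℕ :=
  tab N fun x => (List.range ar).reverse.foldl
    -- Values are shifted by one so that 0 can mean that there is no value. The word has the
    -- relation symbol of the atom at `p`, hence its variables from `p + 1` on.
    (fun acc q => if w.getD (p + 1 + q) 0 = x then w.getD (pos + q) 0 + 1 else acc) 0

/-- Insert the row of a tuple, unless the tuple is inconsistent. -/
def parseStep (w : List ℕ) (N ar p : ℕ) (acc : ℕ × List TRow) : ℕ × List TRow :=
  (acc.1 + ar,
    if ∀ q < ar, (parseRow w N ar p acc.1).getD (w.getD (p + 1 + q) 0) 0 = w.getD (acc.1 + q) 0 + 1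
    then ins N (parseRow w N ar p acc.1, 0) acc.2 else acc.2)

/-- The table of an atom. -/
def parseAtom (w : List ℕ) (N ar p pos cnt : ℕ) : Factor :=
  (1, (tab N fun x => if ∃ q < ar, w.getD (p + 1 + q) 0 = x then 1 else 0,
    ((List.range cnt).reverse.foldl (fun acc _ => parseStep w N ar p acc) (pos, [])).2))

/-- The position of the information on the relation of the atom at `p`. -/
def relPos (w : List ℕ) (p : ℕ) : ℕ :=
  4 + w.getD 2 0 + (w.getD p 0 + w.getD p 0 + w.getD p 0)

/-- The position of the next atom. -/
def nextPos (w : List ℕ) (p : ℕ) : ℕ := p + 1 + w.getD (relPos w p) 0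

/-- The position of the first atom. -/
def atomPos (w : List ℕ) : ℕ := 4 + w.getD 2 0 + (w.getD 1 0 + w.getD 1 0 + w.getD 1 0)

/-- The position of the data block. -/
def dataPos (w : List ℕ) : ℕ :=
  (List.range (w.getD 3 0)).reverse.foldl (fun p _ => nextPos w p) (atomPos w)

/-- Read an atom. -/
def readStep (w : List ℕ) (acc : ℕ × List Factor) : ℕ × List Factor :=
  (nextPos w acc.1, parseAtom w (w.getD 2 0) (w.getD (relPos w acc.1) 0) acc.1
    (dataPos w + w.getD (relPos w acc.1 + 2) 0) (w.getD (relPos w acc.1 + 1) 0) :: acc.2)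

/-- The tables of the query. -/
def readAll (w : List ℕ) : List Factor :=
  trivialFactor (w.getD 2 0) 2 ::
    ((List.range (w.getD 3 0)).reverse.foldl (fun acc _ => readStep w acc) (atomPos w, [])).2

/-- The flags of the free variables. -/
def freeFlags (w : List ℕ) : List ℕ :=
  tab (w.getD 2 0) fun x => if w.getD (4 + x) 0 ≤ 0 then 1 else 0

/-- The final state. -/
def run (w : List ℕ) : List Factor × List GCode :=
  (List.range (w.getD 3 0)).reverse.foldl (fun st _ => step (w.getD 2 0) (freeFlags w) st)
    (readAll w, [(0, (1, 0))])

/-- The gate of the result. -/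
def resultGate (fs : List Factor) : ℕ := (fac fs 0).2.2.foldl (fun _ r => r.2) 0

/-! The output. -/

/-- Use one gate without effect. -/
def useStep (z : ℕ) (acc : ℕ × List GCode) (j : ℕ) : ℕ × List GCode :=
  -- The gate `z` is the constant 0. Adding the product of `z` and gate `j` to the current output
  -- leaves its value alone but gives gate `j` a successor.
  (acc.2.length + 1, (2, (acc.1, acc.2.length)) :: (3, (z, j)) :: acc.2)

/-- Append gates such that all gates but the last one are used. -/
def useAll (g : ℕ) (G : List GCode) : List GCode :=
  ((List.range G.length).reverse.foldl (useStep G.length) (g, (0, (0, 0)) :: G)).2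

/-- Write the code of a gate. -/
def emitStep (acc : List ℕ) (g : GCode) : List ℕ :=
  if g.1 ≤ 1 then g.1 :: g.2.1 :: acc else g.1 :: g.2.1 :: g.2.2 :: acc

/-- The code of the circuit. -/
def circuitOut (w : List ℕ) : List ℕ :=
  (useAll (resultGate (run w).1) (run w).2).foldl emitStep []

/-- The list of the multiples of `(1, a)` by powers of two, the greatest first. -/
def powStep (acc : (ℕ × ℕ) × List (ℕ × ℕ)) : (ℕ × ℕ) × List (ℕ × ℕ) :=
  ((acc.1.1 + acc.1.1, acc.1.2 + acc.1.2), acc.1 :: acc.2)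

/-- Multiplication by doubling, with `B` rounds. -/
def mulNat (B a b : ℕ) : ℕ :=
  (((List.range B).reverse.foldl (fun acc _ => powStep acc) ((1, a), [])).2.foldl
    (fun acc p => if acc.1 + p.1 ≤ b then (acc.1 + p.1, acc.2 + p.2) else acc) (0, 0)).2

/-- The value of a gate at the all-ones point. -/
def gateVal (B : ℕ) (vs : List ℕ) (g : GCode) : ℕ :=
  if g.1 ≤ 0 then g.2.1 else if g.1 ≤ 1 then 1 else
    if g.1 ≤ 2 then vs.getD g.2.1 0 + vs.getD g.2.2 0
    else mulNat B (vs.getD g.2.1 0) (vs.getD g.2.2 0)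

/-- The values of the gates at the all-ones point. -/
def gateVals (G : List GCode) : List ℕ :=
  -- The two reversals append the new value at the end, so that position `k` of the list holds the
  -- value of gate `k`.
  G.reverse.foldl (fun vs g => (gateVal G.length vs g :: vs.reverse).reverse) []

/-- The number of answers. -/
def countOut (w : List ℕ) : List ℕ :=
  [(gateVals (run w).2).getD (resultGate (run w).1) 0]

end Alg

end ACQ

namespace ACQ
namespace Fn
open Alg

/-! ### The algorithm as a program -/

namespace Ty

/-- The type of rows. -/
abbrev row : Ty := .list .nat

/-- The type of rows with gates. -/
abbrev trow : Ty := .prod row .nat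

/-- The type of tables. -/
abbrev factor : Ty := .prod .nat (.prod row (.list trow))

/-- The type of gates. -/
abbrev gate : Ty := .prod .nat (.prod .nat .nat)

/-- The type of lists of gates. -/
abbrev gates : Ty := .list gate

end Ty

namespace Expr

variable {Γ : List Ty} {t u : Ty}

/-- Variables. -/
abbrev v0 {a : Ty} : Expr (a :: Γ) a := .var .z
/-- Variables. -/
abbrev v1 {a b : Ty} : Expr (b :: a :: Γ) a := .var (.s .z)
/-- Variables. -/
abbrev v2 {a b c : Ty} : Expr (c :: b :: a :: Γ) a := .var (.s (.s .z))
/-- Variables. -/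
abbrev v3 {a b c d : Ty} : Expr (d :: c :: b :: a :: Γ) a := .var (.s (.s (.s .z)))
/-- Variables. -/
abbrev v4 {a b c d e : Ty} : Expr (e :: d :: c :: b :: a :: Γ) a := .var (.s (.s (.s (.s .z))))

/-- Conditional on a truth value. -/
abbrev ifE (c : Expr Γ .nat) (p q : Expr Γ t) : Expr Γ t := .ifle (.lit 1) c p q
/-- Conditional on equality. -/
abbrev ifeq (a b : Expr Γ .nat) (p q : Expr Γ t) : Expr Γ t := .ifle a b (.ifle b a p q) q

/-- Whether all elements of a list satisfy a condition. -/
def allL (l : Expr Γ (.list t)) (b : Expr (t :: .nat :: Γ) .nat) : Expr Γ .nat :=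
  .fold l (.lit 1) (ifE b v1 (.lit 0))
/-- Whether some element of a list satisfies a condition. -/
def anyL (l : Expr Γ (.list t)) (b : Expr (t :: .nat :: Γ) .nat) : Expr Γ .nat :=
  .fold l (.lit 0) (ifE b (.lit 1) v1)
/-- Tabulation of a function. -/
def tabE (n : Expr Γ .nat) (b : Expr (.nat :: .list t :: Γ) t) : Expr Γ (.list t) :=
  .fold (.range n) .nil (.cons b v1)

theorem one_le_ite {p : Prop} [Decidable p] : 1 ≤ (if p then 1 else 0) ↔ p := by
  split_ifs with h <;> simp [h]

section
variable (w : List ℕ)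

theorem eval_ifE {c : Expr Γ .nat} {p q : Expr Γ t} {env : Env Γ} {a : Prop} [Decidable a]
    (h : c.eval w env = (if a then 1 else 0 : ℕ)) :
    (ifE c p q).eval w env = if a then p.eval w env else q.eval w env := by
  show (if (1 : ℕ) ≤ c.eval w env then _ else _) = _
  rw [h]
  exact if_congr one_le_ite rfl rfl

theorem eval_allL (l : Expr Γ (.list t)) (b : Expr (t :: .nat :: Γ) .nat) (env : Env Γ)
    (p : t.den → Prop) [Decidable (∀ x ∈ (l.eval w env : List t.den), p x)]
    (h : ∀ x a, (1 ≤ (b.eval w (x, a, env) : ℕ)) ↔ p x) :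
    (allL l b).eval w env = (if ∀ x ∈ (l.eval w env : List t.den), p x then 1 else 0 : ℕ) := by
  classical
  have key : ∀ (xs : List t.den) (a : ℕ), xs.foldl (fun (acc : ℕ) x =>
      if (1 : ℕ) ≤ b.eval w (x, acc, env) then acc else (0 : ℕ)) a =
      if ∀ x ∈ xs, p x then a else 0 := by
    intro xs
    induction xs with
    | nil => intro a; simp
    | cons x xs ih =>
      intro a
      rw [List.foldl_cons, ih]
      by_cases hx : p x
      · rw [if_pos ((h x a).2 hx)]
        exact if_congr (by simp [hx]) rfl rfl
      · rw [if_neg (fun hc => hx ((h x a).1 hc)), ite_self, if_neg (by simp [hx])]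
  refine (key (l.eval w env) 1).trans ?_
  congr

theorem eval_anyL (l : Expr Γ (.list t)) (b : Expr (t :: .nat :: Γ) .nat) (env : Env Γ)
    (p : t.den → Prop) [Decidable (∃ x ∈ (l.eval w env : List t.den), p x)]
    (h : ∀ x a, (1 ≤ (b.eval w (x, a, env) : ℕ)) ↔ p x) :
    (anyL l b).eval w env = (if ∃ x ∈ (l.eval w env : List t.den), p x then 1 else 0 : ℕ) := by
  classical
  have key : ∀ (xs : List t.den) (a : ℕ), xs.foldl (fun (acc : ℕ) x =>
      if (1 : ℕ) ≤ b.eval w (x, acc, env) then (1 : ℕ) else acc) a =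
      if ∃ x ∈ xs, p x then 1 else a := by
    intro xs
    induction xs with
    | nil => intro a; simp
    | cons x xs ih =>
      intro a
      rw [List.foldl_cons, ih]
      by_cases hx : p x
      · rw [if_pos ((h x a).2 hx), ite_self, if_pos ⟨x, by simp, hx⟩]
      · rw [if_neg (fun hc => hx ((h x a).1 hc))]
        exact if_congr (by simp [hx]) rfl rfl
  refine (key (l.eval w env) 0).trans ?_
  congr

theorem eval_allR (n : Expr Γ .nat) (b : Expr (.nat :: .nat :: Γ) .nat) (env : Env Γ)
    (p : ℕ → Prop) [Decidable (∀ x < (n.eval w env : ℕ), p x)]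
    (h : ∀ x a, (1 ≤ (b.eval w (x, a, env) : ℕ)) ↔ p x) :
    (allL (.range n) b).eval w env = (if ∀ x < (n.eval w env : ℕ), p x then 1 else 0 : ℕ) := by
  classical
  rw [eval_allL w (.range n) b env p h]
  simp only [eval, List.mem_reverse, List.mem_range]

theorem eval_anyR (n : Expr Γ .nat) (b : Expr (.nat :: .nat :: Γ) .nat) (env : Env Γ)
    (p : ℕ → Prop) [Decidable (∃ x < (n.eval w env : ℕ), p x)]
    (h : ∀ x a, (1 ≤ (b.eval w (x, a, env) : ℕ)) ↔ p x) :
    (anyL (.range n) b).eval w env = (if ∃ x < (n.eval w env : ℕ), p x then 1 else 0 : ℕ) := by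
  classical
  rw [eval_anyL w (.range n) b env p h]
  simp only [eval, List.mem_reverse, List.mem_range]

theorem eval_tabE (n : Expr Γ .nat) (b : Expr (.nat :: .list t :: Γ) t) (env : Env Γ)
    (g : ℕ → t.den) (h : ∀ x a, b.eval w (x, a, env) = g x) :
    (tabE n b).eval w env = tab (n.eval w env) g := by
  have key : ∀ (xs : List ℕ) (a : List t.den), xs.foldl (fun (acc : List t.den) x =>
      b.eval w (x, acc, env) :: acc) a = (xs.map g).reverse ++ a := by
    intro xs
    induction xs with
    | nil => simp
    | cons x xs ih =>
      intro a
      rw [List.foldl_cons, ih]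
      simp [h]
  refine (key _ _).trans ?_
  simp [tab, eval]

/-! Elementary programs. -/

/-- The element of a list at a position. -/
def nthP (dv : Expr [.prod (.list t) .nat] t) : Expr [.prod (.list t) .nat] t :=
  .snd (.fold (.fst v0) (.pair (.lit 0) dv)
    (.pair (.add (.fst v1) (.lit 1)) (ifeq (.fst v1) (.snd v2) v0 (.snd v1))))

theorem eval_nthP (dv : Expr [.prod (.list t) .nat] t) (l : List t.den) (i : ℕ) :
    (nthP dv).eval w ((l, i), ()) = l.getD i (dv.eval w ((l, i), ())) := by
  -- Here `k` is the position of the head of `xs` in the whole list; the answer is overwritten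
  -- exactly when `k = i`.
  have key : ∀ (xs : List t.den) (k : ℕ) (r : t.den), (xs.foldl
      (fun (acc : ℕ × t.den) x => (acc.1 + 1, if acc.1 ≤ i then if i ≤ acc.1 then x else acc.2
        else acc.2)) (k, r)).2 = if k ≤ i then xs.getD (i - k) r else r := by
    intro xs
    induction xs with
    | nil => simp
    | cons x xs ih =>
      intro k r
      rw [List.foldl_cons, ih]
      rcases lt_trichotomy k i with h | h | h
      · rw [if_pos h.le, if_pos (by omega), if_pos h.le, if_neg (by omega)]
        obtain ⟨d, rfl⟩ : ∃ d, i = k + 1 + d := ⟨i - (k + 1), by omega⟩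
        rw [show k + 1 + d - k = d + 1 by omega, show k + 1 + d - (k + 1) = d by omega,
          List.getD_cons_succ]
      · subst h
        simp
      · rw [if_neg (by omega), if_neg (by omega), if_neg (by omega)]
  refine (key l 0 _).trans ?_
  simp

/-- The entry of a row at a position. -/
def nth (l : Expr Γ .row) (i : Expr Γ .nat) : Expr Γ .nat := .app (.pair l i) (nthP (.lit 0))

@[simp] theorem eval_nth (l : Expr Γ .row) (i : Expr Γ .nat) (env : Env Γ) :
    (nth l i).eval w env = (l.eval w env : List ℕ).getD (i.eval w env) 0 :=
  eval_nthP (t := .nat) w (.lit 0) _ _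

/-- The table at a position. -/
def facE (l : Expr Γ (.list .factor)) (i : Expr Γ .nat) : Expr Γ .factor :=
  .app (.pair l i) (nthP (.pair (.lit 0) (.pair .nil .nil)))

@[simp] theorem eval_facE (l : Expr Γ (.list .factor)) (i : Expr Γ .nat) (env : Env Γ) :
    (facE l i).eval w env = fac (l.eval w env) (i.eval w env) :=
  eval_nthP (t := .factor) w _ _ _

/-- The length of a list. -/
def len (l : Expr Γ (.list t)) : Expr Γ .nat := .fold l (.lit 0) (.add v1 (.lit 1))

@[simp] theorem eval_len (l : Expr Γ (.list t)) (env : Env Γ) :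
    (len l).eval w env = (l.eval w env : List t.den).length := by
  have key : ∀ (xs : List t.den) (k : ℕ), xs.foldl (fun (acc : ℕ) _ => acc + 1) k
      = k + xs.length := by
    intro xs
    induction xs with
    | nil => simp
    | cons x xs ih => intro k; rw [List.foldl_cons, ih, List.length_cons]; omega
  refine (key _ 0).trans ?_
  simp

/-- The predecessor of a number. -/
def predE (n : Expr Γ .nat) : Expr Γ .nat := .fold (.range n) (.lit 0) (.ifle v1 v0 v0 v1)

-- The language has no subtraction; the predecessor of `n` is found as the maximum of the numbers
-- below `n`. Its cost is linear in `n`, so it may only be applied to bounded numbers.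
@[simp] theorem eval_predE (n : Expr Γ .nat) (env : Env Γ) :
    (predE n).eval w env = (n.eval w env : ℕ) - 1 := by
  have key : ∀ (n a : ℕ), (List.range n).reverse.foldl
      (fun (acc x : ℕ) => if acc ≤ x then x else acc) a = max a (n - 1) := by
    intro n
    induction n with
    | zero => simp
    | succ n ih =>
      intro a
      rw [List.range_succ, List.reverse_append, List.reverse_singleton, List.singleton_append,
        List.foldl_cons, ih]
      split_ifs <;> omega
  refine (key _ 0).trans ?_
  simp

/-- The reverse of a list. -/
def rev (l : Expr Γ (.list t)) : Expr Γ (.list t) := .fold l .nil (.cons v0 v1)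

@[simp] theorem eval_rev (l : Expr Γ (.list t)) (env : Env Γ) :
    (rev l).eval w env = (l.eval w env : List t.den).reverse := by
  have key : ∀ (xs a : List t.den), xs.foldl (fun (acc : List t.den) x => x :: acc) a
      = xs.reverse ++ a := by
    intro xs
    induction xs with
    | nil => simp
    | cons x xs ih => intro a; rw [List.foldl_cons, ih]; simp
  refine (key _ []).trans ?_
  simp

/-! Rows. -/

/-- Arguments: `(N, r, s)`. -/
def compatP : Expr [.prod .nat (.prod .row .row)] .nat :=
  allL (.range (.fst v0)) (.ifle (nth (.fst (.snd v2)) v0) (.lit 0) (.lit 1)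
    (.ifle (nth (.snd (.snd v2)) v0) (.lit 0) (.lit 1)
      (ifeq (nth (.fst (.snd v2)) v0) (nth (.snd (.snd v2)) v0) (.lit 1) (.lit 0))))

theorem eval_compatP (N : ℕ) (r s : List ℕ) :
    compatP.eval w ((N, r, s), ()) = if Compat N r s then 1 else 0 := by
  refine eval_allR w (.fst v0) _ _ (fun x => r.getD x 0 = 0 ∨ s.getD x 0 = 0 ∨
    r.getD x 0 = s.getD x 0) ?_
  intro x a
  simp only [eval, eval_nth]
  split_ifs <;> grind

/-- Compatibility of rows. -/
def compatE (a : Expr Γ .nat) (b c : Expr Γ .row) :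
    Expr Γ .nat :=
  .app (.pair a (.pair b c)) compatP

@[simp] theorem eval_compatE (a : Expr Γ .nat) (b c : Expr Γ .row)
    (env : Env Γ) : (compatE a b c).eval w env =
      (if Compat (a.eval w env) (b.eval w env) (c.eval w env) then 1 else 0 : ℕ) :=
  eval_compatP w _ _ _

/-- Arguments: `(N, r, s)`. -/
def eqRowP : Expr [.prod .nat (.prod .row .row)] .nat :=
  allL (.range (.fst v0))
    (ifeq (nth (.fst (.snd v2)) v0) (nth (.snd (.snd v2)) v0) (.lit 1) (.lit 0))

theorem eval_eqRowP (N : ℕ) (r s : List ℕ) :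
    eqRowP.eval w ((N, r, s), ()) = if EqRow N r s then 1 else 0 := by
  refine eval_allR w (.fst v0) _ _ (fun x => r.getD x 0 = s.getD x 0) ?_
  intro x a
  simp only [eval, eval_nth]
  split_ifs <;> grind

/-- Meant for rewriting with `↓`, before the conditional is unfolded: the comparison of 1 with a
truth value becomes the proposition itself, and the result matches the function on lists
definitionally. -/
theorem eval_if_compatE (a : Expr Γ .nat) (b c : Expr Γ .row) (p q : Expr Γ t) (env : Env Γ) :
    (ifE (compatE a b c) p q).eval w env =
      if Compat (a.eval w env) (b.eval w env) (c.eval w env) then p.eval w env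
      else q.eval w env :=
  eval_ifE w (eval_compatE w a b c env)

/-- Equality of rows. -/
def eqRowE (a : Expr Γ .nat) (b c : Expr Γ .row) :
    Expr Γ .nat :=
  .app (.pair a (.pair b c)) eqRowP

@[simp] theorem eval_eqRowE (a : Expr Γ .nat) (b c : Expr Γ .row)
    (env : Env Γ) : (eqRowE a b c).eval w env =
      (if EqRow (a.eval w env) (b.eval w env) (c.eval w env) then 1 else 0 : ℕ) :=
  eval_eqRowP w _ _ _

/-- Arguments: `(N, a, T)`. -/
def insP : Expr [.prod .nat (.prod .trow (.list .trow))] (.list .trow) :=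
  ifE (anyL (.snd (.snd v0)) (eqRowE (.fst v2) (.fst v0) (.fst (.fst (.snd v2))))) (.snd (.snd v0))
    (.cons (.fst (.snd v0)) (.snd (.snd v0)))

theorem eval_insP (N : ℕ) (a : TRow) (T : List TRow) :
    insP.eval w ((N, a, T), ()) = ins N a T := by
  have h := eval_anyL w (Γ := [.prod .nat (.prod .trow (.list .trow))]) (t := .trow)
    (.snd (.snd v0)) (eqRowE (.fst v2) (.fst v0) (.fst (.fst (.snd v2))))
    ((N, a, T), ()) (fun b => EqRow N b.1 a.1) (by
      intro x b
      rw [eval_eqRowE]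
      exact one_le_ite)
  simp only [insP, eval, ins]
  rw [h]
  exact if_congr one_le_ite rfl rfl

/-- Insertion of a row. -/
def insE (a : Expr Γ .nat) (b : Expr Γ .trow) (c : Expr Γ (.list .trow)) :
    Expr Γ (.list .trow) :=
  .app (.pair a (.pair b c)) insP

@[simp] theorem eval_insE (a : Expr Γ .nat) (b : Expr Γ .trow) (c : Expr Γ (.list .trow))
    (env : Env Γ) : (insE a b c).eval w env =
      ins (a.eval w env) (b.eval w env) (c.eval w env) :=
  eval_insP w _ _ _

/-- Arguments: `(N, fr, r)`. -/
def maskP : Expr [.prod .nat (.prod .row .row)] .row :=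
  tabE (.fst v0) (ifE (nth (.fst (.snd v2)) v0) (nth (.snd (.snd v2)) v0) (.lit 0))

theorem eval_maskP (N : ℕ) (fr r : List ℕ) :
    maskP.eval w ((N, fr, r), ()) = mask N fr r := by
  refine eval_tabE (t := .nat) w _ _ _ _ ?_
  intro x a
  simp

/-- Restriction of a row. -/
def maskE (a : Expr Γ .nat) (b c : Expr Γ .row) :
    Expr Γ .row :=
  .app (.pair a (.pair b c)) maskP

@[simp] theorem eval_maskE (a : Expr Γ .nat) (b c : Expr Γ .row)
    (env : Env Γ) : (maskE a b c).eval w env =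
      mask (a.eval w env) (b.eval w env) (c.eval w env) :=
  eval_maskP w _ _ _

/-- Arguments: `(N, fr, r, s)`. -/
def joinP : Expr [.prod .nat (.prod .row (.prod .row .row))] .row :=
  tabE (.fst v0) (ifE (nth (.fst (.snd (.snd v2))) v0) (nth (.fst (.snd (.snd v2))) v0)
    (ifE (nth (.fst (.snd v2)) v0) (nth (.snd (.snd (.snd v2))) v0) (.lit 0)))

theorem eval_joinP (N : ℕ) (fr r s : List ℕ) :
    joinP.eval w ((N, fr, r, s), ()) = joinRow N fr r s := by
  refine eval_tabE (t := .nat) w _ _ _ _ ?_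
  intro x a
  simp

/-- Join of two rows. -/
def joinE (a : Expr Γ .nat) (b c d : Expr Γ .row) :
    Expr Γ .row :=
  .app (.pair a (.pair b (.pair c d))) joinP

@[simp] theorem eval_joinE (a : Expr Γ .nat) (b c d : Expr Γ .row)
    (env : Env Γ) : (joinE a b c d).eval w env =
      joinRow (a.eval w env) (b.eval w env) (c.eval w env) (d.eval w env) :=
  eval_joinP w _ _ _ _

/-! Merging. -/

/-- Arguments: `(N, fr, Ti, Tj, G)`. -/
def qMergeP : Expr [.prod .nat (.prod .row (.prod (.list .trow) (.prod (.list .trow) .gates)))]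
    (.prod (.list .trow) .gates) :=
  .fold (.fst (.snd (.snd (.snd v0)))) (.pair .nil (.snd (.snd (.snd (.snd v0)))))
    (.fold (.fst (.snd (.snd v2))) v1
      (ifE (compatE (.fst v4) (.fst v2) (.fst v0))
        (.pair (insE (.fst v4) (.pair (joinE (.fst v4) (.fst (.snd v4)) (.fst v2) (.fst v0)) (len
          (.snd v1))) (.fst v1))
          (.cons (.pair (.lit 3) (.pair (.snd v2) (.snd v0))) (.snd v1)))
        v1))

theorem eval_qMergeP (N : ℕ) (fr : List ℕ) (Ti Tj : List TRow) (G : List GCode) :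
    qMergeP.eval w ((N, fr, Ti, Tj, G), ()) = qMerge N fr Ti Tj G := by
  simp only [qMergeP, eval, ↓eval_if_compatE, eval_insE, eval_joinE, eval_len]
  rfl

/-- Join of two tables. -/
def qMergeE (a : Expr Γ .nat) (b : Expr Γ .row) (c d : Expr Γ (.list .trow)) (e : Expr Γ .gates) :
    Expr Γ (.prod (.list .trow) .gates) :=
  .app (.pair a (.pair b (.pair c (.pair d e)))) qMergeP

@[simp] theorem eval_qMergeE (a : Expr Γ .nat) (b : Expr Γ .row) (c d : Expr Γ (.list .trow))
    (e : Expr Γ .gates)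
    (env : Env Γ) : (qMergeE a b c d e).eval w env =
      qMerge (a.eval w env) (b.eval w env) (c.eval w env) (d.eval w env) (e.eval w env) :=
  eval_qMergeP w _ _ _ _ _

/-- Arguments: `(N, fr, Ti)`. -/
def projP : Expr [.prod .nat (.prod .row (.list .trow))] (.list .trow) :=
  .fold (.snd (.snd v0)) .nil (insE (.fst v2) (.pair
    (maskE (.fst v2) (.fst (.snd v2)) (.fst v0)) (.snd v0)) v1)

theorem eval_projP (N : ℕ) (fr : List ℕ) (Ti : List TRow) :
    projP.eval w ((N, fr, Ti), ()) = proj N fr Ti := by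
  simp only [projP, eval, eval_insE, eval_maskE]
  rfl

/-- Projection of a table. -/
def projE (a : Expr Γ .nat) (b : Expr Γ .row) (c : Expr Γ (.list .trow)) :
    Expr Γ (.list .trow) :=
  .app (.pair a (.pair b c)) projP

@[simp] theorem eval_projE (a : Expr Γ .nat) (b : Expr Γ .row) (c : Expr Γ (.list .trow))
    (env : Env Γ) : (projE a b c).eval w env =
      proj (a.eval w env) (b.eval w env) (c.eval w env) :=
  eval_projP w _ _ _

/-- Arguments: `(N, W, s, G)`. -/
def monomP : Expr [.prod .nat (.prod .row (.prod .trow .gates))] (.prod .nat .gates) :=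
  .fold (.range (.fst v0)) (.pair (.snd (.fst (.snd (.snd v0)))) (.snd (.snd (.snd v0))))
    (ifE (nth (.fst (.fst (.snd (.snd v2)))) v0)
      (ifE (nth (.fst (.snd v2)) v0) v1
        (.pair (.add (len (.snd v1)) (.lit 1))
          (.cons (.pair (.lit 3) (.pair (.fst v1) (len (.snd v1))))
            (.cons (.pair (.lit 1) (.pair (predE (nth (.fst (.fst (.snd (.snd v2)))) v0))
              (.lit 0))) (.snd v1)))))
      v1)

theorem eval_monomP (N : ℕ) (W : List ℕ) (s : TRow) (G : List GCode) :
    monomP.eval w ((N, W, s, G), ()) = monom N W s G := by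
  simp only [monomP, eval, eval_nth, eval_predE, eval_len]
  rfl

/-- Weight of a row. -/
def monomE (a : Expr Γ .nat) (b : Expr Γ .row) (c : Expr Γ .trow) (d : Expr Γ .gates) :
    Expr Γ (.prod .nat .gates) :=
  .app (.pair a (.pair b (.pair c d))) monomP

@[simp] theorem eval_monomE (a : Expr Γ .nat) (b : Expr Γ .row) (c : Expr Γ .trow)
    (d : Expr Γ .gates)
    (env : Env Γ) : (monomE a b c d).eval w env =
      monom (a.eval w env) (b.eval w env) (c.eval w env) (d.eval w env) :=
  eval_monomP w _ _ _ _

/-- Arguments: `(N, W, P, r, G)`. -/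
def sSumP : Expr [.prod .nat (.prod .row (.prod (.list .trow) (.prod .trow .gates)))]
    (.prod .nat .gates) :=
  .fold (.fst (.snd (.snd v0))) (.pair (len (.snd (.snd (.snd (.snd v0)))))
      (.cons (.pair (.lit 0) (.pair (.lit 0) (.lit 0))) (.snd (.snd (.snd (.snd v0))))))
    (ifE (compatE (.fst v2) (.fst (.fst (.snd (.snd (.snd v2))))) (.fst v0))
      (.letE (monomE (.fst v2) (.fst (.snd v2)) v0 (.snd v1))
        (.pair (len (.snd v0))
          (.cons (.pair (.lit 2) (.pair (.fst v2) (.fst v0))) (.snd v0))))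
      v1)

theorem eval_sSumP (N : ℕ) (W : List ℕ) (P : List TRow) (r : TRow) (G : List GCode) :
    sSumP.eval w ((N, W, P, r, G), ()) = sSum N W P r G := by
  simp only [sSumP, eval, ↓eval_if_compatE, eval_monomE, eval_len]
  rfl

/-- Sum of weights. -/
def sSumE (a : Expr Γ .nat) (b : Expr Γ .row) (c : Expr Γ (.list .trow)) (d : Expr Γ .trow)
    (e : Expr Γ .gates) :
    Expr Γ (.prod .nat .gates) :=
  .app (.pair a (.pair b (.pair c (.pair d e)))) sSumP

@[simp] theorem eval_sSumE (a : Expr Γ .nat) (b : Expr Γ .row) (c : Expr Γ (.list .trow))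
    (d : Expr Γ .trow) (e : Expr Γ .gates)
    (env : Env Γ) : (sSumE a b c d e).eval w env =
      sSum (a.eval w env) (b.eval w env) (c.eval w env) (d.eval w env) (e.eval w env) :=
  eval_sSumP w _ _ _ _ _

/-- Arguments: `(N, fr, W, Ti, Tj, G)`. -/
def sMergeP : Expr [.prod .nat (.prod .row (.prod .row (.prod (.list .trow)
    (.prod (.list .trow) .gates))))] (.prod (.list .trow) .gates) :=
  .letE (projE (.fst v0) (.fst (.snd v0)) (.fst (.snd (.snd (.snd v0)))))
    (.fold (.fst (.snd (.snd (.snd (.snd v1))))) (.pair .nil (.snd (.snd (.snd (.snd (.snd v1))))))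
      (.letE (sSumE (.fst v3) (.fst (.snd (.snd v3))) v2 v0 (.snd v1))
        (.pair (.cons (.pair (.fst v1) (len (.snd v0))) (.fst v2))
          (.cons (.pair (.lit 3) (.pair (.snd v1) (.fst v0))) (.snd v0)))))

theorem eval_sMergeP (N : ℕ) (fr W : List ℕ) (Ti Tj : List TRow) (G : List GCode) :
    sMergeP.eval w ((N, fr, W, Ti, Tj, G), ()) = sMerge N fr W Ti Tj G := by
  simp only [sMergeP, eval, eval_projE, eval_sSumE, eval_len]
  rfl

/-- Summing out a table. -/
def sMergeE (a : Expr Γ .nat) (b c : Expr Γ .row) (d e : Expr Γ (.list .trow)) (f : Expr Γ .gates) :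
    Expr Γ (.prod (.list .trow) .gates) :=
  .app (.pair a (.pair b (.pair c (.pair d (.pair e f))))) sMergeP

@[simp] theorem eval_sMergeE (a : Expr Γ .nat) (b c : Expr Γ .row) (d e : Expr Γ (.list .trow))
    (f : Expr Γ .gates)
    (env : Env Γ) : (sMergeE a b c d e f).eval w env =
      sMerge (a.eval w env) (b.eval w env) (c.eval w env) (d.eval w env) (e.eval w env)
        (f.eval w env) :=
  eval_sMergeP w _ _ _ _ _ _

/-- Arguments: `(N, fr, fi, fj, G)`. -/
def mergeP : Expr [.prod .nat (.prod .row (.prod .factor (.prod .factor .gates)))]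
    (.prod .factor .gates) :=
  ifE (anyL (.range (.fst v0)) (ifE (nth (.fst (.snd (.fst (.snd (.snd v2))))) v0)
      (ifE (nth (.fst (.snd (.fst (.snd (.snd (.snd v2)))))) v0)
        (.ifle (nth (.fst (.snd v2)) v0) (.lit 0) (.lit 1) (.lit 0)) (.lit 0)) (.lit 0)))
    (.letE (qMergeE (.fst v0) (.fst (.snd v0)) (.snd (.snd (.fst (.snd (.snd v0))))) (.snd (.snd
      (.fst (.snd (.snd (.snd v0)))))) (.snd (.snd (.snd (.snd v0)))))
      (.pair (.pair (.fst (.fst (.snd (.snd (.snd v1))))) (.pair (joinE (.fst v1) (.fst (.snd v1))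
        (.fst (.snd (.fst (.snd (.snd (.snd v1)))))) (.fst (.snd (.fst (.snd (.snd v1))))))
        (.fst v0))) (.snd v0)))
    (.letE (sMergeE (.fst v0) (.fst (.snd v0)) (.fst (.snd (.fst (.snd (.snd (.snd v0)))))) (.snd
      (.snd (.fst (.snd (.snd v0))))) (.snd (.snd (.fst (.snd (.snd (.snd v0)))))) (.snd (.snd (.snd
      (.snd v0)))))
      (.pair (.pair (.fst (.fst (.snd (.snd (.snd v1)))))
        (.pair (.fst (.snd (.fst (.snd (.snd (.snd v1)))))) (.fst v0))) (.snd v0)))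

theorem eval_mergeP (N : ℕ) (fr : List ℕ) (fi fj : Factor) (G : List GCode) :
    mergeP.eval w ((N, fr, fi, fj, G), ()) = merge N fr fi fj G := by
  have h := eval_anyR w (Γ := [.prod .nat (.prod .row (.prod .factor (.prod .factor .gates)))])
    (.fst v0) (ifE (nth (.fst (.snd (.fst (.snd (.snd v2))))) v0)
      (ifE (nth (.fst (.snd (.fst (.snd (.snd (.snd v2)))))) v0)
        (.ifle (nth (.fst (.snd v2)) v0) (.lit 0) (.lit 1) (.lit 0)) (.lit 0)) (.lit 0))
    ((N, fr, fi, fj, G), ())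
    (fun x => 1 ≤ fi.2.1.getD x 0 ∧ 1 ≤ fj.2.1.getD x 0 ∧ fr.getD x 0 = 0) (by
      intro x a
      simp only [eval, eval_nth]
      split_ifs <;> grind)
  refine (eval_ifE w h).trans ?_
  simp only [eval, eval_qMergeE, eval_sMergeE, eval_joinE]
  rfl

/-- Merging two tables. -/
def mergeE (a : Expr Γ .nat) (b : Expr Γ .row) (c d : Expr Γ .factor) (e : Expr Γ .gates) :
    Expr Γ (.prod .factor .gates) :=
  .app (.pair a (.pair b (.pair c (.pair d e)))) mergeP

@[simp] theorem eval_mergeE (a : Expr Γ .nat) (b : Expr Γ .row) (c d : Expr Γ .factor)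
    (e : Expr Γ .gates)
    (env : Env Γ) : (mergeE a b c d e).eval w env =
      merge (a.eval w env) (b.eval w env) (c.eval w env) (d.eval w env) (e.eval w env) :=
  eval_mergeP w _ _ _ _ _

/-! The main loop. -/

/-- Arguments: `(N, fs, i, j)`. -/
def goodP : Expr [.prod .nat (.prod (.list .factor) (.prod .nat .nat))] .nat :=
  ifeq (.lit 1) (.fst (facE (.fst (.snd v0)) (.fst (.snd (.snd v0)))))
    (ifE (.fst (facE (.fst (.snd v0)) (.snd (.snd (.snd v0)))))
      (ifeq (.fst (.snd (.snd v0))) (.snd (.snd (.snd v0))) (.lit 0)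
        (allL (.range (.fst v0)) (.ifle
          (nth (.fst (.snd (facE (.fst (.snd v2)) (.fst (.snd (.snd v2)))))) v0) (.lit 0) (.lit 1)
          (ifE (nth (.fst (.snd (facE (.fst (.snd v2)) (.snd (.snd (.snd v2)))))) v0) (.lit 1)
            (allL (.range (len (.fst (.snd v2)))) (ifeq v0 (.fst (.snd (.snd v4))) (.lit 1)
              (.ifle (nth (.fst (.snd (facE (.fst (.snd v4)) v0))) v2) (.lit 0)
                (.lit 1) (.lit 0))))))))
      (.lit 0)) (.lit 0)

theorem eval_goodP (N : ℕ) (fs : List Factor) (i j : ℕ) :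
    goodP.eval w ((N, fs, i, j), ()) = if Good N fs i j then 1 else 0 := by
  have h2 : ∀ (x a : ℕ), (allL (.range (len (.fst (.snd v2)))) (ifeq v0 (.fst (.snd (.snd v4)))
      (.lit 1) (.ifle (nth (.fst (.snd (facE (.fst (.snd v4)) v0))) v2) (.lit 0)
                (.lit 1) (.lit 0))) :
        Expr [.nat, .nat, .prod .nat (.prod (.list .factor) (.prod .nat .nat))] .nat).eval w
        (x, a, (N, fs, i, j), ()) = if ∀ l < fs.length, l = i ∨ pat fs l x = 0 then 1 else 0 := by
    intro x a
    have := eval_allR w (len (.fst (.snd v2)))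
      (ifeq v0 (.fst (.snd (.snd v4))) (.lit 1)
          (.ifle (nth (.fst (.snd (facE (.fst (.snd v4)) v0))) v2) (.lit 0) (.lit 1) (.lit 0)) :
        Expr [.nat, .nat, .nat, .nat, .prod .nat (.prod (.list .factor) (.prod .nat .nat))] .nat)
      (x, a, (N, fs, i, j), ()) (fun l => l = i ∨ pat fs l x = 0) (by
        intro l b
        simp only [eval, eval_nth, eval_facE, pat]
        split_ifs <;> grind)
    simp only [eval_len] at this
    exact this
  have h1 := eval_allR w (.fst v0) (.ifle
      (nth (.fst (.snd (facE (.fst (.snd v2)) (.fst (.snd (.snd v2)))))) v0) (.lit 0) (.lit 1)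
      (ifE (nth (.fst (.snd (facE (.fst (.snd v2)) (.snd (.snd (.snd v2)))))) v0) (.lit 1)
        (allL (.range (len (.fst (.snd v2)))) (ifeq v0 (.fst (.snd (.snd v4))) (.lit 1)
              (.ifle (nth (.fst (.snd (facE (.fst (.snd v4)) v0))) v2) (.lit 0)
                (.lit 1) (.lit 0))))) :
        Expr [.nat, .nat, .prod .nat (.prod (.list .factor) (.prod .nat .nat))] .nat)
    ((N, fs, i, j), ()) (fun x => pat fs i x = 0 ∨ 1 ≤ pat fs j x ∨
      ∀ l < fs.length, l = i ∨ pat fs l x = 0) (by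
      intro x a
      simp only [eval, eval_nth, eval_facE, h2]
      simp only [pat]
      split_ifs <;> grind)
  simp only [goodP, eval, eval_facE, h1, Good]
  split_ifs <;> grind

/-- Test of two tables. -/
def goodE (a : Expr Γ .nat) (b : Expr Γ (.list .factor)) (c d : Expr Γ .nat) :
    Expr Γ .nat :=
  .app (.pair a (.pair b (.pair c d))) goodP

@[simp] theorem eval_goodE (a : Expr Γ .nat) (b : Expr Γ (.list .factor)) (c d : Expr Γ .nat)
    (env : Env Γ) : (goodE a b c d).eval w env =
      (if Good (a.eval w env) (b.eval w env) (c.eval w env) (d.eval w env) then 1 else 0 : ℕ) :=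
  eval_goodP w _ _ _ _

theorem eval_if_goodE (a : Expr Γ .nat) (b : Expr Γ (.list .factor)) (c d : Expr Γ .nat)
    (p q : Expr Γ t) (env : Env Γ) : (ifE (goodE a b c d) p q).eval w env =
      if Good (a.eval w env) (b.eval w env) (c.eval w env) (d.eval w env) then p.eval w env
      else q.eval w env :=
  eval_ifE w (eval_goodE w a b c d env)

/-- Arguments: `(N, fs)`. -/
def pickP : Expr [.prod .nat (.list .factor)] (.prod .nat .nat) :=
  .fold (.range (len (.snd v0))) (.pair (.lit 0) (.lit 0))
    (.fold (.range (len (.snd v2))) v1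
      (ifE (goodE (.fst v4) (.snd v4) v2 v0) (.pair v2 v0) v1))

theorem eval_pickP (N : ℕ) (fs : List Factor) :
    pickP.eval w ((N, fs), ()) = pick N fs := by
  simp only [pickP, eval, ↓eval_if_goodE, eval_len]
  rfl

/-- Choice of two tables. -/
def pickE (a : Expr Γ .nat) (b : Expr Γ (.list .factor)) :
    Expr Γ (.prod .nat .nat) :=
  .app (.pair a b) pickP

@[simp] theorem eval_pickE (a : Expr Γ .nat) (b : Expr Γ (.list .factor))
    (env : Env Γ) : (pickE a b).eval w env =
      pick (a.eval w env) (b.eval w env) :=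
  eval_pickP w _ _

/-- The row without entries. -/
def zerosE (n : Expr Γ .nat) : Expr Γ .row := tabE n (.lit 0)

@[simp] theorem eval_zerosE (n : Expr Γ .nat) (env : Env Γ) :
    (zerosE n).eval w env = zeros (n.eval w env) :=
  eval_tabE (t := .nat) w _ _ _ _ (fun _ _ => rfl)

/-- The table that is always true. -/
def trivE (n : Expr Γ .nat) (a : ℕ) : Expr Γ .factor :=
  .pair (.lit a) (.pair (zerosE n) (.cons (.pair (zerosE n) (.lit 0)) .nil))

@[simp] theorem eval_trivE (n : Expr Γ .nat) (a : ℕ) (env : Env Γ) :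
    (trivE n a).eval w env = trivialFactor (n.eval w env) a := by
  simp [trivE, trivialFactor]

/-- Arguments: `(N, fs, i, j, f)`. -/
def replaceP : Expr [.prod .nat (.prod (.list .factor) (.prod .nat (.prod .nat .factor)))]
    (.list .factor) :=
  tabE (len (.fst (.snd v0))) (ifeq v0 (.fst (.snd (.snd v2))) (trivE (.fst v2) 0)
    (ifeq v0 (.fst (.snd (.snd (.snd v2)))) (.snd (.snd (.snd (.snd v2))))
      (facE (.fst (.snd v2)) v0)))

theorem eval_replaceP (N : ℕ) (fs : List Factor) (i j : ℕ) (f : Factor) :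
    replaceP.eval w ((N, fs, i, j, f), ()) = replace N fs i j f := by
  have := eval_tabE w (len (.fst (.snd v0)))
    (ifeq v0 (.fst (.snd (.snd v2))) (trivE (.fst v2) 0)
      (ifeq v0 (.fst (.snd (.snd (.snd v2)))) (.snd (.snd (.snd (.snd v2))))
      (facE (.fst (.snd v2)) v0)) :
      Expr [.nat, .list .factor, .prod .nat (.prod (.list .factor) (.prod .nat
        (.prod .nat .factor)))]
        .factor) ((N, fs, i, j, f), ())
    (fun l => if l = i then trivialFactor N 0 else if l = j then f else fac fs l) (by
      intro x a
      simp only [eval, eval_trivE, eval_facE]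
      split_ifs <;> grind)
  simp only [eval_len] at this
  exact this

/-- Replacement of two tables. -/
def replaceE (a : Expr Γ .nat) (b : Expr Γ (.list .factor)) (c d : Expr Γ .nat)
    (e : Expr Γ .factor) :
    Expr Γ (.list .factor) :=
  .app (.pair a (.pair b (.pair c (.pair d e)))) replaceP

@[simp] theorem eval_replaceE (a : Expr Γ .nat) (b : Expr Γ (.list .factor)) (c d : Expr Γ .nat)
    (e : Expr Γ .factor)
    (env : Env Γ) : (replaceE a b c d e).eval w env =
      replace (a.eval w env) (b.eval w env) (c.eval w env) (d.eval w env) (e.eval w env) :=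
  eval_replaceP w _ _ _ _ _

/-- Arguments: `(N, fr, fs, G)`. -/
def stepP : Expr [.prod .nat (.prod .row (.prod (.list .factor) .gates))]
    (.prod (.list .factor) .gates) :=
  .letE (pickE (.fst v0) (.fst (.snd (.snd v0))))
    (.letE (mergeE (.fst v1) (.fst (.snd v1)) (facE (.fst (.snd (.snd v1))) (.fst v0)) (facE (.fst
      (.snd (.snd v1))) (.snd v0)) (.snd (.snd (.snd v1))))
      (.pair (replaceE (.fst v2) (.fst (.snd (.snd v2))) (.fst v1) (.snd v1) (.fst v0)) (.snd v0)))

theorem eval_stepP (N : ℕ) (fr : List ℕ) (st : List Factor × List GCode) :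
    stepP.eval w ((N, fr, st), ()) = step N fr st := by
  simp only [stepP, eval, eval_pickE, eval_mergeE, eval_facE, eval_replaceE]
  rfl

end

end Expr
end Fn
end ACQ

/-! ### Programs for reading the input, for the main loop and for the output. -/

namespace ACQ
namespace Fn
open Alg

namespace Expr

variable {Γ : List Ty} {t u : Ty} (w : List ℕ)

theorem eval_ifeq (a b : Expr Γ .nat) (p q : Expr Γ t) (env : Env Γ) :
    (ifeq a b p q).eval w env =
      if (a.eval w env : ℕ) = b.eval w env then p.eval w env else q.eval w env := by
  show (if (a.eval w env : ℕ) ≤ b.eval w env then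
    (if (b.eval w env : ℕ) ≤ a.eval w env then _ else _) else _) = _
  by_cases h : (a.eval w env : ℕ) = b.eval w env
  · rw [if_pos h, if_pos h.le, if_pos h.ge]
  · rw [if_neg h]
    by_cases h1 : (a.eval w env : ℕ) ≤ b.eval w env
    · rw [if_pos h1, if_neg (fun h2 => h (le_antisymm h1 h2))]
    · rw [if_neg h1]

/-- Arguments: `(N, ar, p, pos)`. -/
def parseRowP : Expr [.prod .nat (.prod .nat (.prod .nat .nat))] .row :=
  tabE (.fst v0) (.fold (.range (.fst (.snd v2))) (.lit 0)
    (ifeq (.read (.add (.add (.fst (.snd (.snd v4))) (.lit 1)) v0)) v2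
      (.add (.read (.add (.snd (.snd (.snd v4))) v0)) (.lit 1)) v1))

theorem eval_parseRowP (N ar p pos : ℕ) :
    parseRowP.eval w ((N, ar, p, pos), ()) = parseRow w N ar p pos := by
  refine eval_tabE (t := .nat) w _ _ _ _ ?_
  intro x a
  simp only [↓eval_ifeq, eval]
  rfl

/-- The row of a tuple. -/
def parseRowE (a b c d : Expr Γ .nat) : Expr Γ .row :=
  .app (.pair a (.pair b (.pair c d))) parseRowP

@[simp] theorem eval_parseRowE (a b c d : Expr Γ .nat) (env : Env Γ) :
    (parseRowE a b c d).eval w env =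
      parseRow w (a.eval w env) (b.eval w env) (c.eval w env) (d.eval w env) :=
  eval_parseRowP w _ _ _ _

/-- Arguments: `(N, ar, p, acc)`. -/
def parseStepP : Expr [.prod .nat (.prod .nat (.prod .nat (.prod .nat (.list .trow))))]
    (.prod .nat (.list .trow)) :=
  .letE (parseRowE (.fst v0) (.fst (.snd v0)) (.fst (.snd (.snd v0)))
      (.fst (.snd (.snd (.snd v0)))))
    (.pair (.add (.fst (.snd (.snd (.snd v1)))) (.fst (.snd v1)))
      (ifE (allL (.range (.fst (.snd v1)))
          (ifeq (nth v2 (.read (.add (.add (.fst (.snd (.snd v3))) (.lit 1)) v0)))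
            (.add (.read (.add (.fst (.snd (.snd (.snd v3)))) v0)) (.lit 1)) (.lit 1) (.lit 0)))
        (insE (.fst v1) (.pair v0 (.lit 0)) (.snd (.snd (.snd (.snd v1)))))
        (.snd (.snd (.snd (.snd v1))))))

theorem eval_parseStepP (N ar p : ℕ) (acc : ℕ × List TRow) :
    parseStepP.eval w ((N, ar, p, acc), ()) = parseStep w N ar p acc := by
  have h := eval_allR w
    (Γ := [.row, .prod .nat (.prod .nat (.prod .nat (.prod .nat (.list .trow))))])
    (.fst (.snd v1)) (ifeq (nth v2 (.read (.add (.add (.fst (.snd (.snd v3))) (.lit 1)) v0)))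
            (.add (.read (.add (.fst (.snd (.snd (.snd v3)))) v0)) (.lit 1)) (.lit 1) (.lit 0))
    (parseRow w N ar p acc.1, (N, ar, p, acc), ())
    (fun q => (parseRow w N ar p acc.1).getD (w.getD (p + 1 + q) 0) 0 = w.getD (acc.1 + q) 0 + 1)
    (by
      intro x a
      simp only [eval, eval_nth]
      split_ifs <;> grind)
  refine Prod.ext rfl ?_
  simp only [parseStepP, eval, eval_parseRowE]
  rw [h]
  refine (if_congr one_le_ite rfl rfl).trans ?_
  simp only [eval, eval_insE]
  rfl

/-- Reading a tuple. -/
def parseStepE (a b c : Expr Γ .nat) (d : Expr Γ (.prod .nat (.list .trow))) :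
    Expr Γ (.prod .nat (.list .trow)) :=
  .app (.pair a (.pair b (.pair c d))) parseStepP

@[simp] theorem eval_parseStepE (a b c : Expr Γ .nat) (d : Expr Γ (.prod .nat (.list .trow)))
    (env : Env Γ) : (parseStepE a b c d).eval w env =
      parseStep w (a.eval w env) (b.eval w env) (c.eval w env) (d.eval w env) :=
  eval_parseStepP w _ _ _ _

/-- Arguments: `(N, ar, p, pos, cnt)`. -/
def parseAtomP : Expr [.prod .nat (.prod .nat (.prod .nat (.prod .nat .nat)))] .factor :=
  .pair (.lit 1) (.pair
    (tabE (.fst v0) (anyL (.range (.fst (.snd v2)))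
      (ifeq (.read (.add (.add (.fst (.snd (.snd v4))) (.lit 1)) v0)) v2 (.lit 1) (.lit 0))))
    (.snd (.fold (.range (.snd (.snd (.snd (.snd v0)))))
      (.pair (.fst (.snd (.snd (.snd v0)))) .nil)
      (parseStepE (.fst v2) (.fst (.snd v2)) (.fst (.snd (.snd v2))) v1))))

theorem eval_parseAtomP (N ar p pos cnt : ℕ) :
    parseAtomP.eval w ((N, ar, p, pos, cnt), ()) = parseAtom w N ar p pos cnt := by
  have h := eval_tabE w (t := .nat) (Γ := [.prod .nat (.prod .nat (.prod .nat (.prod .nat .nat)))])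
    (.fst v0) (anyL (.range (.fst (.snd v2)))
      (ifeq (.read (.add (.add (.fst (.snd (.snd v4))) (.lit 1)) v0)) v2 (.lit 1) (.lit 0)))
    ((N, ar, p, pos, cnt), ()) (fun x => if ∃ q < ar, w.getD (p + 1 + q) 0 = x then 1 else 0) (by
      intro x a
      refine eval_anyR w (.fst (.snd v2)) _ _ (fun q => w.getD (p + 1 + q) 0 = x) ?_
      intro q b
      simp only [eval]
      split_ifs <;> grind)
  simp only [parseAtomP, eval, eval_parseStepE]
  refine Prod.ext rfl (Prod.ext h rfl)

/-- Reading an atom. -/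
def parseAtomE (a b c d e : Expr Γ .nat) : Expr Γ .factor :=
  .app (.pair a (.pair b (.pair c (.pair d e)))) parseAtomP

@[simp] theorem eval_parseAtomE (a b c d e : Expr Γ .nat) (env : Env Γ) :
    (parseAtomE a b c d e).eval w env = parseAtom w (a.eval w env) (b.eval w env) (c.eval w env)
      (d.eval w env) (e.eval w env) :=
  eval_parseAtomP w _ _ _ _ _

/-- The position of the information on a relation. -/
def relPosE (p : Expr Γ .nat) : Expr Γ .nat :=
  .add (.add (.lit 4) (.read (.lit 2))) (.add (.add (.read p) (.read p)) (.read p))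

@[simp] theorem eval_relPosE (p : Expr Γ .nat) (env : Env Γ) :
    (relPosE p).eval w env = relPos w (p.eval w env) := rfl

/-- The position of the next atom. -/
def nextPosE (p : Expr Γ .nat) : Expr Γ .nat := .add (.add p (.lit 1)) (.read (relPosE p))

@[simp] theorem eval_nextPosE (p : Expr Γ .nat) (env : Env Γ) :
    (nextPosE p).eval w env = nextPos w (p.eval w env) := rfl

/-- The position of the first atom. -/
def atomPosE : Expr Γ .nat :=
  .add (.add (.lit 4) (.read (.lit 2)))
    (.add (.add (.read (.lit 1)) (.read (.lit 1))) (.read (.lit 1)))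

@[simp] theorem eval_atomPosE (env : Env Γ) : (atomPosE : Expr Γ .nat).eval w env = atomPos w :=
  rfl

/-- The position of the data block. -/
def dataPosE : Expr Γ .nat := .fold (.range (.read (.lit 3))) atomPosE (nextPosE v1)

@[simp] theorem eval_dataPosE (env : Env Γ) : (dataPosE : Expr Γ .nat).eval w env = dataPos w :=
  rfl

/-- The tables of the query. -/
def readAllE : Expr Γ (.list .factor) :=
  .letE dataPosE (.cons (trivE (.read (.lit 2)) 2) (.snd (.fold (.range (.read (.lit 3)))
    (.pair atomPosE .nil) (.pair (nextPosE (.fst v1)) (.cons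
      (parseAtomE (.read (.lit 2)) (.read (relPosE (.fst v1))) (.fst v1)
        (.add v2 (.read (.add (relPosE (.fst v1)) (.lit 2))))
        (.read (.add (relPosE (.fst v1)) (.lit 1)))) (.snd v1))))))

@[simp] theorem eval_readAllE (env : Env Γ) :
    (readAllE : Expr Γ (.list .factor)).eval w env = readAll w := by
  simp only [readAllE, eval, eval_trivE, eval_parseAtomE, eval_nextPosE, eval_relPosE,
    eval_dataPosE, eval_atomPosE]
  rfl

/-- The flags of the free variables. -/
def freeE : Expr Γ .row :=
  tabE (.read (.lit 2)) (.ifle (.read (.add (.lit 4) v0)) (.lit 0) (.lit 1) (.lit 0))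

@[simp] theorem eval_freeE (env : Env Γ) : (freeE : Expr Γ .row).eval w env = freeFlags w :=
  eval_tabE (t := .nat) w _ _ _ _ (fun _ _ => rfl)

/-- One round. -/
def stepE (a : Expr Γ .nat) (b : Expr Γ .row) (c : Expr Γ (.prod (.list .factor) .gates)) :
    Expr Γ (.prod (.list .factor) .gates) :=
  .app (.pair a (.pair b c)) stepP

@[simp] theorem eval_stepE (a : Expr Γ .nat) (b : Expr Γ .row)
    (c : Expr Γ (.prod (.list .factor) .gates)) (env : Env Γ) : (stepE a b c).eval w env =
      step (a.eval w env) (b.eval w env) (c.eval w env) :=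
  eval_stepP w _ _ _

/-- The main loop. -/
def runE : Expr Γ (.prod (.list .factor) .gates) :=
  .letE freeE (.fold (.range (.read (.lit 3)))
    (.pair readAllE (.cons (.pair (.lit 0) (.pair (.lit 1) (.lit 0))) .nil))
    (stepE (.read (.lit 2)) v2 v1))

@[simp] theorem eval_runE (env : Env Γ) :
    (runE : Expr Γ (.prod (.list .factor) .gates)).eval w env = run w := by
  simp only [runE, eval, eval_freeE, eval_readAllE, eval_stepE]
  rfl

/-- The gate of the result. -/
def resultGateE (l : Expr Γ (.list .factor)) : Expr Γ .nat :=
  .fold (.snd (.snd (facE l (.lit 0)))) (.lit 0) (.snd v0)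

@[simp] theorem eval_resultGateE (l : Expr Γ (.list .factor)) (env : Env Γ) :
    (resultGateE l).eval w env = resultGate (l.eval w env) := by
  simp only [resultGateE, eval, eval_facE]
  rfl

/-- Arguments: `(g, G)`. -/
def useAllP : Expr [.prod .nat .gates] .gates :=
  .snd (.fold (.range (len (.snd v0)))
    (.pair (.fst v0) (.cons (.pair (.lit 0) (.pair (.lit 0) (.lit 0))) (.snd v0)))
    (.pair (.add (len (.snd v1)) (.lit 1))
      (.cons (.pair (.lit 2) (.pair (.fst v1) (len (.snd v1))))
        (.cons (.pair (.lit 3) (.pair (len (.snd v2)) v0)) (.snd v1)))))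

theorem eval_useAllP (g : ℕ) (G : List GCode) : useAllP.eval w ((g, G), ()) = useAll g G := by
  simp only [useAllP, eval, eval_len]
  rfl

/-- Using all gates. -/
def useAllE (a : Expr Γ .nat) (b : Expr Γ .gates) : Expr Γ .gates := .app (.pair a b) useAllP

@[simp] theorem eval_useAllE (a : Expr Γ .nat) (b : Expr Γ .gates) (env : Env Γ) :
    (useAllE a b).eval w env = useAll (a.eval w env) (b.eval w env) := eval_useAllP w _ _

/-- The code of the circuit. -/
def circuitE : Expr [] .row :=
  .letE runE (.fold (useAllE (resultGateE (.fst v0)) (.snd v0)) .nil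
    (.ifle (.fst v0) (.lit 1) (.cons (.fst v0) (.cons (.fst (.snd v0)) v1))
      (.cons (.fst v0) (.cons (.fst (.snd v0)) (.cons (.snd (.snd v0)) v1)))))

theorem eval_circuitE : circuitE.eval w () = circuitOut w := by
  simp only [circuitE, eval, eval_runE, eval_useAllE, eval_resultGateE]
  rfl

/-- Arguments: `(B, a, b)`. -/
def mulNatP : Expr [.prod .nat (.prod .nat .nat)] .nat :=
  .snd (.fold (.snd (.fold (.range (.fst v0))
      (.pair (.pair (.lit 1) (.fst (.snd v0))) (.nil (t := .prod .nat .nat)))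
      (.pair (.pair (.add (.fst (.fst v1)) (.fst (.fst v1)))
        (.add (.snd (.fst v1)) (.snd (.fst v1)))) (.cons (.fst v1) (.snd v1)))))
    (.pair (.lit 0) (.lit 0))
    (.ifle (.add (.fst v1) (.fst v0)) (.snd (.snd v2))
      (.pair (.add (.fst v1) (.fst v0)) (.add (.snd v1) (.snd v0))) v1))

theorem eval_mulNatP (B a b : ℕ) : mulNatP.eval w ((B, a, b), ()) = mulNat B a b := rfl

/-- Multiplication. -/
def mulNatE (a b c : Expr Γ .nat) : Expr Γ .nat := .app (.pair a (.pair b c)) mulNatP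

@[simp] theorem eval_mulNatE (a b c : Expr Γ .nat) (env : Env Γ) :
    (mulNatE a b c).eval w env = mulNat (a.eval w env) (b.eval w env) (c.eval w env) := rfl

/-- Arguments: `(B, vs, g)`. -/
def gateValP : Expr [.prod .nat (.prod .row .gate)] .nat :=
  .ifle (.fst (.snd (.snd v0))) (.lit 0) (.fst (.snd (.snd (.snd v0))))
    (.ifle (.fst (.snd (.snd v0))) (.lit 1) (.lit 1)
      (.ifle (.fst (.snd (.snd v0))) (.lit 2)
        (.add (nth (.fst (.snd v0)) (.fst (.snd (.snd (.snd v0)))))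
          (nth (.fst (.snd v0)) (.snd (.snd (.snd (.snd v0))))))
        (mulNatE (.fst v0) (nth (.fst (.snd v0)) (.fst (.snd (.snd (.snd v0)))))
          (nth (.fst (.snd v0)) (.snd (.snd (.snd (.snd v0))))))))

theorem eval_gateValP (B : ℕ) (vs : List ℕ) (g : GCode) :
    gateValP.eval w ((B, vs, g), ()) = gateVal B vs g := by
  simp only [gateValP, eval, eval_nth, eval_mulNatE]
  rfl

/-- The value of a gate. -/
def gateValE (a : Expr Γ .nat) (b : Expr Γ .row) (c : Expr Γ .gate) : Expr Γ .nat :=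
  .app (.pair a (.pair b c)) gateValP

@[simp] theorem eval_gateValE (a : Expr Γ .nat) (b : Expr Γ .row) (c : Expr Γ .gate)
    (env : Env Γ) :
    (gateValE a b c).eval w env = gateVal (a.eval w env) (b.eval w env) (c.eval w env) :=
  eval_gateValP w _ _ _

/-- Argument: `G`. -/
def gateValsP : Expr [.gates] .row :=
  .fold (rev v0) .nil (rev (.cons (gateValE (len v2) v1 v0) (rev v1)))

theorem eval_gateValsP (G : List GCode) : gateValsP.eval w (G, ()) = gateVals G := by
  simp only [gateValsP, eval, eval_rev, eval_gateValE, eval_len]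
  rfl

/-- The values of the gates. -/
def gateValsE (a : Expr Γ .gates) : Expr Γ .row := .app a gateValsP

@[simp] theorem eval_gateValsE (a : Expr Γ .gates) (env : Env Γ) :
    (gateValsE a).eval w env = gateVals (a.eval w env) := eval_gateValsP w _

/-- The number of answers. -/
def countE : Expr [] .row :=
  .letE runE (.cons (nth (gateValsE (.snd v0)) (resultGateE (.fst v0))) .nil)

theorem eval_countE : countE.eval w () = countOut w := by
  simp only [countE, eval, eval_runE, eval_nth, eval_gateValsE, eval_resultGateE]
  rfl

end Expr
end Fn
end ACQ

namespace ACQ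

/-! ### Ear decompositions -/

section Ears

variable {ι κ α : Type*} [DecidableEq ι] [DecidableEq κ]

/-- The set `W i` is an ear of the family `W` on `A`: its intersections with the others lie in one
other set. -/
def Ear (W : ι → Set α) (A : Finset ι) (i : ι) : Prop :=
  ∃ j ∈ A, j ≠ i ∧ ∀ l ∈ A, l ≠ i → W i ∩ W l ⊆ W j

/-- The family `W` on `A` can be reduced to at most one set by removing ears. -/
inductive Red (W : ι → Set α) : Finset ι → Prop
  | small {A : Finset ι} (h : A.card ≤ 1) : Red W A
  | ear {A : Finset ι} (i : ι) (hi : i ∈ A) (h : Ear W A i) (hr : Red W (A.erase i)) : Red W A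

/-- Being an ear is a condition on pairwise intersections only: `W i ∩ W l ⊆ W j` says the same as
`W i ∩ W l ⊆ W i ∩ W j`. So sets may be renamed, and also changed, as long as their pairwise
intersections stay the same. -/
theorem Red.map {W : ι → Set α} {V : κ → Set α} {A : Finset ι} (h : Red W A) (f : ι → κ)
    (hf : Set.InjOn f A)
    (hW : ∀ i ∈ A, ∀ j ∈ A, i ≠ j → V (f i) ∩ V (f j) = W i ∩ W j) : Red V (A.image f) := by
  induction h with
  | small h => exact .small (Finset.card_image_le.trans h)
  | @ear A i hi h hr ih =>
    have he : (A.image f).erase (f i) = (A.erase i).image f := by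
      ext k
      simp only [Finset.mem_erase, Finset.mem_image]
      constructor
      · rintro ⟨hk, a, ha, rfl⟩
        exact ⟨a, ⟨fun h => hk (h ▸ rfl), ha⟩, rfl⟩
      · rintro ⟨a, ⟨hai, ha⟩, rfl⟩
        exact ⟨fun h => hai (hf ha hi h), a, ha, rfl⟩
    refine .ear (f i) (Finset.mem_image_of_mem f hi) ?_ ?_
    · obtain ⟨j, hj, hji, hl⟩ := h
      refine ⟨f j, Finset.mem_image_of_mem f hj, fun h => hji (hf hj hi h), ?_⟩
      intro l hl' hli
      obtain ⟨l, hlA, rfl⟩ := Finset.mem_image.1 hl'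
      have hli' : l ≠ i := fun h => hli (h ▸ rfl)
      rw [hW i hi l hlA hli'.symm]
      intro x hx
      have hxj : x ∈ W j := hl l hlA hli' hx
      have : x ∈ W i ∩ W j := ⟨hx.1, hxj⟩
      rw [← hW i hi j hj hji.symm] at this
      exact this.2
    · rw [he]
      refine ih (hf.mono (by simp)) ?_
      intro a ha b hb hab
      exact hW a (Finset.mem_of_mem_erase ha) b (Finset.mem_of_mem_erase hb) hab

/-- Removing an ear preserves reducibility. -/
theorem Red.erase {W : ι → Set α} {A : Finset ι} (h : Red W A) {i : ι} (hi : i ∈ A)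
    (hE : Ear W A i) : Red W (A.erase i) := by
  induction h with
  | small h => exact .small ((Finset.card_le_card (Finset.erase_subset _ _)).trans h)
  | @ear A i' hi' h hr ih =>
    by_cases hii : i = i'
    · subst hii; exact hr
    obtain ⟨j, hj, hji, hl⟩ := hE
    obtain ⟨j', hj', hji', hl'⟩ := h
    -- In the exceptional case each of the two ears is attached to the other one. Then they have the
    -- same intersections with all remaining sets, so after exchanging their names the family
    -- without one is the family without the other.
    by_cases hm : j = i' ∧ j' = i
    · obtain ⟨rfl, rfl⟩ := hm
      have hcomm : ∀ l ∈ A, l ≠ j → l ≠ j' → W j ∩ W l = W j' ∩ W l := by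
        intro l hlA h1 h2
        ext x
        constructor
        · intro hx; exact ⟨hl' l hlA h1 hx, hx.2⟩
        · intro hx; exact ⟨hl l hlA h2 hx, hx.2⟩
      have himg : A.erase j' = (A.erase j).image (Equiv.swap j j') := by
        ext l
        simp only [Finset.mem_erase, Finset.mem_image]
        constructor
        · rintro ⟨h1, h2⟩
          by_cases hlj : l = j
          · exact ⟨j', ⟨hji', hi⟩, by simp [hlj]⟩
          · exact ⟨l, ⟨hlj, h2⟩, Equiv.swap_apply_of_ne_of_ne hlj h1⟩
        · rintro ⟨a, ⟨h1, h2⟩, rfl⟩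
          by_cases haj : a = j'
          · subst haj; simpa using ⟨hji, hj⟩
          · rw [Equiv.swap_apply_of_ne_of_ne h1 haj]; exact ⟨haj, h2⟩
      rw [himg]
      refine hr.map _ (Equiv.injective _).injOn ?_
      intro a ha b hb hab
      have ha1 := Finset.ne_of_mem_erase ha
      have hb1 := Finset.ne_of_mem_erase hb
      have ha2 := Finset.mem_of_mem_erase ha
      have hb2 := Finset.mem_of_mem_erase hb
      by_cases haj : a = j'
      · subst haj
        rw [Equiv.swap_apply_right, Equiv.swap_apply_of_ne_of_ne hb1 hab.symm]
        exact hcomm b hb2 hb1 hab.symm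
      · by_cases hbj : b = j'
        · subst hbj
          rw [Equiv.swap_apply_right, Equiv.swap_apply_of_ne_of_ne ha1 haj, Set.inter_comm,
            Set.inter_comm (W a)]
          exact hcomm a ha2 ha1 haj
        · rw [Equiv.swap_apply_of_ne_of_ne ha1 haj, Equiv.swap_apply_of_ne_of_ne hb1 hbj]
    -- Otherwise each of the two sets stays an ear when the other one is removed: if the set it was
    -- attached to is the removed one, then the set to which that one was attached takes over.
    · have h1 : Ear W (A.erase i') i := by
        by_cases hj1 : j = i'
        · subst hj1
          have hj2 : j' ≠ i := fun h => hm ⟨rfl, h⟩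
          refine ⟨j', Finset.mem_erase.2 ⟨hji', hj'⟩, hj2, ?_⟩
          intro l hlA hli x hx
          have hlA' := Finset.mem_erase.1 hlA
          exact hl' l hlA'.2 hlA'.1 ⟨hl l hlA'.2 hli hx, hx.2⟩
        · exact ⟨j, Finset.mem_erase.2 ⟨hj1, hj⟩, hji,
            fun l hlA hli => hl l (Finset.mem_of_mem_erase hlA) hli⟩
      have h2 : Ear W (A.erase i) i' := by
        by_cases hj1 : j' = i
        · subst hj1
          have hj2 : j ≠ i' := fun h => hm ⟨h, rfl⟩
          refine ⟨j, Finset.mem_erase.2 ⟨hji, hj⟩, hj2, ?_⟩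
          intro l hlA hli x hx
          have hlA' := Finset.mem_erase.1 hlA
          exact hl l hlA'.2 hlA'.1 ⟨hl' l hlA'.2 hli hx, hx.2⟩
        · exact ⟨j', Finset.mem_erase.2 ⟨hj1, hj'⟩, hji',
            fun l hlA hli => hl' l (Finset.mem_of_mem_erase hlA) hli⟩
      have h3 := ih (Finset.mem_erase.2 ⟨hii, hi⟩) h1
      rw [Finset.erase_right_comm] at h3
      exact .ear i' (Finset.mem_erase.2 ⟨Ne.symm hii, hi'⟩) h2 h3

theorem Red.insert_of_subset {W : ι → Set α} {A : Finset ι} (h : Red W A) {i j : ι} (hi : i ∉ A)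
    (hj : j ∈ A) (hW : W i ⊆ W j) : Red W (insert i A) := by
  refine .ear i (Finset.mem_insert_self _ _) ⟨j, Finset.mem_insert_of_mem hj, ?_, ?_⟩ ?_
  · rintro rfl; exact hi hj
  · intro l _ _ x hx; exact hW hx.1
  · rwa [Finset.erase_insert hi]

theorem Red.union_of_subset {W : ι → Set α} {A : Finset ι} (h : Red W A) (B : Finset ι)
    (hB : ∀ i ∈ B, ∃ j ∈ A, W i ⊆ W j) : Red W (A ∪ B) := by
  induction B using Finset.induction_on with
  | empty => simpa using h
  | insert i B hi ih =>
    have ih := ih fun i hi => hB i (Finset.mem_insert_of_mem hi)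
    by_cases hA : i ∈ A ∪ B
    · rwa [Finset.union_insert, Finset.insert_eq_of_mem hA]
    · obtain ⟨j, hj, hW⟩ := hB i (Finset.mem_insert_self _ _)
      rw [Finset.union_insert]
      exact ih.insert_of_subset hA (Finset.mem_union_left _ hj) hW

/-- A set that is contained in another one is an ear. The larger sets are required outside of `B`,
so they are still present while the elements of `B` are removed one by one. -/
theorem Red.sdiff_of_subset {W : ι → Set α} {A : Finset ι} (h : Red W A) (B : Finset ι)
    (hB : ∀ i ∈ B, ∃ j ∈ A \ B, W i ⊆ W j) : Red W (A \ B) := by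
  have key : ∀ C : Finset ι, C ⊆ B → Red W (A \ C) := by
    intro C
    induction C using Finset.induction_on with
    | empty => intro _; simpa using h
    | insert i C hi ih =>
      intro hC
      have ih := ih ((Finset.subset_insert _ _).trans hC)
      rw [Finset.sdiff_insert]
      by_cases hA : i ∈ A \ C
      · refine ih.erase hA ?_
        obtain ⟨j, hj, hW⟩ := hB i (hC (Finset.mem_insert_self _ _))
        have hj' := Finset.mem_sdiff.1 hj
        refine ⟨j, Finset.mem_sdiff.2 ⟨hj'.1, fun h => hj'.2 (hC (Finset.mem_insert_of_mem h))⟩,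
          ?_, fun l _ _ x hx => hW hx.1⟩
        rintro rfl
        exact hj'.2 (hC (Finset.mem_insert_self _ _))
      · rwa [Finset.erase_eq_of_notMem hA]
  exact key B subset_rfl

/-- A reducible family of at least two sets has an ear. -/
theorem Red.exists_ear {W : ι → Set α} {A : Finset ι} (h : Red W A) (hA : 2 ≤ A.card) :
    ∃ i ∈ A, Ear W A i := by
  cases h with
  | small h => omega
  | ear i hi h hr => exact ⟨i, hi, h⟩

end Ears

section JoinTrees

variable {α : Type*}

/-- A leaf is an ear attached to its neighbour: if `v` lies in the label of the leaf and in another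
label, the path between the two nodes inside the subtree of `v` begins with the step to the
neighbour. Deleting the leaf keeps the tree and the subtree of every `v` connected, and induction
applies. -/
theorem red_of_tree {V : Type*} [Fintype V] [DecidableEq V] {T : SimpleGraph V} (hT : T.IsTree)
    (lam : V → Set α)
    (h : ∀ v, (T.induce {t | v ∈ lam t}).Preconnected) : Red lam Finset.univ := by
  classical
  induction hn : Fintype.card V generalizing V with
  | zero => exact .small (by simp [hn])
  | succ n ih =>
    by_cases hn0 : n = 0
    · exact .small (by simp [hn, hn0])
    have : Nontrivial V := Fintype.one_lt_card_iff_nontrivial.1 (by omega)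
    obtain ⟨i, hi⟩ := hT.exists_vert_degree_one_of_nontrivial
    obtain ⟨j, hj, huniq⟩ := SimpleGraph.degree_eq_one_iff_existsUnique_adj.1 hi
    have hconn := hT.connected.induce_compl_singleton_of_degree_eq_one hi
    have hT' : (T.induce {i}ᶜ).IsTree := ⟨hconn, hT.isAcyclic.induce _⟩
    have hcard : Fintype.card (({i}ᶜ : Set V)) = n := by
      rw [Fintype.card_compl_set, hn]; simp
    have hr := ih hT' (fun t => lam t.1) ?_ hcard
    · have hr' := hr.map (V := lam) Subtype.val Subtype.val_injective.injOn (fun _ _ _ _ _ => rfl)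
      have hun : (Finset.univ : Finset (({i}ᶜ : Set V))).image Subtype.val
          = Finset.univ.erase i := by
        ext x
        simp
      rw [hun] at hr'
      refine .ear i (Finset.mem_univ _) ⟨j, Finset.mem_univ _, hj.ne', ?_⟩ hr'
      intro l _ hli v hv
      obtain ⟨p⟩ := h v ⟨i, hv.1⟩ ⟨l, hv.2⟩
      cases p with
      | nil => exact absurd rfl hli
      | @cons _ b _ hadj _ =>
        have : b.1 = j := huniq b.1 hadj
        rw [← this]
        exact b.2
    · intro v
      have h1 := (h v).induce_of_degree_eq_one (s := {t | t.1 ≠ i}) (by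
        intro t ht a ha b hb
        have ht' : t.1 = i := not_not.1 ht
        refine Subtype.ext ?_
        have ha' : T.Adj t.1 a.1 := ha
        have hb' : T.Adj t.1 b.1 := hb
        rw [ht'] at ha' hb'
        exact (huniq _ ha').trans (huniq _ hb').symm)
      refine h1.map (f := ⟨fun x => ⟨⟨x.1.1, x.2⟩, x.1.2⟩, fun h => h⟩) ?_
      rintro ⟨⟨x, hx⟩, hx'⟩
      exact ⟨⟨⟨x, hx'⟩, hx⟩, rfl⟩

/-- Several tree nodes or several atoms may have the same variable set, so nodes and atoms do not
correspond one to one. In the disjoint union of both families every atom is a copy of a node, hence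
may be added, and every node is a copy of an atom, hence may be taken away. -/
theorem red_of_isAcyclic {H : Hypergraph α} (hH : IsAcyclic H) (hV : H.vertexSet = Set.univ)
    {m : ℕ} (e : Fin m → Set α) (he : ∀ i, e i ∈ H.edgeSet)
    (hsurj : ∀ f ∈ H.edgeSet, ∃ i, e i = f) : Red e Finset.univ := by
  obtain ⟨n, T, lam, hT, hlam, hon, hconn⟩ := hH
  have h0 := red_of_tree hT lam fun v => hconn v (hV ▸ Set.mem_univ v)
  have h1 := (h0.map (V := Sum.elim lam e) Sum.inl Sum.inl_injective.injOn
    (fun _ _ _ _ _ => rfl)).union_of_subset (Finset.univ.image Sum.inr) (by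
      intro i hi
      obtain ⟨a, _, rfl⟩ := Finset.mem_image.1 hi
      obtain ⟨t, ht⟩ := hon _ (he a)
      exact ⟨Sum.inl t, by simp, by simp [ht]⟩)
  have h2 := h1.sdiff_of_subset (Finset.univ.image Sum.inl) (by
      intro i hi
      obtain ⟨t, _, rfl⟩ := Finset.mem_image.1 hi
      obtain ⟨a, ha⟩ := hsurj _ (hlam t)
      exact ⟨Sum.inr a, by simp, by simp [ha]⟩)
  by_cases hm : m = 0
  · subst hm; exact .small (by simp)
  have : NeZero m := ⟨hm⟩
  -- Only atoms are left, so the value 0 on tree nodes is never used; it merely makes the map total.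
  have h3 := h2.map (V := e) (Sum.elim (fun _ => 0) id) (by
      rintro (a | a) ha (b | b) hb hab
      · simp at ha
      · simp at ha
      · simp at hb
      · exact congrArg _ hab) (by
      rintro (a | a) ha (b | b) hb hab
      · simp at ha
      · simp at ha
      · simp at hb
      · rfl)
  convert h3
  ext a
  simp

end JoinTrees

end ACQ

namespace ACQ
namespace Alg

/-! ### Rows as functions -/

/-- The entries of a row. -/
def fn (r : List ℕ) : ℕ → ℕ := fun x => r.getD x 0

theorem getD_eq_fn (r : List ℕ) (x : ℕ) : r.getD x 0 = fn r x := rfl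

@[simp] theorem length_tab {α : Type*} (n : ℕ) (f : ℕ → α) : (tab n f).length = n := by
  simp [tab]

theorem getD_tab {α : Type*} (n : ℕ) (f : ℕ → α) (x : ℕ) (d : α) :
    (tab n f).getD x d = if x < n then f x else d := by
  simp only [tab, List.getD_eq_getElem?_getD, List.getElem?_map]
  by_cases h : x < n
  · simp [h]
  · rw [List.getElem?_eq_none (by simpa using h)]
    simp [h]

theorem fn_tab (n : ℕ) (f : ℕ → ℕ) : fn (tab n f) = fun x => if x < n then f x else 0 :=
  funext fun x => getD_tab n f x 0

theorem fn_of_le {r : List ℕ} {x : ℕ} (h : r.length ≤ x) : fn r x = 0 := by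
  simp [fn, h]

theorem fn_injective {r s : List ℕ} (hl : r.length = s.length) (h : fn r = fn s) : r = s := by
  refine List.ext_getElem hl fun x h1 h2 => ?_
  have := congrFun h x
  simpa [fn, h1, h2] using this

theorem eqRow_iff {N : ℕ} {r s : List ℕ} (hr : r.length = N) (hs : s.length = N) :
    EqRow N r s ↔ r = s := by
  constructor
  · intro h
    refine fn_injective (hr.trans hs.symm) (funext fun x => ?_)
    by_cases hx : x < N
    · exact h x hx
    · rw [fn_of_le (by omega), fn_of_le (by omega)]
  · rintro rfl x _
    rfl

theorem ins_eq {N : ℕ} {a : TRow} {T : List TRow} (ha : a.1.length = N)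
    (hT : ∀ r ∈ T, r.1.length = N) : ins N a T = if a.1 ∈ T.map Prod.fst then T else a :: T := by
  have : (∃ b ∈ T, EqRow N b.1 a.1) ↔ a.1 ∈ T.map Prod.fst := by
    rw [List.mem_map]
    exact exists_congr fun b => and_congr_right fun hb => eqRow_iff (hT b hb) ha
  unfold ins
  by_cases h : a.1 ∈ T.map Prod.fst
  · rw [if_pos h, if_pos (this.2 h)]
  · rw [if_neg h, if_neg (fun h' => h (this.1 h'))]

theorem mem_of_mem_ins {N : ℕ} {a b : TRow} {T : List TRow} (h : b ∈ ins N a T) :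
    b = a ∨ b ∈ T := by
  unfold ins at h
  split_ifs at h
  · exact Or.inr h
  · exact List.mem_cons.1 h

theorem length_ins_le (N : ℕ) (a : TRow) (T : List TRow) : (ins N a T).length ≤ T.length + 1 := by
  unfold ins
  split_ifs <;> simp

/-- A list of rows of length `N`, without repetition. -/
def Proper (N : ℕ) (T : List TRow) : Prop :=
  (∀ r ∈ T, r.1.length = N) ∧ (T.map Prod.fst).Nodup

theorem Proper.nil (N : ℕ) : Proper N [] := ⟨by simp, by simp⟩

theorem Proper.ins {N : ℕ} {T : List TRow} (hT : Proper N T) {a : TRow} (ha : a.1.length = N) :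
    Proper N (ins N a T) := by
  rw [ins_eq ha hT.1]
  split_ifs with h
  · exact hT
  · refine ⟨?_, ?_⟩
    · intro r hr
      rcases List.mem_cons.1 hr with rfl | hr
      · exact ha
      · exact hT.1 r hr
    · rw [List.map_cons, List.nodup_cons]
      exact ⟨h, hT.2⟩

open Classical in
/-- The set of the rows of a table, as functions. -/
noncomputable def rows (T : List TRow) : Finset (ℕ → ℕ) := (T.map fun r => fn r.1).toFinset

theorem mem_rows {T : List TRow} {f : ℕ → ℕ} : f ∈ rows T ↔ ∃ r ∈ T, fn r.1 = f := by
  simp [rows]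

theorem fn_mem_rows {T : List TRow} {r : TRow} (h : r ∈ T) : fn r.1 ∈ rows T :=
  mem_rows.2 ⟨r, h, rfl⟩

theorem rows_ins {N : ℕ} {T : List TRow} (hT : Proper N T) {a : TRow} (ha : a.1.length = N)
    (f : ℕ → ℕ) : f ∈ rows (Alg.ins N a T) ↔ f = fn a.1 ∨ f ∈ rows T := by
  rw [ins_eq ha hT.1]
  split_ifs with h
  · constructor
    · exact Or.inr
    · rintro (rfl | h')
      · obtain ⟨b, hb, hba⟩ := List.mem_map.1 h
        rw [← hba]
        exact fn_mem_rows hb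
      · exact h'
  · simp only [mem_rows, List.mem_cons, exists_eq_or_imp]
    rw [eq_comm]

theorem Proper.nodup_fn {N : ℕ} {T : List TRow} (hT : Proper N T) :
    (T.map fun r => fn r.1).Nodup := by
  have : (T.map fun r => fn r.1) = (T.map Prod.fst).map fn := by simp
  rw [this]
  refine hT.2.map_on ?_
  intro r hr s hs h
  obtain ⟨a, ha, rfl⟩ := List.mem_map.1 hr
  obtain ⟨b, hb, rfl⟩ := List.mem_map.1 hs
  exact fn_injective ((hT.1 a ha).trans (hT.1 b hb).symm) h

theorem Proper.card_rows {N : ℕ} {T : List TRow} (hT : Proper N T) :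
    (rows T).card = T.length := by
  classical
  unfold rows
  rw [List.toFinset_card_of_nodup hT.nodup_fn, List.length_map]

/-! ### Loops -/

theorem foldl_const {α β : Type*} (f : α → α) (l : List β) (a : α) :
    l.foldl (fun acc _ => f acc) a = f^[l.length] a := by
  induction l generalizing a with
  | nil => rfl
  | cons b l ih => simp [ih]

theorem foldl_range_const {α : Type*} (f : α → α) (n : ℕ) (a : α) :
    (List.range n).reverse.foldl (fun acc _ => f acc) a = f^[n] a := by
  rw [foldl_const]; simp

/-- A loop that looks for an index with a property. -/
theorem foldl_find (P : ℕ → Prop) [DecidablePred P] (f : ℕ → ℕ) (l : List ℕ) (a : ℕ) :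
    (∃ q ∈ l, P q ∧ l.foldl (fun acc q => if P q then f q else acc) a = f q) ∨
      ((∀ q ∈ l, ¬ P q) ∧ l.foldl (fun acc q => if P q then f q else acc) a = a) := by
  induction l using List.reverseRecOn with
  | nil => simp
  | append_singleton l q ih =>
    rw [List.foldl_append]
    by_cases hq : P q
    · left
      exact ⟨q, by simp, hq, by simp [hq]⟩
    · rcases ih with ⟨q', h1, h2, h3⟩ | ⟨h1, h2⟩
      · left
        exact ⟨q', by simp [h1], h2, by simp [hq, h3]⟩
      · right
        refine ⟨?_, by simp [hq, h2]⟩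
        intro q' hq'
        rcases List.mem_append.1 hq' with h | h
        · exact h1 q' h
        · rw [List.mem_singleton.1 h]; exact hq

/-! ### The table of an atom -/

/-- An assignment as a function with values shifted by one. -/
def lift {N D : ℕ} (b : Fin N → Fin D) : ℕ → ℕ := fun x => if h : x < N then b ⟨x, h⟩ + 1 else 0

theorem lift_val {N D : ℕ} (b : Fin N → Fin D) (x : Fin N) : lift b x = b x + 1 := by
  simp [lift]

theorem parseRow_spec {w : List ℕ} {N D ar p pos : ℕ} {v : Fin ar → Fin N} {t : Fin ar → Fin D}
    (hv : ∀ q : Fin ar, w.getD (p + 1 + q) 0 = v q) (ht : ∀ q : Fin ar, w.getD (pos + q) 0 = t q)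
    (x : ℕ) : (∃ q, (v q : ℕ) = x ∧ fn (parseRow w N ar p pos) x = t q + 1) ∨
      (∀ q, (v q : ℕ) ≠ x) ∧ fn (parseRow w N ar p pos) x = 0 := by
  unfold parseRow
  rw [fn_tab]
  by_cases hx : x < N
  · simp only [if_pos hx]
    rcases foldl_find (fun q => w.getD (p + 1 + q) 0 = x) (fun q => w.getD (pos + q) 0 + 1)
      (List.range ar).reverse 0 with ⟨q, h1, h2, h3⟩ | ⟨h1, h2⟩
    · left
      have hq : q < ar := by simpa using h1
      refine ⟨⟨q, hq⟩, ?_, ?_⟩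
      · rw [← hv]; exact h2
      · rw [h3, ht ⟨q, hq⟩]
    · right
      refine ⟨fun q hq => h1 q (by simp) ?_, h2⟩
      rw [hv, hq]
  · right
    simp only [if_neg hx, and_true]
    intro q hq
    exact hx (hq ▸ (v q).2)

theorem parseRow_eq {w : List ℕ} {N D ar p pos : ℕ} {v : Fin ar → Fin N} {t : Fin ar → Fin D}
    (hv : ∀ q : Fin ar, w.getD (p + 1 + q) 0 = v q) (ht : ∀ q : Fin ar, w.getD (pos + q) 0 = t q)
    (b : Fin N → Fin D) (hb : ∀ q, b (v q) = t q) :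
    fn (parseRow w N ar p pos) =
      (Set.range fun q => (v q : ℕ)).indicator (lift b) := by
  funext x
  rcases parseRow_spec (N := N) hv ht x with ⟨q, rfl, h⟩ | ⟨h1, h2⟩
  · rw [h, Set.indicator_of_mem (Set.mem_range_self q), lift_val, hb]
  · rw [h2, Set.indicator_of_notMem]
    rintro ⟨q, hq⟩
    exact h1 q hq

/-- An atom may repeat a variable, and a tuple fits an assignment only if it has equal values at the
repeated places. The row keeps one value for each variable, so comparing it with all entries of the
tuple detects a conflict. -/
theorem parse_consistent_iff {w : List ℕ} {N D ar p pos : ℕ} (hD : 0 < D) {v : Fin ar → Fin N}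
    {t : Fin ar → Fin D}
    (hv : ∀ q : Fin ar, w.getD (p + 1 + q) 0 = v q)
    (ht : ∀ q : Fin ar, w.getD (pos + q) 0 = t q) :
    (∀ q < ar, (parseRow w N ar p pos).getD (w.getD (p + 1 + q) 0) 0 = w.getD (pos + q) 0 + 1) ↔
      ∃ b : Fin N → Fin D, ∀ q, b (v q) = t q := by
  constructor
  · intro h
    have h' : ∀ q : Fin ar, fn (parseRow w N ar p pos) (v q) = t q + 1 := by
      intro q
      have := h q q.2
      rwa [hv, ht] at this
    -- The remainder only supplies some domain element at the variables outside the atom; at a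
    -- variable of the atom the number is already below `D`.
    refine ⟨fun x => ⟨(fn (parseRow w N ar p pos) x - 1) % D, Nat.mod_lt _ hD⟩, ?_⟩
    intro q
    refine Fin.ext ?_
    simp only [h', Nat.add_sub_cancel]
    exact Nat.mod_eq_of_lt (t q).2
  · rintro ⟨b, hb⟩ q hq
    rw [hv ⟨q, hq⟩, ht ⟨q, hq⟩, getD_eq_fn, parseRow_eq hv ht b hb,
      Set.indicator_of_mem (Set.mem_range_self (⟨q, hq⟩ : Fin ar)), lift_val, hb]

/-- What is needed of the table of an atom with variables `v` and relation `rel`. -/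
structure AtomTable {N D ar : ℕ} (v : Fin ar → Fin N) (rel : List (Fin ar → Fin D))
    (f : Factor) : Prop where
  status : f.1 = 1
  patLength : f.2.1.length = N
  pattern : ∀ x, 1 ≤ fn f.2.1 x ↔ ∃ q, (v q : ℕ) = x
  proper : Proper N f.2.2
  gates : ∀ r ∈ f.2.2, r.2 = 0
  length : f.2.2.length ≤ rel.length
  rows : ∀ g, g ∈ rows f.2.2 ↔
    ∃ b : Fin N → Fin D, (fun q => b (v q)) ∈ rel ∧ (Set.range fun q => (v q : ℕ)).indicator
      (lift b) = g

theorem atomTable_parseAtom {w : List ℕ} {N D ar p pos : ℕ} (hD : 0 < D) (v : Fin ar → Fin N)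
    (rel : List (Fin ar → Fin D)) (hv : ∀ q : Fin ar, w.getD (p + 1 + q) 0 = v q)
    (ht : ∀ (i : ℕ) (hi : i < rel.length) (q : Fin ar), w.getD (pos + i * ar + q) 0 = rel[i] q) :
    AtomTable v rel (parseAtom w N ar p pos rel.length) := by
  have key : ∀ i ≤ rel.length, ∃ T, (parseStep w N ar p)^[i] (pos, []) = (pos + i * ar, T) ∧
      Proper N T ∧ (∀ r ∈ T, r.2 = 0) ∧ T.length ≤ i ∧ ∀ g, g ∈ Alg.rows T ↔
        ∃ b : Fin N → Fin D, (fun q => b (v q)) ∈ rel.take i ∧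
          (Set.range fun q => (v q : ℕ)).indicator (lift b) = g := by
    intro i
    induction i with
    | zero => intro _; exact ⟨[], by simp, Proper.nil N, by simp, by simp, by simp [Alg.rows]⟩
    | succ i ih =>
      intro hi
      obtain ⟨T, h1, h2, h3, h4, h5⟩ := ih (by omega)
      have hti := ht i (by omega)
      rw [Function.iterate_succ_apply', h1]
      refine ⟨_, Prod.ext (by simp [parseStep]; ring) rfl, ?_⟩
      have hlen : (parseRow w N ar p (pos + i * ar)).length = N := by simp [parseRow]
      have htake : rel.take (i + 1) = rel.take i ++ [rel[i]] := by
        rw [List.take_add_one, List.getElem?_eq_getElem (by omega)]; rfl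
      simp only [parseStep, parse_consistent_iff hD hv hti]
      split_ifs with hc
      · refine ⟨h2.ins hlen, ?_, (length_ins_le _ _ _).trans (by omega), ?_⟩
        · intro r hr
          rcases mem_of_mem_ins hr with rfl | hr
          · rfl
          · exact h3 r hr
        · intro g
          rw [rows_ins h2 hlen, h5, htake]
          obtain ⟨b₀, hb₀⟩ := hc
          constructor
          · rintro (rfl | ⟨b, hb, rfl⟩)
            · refine ⟨b₀, ?_, (parseRow_eq hv hti b₀ hb₀).symm⟩
              rw [List.mem_append]
              right
              rw [List.mem_singleton]
              exact funext hb₀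
            · exact ⟨b, List.mem_append_left _ hb, rfl⟩
          · rintro ⟨b, hb, rfl⟩
            rcases List.mem_append.1 hb with hb | hb
            · exact Or.inr ⟨b, hb, rfl⟩
            · left
              exact (parseRow_eq hv hti b (fun q => congrFun (List.mem_singleton.1 hb) q)).symm
      · refine ⟨h2, h3, by omega, ?_⟩
        intro g
        rw [h5, htake]
        constructor
        · rintro ⟨b, hb, rfl⟩
          exact ⟨b, List.mem_append_left _ hb, rfl⟩
        · rintro ⟨b, hb, rfl⟩
          rcases List.mem_append.1 hb with hb | hb
          · exact ⟨b, hb, rfl⟩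
          · exact absurd ⟨b, fun q => congrFun (List.mem_singleton.1 hb) q⟩ hc
  obtain ⟨T, h1, h2, h3, h4, h5⟩ := key rel.length le_rfl
  have hT : (parseAtom w N ar p pos rel.length).2.2 = T := by
    unfold parseAtom
    simp only [foldl_range_const, h1]
  refine ⟨rfl, by simp [parseAtom], ?_, ?_, ?_, ?_, ?_⟩
  · intro x
    have : (∃ q < ar, w.getD (p + 1 + q) 0 = x) ↔ ∃ q, (v q : ℕ) = x := by
      constructor
      · rintro ⟨q, hq, h⟩; exact ⟨⟨q, hq⟩, by rw [← hv]; exact h⟩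
      · rintro ⟨q, h⟩; exact ⟨q, q.2, by rw [hv, h]⟩
    simp only [parseAtom, fn_tab, this]
    constructor
    · intro h
      by_contra hc
      simp [hc] at h
    · intro h
      have hx : x < N := by obtain ⟨q, rfl⟩ := h; exact (v q).2
      simp [hx, h]
  · rw [hT]; exact h2
  · rw [hT]; exact h3
  · rw [hT]; exact h4
  · rw [hT]; simpa using h5

end Alg
end ACQ

namespace ACQ
open Alg

/-! ### Reading the encoding of a query -/

/-- The input word is a concatenation of blocks. Each lemma below that locates a piece of the query
writes the word with that piece as the middle block. -/
theorem getD_middle {l pre mid post : List ℕ} (hl : l = pre ++ (mid ++ post)) {p q : ℕ}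
    (hp : p = pre.length) (hq : q < mid.length) : l.getD (p + q) 0 = mid.getD q 0 := by
  subst hl hp
  rw [List.getD_append_right _ _ _ _ (by omega), Nat.add_sub_cancel_left,
    List.getD_append _ _ _ _ hq]

namespace Query

variable (Φ : Query)

/-- The flags of the quantified variables. -/
def flagBlock : List ℕ := List.ofFn fun x => if x ∈ Φ.quantified then 1 else 0

/-- The information on a relation. -/
def relInfo (R : Fin Φ.nRel) : List ℕ := [Φ.arity R, (Φ.rel R).length, (Φ.dataBefore R).length]

/-- The code of an atom. -/
def atomCode (a : Σ R : Fin Φ.nRel, Fin (Φ.arity R) → Fin Φ.nVar) : List ℕ :=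
  (a.1 : ℕ) :: List.ofFn fun p => (a.2 p : ℕ)

theorem encode_eq : Φ.encode = [Φ.nDom, Φ.nRel, Φ.nVar, Φ.atoms.length] ++ (Φ.flagBlock ++
    ((List.finRange Φ.nRel).flatMap Φ.relInfo ++ (Φ.atoms.flatMap Φ.atomCode ++
      Φ.dataBefore Φ.nRel))) := by
  simp only [encode, List.append_assoc]
  rfl

@[simp] theorem encode_one : Φ.encode.getD 1 0 = Φ.nRel := by rw [encode_eq]; rfl
@[simp] theorem encode_two : Φ.encode.getD 2 0 = Φ.nVar := by rw [encode_eq]; rfl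
@[simp] theorem encode_three : Φ.encode.getD 3 0 = Φ.atoms.length := by rw [encode_eq]; rfl

theorem length_flagBlock : Φ.flagBlock.length = Φ.nVar := by simp [flagBlock]

theorem encode_flag (x : Fin Φ.nVar) :
    Φ.encode.getD (4 + x) 0 = if x ∈ Φ.quantified then 1 else 0 := by
  refine (getD_middle (p := 4) Φ.encode_eq rfl (by rw [length_flagBlock]; exact x.2)).trans ?_
  simp [flagBlock, List.getD_eq_getElem?_getD]

theorem finRange_split {n : ℕ} (R : Fin n) :
    List.finRange n = (List.finRange n).take R ++ (R :: (List.finRange n).drop (R + 1)) := by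
  conv_lhs => rw [← List.take_append_drop R (List.finRange n)]
  rw [List.drop_eq_getElem_cons (by simp)]
  simp

theorem length_flatMap_relInfo (l : List (Fin Φ.nRel)) :
    (l.flatMap Φ.relInfo).length = 3 * l.length := by
  induction l with
  | nil => rfl
  | cons R l ih => simp [ih, relInfo]; ring

theorem encode_relInfo (R : Fin Φ.nRel) {q : ℕ} (hq : q < 3) :
    Φ.encode.getD (4 + Φ.nVar + (R + R + R) + q) 0 = (Φ.relInfo R).getD q 0 := by
  have h := Φ.encode_eq
  rw [finRange_split R, List.flatMap_append, List.flatMap_cons] at h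
  refine getD_middle (pre := [Φ.nDom, Φ.nRel, Φ.nVar, Φ.atoms.length] ++ Φ.flagBlock ++
    ((List.finRange Φ.nRel).take R).flatMap Φ.relInfo)
    (post := ((List.finRange Φ.nRel).drop (R + 1)).flatMap Φ.relInfo ++
      (Φ.atoms.flatMap Φ.atomCode ++ Φ.dataBefore Φ.nRel)) (h.trans ?_) ?_ hq
  · simp only [List.append_assoc]
  · have : (R : ℕ) ≤ Φ.nRel := R.2.le
    simp only [List.length_append, length_flagBlock, length_flatMap_relInfo, List.length_take,
      List.length_finRange, min_eq_left this]
    simp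
    ring

/-- The position of the atoms. -/
def atomsPos : ℕ := 4 + Φ.nVar + (Φ.nRel + Φ.nRel + Φ.nRel)

theorem atomPos_encode : atomPos Φ.encode = Φ.atomsPos := by
  simp only [atomPos, encode_two, encode_one]; rfl

theorem length_header : ([Φ.nDom, Φ.nRel, Φ.nVar, Φ.atoms.length] ++ Φ.flagBlock ++
    (List.finRange Φ.nRel).flatMap Φ.relInfo).length = Φ.atomsPos := by
  simp only [List.length_append, length_flagBlock, length_flatMap_relInfo, List.length_finRange,
    atomsPos]
  simp
  ring

theorem encode_atom {pre suf : List (Σ R : Fin Φ.nRel, Fin (Φ.arity R) → Fin Φ.nVar)}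
    {a : Σ R : Fin Φ.nRel, Fin (Φ.arity R) → Fin Φ.nVar} (h : Φ.atoms = pre ++ a :: suf) {q : ℕ}
    (hq : q < Φ.arity a.1 + 1) :
    Φ.encode.getD (Φ.atomsPos + (pre.flatMap Φ.atomCode).length + q) 0 =
      (Φ.atomCode a).getD q 0 := by
  have h' := Φ.encode_eq
  rw [show Φ.atoms.flatMap Φ.atomCode = pre.flatMap Φ.atomCode ++ (Φ.atomCode a ++
    suf.flatMap Φ.atomCode) by rw [h]; simp] at h'
  refine getD_middle (pre := [Φ.nDom, Φ.nRel, Φ.nVar, Φ.atoms.length] ++ Φ.flagBlock ++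
    (List.finRange Φ.nRel).flatMap Φ.relInfo ++ pre.flatMap Φ.atomCode)
    (post := suf.flatMap Φ.atomCode ++ Φ.dataBefore Φ.nRel) (h'.trans ?_) ?_ ?_
  · simp only [List.append_assoc]
  · rw [List.length_append (as := _ ++ _ ++ _), length_header]
  · simpa [atomCode] using hq

theorem length_atomCode (a : Σ R : Fin Φ.nRel, Fin (Φ.arity R) → Fin Φ.nVar) :
    (Φ.atomCode a).length = 1 + Φ.arity a.1 := by
  simp [atomCode]; ring

theorem relPos_encode {pre suf : List (Σ R : Fin Φ.nRel, Fin (Φ.arity R) → Fin Φ.nVar)}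
    {a : Σ R : Fin Φ.nRel, Fin (Φ.arity R) → Fin Φ.nVar} (h : Φ.atoms = pre ++ a :: suf) :
    relPos Φ.encode (Φ.atomsPos + (pre.flatMap Φ.atomCode).length) =
      4 + Φ.nVar + ((a.1 : ℕ) + a.1 + a.1) := by
  have := Φ.encode_atom h (q := 0) (by omega)
  rw [Nat.add_zero] at this
  rw [relPos, encode_two, this]
  rfl

theorem nextPos_encode {pre suf : List (Σ R : Fin Φ.nRel, Fin (Φ.arity R) → Fin Φ.nVar)}
    {a : Σ R : Fin Φ.nRel, Fin (Φ.arity R) → Fin Φ.nVar} (h : Φ.atoms = pre ++ a :: suf) :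
    nextPos Φ.encode (Φ.atomsPos + (pre.flatMap Φ.atomCode).length) =
      Φ.atomsPos + ((pre ++ [a]).flatMap Φ.atomCode).length := by
  have := Φ.encode_relInfo a.1 (q := 0) (by omega)
  rw [nextPos, Φ.relPos_encode h, ← Nat.add_zero (4 + _ + _), this]
  simp [relInfo, length_atomCode]
  ring

/-- The codes of the atoms have different lengths, so the end of their block is only reached by
walking from atom to atom, looking up the arity each time. -/
theorem dataPos_encode :
    dataPos Φ.encode = Φ.atomsPos + (Φ.atoms.flatMap Φ.atomCode).length := by
  have key : ∀ suf pre, Φ.atoms = pre ++ suf →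
      (nextPos Φ.encode)^[suf.length] (Φ.atomsPos + (pre.flatMap Φ.atomCode).length) =
        Φ.atomsPos + (Φ.atoms.flatMap Φ.atomCode).length := by
    intro suf
    induction suf with
    | nil => intro pre h; simp [h]
    | cons a suf ih =>
      intro pre h
      rw [List.length_cons, Function.iterate_succ_apply, Φ.nextPos_encode h]
      exact ih (pre ++ [a]) (by simp [h])
  rw [dataPos, foldl_range_const, encode_three, atomPos_encode]
  simpa using key Φ.atoms [] rfl

theorem getD_flatMap_const {β : Type*} {f : β → List ℕ} {n : ℕ} (hf : ∀ b, (f b).length = n)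
    (l : List β) {i q : ℕ} (hi : i < l.length) (hq : q < n) :
    (l.flatMap f).getD (i * n + q) 0 = (f l[i]).getD q 0 := by
  induction l generalizing i with
  | nil => simp at hi
  | cons b l ih =>
    rw [List.flatMap_cons]
    cases i with
    | zero => simpa using List.getD_append _ _ _ _ (by rw [hf]; omega)
    | succ i =>
      rw [List.getD_append_right _ _ _ _ (by rw [hf]; nlinarith), hf,
        show (i + 1) * n + q - n = i * n + q by rw [Nat.add_mul]; omega]
      exact ih (by simpa using hi)

theorem length_flatMap_const {β : Type*} {f : β → List ℕ} {n : ℕ} (hf : ∀ b, (f b).length = n)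
    (l : List β) : (l.flatMap f).length = l.length * n := by
  induction l with
  | nil => simp
  | cons b l ih => simp [ih, hf]; ring

theorem encode_data (R : Fin Φ.nRel) {i : ℕ} (hi : i < (Φ.rel R).length) (q : Fin (Φ.arity R)) :
    Φ.encode.getD (Φ.atomsPos + (Φ.atoms.flatMap Φ.atomCode).length + (Φ.dataBefore R).length +
      i * Φ.arity R + q) 0 = (Φ.rel R)[i] q := by
  have h' := Φ.encode_eq
  have hd : Φ.dataBefore Φ.nRel = Φ.dataBefore R ++ (Φ.relData R ++
      ((List.finRange Φ.nRel).drop (R + 1)).flatMap Φ.relData) := by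
    unfold dataBefore
    rw [List.take_of_length_le (by simp)]
    conv_lhs => rw [finRange_split R, List.flatMap_append, List.flatMap_cons]
  have hf : ∀ t : Fin (Φ.arity R) → Fin Φ.nDom, (List.ofFn fun p => (t p : ℕ)).length =
      Φ.arity R := fun t => by simp
  have hlen : (Φ.relData R).length = (Φ.rel R).length * Φ.arity R := length_flatMap_const hf _
  rw [add_assoc (_ + _)]
  rw [getD_middle (pre := [Φ.nDom, Φ.nRel, Φ.nVar, Φ.atoms.length] ++ Φ.flagBlock ++
    (List.finRange Φ.nRel).flatMap Φ.relInfo ++ Φ.atoms.flatMap Φ.atomCode ++ Φ.dataBefore R)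
    (mid := Φ.relData R) (post := ((List.finRange Φ.nRel).drop (R + 1)).flatMap Φ.relData)]
  · refine (getD_flatMap_const hf _ hi q.2).trans ?_
    simp [List.getD_eq_getElem?_getD]
  · rw [h', hd]
    simp only [List.append_assoc]
  · rw [List.length_append, List.length_append (as := _ ++ _ ++ _), length_header]
  · rw [hlen]
    calc i * Φ.arity R + q < i * Φ.arity R + Φ.arity R := by omega
      _ = (i + 1) * Φ.arity R := by ring
      _ ≤ _ := Nat.mul_le_mul_right _ hi

/-- Each table is put in front of the earlier ones, which is why the tables follow the atoms in
reverse order. The extra table comes before all of them. -/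
theorem readAll_encode : ∃ fs, readAll Φ.encode = trivialFactor Φ.nVar 2 :: fs ∧
    List.Forall₂ (fun a f => AtomTable a.2 (Φ.rel a.1) f) Φ.atoms.reverse fs := by
  have key : ∀ suf pre acc, Φ.atoms = pre ++ suf →
      List.Forall₂ (fun a f => AtomTable a.2 (Φ.rel a.1) f) pre.reverse acc →
      List.Forall₂ (fun a f => AtomTable a.2 (Φ.rel a.1) f) Φ.atoms.reverse
        ((readStep Φ.encode)^[suf.length]
          (Φ.atomsPos + (pre.flatMap Φ.atomCode).length, acc)).2 := by
    intro suf
    induction suf with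
    | nil => intro pre acc h1 h2; simpa [h1] using h2
    | cons a suf ih =>
      intro pre acc h1 h2
      rw [List.length_cons, Function.iterate_succ_apply, readStep]
      simp only
      rw [Φ.nextPos_encode h1]
      refine ih (pre ++ [a]) _ (by simp [h1]) ?_
      rw [List.reverse_append, List.reverse_singleton, List.singleton_append]
      refine List.Forall₂.cons ?_ h2
      rw [Φ.relPos_encode h1]
      have i0 := Φ.encode_relInfo a.1 (q := 0) (by omega)
      have i1 := Φ.encode_relInfo a.1 (q := 1) (by omega)
      have i2 := Φ.encode_relInfo a.1 (q := 2) (by omega)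
      rw [Nat.add_zero] at i0
      rw [i0, i1, i2, dataPos_encode, encode_two]
      refine atomTable_parseAtom Φ.nDom_pos a.2 (Φ.rel a.1) ?_ ?_
      · intro q
        rw [add_assoc _ 1, Φ.encode_atom h1 (by omega), add_comm 1]
        simp [atomCode, List.getD_eq_getElem?_getD]
      · intro i hi q
        exact Φ.encode_data a.1 hi q
  refine ⟨_, by rw [readAll, encode_two], ?_⟩
  rw [foldl_range_const, encode_three, atomPos_encode]
  simpa using key Φ.atoms [] [] rfl (by simp)

theorem fn_freeFlags (x : ℕ) :
    1 ≤ fn (freeFlags Φ.encode) x ↔ ∃ y ∈ Φ.free, (y : ℕ) = x := by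
  rw [freeFlags, encode_two, fn_tab]
  by_cases hx : x < Φ.nVar
  · have := Φ.encode_flag ⟨x, hx⟩
    simp only [hx, if_true]
    simp only at this
    rw [this]
    by_cases hq : (⟨x, hx⟩ : Fin Φ.nVar) ∈ Φ.quantified
    · simp only [hq, if_true]
      simp only [free, Finset.mem_sdiff, Finset.mem_univ, true_and]
      constructor
      · intro h; simp at h
      · rintro ⟨y, hy, rfl⟩; exact absurd hq hy
    · simp only [hq, if_false, le_refl, if_true, true_iff]
      exact ⟨⟨x, hx⟩, by simp [free, hq], rfl⟩
  · simp only [hx, if_false]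
    constructor
    · intro h; omega
    · rintro ⟨y, _, rfl⟩; exact absurd y.2 hx

end Query
end ACQ

namespace ACQ

/-! ### The polynomial of a family of weighted tables -/

open Classical in
/-- The assignments of `D` values `1, …, D` to the variables below `N`, extended by `0`. -/
noncomputable def total (N D : ℕ) : Finset (ℕ → ℕ) :=
  (Finset.univ : Finset (Fin N → Fin D)).image Alg.lift

theorem mem_total {N D : ℕ} {b : ℕ → ℕ} :
    b ∈ total N D ↔ (∀ x < N, b x ≠ 0 ∧ b x ≤ D) ∧ ∀ x, N ≤ x → b x = 0 := by
  simp only [total, Finset.mem_image, Finset.mem_univ, true_and]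
  constructor
  · rintro ⟨c, rfl⟩
    refine ⟨fun x hx => ?_, fun x hx => ?_⟩
    · have := (c ⟨x, hx⟩).2
      simp only [Alg.lift, hx, dif_pos]
      omega
    · simp only [Alg.lift, not_lt.2 hx, dif_neg, not_false_iff]
  · rintro ⟨h1, h2⟩
    refine ⟨fun x => ⟨b x - 1, by have := h1 x x.2; omega⟩, funext fun x => ?_⟩
    by_cases hx : x < N
    · have := h1 x hx
      simp only [Alg.lift, hx, dif_pos]
      omega
    · simp only [Alg.lift, hx, dif_neg, not_false_iff]
      exact (h2 x (by omega)).symm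

/-- Two partial assignments, with `0` for undefined, are compatible. -/
def CompatFn (r s : ℕ → ℕ) : Prop := ∀ x, r x = 0 ∨ s x = 0 ∨ r x = s x

/-- A partial assignment extended by another one. -/
def joinFn (r s : ℕ → ℕ) : ℕ → ℕ := fun x => if r x = 0 then s x else r x

theorem joinFn_apply (r s : ℕ → ℕ) (x : ℕ) : joinFn r s x = if r x = 0 then s x else r x := rfl

/-- The variable for a value; `1` if undefined. -/
def varOf {M : Type*} [One M] (X : ℕ → M) (v : ℕ) : M := if v = 0 then 1 else X (v - 1)

/-- The monomial of a partial assignment. -/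
def mon {M : Type*} [CommMonoid M] (X : ℕ → M) (N : ℕ) (a : ℕ → ℕ) : M :=
  ∏ x ∈ Finset.range N, varOf X (a x)

/-- A family of tables: their variables, their rows, and the weights of the rows. -/
structure Tables (M : Type*) where
  W : ℕ → Set ℕ
  T : ℕ → Finset (ℕ → ℕ)
  ω : ℕ → (ℕ → ℕ) → M

namespace Tables

variable {M : Type*} (τ : Tables M) (N D : ℕ) (S : Set ℕ) (I : Finset ℕ)

/-- The rows are assignments of the variables. -/
def Valid : Prop :=
  ∀ l ∈ I, (∀ x ∈ τ.W l, x < N) ∧ ∀ r ∈ τ.T l, (∀ x, r x ≠ 0 ↔ x ∈ τ.W l) ∧ ∀ x, r x ≤ D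

/-- The free variables that occur in the tables. -/
def alive : Set ℕ := {x | (∃ l ∈ I, x ∈ τ.W l) ∧ x ∈ S}

/-- The assignment satisfies all tables. -/
def Sat (b : ℕ → ℕ) : Prop := ∀ l ∈ I, (τ.W l).indicator b ∈ τ.T l

open Classical in
/-- The answers. -/
noncomputable def res : Finset (ℕ → ℕ) :=
  ((total N D).filter (τ.Sat I)).image fun b => (τ.alive S I).indicator b

theorem mem_res {a : ℕ → ℕ} : a ∈ τ.res N D S I ↔
    ∃ b ∈ total N D, τ.Sat I b ∧ (τ.alive S I).indicator b = a := by
  simp [res, and_assoc]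

/-- The weighted sum over the answers. -/
noncomputable def poly [CommSemiring M] (X : ℕ → M) : M :=
  ∑ a ∈ τ.res N D S I, mon X N a * ∏ l ∈ I, τ.ω l ((τ.W l).indicator a)

/-- The variables of the table `i` that do not belong to the table `j` belong to no other table. -/
def EarAt (i j : ℕ) : Prop := ∀ x ∈ τ.W i, x ∈ τ.W j ∨ ∀ l ∈ I, l ≠ i → x ∉ τ.W l

/-- `τ'` arises from `τ` by joining the table `i` to the table `j`. -/
structure JoinInto [CommSemiring M] (τ' : Tables M) (i j : ℕ) : Prop where
  W_other : ∀ l ∈ I, l ≠ i → l ≠ j → τ'.W l = τ.W l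
  T_other : ∀ l ∈ I, l ≠ i → l ≠ j → τ'.T l = τ.T l
  ω_other : ∀ l ∈ I, l ≠ i → l ≠ j → τ'.ω l = τ.ω l
  W_i : τ'.W i = ∅
  T_i : τ'.T i = {0}
  ω_i : τ'.ω i 0 = 1
  W_j : τ'.W j = τ.W j ∪ (τ.W i ∩ S)
  T_j : ∀ f, f ∈ τ'.T j ↔ ∃ r ∈ τ.T j, ∃ s ∈ τ.T i, CompatFn r s ∧ joinFn r (S.indicator s) = f
  ω_j : ∀ a, τ'.ω j a = τ.ω j ((τ.W j).indicator a) * τ.ω i ((τ.W i).indicator a)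

open Classical in
/-- `τ'` arises from `τ` by summing out the table `i` over the table `j`. -/
structure SumInto [CommSemiring M] (X : ℕ → M) (τ' : Tables M) (i j : ℕ) : Prop where
  W_other : ∀ l ∈ I, l ≠ i → τ'.W l = τ.W l
  T_other : ∀ l ∈ I, l ≠ i → τ'.T l = τ.T l
  ω_other : ∀ l ∈ I, l ≠ i → l ≠ j → τ'.ω l = τ.ω l
  W_i : τ'.W i = ∅
  T_i : τ'.T i = {0}
  ω_i : τ'.ω i 0 = 1
  ω_j : ∀ a, τ'.ω j a = τ.ω j a * ∑ s ∈ ((τ.T i).image S.indicator).filter (CompatFn a),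
    τ.ω i s * ∏ x ∈ Finset.range N, if x ∈ τ.W j then 1 else varOf X (s x)

variable {τ N D S I}

theorem prod_split [CommMonoid M] {i j : ℕ} (hi : i ∈ I) (hj : j ∈ I) (hij : i ≠ j) (f : ℕ → M) :
    ∏ l ∈ I, f l = f i * (f j * ∏ l ∈ (I.erase i).erase j, f l) := by
  rw [Finset.mul_prod_erase (I.erase i) f (Finset.mem_erase.2 ⟨hij.symm, hj⟩),
    Finset.mul_prod_erase I f hi]

/-- The set of answers does not change: an assignment for the joined table gives rows of both old
tables, and only the variables of `i` that neither `j` nor the answers see may have to be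
reassigned. Those occur in no other table because `i` is an ear. The weight of a joined row is the
product of the two old weights, so the sums agree term by term. -/
theorem JoinInto.poly_eq [CommSemiring M] (X : ℕ → M) {τ' : Tables M} {i j : ℕ}
    (h : τ.JoinInto S I τ' i j) (hV : τ.Valid N D I) (hi : i ∈ I) (hj : j ∈ I) (hij : i ≠ j)
    (hE : τ.EarAt I i j) : τ'.poly N D S I X = τ.poly N D S I X := by
  have hA : τ'.alive S I = τ.alive S I := by
    ext x
    constructor
    · rintro ⟨⟨l, hl, hx⟩, hS⟩
      refine ⟨?_, hS⟩
      by_cases h1 : l = i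
      · subst h1; rw [h.W_i] at hx; exact hx.elim
      by_cases h2 : l = j
      · subst h2
        rw [h.W_j] at hx
        rcases hx with hx | hx
        · exact ⟨l, hl, hx⟩
        · exact ⟨i, hi, hx.1⟩
      · rw [h.W_other l hl h1 h2] at hx
        exact ⟨l, hl, hx⟩
    · rintro ⟨⟨l, hl, hx⟩, hS⟩
      refine ⟨?_, hS⟩
      by_cases h1 : l = i
      · subst h1; exact ⟨j, hj, by rw [h.W_j]; exact Or.inr ⟨hx, hS⟩⟩
      by_cases h2 : l = j
      · subst h2; exact ⟨l, hl, by rw [h.W_j]; exact Or.inl hx⟩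
      · exact ⟨l, hl, by rw [h.W_other l hl h1 h2]; exact hx⟩
  have hres : τ'.res N D S I = τ.res N D S I := by
    ext a
    rw [mem_res, mem_res, hA]
    constructor
    · rintro ⟨b, hb, hsat, rfl⟩
      obtain ⟨r, hr, s, hs, hc, hrs⟩ := (h.T_j _).1 (hsat j hj)
      have hrs' : ∀ x, joinFn r (S.indicator s) x = (τ'.W j).indicator b x := fun x => by rw [hrs]
      have hr1 := ((hV j hj).2 r hr).1
      have hs1 := ((hV i hi).2 s hs).1
      have hbr : ∀ x ∈ τ.W j, b x = r x := by
        intro x hx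
        have h1 := hrs' x
        rw [Set.indicator_of_mem (by rw [h.W_j]; exact Or.inl hx), joinFn,
          if_neg ((hr1 x).2 hx)] at h1
        exact h1.symm
      have hbs : ∀ x ∈ τ.W i, (x ∈ τ.W j ∨ x ∈ S) → b x = s x := by
        intro x hx hx'
        by_cases hxj : x ∈ τ.W j
        · rw [hbr x hxj]
          rcases hc x with h1 | h1 | h1
          · exact absurd h1 ((hr1 x).2 hxj)
          · exact absurd h1 ((hs1 x).2 hx)
          · exact h1
        · have hxS := hx'.resolve_left hxj
          have h1 := hrs' x
          have h0 : r x = 0 := by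
            by_contra h0
            exact hxj ((hr1 x).1 h0)
          rw [Set.indicator_of_mem (by rw [h.W_j]; exact Or.inr ⟨hx, hxS⟩), joinFn, if_pos h0,
            Set.indicator_of_mem hxS] at h1
          exact h1.symm
      classical
      -- The joined table has forgotten the quantified variables private to `i`, where `b` is
      -- arbitrary. Taking the values of `s` there satisfies the old table `i`, and no other table
      -- or answer notices.
      set b' : ℕ → ℕ := fun x => if x ∈ τ.W i then s x else b x with hb'
      have hsame : ∀ x, (∃ l ∈ I, l ≠ i ∧ x ∈ τ.W l) ∨ x ∈ S → b' x = b x := by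
        intro x hx
        by_cases hxi : x ∈ τ.W i
        · simp only [hb', if_pos hxi]
          refine (hbs x hxi ?_).symm
          rcases hx with ⟨l, hl, hli, hxl⟩ | hx
          · left
            rcases hE x hxi with h1 | h1
            · exact h1
            · exact absurd hxl (h1 l hl hli)
          · exact Or.inr hx
        · simp only [hb', if_neg hxi]
      refine ⟨b', ?_, ?_, ?_⟩
      · rw [mem_total] at hb ⊢
        refine ⟨fun x hx => ?_, fun x hx => ?_⟩
        · by_cases hxi : x ∈ τ.W i
          · simp only [hb', if_pos hxi]
            exact ⟨(hs1 x).2 hxi, ((hV i hi).2 s hs).2 x⟩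
          · simp only [hb', if_neg hxi]
            exact hb.1 x hx
        · have hxi : x ∉ τ.W i := fun hxi => absurd ((hV i hi).1 x hxi) (by omega)
          simp only [hb', if_neg hxi]
          exact hb.2 x hx
      · intro l hl
        by_cases h1 : l = i
        · subst h1
          convert hs using 1
          funext x
          by_cases hx : x ∈ τ.W l
          · rw [Set.indicator_of_mem hx]; simp only [hb', if_pos hx]
          · rw [Set.indicator_of_notMem hx]
            by_contra h0
            exact hx ((hs1 x).1 (Ne.symm h0))
        · have h3 : (τ.W l).indicator b' = (τ.W l).indicator b :=
            Set.indicator_congr fun x hx => hsame x (Or.inl ⟨l, hl, h1, hx⟩)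
          rw [h3]
          by_cases h2 : l = j
          · subst h2
            convert hr using 1
            funext x
            by_cases hx : x ∈ τ.W l
            · rw [Set.indicator_of_mem hx, hbr x hx]
            · rw [Set.indicator_of_notMem hx]
              by_contra h0
              exact hx ((hr1 x).1 (Ne.symm h0))
          · have := hsat l hl
            rwa [h.W_other l hl h1 h2, h.T_other l hl h1 h2] at this
      · exact Set.indicator_congr fun x hx => hsame x (Or.inr hx.2)
    · rintro ⟨b, hb, hsat, rfl⟩
      refine ⟨b, hb, ?_, rfl⟩
      intro l hl
      by_cases h1 : l = i
      · subst h1; rw [h.W_i, h.T_i, Set.indicator_empty]; exact Finset.mem_singleton_self _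
      by_cases h2 : l = j
      · subst h2
        rw [h.T_j]
        refine ⟨_, hsat l hl, _, hsat i hi, ?_, ?_⟩
        · intro x
          by_cases h3 : x ∈ τ.W l <;> by_cases h4 : x ∈ τ.W i <;> simp [h3, h4]
        · funext x
          rw [h.W_j, joinFn]
          by_cases h3 : x ∈ τ.W l
          · have : b x ≠ 0 := ((mem_total.1 hb).1 x ((hV l hl).1 x h3)).1
            simp [h3, this]
          · by_cases h4 : x ∈ τ.W i <;> by_cases h5 : x ∈ S <;> simp [h3, h4, h5]
      · rw [h.W_other l hl h1 h2, h.T_other l hl h1 h2]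
        exact hsat l hl
  unfold poly
  rw [hres]
  refine Finset.sum_congr rfl fun a ha => ?_
  congr 1
  obtain ⟨b, hb, hsat, rfl⟩ := (mem_res ..).1 ha
  rw [prod_split hi hj hij, prod_split hi hj hij, h.W_i, Set.indicator_empty, h.ω_j]
  have e0 : τ'.ω i (fun _ => 0) = 1 := h.ω_i
  rw [e0, one_mul]
  have e1 : ∏ l ∈ (I.erase i).erase j, τ'.ω l ((τ'.W l).indicator ((τ.alive S I).indicator b)) =
      ∏ l ∈ (I.erase i).erase j, τ.ω l ((τ.W l).indicator ((τ.alive S I).indicator b)) := by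
    refine Finset.prod_congr rfl fun l hl => ?_
    simp only [Finset.mem_erase] at hl
    rw [h.W_other l hl.2.2 hl.2.1 hl.1, h.ω_other l hl.2.2 hl.2.1 hl.1]
  have e2 : (τ.W j).indicator ((τ'.W j).indicator ((τ.alive S I).indicator b)) =
      (τ.W j).indicator ((τ.alive S I).indicator b) := by
    rw [Set.indicator_indicator, h.W_j, Set.inter_eq_left.2 Set.subset_union_left]
  -- The new table lacks some variables of `i`, but these are quantified and an answer is 0 there
  -- anyway.
  have e3 : (τ.W i).indicator ((τ'.W j).indicator ((τ.alive S I).indicator b)) =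
      (τ.W i).indicator ((τ.alive S I).indicator b) := by
    refine Set.indicator_congr fun x hx => ?_
    by_cases hxS : x ∈ S
    · rw [Set.indicator_of_mem]
      rw [h.W_j]
      exact Or.inr ⟨hx, hxS⟩
    · have : (τ.alive S I).indicator b x = 0 := Set.indicator_of_notMem (fun h => hxS h.2) _
      rw [this]
      by_cases hx' : x ∈ τ'.W j
      · rw [Set.indicator_of_mem hx', this]
      · rw [Set.indicator_of_notMem hx']
  rw [e1, e2, e3]
  ring

/-- An answer splits into its restriction to the variables that stay alive and its restriction to `W
i`, a projected row compatible with the former. Conversely such a pair glues to an answer, because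
all variables that `i` shares with other tables lie in `j` and are free, so agreement on the free
part of `j` is agreement everywhere. Summing over the second component first gives the factor in the
new weight of `j`. Rows of `j` without a partner may stay: they receive the weight 0. -/
theorem SumInto.poly_eq [CommSemiring M] {X : ℕ → M} {τ' : Tables M} {i j : ℕ}
    (h : τ.SumInto N S I X τ' i j) (hV : τ.Valid N D I) (hi : i ∈ I) (hj : j ∈ I) (hij : i ≠ j)
    (hE : τ.EarAt I i j) (hS : τ.W i ∩ τ.W j ⊆ S) :
    τ'.poly N D S I X = τ.poly N D S I X := by
  classical
  have hA : ∀ x, x ∈ τ'.alive S I ↔ (∃ l ∈ I, l ≠ i ∧ x ∈ τ.W l) ∧ x ∈ S := by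
    intro x
    constructor
    · rintro ⟨⟨l, hl, hx⟩, hxS⟩
      refine ⟨?_, hxS⟩
      by_cases h1 : l = i
      · subst h1; rw [h.W_i] at hx; exact hx.elim
      · rw [h.W_other l hl h1] at hx
        exact ⟨l, hl, h1, hx⟩
    · rintro ⟨⟨l, hl, h1, hx⟩, hxS⟩
      exact ⟨⟨l, hl, by rwa [h.W_other l hl h1]⟩, hxS⟩
  have hAA : ∀ x, x ∈ τ.alive S I ↔ x ∈ τ'.alive S I ∨ (x ∈ τ.W i ∧ x ∈ S) := by
    intro x
    rw [hA]
    constructor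
    · rintro ⟨⟨l, hl, hx⟩, hxS⟩
      by_cases h1 : l = i
      · subst h1; exact Or.inr ⟨hx, hxS⟩
      · exact Or.inl ⟨⟨l, hl, h1, hx⟩, hxS⟩
    · rintro (⟨⟨l, hl, _, hx⟩, hxS⟩ | ⟨hx, hxS⟩)
      · exact ⟨⟨l, hl, hx⟩, hxS⟩
      · exact ⟨⟨i, hi, hx⟩, hxS⟩
  have hov : ∀ x ∈ τ.W i, ∀ l ∈ I, l ≠ i → x ∈ τ.W l → x ∈ τ.W j := by
    intro x hx l hl hli hxl
    exact (hE x hx).resolve_right fun h1 => h1 l hl hli hxl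
  have hovA : ∀ x ∈ τ.W i, x ∈ τ'.alive S I → x ∈ τ.W j := by
    intro x hx hxA
    obtain ⟨⟨l, hl, hli, hxl⟩, _⟩ := (hA x).1 hxA
    exact hov x hx l hl hli hxl
  have hjA : ∀ x ∈ τ.W j, x ∈ S → x ∈ τ'.alive S I := fun x hx hxS =>
    (hA x).2 ⟨⟨j, hj, hij.symm, hx⟩, hxS⟩
  have hWj : τ'.W j = τ.W j := h.W_other j hj hij.symm
  have hsupp : ∀ s ∈ (τ.T i).image S.indicator, ∀ x, s x ≠ 0 ↔ x ∈ τ.W i ∧ x ∈ S := by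
    intro s hs x
    obtain ⟨s₀, hs₀, rfl⟩ := Finset.mem_image.1 hs
    have := ((hV i hi).2 s₀ hs₀).1 x
    by_cases hx : x ∈ S
    · rw [Set.indicator_of_mem hx, this]; simp [hx]
    · simp [hx]
  have hares : ∀ a ∈ τ'.res N D S I, ∀ x, a x ≠ 0 ↔ x ∈ τ'.alive S I := by
    intro a ha x
    obtain ⟨b, hb, -, rfl⟩ := (mem_res ..).1 ha
    by_cases hx : x ∈ τ'.alive S I
    · obtain ⟨⟨l, hl, _, hxl⟩, _⟩ := (hA x).1 hx
      rw [Set.indicator_of_mem hx]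
      exact iff_of_true ((mem_total.1 hb).1 x ((hV l hl).1 x hxl)).1 hx
    · simp [hx]
  -- the answers are the pairs of a remaining answer and a compatible projected row
  have hsum : τ.poly N D S I X = ∑ a ∈ τ'.res N D S I,
      ∑ s ∈ ((τ.T i).image S.indicator).filter (CompatFn ((τ.W j).indicator a)),
        mon X N (joinFn s a) * ∏ l ∈ I, τ.ω l ((τ.W l).indicator (joinFn s a)) := by
    unfold poly
    rw [Finset.sum_sigma']
    refine Finset.sum_bij' (fun a _ => ⟨(τ'.alive S I).indicator a, (τ.W i).indicator a⟩)
      (fun p _ => joinFn p.2 p.1) ?_ ?_ ?_ ?_ ?_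
    · intro a ha
      obtain ⟨b, hb, hsat, rfl⟩ := (mem_res ..).1 ha
      rw [Finset.mem_sigma, Finset.mem_filter]
      refine ⟨(mem_res ..).2 ⟨b, hb, ?_, ?_⟩, ?_, ?_⟩
      · intro l hl
        by_cases h1 : l = i
        · subst h1; rw [h.W_i, h.T_i, Set.indicator_empty]; exact Finset.mem_singleton_self _
        · rw [h.W_other l hl h1, h.T_other l hl h1]; exact hsat l hl
      · funext x
        by_cases hx : x ∈ τ'.alive S I
        · simp only [Set.indicator_of_mem hx]
          rw [Set.indicator_of_mem ((hAA x).2 (Or.inl hx))]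
        · simp only [Set.indicator_of_notMem hx]
      · refine Finset.mem_image.2 ⟨_, hsat i hi, funext fun x => ?_⟩
        by_cases hx : x ∈ τ.W i
        · by_cases hxS : x ∈ S
          · simp [hx, hxS, (hAA x).2 (Or.inr ⟨hx, hxS⟩)]
          · have : x ∉ τ.alive S I := fun h => hxS h.2
            simp [hx, hxS, this]
        · by_cases hxS : x ∈ S <;> simp [hx, hxS]
      · intro x
        simp only
        by_cases h3 : x ∈ τ.W j <;> by_cases h4 : x ∈ τ.W i <;>
          by_cases h5 : x ∈ τ'.alive S I <;> simp [h3, h4, h5]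
    · rintro ⟨a, s⟩ hp
      rw [Finset.mem_sigma, Finset.mem_filter] at hp
      obtain ⟨ha, hs, hc⟩ := hp
      simp only at ha hs hc
      obtain ⟨b, hb, hsat, rfl⟩ := (mem_res ..).1 ha
      obtain ⟨s₀, hs₀, rfl⟩ := Finset.mem_image.1 hs
      have hs1 := ((hV i hi).2 s₀ hs₀).1
      -- This is where the shared variables have to be free: compatibility was only tested against
      -- the answer, which knows nothing of quantified variables.
      have hsb : ∀ x ∈ τ.W i, x ∈ τ.W j → s₀ x = b x := by
        intro x hx hxj
        have hxS : x ∈ S := hS ⟨hx, hxj⟩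
        have := hc x
        rw [Set.indicator_of_mem hxj, Set.indicator_of_mem (hjA x hxj hxS),
          Set.indicator_of_mem hxS] at this
        rcases this with h1 | h1 | h1
        · exact absurd h1 ((mem_total.1 hb).1 x ((hV j hj).1 x hxj)).1
        · exact absurd h1 ((hs1 x).2 hx)
        · exact h1.symm
      set b' : ℕ → ℕ := fun x => if x ∈ τ.W i then s₀ x else b x with hb'
      refine (mem_res ..).2 ⟨b', ?_, ?_, ?_⟩
      · rw [mem_total] at hb ⊢
        refine ⟨fun x hx => ?_, fun x hx => ?_⟩
        · by_cases hxi : x ∈ τ.W i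
          · simp only [hb', if_pos hxi]
            exact ⟨(hs1 x).2 hxi, ((hV i hi).2 s₀ hs₀).2 x⟩
          · simp only [hb', if_neg hxi]
            exact hb.1 x hx
        · have hxi : x ∉ τ.W i := fun hxi => absurd ((hV i hi).1 x hxi) (by omega)
          simp only [hb', if_neg hxi]
          exact hb.2 x hx
      · intro l hl
        by_cases h1 : l = i
        · subst h1
          convert hs₀ using 1
          funext x
          by_cases hx : x ∈ τ.W l
          · rw [Set.indicator_of_mem hx]; simp only [hb', if_pos hx]
          · rw [Set.indicator_of_notMem hx]
            by_contra h0
            exact hx ((hs1 x).1 (Ne.symm h0))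
        · have h3 : (τ.W l).indicator b' = (τ.W l).indicator b := by
            refine Set.indicator_congr fun x hx => ?_
            by_cases hxi : x ∈ τ.W i
            · simp only [hb', if_pos hxi]
              exact hsb x hxi (hov x hxi l hl h1 hx)
            · simp only [hb', if_neg hxi]
          rw [h3]
          have := hsat l hl
          rwa [h.W_other l hl h1, h.T_other l hl h1] at this
      · funext x
        simp only [joinFn, hb']
        by_cases hxi : x ∈ τ.W i
        · by_cases hxS : x ∈ S
          · have : s₀ x ≠ 0 := (hs1 x).2 hxi
            simp [hxi, hxS, this, (hAA x).2 (Or.inr ⟨hxi, hxS⟩)]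
          · have h1 : x ∉ τ.alive S I := fun h => hxS h.2
            have h2 : x ∉ τ'.alive S I := fun h => hxS h.2
            simp [hxS, h1, h2]
        · have h0 : s₀ x = 0 := by
            by_contra h0
            exact hxi ((hs1 x).1 h0)
          have h1 : S.indicator s₀ x = 0 := by
            by_cases hxS : x ∈ S <;> simp [hxS, h0]
          rw [if_pos h1]
          by_cases hxA : x ∈ τ'.alive S I
          · simp [hxi, hxA, (hAA x).2 (Or.inl hxA)]
          · have : x ∉ τ.alive S I := fun h => by
              rcases (hAA x).1 h with h | h
              · exact hxA h
              · exact hxi h.1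
            simp [hxA, this]
    · intro a ha
      obtain ⟨b, hb, hsat, rfl⟩ := (mem_res ..).1 ha
      funext x
      simp only [joinFn]
      by_cases hxi : x ∈ τ.W i <;> by_cases hxA' : x ∈ τ'.alive S I <;>
        by_cases hxA : x ∈ τ.alive S I <;> simp [hxi, hxA, hxA']
      · exact fun h => h.symm
      · rcases (hAA x).1 hxA with h | h
        · exact absurd h hxA'
        · exact absurd h.1 hxi
    · rintro ⟨a, s⟩ hp
      rw [Finset.mem_sigma, Finset.mem_filter] at hp
      obtain ⟨ha, hs, hc⟩ := hp
      simp only at ha hs hc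
      have h1 := hsupp s hs
      have h2 := hares a ha
      refine Sigma.ext ?_ (heq_of_eq ?_)
      · funext x
        simp only
        by_cases hx : x ∈ τ'.alive S I
        · rw [Set.indicator_of_mem hx, joinFn_apply]
          by_cases hs0 : s x = 0
          · rw [if_pos hs0]
          · rw [if_neg hs0]
            have := hc x
            rw [Set.indicator_of_mem (hovA x ((h1 x).1 hs0).1 hx)] at this
            rcases this with h3 | h3 | h3
            · exact absurd h3 ((h2 x).2 hx)
            · exact absurd h3 hs0
            · exact h3.symm
        · rw [Set.indicator_of_notMem hx]
          by_contra h0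
          exact hx ((h2 x).1 (Ne.symm h0))
      · funext x
        simp only
        by_cases hx : x ∈ τ.W i
        · rw [Set.indicator_of_mem hx, joinFn_apply]
          by_cases hs0 : s x = 0
          · rw [if_pos hs0, hs0]
            by_contra h0
            exact absurd hs0 ((h1 x).2 ⟨hx, ((hA x).1 ((h2 x).1 h0)).2⟩)
          · rw [if_neg hs0]
        · rw [Set.indicator_of_notMem hx]
          by_contra h0
          exact hx ((h1 x).1 (Ne.symm h0)).1
    · intro a ha
      have : joinFn ((τ.W i).indicator a) ((τ'.alive S I).indicator a) = a := by
        obtain ⟨b, hb, hsat, rfl⟩ := (mem_res ..).1 ha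
        funext x
        simp only [joinFn]
        by_cases hxi : x ∈ τ.W i <;> by_cases hxA' : x ∈ τ'.alive S I <;>
          by_cases hxA : x ∈ τ.alive S I <;> simp [hxi, hxA, hxA']
        · exact fun h => h.symm
        · rcases (hAA x).1 hxA with h | h
          · exact absurd h hxA'
          · exact absurd h.1 hxi
      simp only [this]
  rw [hsum]
  unfold poly
  refine Finset.sum_congr rfl fun a ha => ?_
  have h2 := hares a ha
  rw [prod_split hi hj hij, h.W_i, Set.indicator_empty, h.ω_j, hWj]
  have e0 : τ'.ω i (fun _ => 0) = 1 := h.ω_i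
  rw [e0, one_mul, mul_comm (τ.ω j _), mul_assoc, mul_left_comm, Finset.sum_mul]
  refine Finset.sum_congr rfl fun s hs => ?_
  rw [Finset.mem_filter] at hs
  obtain ⟨hs, hc⟩ := hs
  have h1 := hsupp s hs
  have eqA : ∀ x ∈ τ'.alive S I, joinFn s a x = a x := by
    intro x hx
    rw [joinFn_apply]
    by_cases hs0 : s x = 0
    · rw [if_pos hs0]
    · rw [if_neg hs0]
      have := hc x
      rw [Set.indicator_of_mem (hovA x ((h1 x).1 hs0).1 hx)] at this
      rcases this with h3 | h3 | h3
      · exact absurd h3 ((h2 x).2 hx)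
      · exact absurd h3 hs0
      · exact h3.symm
  have eqW : ∀ l ∈ I, l ≠ i → (τ.W l).indicator (joinFn s a) = (τ.W l).indicator a := by
    intro l hl hli
    refine Set.indicator_congr fun x hx => ?_
    by_cases hxS : x ∈ S
    · exact eqA x ((hA x).2 ⟨⟨l, hl, hli, hx⟩, hxS⟩)
    · have : s x = 0 := by
        by_contra h0
        exact hxS ((h1 x).1 h0).2
      simp [joinFn, this]
  have eqI : (τ.W i).indicator (joinFn s a) = s := by
    funext x
    by_cases hx : x ∈ τ.W i
    · rw [Set.indicator_of_mem hx, joinFn_apply]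
      by_cases hs0 : s x = 0
      · rw [if_pos hs0, hs0]
        by_contra h0
        exact absurd hs0 ((h1 x).2 ⟨hx, ((hA x).1 ((h2 x).1 h0)).2⟩)
      · rw [if_neg hs0]
    · rw [Set.indicator_of_notMem hx]
      by_contra h0
      exact hx ((h1 x).1 (Ne.symm h0)).1
  -- The variables of `i` that also lie in `j` are already accounted for in the monomial of `a`;
  -- only those outside `W j` contribute new factors.
  have emon : mon X N (joinFn s a) =
      mon X N a * ∏ x ∈ Finset.range N, if x ∈ τ.W j then 1 else varOf X (s x) := by
    unfold mon
    rw [← Finset.prod_mul_distrib]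
    refine Finset.prod_congr rfl fun x _ => ?_
    by_cases hxj : x ∈ τ.W j
    · rw [if_pos hxj, mul_one]
      by_cases hxS : x ∈ S
      · rw [eqA x (hjA x hxj hxS)]
      · have : s x = 0 := by
          by_contra h0
          exact hxS ((h1 x).1 h0).2
        simp [joinFn, this]
    · rw [if_neg hxj]
      by_cases hs0 : s x = 0
      · simp [joinFn, hs0, varOf]
      · have ha0 : a x = 0 := by
          by_contra h0
          exact hxj (hovA x ((h1 x).1 hs0).1 ((h2 x).1 h0))
        simp [joinFn, hs0, ha0, varOf]
  rw [prod_split hi hj hij, eqI, eqW j hj hij.symm, emon]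
  have e1 : ∏ l ∈ (I.erase i).erase j, τ'.ω l ((τ'.W l).indicator a) =
      ∏ l ∈ (I.erase i).erase j, τ.ω l ((τ.W l).indicator (joinFn s a)) := by
    refine Finset.prod_congr rfl fun l hl => ?_
    simp only [Finset.mem_erase] at hl
    rw [h.W_other l hl.2.2 hl.2.1, h.ω_other l hl.2.2 hl.2.1 hl.1, eqW l hl.2.2 hl.2.1]
  rw [e1]
  ring

end Tables

end ACQ

namespace ACQ
namespace Alg

/-! ### The values of gates -/

section Values

variable {M : Type*} [CommSemiring M] (X : ℕ → M)

/-- The value of a gate, given the values of the earlier gates. -/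
def gval (v : ℕ → M) (g : GCode) : M :=
  if g.1 = 0 then (g.2.1 : M) else if g.1 = 1 then X g.2.1
  else if g.1 = 2 then v g.2.1 + v g.2.2 else v g.2.1 * v g.2.2

/-- The values of the gates of a list, latest first. -/
def gv : List GCode → ℕ → M
  | [], _ => 0
  | g :: G, k => if k = G.length then gval X (gv G) g else gv G k

/-- A gate that may follow `n` gates. -/
def GateOK (D n : ℕ) (g : GCode) : Prop :=
  g.1 = 0 ∨ (g.1 = 1 ∧ g.2.1 < D) ∨ ((g.1 = 2 ∨ g.1 = 3) ∧ g.2.1 < n ∧ g.2.2 < n)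

/-- The list `G'` arises from `G` by appending gates; the second factors of the products have the
property `ok`. -/
inductive Grow (ok : M → Prop) (D : ℕ) (G : List GCode) : List GCode → Prop
  | refl : Grow ok D G G
  | cons {G' : List GCode} (g : GCode) (h : Grow ok D G G') (hg : GateOK D G'.length g)
      (hm : g.1 = 3 → ok (gv X G' g.2.2)) : Grow ok D G (g :: G')

variable {X} {ok : M → Prop} {D : ℕ} {G G' G'' : List GCode}

theorem Grow.trans (h : Grow X ok D G G') (h' : Grow X ok D G' G'') : Grow X ok D G G'' := by
  induction h' with
  | refl => exact h
  | cons g _ hg hm ih => exact .cons g ih hg hm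

theorem Grow.length_le (h : Grow X ok D G G') : G.length ≤ G'.length := by
  induction h with
  | refl => exact le_rfl
  | cons g _ _ _ ih => exact ih.trans (by simp)

theorem gv_cons_lt (g : GCode) {k : ℕ} (hk : k < G.length) : gv X (g :: G) k = gv X G k := by
  rw [gv, if_neg hk.ne]

theorem gv_cons_length (g : GCode) : gv X (g :: G) G.length = gval X (gv X G) g := by
  rw [gv, if_pos rfl]

theorem Grow.gv_eq (h : Grow X ok D G G') {k : ℕ} (hk : k < G.length) :
    gv X G' k = gv X G k := by
  induction h with
  | refl => rfl
  | cons g h _ _ ih => rw [gv_cons_lt g (hk.trans_le h.length_le), ih]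

/-! ### Joining tables -/

/-- The set of variables of a pattern. -/
def vars (W : List ℕ) : Set ℕ := {x | 1 ≤ fn W x}

theorem compat_iff {N : ℕ} {r s : List ℕ} (hr : r.length = N) :
    Compat N r s ↔ CompatFn (fn r) (fn s) := by
  constructor
  · intro h x
    by_cases hx : x < N
    · exact h x hx
    · exact Or.inl (fn_of_le (by omega))
  · intro h x _
    exact h x

theorem fn_mask {N : ℕ} {fr r : List ℕ} (hr : r.length = N) :
    fn (mask N fr r) = (vars fr).indicator (fn r) := by
  classical
  rw [mask, fn_tab]
  funext x
  by_cases hx : x < N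
  · rw [if_pos hx]
    by_cases h : x ∈ vars fr
    · rw [Set.indicator_of_mem h]
      exact if_pos h
    · rw [Set.indicator_of_notMem h]
      exact if_neg h
  · rw [if_neg hx]
    by_cases h : x ∈ vars fr
    · rw [Set.indicator_of_mem h, fn_of_le (by omega)]
    · rw [Set.indicator_of_notMem h]

theorem fn_joinRow {N : ℕ} {fr r s : List ℕ} (hr : r.length = N) (hs : s.length = N) :
    fn (joinRow N fr r s) = joinFn (fn r) ((vars fr).indicator (fn s)) := by
  classical
  rw [joinRow, fn_tab]
  funext x
  rw [joinFn_apply]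
  by_cases hx : x < N
  · rw [if_pos hx]
    by_cases h0 : fn r x = 0
    · rw [if_pos h0, getD_eq_fn, h0, if_neg (by omega)]
      by_cases h : x ∈ vars fr
      · rw [Set.indicator_of_mem h]
        exact if_pos h
      · rw [Set.indicator_of_notMem h]
        exact if_neg h
    · rw [if_neg h0, getD_eq_fn, if_pos (by omega)]
  · rw [if_neg hx, fn_of_le (r := r) (by omega), if_pos rfl]
    by_cases h : x ∈ vars fr
    · rw [Set.indicator_of_mem h, fn_of_le (by omega)]
    · rw [Set.indicator_of_notMem h]

theorem length_mask (N : ℕ) (fr r : List ℕ) : (mask N fr r).length = N := length_tab _ _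

theorem length_joinRow (N : ℕ) (fr r s : List ℕ) : (joinRow N fr r s).length = N := length_tab _ _

theorem qMerge_eq (N : ℕ) (fr : List ℕ) (Ti Tj : List TRow) (G : List GCode) :
    qMerge N fr Ti Tj G = (Tj.flatMap fun r => Ti.map fun s => (r, s)).foldl
      (fun acc p => qStep N fr p.1 acc p.2) ([], G) := by
  simp only [qMerge, List.foldl_flatMap, List.foldl_map]

/-- Each compatible pair produces a product gate. If several pairs give the same joined row, only
the first gate is kept for it, so the last clause names some pair for each row rather than all. That
suffices, since weights depend on free parts only and the joined row determines the free parts of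
both rows. -/
theorem foldl_qStep_spec {N : ℕ} {fr : List ℕ} (ps : List (TRow × TRow))
    (acc : List TRow × List GCode) (hP : Proper N acc.1)
    (hps : ∀ p ∈ ps, p.1.2 < acc.2.length ∧ p.2.2 < acc.2.length ∧ ok (gv X acc.2 p.2.2)) :
    Grow X ok D acc.2 (ps.foldl (fun acc p => qStep N fr p.1 acc p.2) acc).2 ∧
    (ps.foldl (fun acc p => qStep N fr p.1 acc p.2) acc).2.length ≤ acc.2.length + ps.length ∧
    Proper N (ps.foldl (fun acc p => qStep N fr p.1 acc p.2) acc).1 ∧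
    (∀ f, f ∈ rows (ps.foldl (fun acc p => qStep N fr p.1 acc p.2) acc).1 ↔ f ∈ rows acc.1 ∨
      ∃ p ∈ ps, Compat N p.1.1 p.2.1 ∧ fn (joinRow N fr p.1.1 p.2.1) = f) ∧
    ∀ q ∈ (ps.foldl (fun acc p => qStep N fr p.1 acc p.2) acc).1, q ∈ acc.1 ∨
      ∃ p ∈ ps, Compat N p.1.1 p.2.1 ∧ q.1 = joinRow N fr p.1.1 p.2.1 ∧
        q.2 < (ps.foldl (fun acc p => qStep N fr p.1 acc p.2) acc).2.length ∧
        gv X (ps.foldl (fun acc p => qStep N fr p.1 acc p.2) acc).2 q.2 =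
          gv X acc.2 p.1.2 * gv X acc.2 p.2.2 := by
  induction ps generalizing acc with
  | nil => exact ⟨.refl, by simp, hP, by simp, by simp⟩
  | cons p ps ih =>
    obtain ⟨hp1, hp2, hp3⟩ := hps p (by simp)
    rw [List.foldl_cons]
    by_cases hc : Compat N p.1.1 p.2.1
    · have hstep : qStep N fr p.1 acc p.2 = (ins N (joinRow N fr p.1.1 p.2.1, acc.2.length) acc.1,
          (3, (p.1.2, p.2.2)) :: acc.2) := by rw [qStep, if_pos hc]
      have hg : Grow X ok D acc.2 ((3, (p.1.2, p.2.2)) :: acc.2) :=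
        .cons _ .refl (Or.inr (Or.inr ⟨Or.inr rfl, hp1, hp2⟩)) fun _ => hp3
      have hlen := length_joinRow N fr p.1.1 p.2.1
      obtain ⟨i1, i2, i3, i4, i5⟩ := ih (qStep N fr p.1 acc p.2)
        (by rw [hstep]; exact hP.ins hlen) (by
          intro q hq
          obtain ⟨h1, h2, h3⟩ := hps q (by simp [hq])
          rw [hstep]
          exact ⟨h1.trans (by simp), h2.trans (by simp), by rwa [hg.gv_eq h2]⟩)
      generalize ps.foldl (fun acc p => qStep N fr p.1 acc p.2) (qStep N fr p.1 acc p.2) = R at *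
      rw [hstep] at i1 i2 i4 i5
      refine ⟨hg.trans i1, ?_, i3, ?_, ?_⟩
      · simp only [List.length_cons] at i2 ⊢
        omega
      · intro f
        rw [i4, rows_ins hP hlen]
        simp only [List.mem_cons, exists_eq_or_imp, hc, true_and]
        constructor
        · rintro ((h | h) | h)
          · exact Or.inr (Or.inl h.symm)
          · exact Or.inl h
          · exact Or.inr (Or.inr h)
        · rintro (h | h | h)
          · exact Or.inl (Or.inr h)
          · exact Or.inl (Or.inl h.symm)
          · exact Or.inr h
      · intro q hq
        rcases i5 q hq with h | ⟨p', hp', h1, h2, h3, h4⟩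
        · rcases mem_of_mem_ins h with rfl | h
          · right
            have hlt : acc.2.length < ((3, (p.1.2, p.2.2)) :: acc.2).length := by simp
            refine ⟨p, by simp, hc, rfl, hlt.trans_le i1.length_le, ?_⟩
            rw [i1.gv_eq hlt, gv_cons_length]
            rfl
          · exact Or.inl h
        · right
          obtain ⟨g1, g2, -⟩ := hps p' (by simp [hp'])
          refine ⟨p', by simp [hp'], h1, h2, h3, ?_⟩
          rw [h4, hg.gv_eq g1, hg.gv_eq g2]
    · have hstep : qStep N fr p.1 acc p.2 = acc := by rw [qStep, if_neg hc]
      rw [hstep]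
      obtain ⟨i1, i2, i3, i4, i5⟩ := ih acc hP fun q hq => hps q (by simp [hq])
      refine ⟨i1, by simp only [List.length_cons]; omega, i3, ?_, ?_⟩
      · intro f
        rw [i4]
        simp only [List.mem_cons, exists_eq_or_imp, hc, false_and, false_or]
      · intro q hq
        rcases i5 q hq with h | ⟨p', hp', h⟩
        · exact Or.inl h
        · exact Or.inr ⟨p', by simp [hp'], h⟩

theorem length_pairs (Ti Tj : List TRow) :
    (Tj.flatMap fun r => Ti.map fun s => (r, s)).length = Tj.length * Ti.length := by
  induction Tj with
  | nil => simp
  | cons r T ih => simp [ih]; ring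

theorem qMerge_spec {N : ℕ} {fr : List ℕ} {Ti Tj : List TRow}
    (hi : ∀ s ∈ Ti, s.2 < G.length ∧ ok (gv X G s.2)) (hj : ∀ r ∈ Tj, r.2 < G.length) :
    Grow X ok D G (qMerge N fr Ti Tj G).2 ∧
    (qMerge N fr Ti Tj G).2.length ≤ G.length + Tj.length * Ti.length ∧
    Proper N (qMerge N fr Ti Tj G).1 ∧
    (∀ f, f ∈ rows (qMerge N fr Ti Tj G).1 ↔
      ∃ r ∈ Tj, ∃ s ∈ Ti, Compat N r.1 s.1 ∧ fn (joinRow N fr r.1 s.1) = f) ∧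
    ∀ q ∈ (qMerge N fr Ti Tj G).1, q.2 < (qMerge N fr Ti Tj G).2.length ∧
      ∃ r ∈ Tj, ∃ s ∈ Ti, Compat N r.1 s.1 ∧ q.1 = joinRow N fr r.1 s.1 ∧
        gv X (qMerge N fr Ti Tj G).2 q.2 = gv X G r.2 * gv X G s.2 := by
  have h := foldl_qStep_spec (X := X) (ok := ok) (D := D) (N := N) (fr := fr)
    (Tj.flatMap fun r => Ti.map fun s => (r, s))
    ([], G) (Proper.nil N) (by
      intro p hp
      simp only [List.mem_flatMap, List.mem_map] at hp
      obtain ⟨r, hr, s, hs, rfl⟩ := hp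
      exact ⟨hj r hr, hi s hs⟩)
  rw [← qMerge_eq, length_pairs] at h
  obtain ⟨i1, i2, i3, i4, i5⟩ := h
  refine ⟨i1, i2, i3, ?_, ?_⟩
  · intro f
    rw [i4]
    simp only [List.mem_flatMap, List.mem_map]
    constructor
    · rintro (h | ⟨p, ⟨r, hr, s, hs, rfl⟩, h⟩)
      · simp [rows] at h
      · exact ⟨r, hr, s, hs, h⟩
    · rintro ⟨r, hr, s, hs, h⟩
      exact Or.inr ⟨_, ⟨r, hr, s, hs, rfl⟩, h⟩
  · intro q hq
    rcases i5 q hq with h | ⟨p, hp, h1, h2, h3, h4⟩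
    · simp at h
    · simp only [List.mem_flatMap, List.mem_map] at hp
      obtain ⟨r, hr, s, hs, rfl⟩ := hp
      exact ⟨h3, r, hr, s, hs, h1, h2, h4⟩

/-! ### Summing out a table -/

/-- Here too the first of several rows with the same projection supplies the gate. Under
`HasWeights` they all have the same value. -/
theorem proj_spec (N : ℕ) (fr : List ℕ) (Ti : List TRow) :
    Proper N (proj N fr Ti) ∧ (proj N fr Ti).length ≤ Ti.length ∧
    (∀ f, f ∈ rows (proj N fr Ti) ↔ ∃ s ∈ Ti, fn (mask N fr s.1) = f) ∧
    ∀ p ∈ proj N fr Ti, ∃ s ∈ Ti, p = (mask N fr s.1, s.2) := by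
  unfold proj
  induction Ti using List.reverseRecOn with
  | nil => exact ⟨Proper.nil N, le_rfl, by simp [rows], by simp⟩
  | append_singleton T a ih =>
    obtain ⟨i1, i2, i3, i4⟩ := ih
    rw [List.foldl_append]
    simp only [List.foldl_cons, List.foldl_nil]
    refine ⟨i1.ins (length_mask ..), ?_, ?_, ?_⟩
    · rw [List.length_append, List.length_singleton]
      exact (length_ins_le _ _ _).trans (by omega)
    · intro f
      rw [rows_ins i1 (length_mask ..), i3]
      simp only [List.mem_append, List.mem_singleton, or_and_right, exists_or, exists_eq_left]
      rw [or_comm, eq_comm (a := f)]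
    · intro p hp
      rcases mem_of_mem_ins hp with rfl | hp
      · exact ⟨a, by simp, rfl⟩
      · obtain ⟨s, hs, h⟩ := i4 p hp
        exact ⟨s, by simp [hs], h⟩

-- Each entry of the row outside `W` costs two gates, hence the bound 2 * N. The second factor of
-- each product is a variable, so `ok` is only needed for the values of `X`.
open Classical in
theorem monom_spec {N : ℕ} (W : List ℕ) {s : List ℕ} (hs : ∀ x, fn s x ≤ D)
    (hok : ∀ d, ok (X d)) (acc : ℕ × List GCode) (hacc : acc.1 < acc.2.length) :
    Grow X ok D acc.2 ((List.range N).reverse.foldl (varStep W s) acc).2 ∧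
    ((List.range N).reverse.foldl (varStep W s) acc).2.length ≤ acc.2.length + 2 * N ∧
    ((List.range N).reverse.foldl (varStep W s) acc).1 <
      ((List.range N).reverse.foldl (varStep W s) acc).2.length ∧
    gv X ((List.range N).reverse.foldl (varStep W s) acc).2
      ((List.range N).reverse.foldl (varStep W s) acc).1 = gv X acc.2 acc.1 *
        ∏ x ∈ Finset.range N, if x ∈ vars W then 1 else varOf X (fn s x) := by
  induction N generalizing acc with
  | zero => exact ⟨.refl, by simp, by simpa using hacc, by simp⟩
  | succ N ih =>
    rw [List.range_succ, List.reverse_append, List.reverse_singleton, List.singleton_append,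
      List.foldl_cons]
    have key : Grow X ok D acc.2 (varStep W s acc N).2 ∧
        (varStep W s acc N).2.length ≤ acc.2.length + 2 ∧
        (varStep W s acc N).1 < (varStep W s acc N).2.length ∧
        gv X (varStep W s acc N).2 (varStep W s acc N).1 = gv X acc.2 acc.1 *
          if N ∈ vars W then 1 else varOf X (fn s N) := by
      unfold varStep
      by_cases h1 : 1 ≤ s.getD N 0
      · rw [if_pos h1]
        by_cases h2 : 1 ≤ W.getD N 0
        · have h2' : N ∈ vars W := h2
          rw [if_pos h2]
          exact ⟨.refl, by omega, hacc, by simp [h2']⟩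
        · have h2' : N ∉ vars W := h2
          have hD : s.getD N 0 ≤ D := hs N
          have hg1 : Grow X ok D acc.2 ((1, (s.getD N 0 - 1, 0)) :: acc.2) :=
            .cons _ .refl (Or.inr (Or.inl ⟨rfl, by simp only; omega⟩)) fun h => by simp at h
          have hval : gv X ((1, (s.getD N 0 - 1, 0)) :: acc.2) acc.2.length =
            X (s.getD N 0 - 1) := by rw [gv_cons_length]; rfl
          rw [if_neg h2]
          refine ⟨.cons _ hg1 (Or.inr (Or.inr ⟨Or.inr rfl, ?_, ?_⟩)) fun _ => ?_, ?_, ?_, ?_⟩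
          · simp only [List.length_cons]; omega
          · simp
          · simp only [hval]; exact hok _
          · simp
          · simp
          · have : acc.2.length + 1 =
                (((1, (s.getD N 0 - 1, 0)) :: acc.2 : List GCode)).length := by simp
            rw [this, gv_cons_length]
            simp only [gval]
            have hv : varOf X (fn s N) = X (s.getD N 0 - 1) :=
              if_neg (by rw [← getD_eq_fn]; omega)
            rw [hval, gv_cons_lt _ hacc, if_neg h2', hv]
            simp
      · have h0 : fn s N = 0 := by simp only [fn]; omega
        rw [if_neg h1]
        exact ⟨.refl, by omega, hacc, by simp [h0, varOf]⟩
    obtain ⟨k1, k2, k3, k4⟩ := key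
    obtain ⟨i1, i2, i3, i4⟩ := ih (varStep W s acc N) k3
    refine ⟨k1.trans i1, by omega, i3, ?_⟩
    rw [i4, k4, Finset.prod_range_succ]
    ring

-- Every compatible row contributes an addition gate. The resulting lower bound on the number of new
-- gates plays no role for correctness; it is what pays for the bit length of the sum when the gates
-- are evaluated as numbers.
open Classical in
theorem foldl_sStep_spec {N : ℕ} (W : List ℕ) (r : TRow) (hok : ∀ d, ok (X d)) (P : List TRow)
    (hP : ∀ p ∈ P, ∀ x, fn p.1 x ≤ D) (acc : ℕ × List GCode) (hacc : acc.1 < acc.2.length)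
    (hg : ∀ p ∈ P, p.2 < acc.2.length) :
    Grow X ok D acc.2 (P.foldl (sStep N W r) acc).2 ∧
    (P.foldl (sStep N W r) acc).2.length ≤ acc.2.length + P.length * (2 * N + 1) ∧
    acc.2.length + (P.filter fun p => Compat N r.1 p.1).length ≤
      (P.foldl (sStep N W r) acc).2.length ∧
    (P.foldl (sStep N W r) acc).1 < (P.foldl (sStep N W r) acc).2.length ∧
    gv X (P.foldl (sStep N W r) acc).2 (P.foldl (sStep N W r) acc).1 = gv X acc.2 acc.1 +
      ((P.filter fun p => Compat N r.1 p.1).map fun p => gv X acc.2 p.2 *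
        ∏ x ∈ Finset.range N, if x ∈ vars W then 1 else varOf X (fn p.1 x)).sum := by
  induction P generalizing acc with
  | nil => exact ⟨.refl, by simp, by simp, hacc, by simp⟩
  | cons p P ih =>
    rw [List.foldl_cons]
    by_cases hc : Compat N r.1 p.1
    · obtain ⟨m1, m2, m3, m4⟩ := monom_spec (N := N) W (hP p (by simp)) hok (p.2, acc.2)
        (hg p (by simp))
      have hstep : sStep N W r acc p = ((monom N W p acc.2).2.length,
          (2, (acc.1, (monom N W p acc.2).1)) :: (monom N W p acc.2).2) := by
        rw [sStep, if_pos hc]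
      have hm : monom N W p acc.2 = (List.range N).reverse.foldl (varStep W p.1) (p.2, acc.2) :=
        rfl
      rw [← hm] at m1 m2 m3 m4
      generalize hR : monom N W p acc.2 = R at *
      have hg1 : Grow X ok D acc.2 ((2, (acc.1, R.1)) :: R.2) :=
        .cons _ m1 (Or.inr (Or.inr ⟨Or.inl rfl, hacc.trans_le m1.length_le, m3⟩))
          fun h => by simp at h
      obtain ⟨i1, i2, i3, i4, i5⟩ := ih (fun q hq => hP q (by simp [hq])) (sStep N W r acc p)
        (by rw [hstep]; simp) (fun q hq => by
          rw [hstep]; exact (hg q (by simp [hq])).trans_le hg1.length_le)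
      rw [hstep] at i1 i2 i3 i4 i5
      rw [hstep]
      have hle := m1.length_le
      refine ⟨hg1.trans i1, ?_, ?_, i4, ?_⟩
      · simp only [List.length_cons] at i2 ⊢
        simp only at m2
        nlinarith
      · rw [List.filter_cons_of_pos (by simpa using hc)]
        simp only [List.length_cons] at i3 hle ⊢
        omega
      · rw [i5, List.filter_cons_of_pos (by simpa using hc), List.map_cons, List.sum_cons,
          ← add_assoc]
        congr 1
        · rw [gv_cons_length]
          simp only [gval]
          rw [m4, m1.gv_eq hacc]
          simp
        · congr 1
          refine List.map_congr_left fun q hq => ?_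
          rw [hg1.gv_eq (hg q (by simp [List.mem_of_mem_filter hq]))]
    · have hstep : sStep N W r acc p = acc := by rw [sStep, if_neg hc]
      rw [hstep]
      obtain ⟨i1, i2, i3, i4, i5⟩ := ih (fun q hq => hP q (by simp [hq])) acc hacc
        (fun q hq => hg q (by simp [hq]))
      rw [List.filter_cons_of_neg (by simpa using hc)]
      refine ⟨i1, ?_, i3, i4, i5⟩
      simp only [List.length_cons]
      nlinarith

open Classical in
/-- The value of the sum over the rows of `P` that are compatible with `r`. -/
noncomputable def sumVal (X : ℕ → M) (N : ℕ) (W : List ℕ) (P : List TRow) (G : List GCode)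
    (r : List ℕ) : M :=
  ((P.filter fun p => Compat N r p.1).map fun p => gv X G p.2 *
    ∏ x ∈ Finset.range N, if x ∈ vars W then 1 else varOf X (fn p.1 x)).sum

theorem sumVal_congr {N : ℕ} {W : List ℕ} {P : List TRow} (h : Grow X ok D G G')
    (hg : ∀ p ∈ P, p.2 < G.length) (r : List ℕ) : sumVal X N W P G' r = sumVal X N W P G r := by
  unfold sumVal
  congr 1
  refine List.map_congr_left fun q hq => ?_
  rw [h.gv_eq (hg q (List.mem_of_mem_filter hq))]

/-- Each row needs a constant 0 to start its sum and a final product, which are the two gates beyond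
the sum. The product has the sum as its second factor, so `ok` is required of the sums. Rows are
never dropped, only reversed in order. -/
theorem foldl_sRow_spec {N : ℕ} (W : List ℕ) (hok : ∀ d, ok (X d)) (P : List TRow)
    (hP : ∀ p ∈ P, ∀ x, fn p.1 x ≤ D) (T : List TRow) (acc : List TRow × List GCode)
    (hg : ∀ p ∈ P, p.2 < acc.2.length) (hT : ∀ r ∈ T, r.2 < acc.2.length)
    (hs : ∀ r ∈ T, ok (sumVal X N W P acc.2 r.1)) :
    Grow X ok D acc.2 (T.foldl (sRow N W P) acc).2 ∧
    (T.foldl (sRow N W P) acc).2.length ≤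
      acc.2.length + T.length * (P.length * (2 * N + 1) + 2) ∧
    (∀ r ∈ T, acc.2.length + (P.filter fun p => Compat N r.1 p.1).length ≤
      (T.foldl (sRow N W P) acc).2.length) ∧
    (T.foldl (sRow N W P) acc).1.map Prod.fst = (T.map Prod.fst).reverse ++ acc.1.map Prod.fst ∧
    ∀ q ∈ (T.foldl (sRow N W P) acc).1, q ∈ acc.1 ∨
      q.2 < (T.foldl (sRow N W P) acc).2.length ∧ ∃ r ∈ T, q.1 = r.1 ∧
        gv X (T.foldl (sRow N W P) acc).2 q.2 = gv X acc.2 r.2 * sumVal X N W P acc.2 r.1 := by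
  induction T generalizing acc with
  | nil => exact ⟨.refl, by simp, by simp, by simp, by simp⟩
  | cons r T ih =>
    rw [List.foldl_cons]
    have h0 : Grow X ok D acc.2 ((0, (0, 0)) :: acc.2) :=
      .cons _ .refl (Or.inl rfl) fun h => by simp at h
    obtain ⟨s1, s2, s3, s4, s5⟩ := foldl_sStep_spec (N := N) W r hok P hP
      (acc.2.length, (0, (0, 0)) :: acc.2) (by simp)
      (fun p hp => (hg p hp).trans_le h0.length_le)
    have hsum : sSum N W P r acc.2 = P.foldl (sStep N W r) (acc.2.length, (0, (0, 0)) :: acc.2) :=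
      rfl
    have hstep : sRow N W P acc r = ((r.1, (sSum N W P r acc.2).2.length) :: acc.1,
      (3, (r.2, (sSum N W P r acc.2).1)) :: (sSum N W P r acc.2).2) := rfl
    rw [← hsum] at s1 s2 s3 s4 s5
    generalize sSum N W P r acc.2 = R at *
    have hR : gv X R.2 R.1 = sumVal X N W P acc.2 r.1 := by
      rw [s5]
      simp only [gv_cons_length]
      rw [gval, if_pos rfl, Nat.cast_zero, zero_add]
      exact sumVal_congr h0 hg r.1
    have hgr := h0.trans s1
    have hg1 : Grow X ok D acc.2 ((3, (r.2, R.1)) :: R.2) :=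
      .cons _ hgr (Or.inr (Or.inr ⟨Or.inr rfl, (hT r (by simp)).trans_le hgr.length_le, s4⟩))
        fun _ => by simp only [hR]; exact hs r (by simp)
    obtain ⟨i1, i2, i3, i4, i5⟩ := ih (sRow N W P acc r)
      (fun p hp => by rw [hstep]; exact (hg p hp).trans_le hg1.length_le)
      (fun q hq => by rw [hstep]; exact (hT q (by simp [hq])).trans_le hg1.length_le)
      (fun q hq => by rw [hstep, sumVal_congr hg1 hg]; exact hs q (by simp [hq]))
    rw [hstep] at i1 i2 i3 i4 i5
    rw [hstep]
    have hlt : R.2.length < ((3, (r.2, R.1)) :: R.2 : List GCode).length := by simp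
    refine ⟨hg1.trans i1, ?_, ?_, ?_, ?_⟩
    · simp only [List.length_cons] at i2 s2 ⊢
      nlinarith
    · intro q hq
      rcases List.mem_cons.1 hq with rfl | hq
      · refine le_trans ?_ i1.length_le
        simp only [List.length_cons] at s3 ⊢
        omega
      · refine le_trans ?_ (i3 q hq)
        simpa using hg1.length_le
    · rw [i4]; simp
    · intro q hq
      rcases i5 q hq with h | ⟨h1, r', hr', h2, h3⟩
      · rcases List.mem_cons.1 h with rfl | h
        · right
          refine ⟨hlt.trans_le i1.length_le, r, by simp, rfl, ?_⟩
          rw [i1.gv_eq hlt, gv_cons_length]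
          simp only [gval]
          rw [hR, hgr.gv_eq (hT r (by simp))]
          simp
        · exact Or.inl h
      · right
        refine ⟨h1, r', by simp [hr'], h2, ?_⟩
        rw [h3, hg1.gv_eq (hT r' (by simp [hr'])), sumVal_congr hg1 hg]

end Values

end Alg
end ACQ

namespace ACQ
namespace Alg

/-! ### One round of the algorithm -/

/-- A table whose rows are assignments of its variables, with gates below `n`. -/
structure FacOK (N D n : ℕ) (f : Factor) : Prop where
  patLength : f.2.1.length = N
  proper : Proper N f.2.2
  supp : ∀ r ∈ f.2.2, ∀ x, fn r.1 x ≠ 0 ↔ x ∈ vars f.2.1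
  le : ∀ r ∈ f.2.2, ∀ x, fn r.1 x ≤ D
  gate : ∀ r ∈ f.2.2, r.2 < n

theorem FacOK.mono {N D n n' : ℕ} {f : Factor} (h : FacOK N D n f) (hn : n ≤ n') :
    FacOK N D n' f :=
  ⟨h.patLength, h.proper, h.supp, h.le, fun r hr => (h.gate r hr).trans_le hn⟩

theorem FacOK.lt {N D n : ℕ} {f : Factor} (h : FacOK N D n f) {x : ℕ} (hx : x ∈ vars f.2.1) :
    x < N := by
  by_contra hc
  have h0 := fn_of_le (r := f.2.1) (x := x) (by rw [h.patLength]; omega)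
  have : 1 ≤ fn f.2.1 x := hx
  omega

theorem fn_zeros (N : ℕ) : fn (zeros N) = 0 := by
  rw [zeros, fn_tab]
  funext x
  simp

theorem vars_zeros (N : ℕ) : vars (zeros N) = ∅ := by
  ext x
  simp [vars, fn_zeros]

theorem rows_zeros (N g : ℕ) : rows [(zeros N, g)] = {0} := by
  simp [rows, fn_zeros]

theorem facOK_trivialFactor (N D : ℕ) {n : ℕ} (hn : 0 < n) (a : ℕ) :
    FacOK N D n (trivialFactor N a) := by
  have hr : ∀ r ∈ (trivialFactor N a).2.2, r = (zeros N, 0) := by simp [trivialFactor]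
  refine ⟨length_tab _ _, ⟨?_, by simp [trivialFactor]⟩, ?_, ?_, ?_⟩ <;> intro r h <;>
    rw [hr r h]
  · exact length_tab _ _
  · simp [fn_zeros, vars_zeros, trivialFactor]
  · simp [fn_zeros]
  · exact hn

theorem length_replace (N : ℕ) (fs : List Factor) (i j : ℕ) (f : Factor) :
    (replace N fs i j f).length = fs.length := length_tab _ _

theorem fac_replace (N : ℕ) (fs : List Factor) (i j : ℕ) (f : Factor) {l : ℕ}
    (hl : l < fs.length) : fac (replace N fs i j f) l =
      if l = i then trivialFactor N 0 else if l = j then f else fac fs l := by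
  rw [fac, replace, getD_tab, if_pos hl]

theorem vars_joinRow {N : ℕ} {fr r s : List ℕ} (hr : r.length = N) (hs : s.length = N) :
    vars (joinRow N fr r s) = vars r ∪ (vars s ∩ vars fr) := by
  classical
  ext x
  simp only [vars, fn_joinRow hr hs, Set.mem_ofPred_eq, joinFn_apply, Set.mem_union,
    Set.mem_inter_iff, Set.indicator_apply]
  split_ifs with h1 h2 <;> grind

/-- Together with the next lemma: the free part of a joined row determines the free parts of the two
rows it came from. So the weight of a joined row is again a function of its free part. -/
theorem indicator_joinFn_left {r s : ℕ → ℕ} {W S : Set ℕ} (hr : ∀ x, r x ≠ 0 ↔ x ∈ W) :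
    W.indicator (S.indicator (joinFn r (S.indicator s))) = S.indicator r := by
  classical
  funext x
  have := hr x
  simp only [Set.indicator_apply, joinFn_apply]
  split_ifs <;> grind

theorem indicator_joinFn_right {r s : ℕ → ℕ} {W S : Set ℕ} (hs : ∀ x, s x ≠ 0 ↔ x ∈ W)
    (hc : CompatFn r s) :
    W.indicator (S.indicator (joinFn r (S.indicator s))) = S.indicator s := by
  classical
  funext x
  have h1 := hs x
  have h2 := hc x
  simp only [Set.indicator_apply, joinFn_apply]
  split_ifs <;> grind

/-- The family of tables, with given weights. -/
noncomputable def tables {M : Type*} (fs : List Factor) (ω : ℕ → (ℕ → ℕ) → M) : Tables M :=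
  ⟨fun l => vars (fac fs l).2.1, fun l => rows (fac fs l).2.2, ω⟩

theorem valid_tables {M : Type*} {fs : List Factor} {N D n : ℕ} (ω : ℕ → (ℕ → ℕ) → M)
    (h : ∀ l < fs.length, FacOK N D n (fac fs l)) :
    (tables fs ω).Valid N D (Finset.range fs.length) := by
  intro l hl
  have hl := h l (Finset.mem_range.1 hl)
  refine ⟨fun x hx => hl.lt hx, fun r hr => ?_⟩
  obtain ⟨q, hq, rfl⟩ := mem_rows.1 hr
  exact ⟨hl.supp q hq, hl.le q hq⟩

variable {M : Type*} [CommSemiring M] {X : ℕ → M} {ok : M → Prop} {N D : ℕ} {fr : List ℕ}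
  {G : List GCode}

theorem facOK_qMerge {fi fj : Factor} (hi : FacOK N D G.length fi) (hj : FacOK N D G.length fj)
    (a : ℕ) : FacOK N D (qMerge N fr fi.2.2 fj.2.2 G).2.length
      (a, (joinRow N fr fj.2.1 fi.2.1, (qMerge N fr fi.2.2 fj.2.2 G).1)) := by
  -- Only the rows and the positions of gates are of interest, not the values, so any semiring and
  -- any `X` will do.
  obtain ⟨-, -, h3, -, h5⟩ := qMerge_spec (X := fun _ => (0 : ℕ)) (ok := fun _ => True)
    (D := D) (N := N) (fr := fr) (fun s hs => ⟨hi.gate s hs, trivial⟩) hj.gate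
  have key : ∀ q ∈ (qMerge N fr fi.2.2 fj.2.2 G).1, ∀ x,
      (fn q.1 x ≠ 0 ↔ x ∈ vars (joinRow N fr fj.2.1 fi.2.1)) ∧ fn q.1 x ≤ D := by
    classical
    intro q hq x
    obtain ⟨_, r, hr, s, hs, -, hq1, -⟩ := h5 q hq
    have hrx := hj.supp r hr x
    have hsx := hi.supp s hs x
    have hrD := hj.le r hr x
    have hsD := hi.le s hs x
    rw [hq1, fn_joinRow (hj.proper.1 r hr) (hi.proper.1 s hs), joinFn_apply,
      vars_joinRow hj.patLength hi.patLength]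
    by_cases hx : x ∈ vars fr
    · rw [Set.indicator_of_mem hx]
      by_cases h0 : fn r.1 x = 0
      · have : x ∉ vars fj.2.1 := fun h => hrx.2 h h0
        rw [if_pos h0, Set.mem_union, Set.mem_inter_iff]
        exact ⟨by tauto, hsD⟩
      · rw [if_neg h0, Set.mem_union]
        exact ⟨iff_of_true h0 (Or.inl (hrx.1 h0)), hrD⟩
    · rw [Set.indicator_of_notMem hx]
      by_cases h0 : fn r.1 x = 0
      · have : x ∉ vars fj.2.1 := fun h => hrx.2 h h0
        rw [if_pos h0, Set.mem_union, Set.mem_inter_iff]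
        exact ⟨by tauto, by omega⟩
      · rw [if_neg h0, Set.mem_union]
        exact ⟨iff_of_true h0 (Or.inl (hrx.1 h0)), hrD⟩
  exact ⟨length_joinRow .., h3, fun q hq x => (key q hq x).1, fun q hq x => (key q hq x).2,
    fun q hq => (h5 q hq).1⟩

theorem proj_le {fi : Factor} (hi : FacOK N D G.length fi) :
    ∀ p ∈ proj N fr fi.2.2, ∀ x, fn p.1 x ≤ D := by
  classical
  intro p hp x
  obtain ⟨s, hs, rfl⟩ := (proj_spec N fr fi.2.2).2.2.2 p hp
  simp only
  rw [fn_mask (hi.proper.1 s hs), Set.indicator_apply]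
  split_ifs
  · exact hi.le s hs x
  · exact Nat.zero_le _

theorem proj_gate {fi : Factor} (hi : FacOK N D G.length fi) :
    ∀ p ∈ proj N fr fi.2.2, p.2 < G.length := by
  intro p hp
  obtain ⟨s, hs, rfl⟩ := (proj_spec N fr fi.2.2).2.2.2 p hp
  exact hi.gate s hs

theorem sMerge_spec {fi fj : Factor} (hok : ∀ d, ok (X d)) (hi : FacOK N D G.length fi)
    (hj : FacOK N D G.length fj)
    (hs : ∀ r ∈ fj.2.2, ok (sumVal X N fj.2.1 (proj N fr fi.2.2) G r.1)) :
    Grow X ok D G (sMerge N fr fj.2.1 fi.2.2 fj.2.2 G).2 ∧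
    (sMerge N fr fj.2.1 fi.2.2 fj.2.2 G).2.length ≤
      G.length + fj.2.2.length * (fi.2.2.length * (2 * N + 1) + 2) ∧
    (∀ r ∈ fj.2.2, G.length + ((proj N fr fi.2.2).filter fun p => Compat N r.1 p.1).length ≤
      (sMerge N fr fj.2.1 fi.2.2 fj.2.2 G).2.length) ∧
    (sMerge N fr fj.2.1 fi.2.2 fj.2.2 G).1.map Prod.fst = (fj.2.2.map Prod.fst).reverse ∧
    ∀ q ∈ (sMerge N fr fj.2.1 fi.2.2 fj.2.2 G).1,
      q.2 < (sMerge N fr fj.2.1 fi.2.2 fj.2.2 G).2.length ∧ ∃ r ∈ fj.2.2, q.1 = r.1 ∧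
        gv X (sMerge N fr fj.2.1 fi.2.2 fj.2.2 G).2 q.2 =
          gv X G r.2 * sumVal X N fj.2.1 (proj N fr fi.2.2) G r.1 := by
  obtain ⟨h1, h2, h3, h4, h5⟩ := foldl_sRow_spec (X := X) (ok := ok) (D := D) (N := N) fj.2.1 hok
    (proj N fr fi.2.2) (proj_le hi) fj.2.2 ([], G) (proj_gate hi) hj.gate hs
  refine ⟨h1, h2.trans ?_, h3, h4.trans (by simp), ?_⟩
  · have := (proj_spec N fr fi.2.2).2.1
    simp only
    gcongr
  · intro q hq
    exact (h5 q hq).resolve_left (by simp)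

theorem facOK_sMerge {fi fj : Factor} (hi : FacOK N D G.length fi) (hj : FacOK N D G.length fj)
    (a : ℕ) : FacOK N D (sMerge N fr fj.2.1 fi.2.2 fj.2.2 G).2.length
      (a, (fj.2.1, (sMerge N fr fj.2.1 fi.2.2 fj.2.2 G).1)) := by
  obtain ⟨-, -, -, h4, h5⟩ := sMerge_spec (X := fun _ => (0 : ℕ)) (ok := fun _ => True) (fr := fr)
    (fun _ => trivial) hi hj (fun _ _ => trivial)
  refine ⟨hj.patLength, ⟨?_, ?_⟩, ?_, ?_, fun q hq => (h5 q hq).1⟩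
  · intro q hq
    obtain ⟨_, r, hr, hq1, -⟩ := h5 q hq
    rw [hq1]; exact hj.proper.1 r hr
  · simp only
    rw [h4, List.nodup_reverse]
    exact hj.proper.2
  · intro q hq
    obtain ⟨_, r, hr, hq1, -⟩ := h5 q hq
    rw [hq1]; exact hj.supp r hr
  · intro q hq
    obtain ⟨_, r, hr, hq1, -⟩ := h5 q hq
    rw [hq1]; exact hj.le r hr

theorem rows_sMerge {fi fj : Factor} (hi : FacOK N D G.length fi) (hj : FacOK N D G.length fj) :
    rows (sMerge N fr fj.2.1 fi.2.2 fj.2.2 G).1 = rows fj.2.2 := by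
  obtain ⟨-, -, -, h4, -⟩ := sMerge_spec (X := fun _ => (0 : ℕ)) (ok := fun _ => True) (fr := fr)
    (fun _ => trivial) hi hj (fun _ _ => trivial)
  ext f
  have e : ∀ T : List TRow, f ∈ rows T ↔ ∃ r ∈ T.map Prod.fst, fn r = f := by
    intro T
    rw [mem_rows]
    simp
  rw [e, e, h4]
  simp

theorem facOK_replace {fs : List Factor} (h : ∀ l < fs.length, FacOK N D G.length (fac fs l))
    {n : ℕ} (hn : G.length ≤ n) (hn0 : 0 < n) (i j : ℕ) {f : Factor} (hf : FacOK N D n f) :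
    ∀ l < (replace N fs i j f).length, FacOK N D n (fac (replace N fs i j f) l) := by
  intro l hl
  rw [length_replace] at hl
  rw [fac_replace N fs i j f hl]
  split_ifs
  · exact facOK_trivialFactor N D hn0 0
  · exact hf
  · exact (h l hl).mono hn

/-- The gates of the rows have the values given by the weights. -/
def HasWeights (X : ℕ → M) (fr : List ℕ) (fs : List Factor) (G : List GCode)
    (ω : ℕ → (ℕ → ℕ) → M) : Prop :=
  ∀ l < fs.length, ∀ r ∈ (fac fs l).2.2, gv X G r.2 = ω l ((vars fr).indicator (fn r.1))

/-- Appended gates do not alter earlier values, so the untouched tables keep their weights. The row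
of the trivial table points to gate 0, the constant 1. Only the new table at `j` has to be checked.
-/
theorem hasWeights_replace {fs : List Factor} {ω ω' : ℕ → (ℕ → ℕ) → M}
    (hF : ∀ l < fs.length, FacOK N D G.length (fac fs l)) {G' : List GCode}
    (hω : HasWeights X fr fs G ω) (hG : Grow X ok D G G') (hG0 : 0 < G.length)
    (hG1 : gv X G 0 = 1) {i j : ℕ} {f : Factor} (hωi : ω' i = fun _ => 1)
    (hωl : ∀ l, l ≠ i → l ≠ j → ω' l = ω l)
    (hf : ∀ q ∈ f.2.2, gv X G' q.2 = ω' j ((vars fr).indicator (fn q.1))) :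
    HasWeights X fr (replace N fs i j f) G' ω' := by
  intro l hl r hr
  rw [length_replace] at hl
  rw [fac_replace N fs i j f hl] at hr
  by_cases h1 : l = i
  · rw [if_pos h1] at hr
    obtain rfl : r = (zeros N, 0) := by simpa [trivialFactor] using hr
    rw [h1, hωi, hG.gv_eq hG0, hG1]
  · rw [if_neg h1] at hr
    by_cases h2 : l = j
    · rw [if_pos h2] at hr
      rw [h2]
      exact hf r hr
    · rw [if_neg h2] at hr
      rw [hωl l h1 h2, hG.gv_eq ((hF l hl).gate r hr)]
      exact hω l hl r hr

theorem qMerge_joinInto {fs : List Factor} {ω : ℕ → (ℕ → ℕ) → M}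
    (hF : ∀ l < fs.length, FacOK N D G.length (fac fs l)) (hω : HasWeights X fr fs G ω)
    (hG0 : 0 < G.length) (hG1 : gv X G 0 = 1) {i j : ℕ} (hi : i < fs.length) (hj : j < fs.length)
    (hij : i ≠ j) (a : ℕ) :
    ∃ ω', (tables fs ω).JoinInto (vars fr) (Finset.range fs.length)
      (tables (replace N fs i j (a, (joinRow N fr (fac fs j).2.1 (fac fs i).2.1,
        (qMerge N fr (fac fs i).2.2 (fac fs j).2.2 G).1))) ω') i j ∧
      HasWeights X fr (replace N fs i j (a, (joinRow N fr (fac fs j).2.1 (fac fs i).2.1,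
        (qMerge N fr (fac fs i).2.2 (fac fs j).2.2 G).1)))
        (qMerge N fr (fac fs i).2.2 (fac fs j).2.2 G).2 ω' := by
  classical
  have Hi := hF i hi
  have Hj := hF j hj
  obtain ⟨h1, -, -, h4, h5⟩ := qMerge_spec (X := X) (ok := fun _ => True)
    (D := D) (N := N) (fr := fr) (fun s hs => ⟨Hi.gate s hs, trivial⟩) Hj.gate
  have hfi : ∀ f, fac (replace N fs i j f) i = trivialFactor N 0 := fun f => by
    rw [fac_replace N fs i j f hi, if_pos rfl]
  have hfj : ∀ f, fac (replace N fs i j f) j = f := fun f => by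
    rw [fac_replace N fs i j f hj, if_neg hij.symm, if_pos rfl]
  have hfl : ∀ f, ∀ l ∈ Finset.range fs.length, l ≠ i → l ≠ j →
      fac (replace N fs i j f) l = fac fs l := fun f l hl h1 h2 => by
    rw [fac_replace N fs i j f (Finset.mem_range.1 hl), if_neg h1, if_neg h2]
  refine ⟨fun l => if l = i then fun _ => 1 else if l = j then fun a =>
    ω j ((vars (fac fs j).2.1).indicator a) * ω i ((vars (fac fs i).2.1).indicator a) else ω l,
    ⟨?_, ?_, ?_, ?_, ?_, ?_, ?_, ?_, ?_⟩, ?_⟩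
  · intro l hl h1 h2
    simp only [tables, hfl _ l hl h1 h2]
  · intro l hl h1 h2
    simp only [tables, hfl _ l hl h1 h2]
  · intro l hl h1 h2
    simp only [tables, if_neg h1, if_neg h2]
  · simp only [tables, hfi]; exact vars_zeros N
  · simp only [tables, hfi]; exact rows_zeros N 0
  · simp only [tables, if_pos]
  · simp only [tables, hfj]; exact vars_joinRow Hj.patLength Hi.patLength
  · intro f
    simp only [tables, hfj]
    rw [h4]
    constructor
    · rintro ⟨r, hr, s, hs, hc, rfl⟩
      refine ⟨_, fn_mem_rows hr, _, fn_mem_rows hs, (compat_iff (Hj.proper.1 r hr)).1 hc, ?_⟩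
      rw [fn_joinRow (Hj.proper.1 r hr) (Hi.proper.1 s hs)]
    · rintro ⟨r', hr', s', hs', hc, rfl⟩
      obtain ⟨r, hr, rfl⟩ := mem_rows.1 hr'
      obtain ⟨s, hs, rfl⟩ := mem_rows.1 hs'
      exact ⟨r, hr, s, hs, (compat_iff (Hj.proper.1 r hr)).2 hc,
        fn_joinRow (Hj.proper.1 r hr) (Hi.proper.1 s hs)⟩
  · intro a
    simp only [tables, if_neg hij.symm, if_pos]
  · refine hasWeights_replace hF hω h1 hG0 hG1 (by simp) (fun l h1 h2 => by simp [h1, h2]) ?_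
    intro q hq
    obtain ⟨_, r, hr, s, hs, hc, hq1, hq2⟩ := h5 q hq
    simp only [if_neg hij.symm, if_pos]
    rw [hq2, hω j hj r hr, hω i hi s hs, hq1, fn_joinRow (Hj.proper.1 r hr) (Hi.proper.1 s hs)]
    have hc' := (compat_iff (Hj.proper.1 r hr)).1 hc
    have hrx := Hj.supp r hr
    have hsx := Hi.supp s hs
    rw [indicator_joinFn_left hrx, indicator_joinFn_right hsx hc']

/-- The projected list has no repetitions, so the sum over the list is a sum over the set of
projected rows. Compatibility of the whole row `r` with a projected row is compatibility of its free
part, as the projected row is 0 elsewhere. -/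
theorem sumVal_eq {fi : Factor} (W : List ℕ) (hi : FacOK N D G.length fi)
    {ωi : (ℕ → ℕ) → M} (hω : ∀ r ∈ fi.2.2, gv X G r.2 = ωi ((vars fr).indicator (fn r.1)))
    {r : List ℕ} (hr : r.length = N) [DecidablePred (CompatFn ((vars fr).indicator (fn r)))]
    [DecidableEq (ℕ → ℕ)] [DecidablePred (· ∈ vars W)] :
    sumVal X N W (proj N fr fi.2.2) G r =
      ∑ s ∈ ((rows fi.2.2).image (vars fr).indicator).filter
        (CompatFn ((vars fr).indicator (fn r))),
        ωi s * ∏ x ∈ Finset.range N, if x ∈ vars W then 1 else varOf X (s x) := by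
  classical
  obtain ⟨p1, -, p3, p4⟩ := proj_spec N fr fi.2.2
  have hcomp : ∀ p ∈ proj N fr fi.2.2,
      Compat N r p.1 ↔ CompatFn ((vars fr).indicator (fn r)) (fn p.1) := by
    intro p hp
    obtain ⟨s, hs, rfl⟩ := p4 p hp
    rw [compat_iff hr]
    simp only
    rw [fn_mask (hi.proper.1 s hs)]
    refine forall_congr' fun x => ?_
    by_cases hx : x ∈ vars fr <;> simp [hx]
  have hset : ((rows fi.2.2).image (vars fr).indicator).filter
      (CompatFn ((vars fr).indicator (fn r))) =
      (((proj N fr fi.2.2).filter fun p => Compat N r p.1).map fun p => fn p.1).toFinset := by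
    ext f
    rw [Finset.mem_filter, Finset.mem_image, List.mem_toFinset, List.mem_map]
    have : (∃ a ∈ rows fi.2.2, (vars fr).indicator a = f) ↔ f ∈ rows (proj N fr fi.2.2) := by
      rw [p3]
      constructor
      · rintro ⟨a, ha, rfl⟩
        obtain ⟨s, hs, rfl⟩ := mem_rows.1 ha
        exact ⟨s, hs, fn_mask (hi.proper.1 s hs)⟩
      · rintro ⟨s, hs, rfl⟩
        exact ⟨_, fn_mem_rows hs, (fn_mask (hi.proper.1 s hs)).symm⟩
    rw [this, mem_rows]
    constructor
    · rintro ⟨⟨p, hp, rfl⟩, hc⟩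
      exact ⟨p, List.mem_filter.2 ⟨hp, by simpa using (hcomp p hp).2 hc⟩, rfl⟩
    · rintro ⟨p, hp, rfl⟩
      obtain ⟨hp, hc⟩ := List.mem_filter.1 hp
      exact ⟨⟨p, hp, rfl⟩, (hcomp p hp).1 (by simpa using hc)⟩
  have hnd : (((proj N fr fi.2.2).filter fun p => Compat N r p.1).map fun p => fn p.1).Nodup :=
    p1.nodup_fn.sublist (List.filter_sublist.map _)
  rw [hset, List.sum_toFinset _ hnd, sumVal, List.map_map]
  congr 1
  refine List.map_congr_left fun p hp => ?_
  obtain ⟨s, hs, rfl⟩ := p4 p (List.mem_of_mem_filter hp)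
  simp only [Function.comp]
  rw [hω s hs, fn_mask (hi.proper.1 s hs)]

theorem sMerge_sumInto {fs : List Factor} {ω : ℕ → (ℕ → ℕ) → M}
    (hF : ∀ l < fs.length, FacOK N D G.length (fac fs l)) (hω : HasWeights X fr fs G ω)
    (hG0 : 0 < G.length) (hG1 : gv X G 0 = 1) {i j : ℕ} (hi : i < fs.length) (hj : j < fs.length)
    (hij : i ≠ j) (a : ℕ) :
    ∃ ω', (tables fs ω).SumInto N (vars fr) (Finset.range fs.length) X
      (tables (replace N fs i j (a, ((fac fs j).2.1,
        (sMerge N fr (fac fs j).2.1 (fac fs i).2.2 (fac fs j).2.2 G).1))) ω') i j ∧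
      HasWeights X fr (replace N fs i j (a, ((fac fs j).2.1,
        (sMerge N fr (fac fs j).2.1 (fac fs i).2.2 (fac fs j).2.2 G).1)))
        (sMerge N fr (fac fs j).2.1 (fac fs i).2.2 (fac fs j).2.2 G).2 ω' := by
  classical
  have Hi := hF i hi
  have Hj := hF j hj
  obtain ⟨h1, -, -, -, h5⟩ := sMerge_spec (X := X) (ok := fun _ => True) (fr := fr)
    (fun _ => trivial) Hi Hj (fun _ _ => trivial)
  have hfi : ∀ f, fac (replace N fs i j f) i = trivialFactor N 0 := fun f => by
    rw [fac_replace N fs i j f hi, if_pos rfl]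
  have hfj : ∀ f, fac (replace N fs i j f) j = f := fun f => by
    rw [fac_replace N fs i j f hj, if_neg hij.symm, if_pos rfl]
  have hfl : ∀ f, ∀ l ∈ Finset.range fs.length, l ≠ i → l ≠ j →
      fac (replace N fs i j f) l = fac fs l := fun f l hl h1 h2 => by
    rw [fac_replace N fs i j f (Finset.mem_range.1 hl), if_neg h1, if_neg h2]
  refine ⟨fun l => if l = i then fun _ => 1 else if l = j then fun a => ω j a *
    ∑ s ∈ ((rows (fac fs i).2.2).image (vars fr).indicator).filter (CompatFn a),
      ω i s * ∏ x ∈ Finset.range N, if x ∈ vars (fac fs j).2.1 then 1 else varOf X (s x)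
    else ω l, ⟨?_, ?_, ?_, ?_, ?_, ?_, ?_⟩, ?_⟩
  · intro l hl h1
    by_cases h2 : l = j
    · subst h2; simp only [tables, hfj]
    · simp only [tables, hfl _ l hl h1 h2]
  · intro l hl h1
    by_cases h2 : l = j
    · subst h2; simp only [tables, hfj]; exact rows_sMerge Hi Hj
    · simp only [tables, hfl _ l hl h1 h2]
  · intro l hl h1 h2
    simp only [tables, if_neg h1, if_neg h2]
  · simp only [tables, hfi]; exact vars_zeros N
  · simp only [tables, hfi]; exact rows_zeros N 0
  · simp only [tables, if_pos]
  · intro a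
    simp only [tables, if_neg hij.symm, if_pos]
    congr!
  · refine hasWeights_replace hF hω h1 hG0 hG1 (by simp) (fun l h1 h2 => by simp [h1, h2]) ?_
    intro q hq
    obtain ⟨_, r, hr, hq1, hq2⟩ := h5 q hq
    simp only [if_neg hij.symm, if_pos]
    rw [hq2, hω j hj r hr, sumVal_eq (fr := fr) _ Hi (hω i hi) (Hj.proper.1 r hr), hq1]

end Alg
end ACQ

namespace ACQ
namespace Alg

/-! ### The tables that remain -/

/-- The variables of a table. -/
def W (fs : List Factor) (l : ℕ) : Set ℕ := vars (fac fs l).2.1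

/-- The tables that are neither merged nor the first one. -/
def act (fs : List Factor) : Finset ℕ := (Finset.range fs.length).filter fun l => (fac fs l).1 = 1

/-- The table `i` may be merged into the table `j`. -/
structure Picked (fs : List Factor) (i j : ℕ) : Prop where
  hi : i < fs.length
  hj : j < fs.length
  ne : i ≠ j
  statusi : (fac fs i).1 = 1
  statusj : 1 ≤ (fac fs j).1
  ear : ∀ x ∈ W fs i, x ∈ W fs j ∨ ∀ l < fs.length, l ≠ i → x ∉ W fs l

/-- The state of the elimination: the first table has no variables and one row, and the tables that
remain form a reducible family. -/
structure Ctl (N : ℕ) (fs : List Factor) : Prop where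
  pos : 0 < fs.length
  status_zero : (fac fs 0).1 = 2
  W_zero : W fs 0 = ∅
  rows_zero : (fac fs 0).2.2.map Prod.fst = [zeros N]
  status : ∀ l < fs.length, l ≠ 0 → (fac fs l).1 = 1 ∨ fac fs l = trivialFactor N 0
  red : Red (W fs) (act fs)

theorem Ctl.W_eq_empty {N : ℕ} {fs : List Factor} (h : Ctl N fs) {l : ℕ} (hl : l < fs.length)
    (hA : l ∉ act fs) : W fs l = ∅ := by
  by_cases h0 : l = 0
  · rw [h0]; exact h.W_zero
  · rcases h.status l hl h0 with h1 | h1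
    · exact absurd (Finset.mem_filter.2 ⟨Finset.mem_range.2 hl, h1⟩) hA
    · rw [W, h1]; exact vars_zeros N

theorem good_iff {N D n : ℕ} {fs : List Factor} (hF : ∀ l < fs.length, FacOK N D n (fac fs l))
    {i j : ℕ} (hi : i < fs.length) (hj : j < fs.length) : Good N fs i j ↔ Picked fs i j := by
  have hpat : ∀ l x, (pat fs l x = 0 ↔ x ∉ W fs l) ∧ (1 ≤ pat fs l x ↔ x ∈ W fs l) := by
    intro l x
    have : 1 ≤ pat fs l x ↔ x ∈ W fs l := Iff.rfl
    refine ⟨?_, this⟩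
    rw [← this]
    omega
  constructor
  · rintro ⟨⟨h1, h2⟩, h3, h4, h5⟩
    refine ⟨hi, hj, h4, le_antisymm h2 h1, h3, ?_⟩
    intro x hx
    rcases h5 x ((hF i hi).lt hx) with h | h | h
    · exact absurd hx ((hpat i x).1.1 h)
    · exact Or.inl ((hpat j x).2.1 h)
    · right
      intro l hl hli
      exact (hpat l x).1.1 ((h l hl).resolve_left hli)
  · intro h
    refine ⟨⟨h.statusi.ge, h.statusi.le⟩, h.statusj, h.ne, ?_⟩
    intro x _
    by_cases hx : x ∈ W fs i
    · right
      rcases h.ear x hx with h | h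
      · exact Or.inl ((hpat j x).2.2 h)
      · right
        intro l hl
        by_cases hli : l = i
        · exact Or.inl hli
        · exact Or.inr ((hpat l x).1.2 (h l hl hli))
    · exact Or.inl ((hpat i x).1.2 hx)

theorem foldl_select {α : Type*} (P : α → Prop) [DecidablePred P] (l : List α) (a : α) :
    (l.foldl (fun acc p => if P p then p else acc) a ∈ l ∧
      P (l.foldl (fun acc p => if P p then p else acc) a)) ∨ ∀ p ∈ l, ¬ P p := by
  induction l using List.reverseRecOn with
  | nil => simp
  | append_singleton l q ih =>
    rw [List.foldl_append]
    by_cases hq : P q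
    · left
      simp [hq]
    · rcases ih with ⟨h1, h2⟩ | h
      · left
        simp only [List.foldl_cons, List.foldl_nil, if_neg hq]
        exact ⟨List.mem_append_left _ h1, h2⟩
      · right
        intro p hp
        rcases List.mem_append.1 hp with h' | h'
        · exact h p h'
        · rw [List.mem_singleton.1 h']; exact hq

theorem pick_spec (N : ℕ) (fs : List Factor)
    (h : ∃ i < fs.length, ∃ j < fs.length, Good N fs i j) :
    (pick N fs).1 < fs.length ∧ (pick N fs).2 < fs.length ∧
      Good N fs (pick N fs).1 (pick N fs).2 := by
  have e : pick N fs = ((List.range fs.length).reverse.flatMap fun i =>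
      (List.range fs.length).reverse.map fun j => (i, j)).foldl
      (fun acc p => if Good N fs p.1 p.2 then p else acc) (0, 0) := by
    simp only [pick, List.foldl_flatMap, List.foldl_map]
  rcases foldl_select (fun p : ℕ × ℕ => Good N fs p.1 p.2)
    ((List.range fs.length).reverse.flatMap fun i =>
      (List.range fs.length).reverse.map fun j => (i, j)) (0, 0) with ⟨h1, h2⟩ | h'
  · rw [← e] at h1 h2
    simp only [List.mem_flatMap, List.mem_map, List.mem_reverse, List.mem_range] at h1
    obtain ⟨i, hi, j, hj, hij⟩ := h1
    rw [← hij] at h2 ⊢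
    exact ⟨hi, hj, h2⟩
  · obtain ⟨i, hi, j, hj, hg⟩ := h
    refine absurd hg (h' (i, j) ?_)
    simp only [List.mem_flatMap, List.mem_map, List.mem_reverse, List.mem_range]
    exact ⟨i, hi, j, hj, rfl⟩

/-- With at least two tables left, reducibility supplies an ear; the merged tables and table 0 have
no variables and do not interfere. A single remaining table shares no variable with any other and
can be merged into table 0. -/
theorem Ctl.exists_picked {N : ℕ} {fs : List Factor} (h : Ctl N fs) (hA : (act fs).Nonempty) :
    ∃ i j, Picked fs i j := by
  by_cases h2 : 2 ≤ (act fs).card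
  · obtain ⟨i, hi, j, hj, hji, hl⟩ := h.red.exists_ear h2
    have hi' := Finset.mem_filter.1 hi
    have hj' := Finset.mem_filter.1 hj
    refine ⟨i, j, Finset.mem_range.1 hi'.1, Finset.mem_range.1 hj'.1, hji.symm, hi'.2, hj'.2.ge,
      ?_⟩
    intro x hx
    by_cases hxj : x ∈ W fs j
    · exact Or.inl hxj
    · right
      intro l hl' hli hxl
      by_cases hlA : l ∈ act fs
      · exact hxj (hl l hlA hli ⟨hx, hxl⟩)
      · rw [h.W_eq_empty hl' hlA] at hxl
        exact hxl
  · obtain ⟨i, hi⟩ := hA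
    have hi' := Finset.mem_filter.1 hi
    refine ⟨i, 0, Finset.mem_range.1 hi'.1, h.pos, ?_, hi'.2, by rw [h.status_zero]; omega, ?_⟩
    · rintro rfl
      rw [h.status_zero] at hi'
      omega
    · intro x hx
      right
      intro l hl hli hxl
      have hlA : l ∉ act fs := by
        intro hlA
        have : 1 < (act fs).card := Finset.one_lt_card.2 ⟨l, hlA, i, hi, hli⟩
        omega
      rw [h.W_eq_empty hl hlA] at hxl
      exact hxl

theorem linked_iff {N D n : ℕ} {fr : List ℕ} {fi fj : Factor} (hi : FacOK N D n fi) :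
    Linked N fr fi.2.1 fj.2.1 ↔ ∃ x ∈ vars fi.2.1 ∩ vars fj.2.1, x ∉ vars fr := by
  constructor
  · rintro ⟨x, _, h1, h2, h3⟩
    refine ⟨x, ⟨h1, h2⟩, fun h : 1 ≤ fn fr x => ?_⟩
    rw [getD_eq_fn] at h3
    omega
  · rintro ⟨x, ⟨h1, h2⟩, h3⟩
    refine ⟨x, hi.lt h1, h1, h2, ?_⟩
    have : ¬ 1 ≤ fn fr x := h3
    rw [getD_eq_fn]
    omega

/-- The result of joining the table `i` to the table `j`. -/
def joinState (N : ℕ) (fr : List ℕ) (fs : List Factor) (G : List GCode) (i j : ℕ) :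
    List Factor × List GCode :=
  (replace N fs i j ((fac fs j).1, (joinRow N fr (fac fs j).2.1 (fac fs i).2.1,
    (qMerge N fr (fac fs i).2.2 (fac fs j).2.2 G).1)),
    (qMerge N fr (fac fs i).2.2 (fac fs j).2.2 G).2)

/-- The result of summing out the table `i` over the table `j`. -/
def sumState (N : ℕ) (fr : List ℕ) (fs : List Factor) (G : List GCode) (i j : ℕ) :
    List Factor × List GCode :=
  (replace N fs i j ((fac fs j).1, ((fac fs j).2.1,
    (sMerge N fr (fac fs j).2.1 (fac fs i).2.2 (fac fs j).2.2 G).1)),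
    (sMerge N fr (fac fs j).2.1 (fac fs i).2.2 (fac fs j).2.2 G).2)

/-- All invariants of a round are derived from this description. It does not matter which pair the
search finds, only that the pair is admissible and that the join is used exactly when a quantified
variable is shared. -/
theorem step_cases {N D : ℕ} {fr : List ℕ} {fs : List Factor} {G : List GCode}
    (hF : ∀ l < fs.length, FacOK N D G.length (fac fs l)) (hC : Ctl N fs)
    (hA : (act fs).Nonempty) : ∃ i j, Picked fs i j ∧
      ((∃ x ∈ W fs i ∩ W fs j, x ∉ vars fr) ∧ step N fr (fs, G) = joinState N fr fs G i j ∨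
        W fs i ∩ W fs j ⊆ vars fr ∧ step N fr (fs, G) = sumState N fr fs G i j) := by
  obtain ⟨i₀, j₀, h₀⟩ := hC.exists_picked hA
  obtain ⟨hi, hj, hg⟩ := pick_spec N fs ⟨i₀, h₀.hi, j₀, h₀.hj, (good_iff hF h₀.hi h₀.hj).2 h₀⟩
  refine ⟨(pick N fs).1, (pick N fs).2, (good_iff hF hi hj).1 hg, ?_⟩
  unfold step
  simp only
  generalize (pick N fs).1 = i at *
  generalize (pick N fs).2 = j at *
  have hl := linked_iff (fr := fr) (fj := fac fs j) (hF i hi)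
  unfold merge
  by_cases h : Linked N fr (fac fs i).2.1 (fac fs j).2.1
  · left
    exact ⟨hl.1 h, by rw [if_pos h]; rfl⟩
  · right
    refine ⟨fun x hx => ?_, by rw [if_neg h]; rfl⟩
    by_contra hc
    exact h (hl.2 ⟨x, hx, hc⟩)

theorem W_replace {N : ℕ} {fs : List Factor} {i j : ℕ} {f : Factor} (h : Picked fs i j) :
    W (replace N fs i j f) i = ∅ ∧ W (replace N fs i j f) j = vars f.2.1 ∧
      ∀ l < fs.length, l ≠ i → l ≠ j → W (replace N fs i j f) l = W fs l := by
  refine ⟨?_, ?_, fun l hl h1 h2 => ?_⟩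
  · rw [W, fac_replace N fs i j f h.hi, if_pos rfl]
    exact vars_zeros N
  · rw [W, fac_replace N fs i j f h.hj, if_neg h.ne.symm, if_pos rfl]
  · rw [W, fac_replace N fs i j f hl, if_neg h1, if_neg h2]
    rfl

theorem act_replace {N : ℕ} {fs : List Factor} {i j : ℕ} {f : Factor} (h : Picked fs i j)
    (hf : f.1 = (fac fs j).1) : act (replace N fs i j f) = (act fs).erase i := by
  ext l
  simp only [act, Finset.mem_filter, Finset.mem_range, Finset.mem_erase, length_replace]
  constructor
  · rintro ⟨hl, h1⟩
    rw [fac_replace N fs i j f hl] at h1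
    split_ifs at h1 with h2 h3
    · simp [trivialFactor] at h1
    · subst h3; exact ⟨h2, hl, by rw [← hf]; exact h1⟩
    · exact ⟨h2, hl, h1⟩
  · rintro ⟨h2, hl, h1⟩
    refine ⟨hl, ?_⟩
    rw [fac_replace N fs i j f hl, if_neg h2]
    split_ifs with h3
    · subst h3; rw [hf]; exact h1
    · exact h1

theorem Picked.mem_act {fs : List Factor} {i j : ℕ} (h : Picked fs i j) : i ∈ act fs :=
  Finset.mem_filter.2 ⟨Finset.mem_range.2 h.hi, h.statusi⟩

/-- If the receiving table is table 0, it has no variables, so `W i` is disjoint from all other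
remaining sets and may be attached to any one of them. -/
theorem Picked.ear_act {N : ℕ} {fs : List Factor} {i j : ℕ} (h : Picked fs i j) (hC : Ctl N fs)
    (h2 : 2 ≤ (act fs).card) : Ear (W fs) (act fs) i := by
  have key : ∀ l ∈ act fs, l ≠ i → W fs i ∩ W fs l ⊆ W fs j := by
    intro l hl hli x hx
    rcases h.ear x hx.1 with h1 | h1
    · exact h1
    · exact absurd hx.2 (h1 l (Finset.mem_range.1 (Finset.mem_filter.1 hl).1) hli)
  by_cases hj : j ∈ act fs
  · exact ⟨j, hj, h.ne.symm, key⟩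
  · obtain ⟨j', hj', hne⟩ := Finset.exists_mem_ne (by omega : 1 < (act fs).card) i
    refine ⟨j', hj', hne, fun l hl hli x hx => ?_⟩
    have := key l hl hli hx
    rw [hC.W_eq_empty h.hj hj] at this
    exact this.elim

/-- A join gives table `j` new variables, but they come from `i`, which is an ear, and so occur in
no other remaining table unless `j` had them already. The pairwise intersections among the remaining
tables are unchanged, so reducibility passes from the old sets without `i` to the new ones. Table 0
never takes part in a join; a sum at most reverses its single row. -/
theorem Ctl.replace {N : ℕ} {fs : List Factor} (hC : Ctl N fs) {i j : ℕ} (h : Picked fs i j)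
    {f : Factor} (hf : f.1 = (fac fs j).1) {S : Set ℕ}
    (hW : vars f.2.1 = W fs j ∪ (W fs i ∩ S) ∧ j ≠ 0 ∨
      vars f.2.1 = W fs j ∧ f.2.2.map Prod.fst = ((fac fs j).2.2.map Prod.fst).reverse) :
    Ctl N (replace N fs i j f) := by
  obtain ⟨hWi, hWj, hWl⟩ := W_replace (N := N) (f := f) h
  have hi0 : i ≠ 0 := by
    rintro rfl
    have := h.statusi
    rw [hC.status_zero] at this
    omega
  have h0 : fac (Alg.replace N fs i j f) 0 = if 0 = j then f else fac fs 0 := by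
    rw [fac_replace N fs i j f hC.pos, if_neg hi0.symm]
  refine ⟨by rw [length_replace]; exact hC.pos, ?_, ?_, ?_, ?_, ?_⟩
  · rw [h0]
    split_ifs with h1
    · rw [hf, ← h1]; exact hC.status_zero
    · exact hC.status_zero
  · by_cases h1 : 0 = j
    · subst h1
      rw [hWj]
      rcases hW with hW | hW
      · exact absurd rfl hW.2
      · rw [hW.1]; exact hC.W_zero
    · rw [hWl 0 hC.pos hi0.symm h1]; exact hC.W_zero
  · rw [h0]
    split_ifs with h1
    · subst h1
      rcases hW with hW | hW
      · exact absurd rfl hW.2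
      · rw [hW.2, hC.rows_zero]; rfl
    · exact hC.rows_zero
  · intro l hl hl0
    rw [length_replace] at hl
    rw [fac_replace N fs i j f hl]
    split_ifs with h1 h2
    · exact Or.inr rfl
    · subst h2
      rcases hC.status l hl hl0 with h3 | h3
      · exact Or.inl (hf.trans h3)
      · have := h.statusj
        rw [h3] at this
        exact absurd this (by simp [trivialFactor])
    · exact hC.status l hl hl0
  · rw [act_replace h hf]
    by_cases h2 : 2 ≤ (act fs).card
    · have hr := (hC.red.erase h.mem_act (h.ear_act hC h2)).map (V := W (Alg.replace N fs i j f)) id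
        (Function.injective_id.injOn) ?_
      · rwa [Finset.image_id] at hr
      · have key : ∀ a ∈ (act fs).erase i, ∀ b ∈ (act fs).erase i, a ≠ b → b ≠ j →
            W (Alg.replace N fs i j f) a ∩ W (Alg.replace N fs i j f) b = W fs a ∩ W fs b := by
          intro a ha b hb hab hbj
          obtain ⟨ha1, ha2⟩ := Finset.mem_erase.1 ha
          obtain ⟨hb1, hb2⟩ := Finset.mem_erase.1 hb
          have ha3 := Finset.mem_range.1 (Finset.mem_filter.1 ha2).1
          have hb3 := Finset.mem_range.1 (Finset.mem_filter.1 hb2).1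
          rw [hWl b hb3 hb1 hbj]
          by_cases haj : a = j
          · subst haj
            rw [hWj]
            rcases hW with hW | hW
            · rw [hW.1]
              ext x
              constructor
              · rintro ⟨hx | hx, hxb⟩
                · exact ⟨hx, hxb⟩
                · rcases h.ear x hx.1 with h3 | h3
                  · exact ⟨h3, hxb⟩
                  · exact absurd hxb (h3 b hb3 hb1)
              · rintro ⟨hx, hxb⟩
                exact ⟨Or.inl hx, hxb⟩
            · rw [hW.1]
          · rw [hWl a ha3 ha1 haj]
        intro a ha b hb hab
        by_cases hbj : b = j
        · rw [Set.inter_comm, Set.inter_comm (W fs a)]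
          exact key b hb a ha hab.symm (fun h => hab (h.trans hbj.symm))
        · exact key a ha b hb hab hbj
    · refine .small ?_
      have := Finset.card_erase_le (s := act fs) (a := i)
      omega

theorem Picked.ne_zero_of_linked {N : ℕ} {fs : List Factor} {i j : ℕ} (hC : Ctl N fs)
    {S : Set ℕ} (hl : ∃ x ∈ W fs i ∩ W fs j, x ∉ S) : j ≠ 0 := by
  rintro rfl
  obtain ⟨x, hx, -⟩ := hl
  rw [hC.W_zero] at hx
  exact hx.2

/-- The facts on a state of the algorithm that do not depend on the weights. -/
structure StateOK (N D : ℕ) (st : List Factor × List GCode) : Prop where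
  fac : ∀ l < st.1.length, FacOK N D st.2.length (fac st.1 l)
  ctl : Ctl N st.1
  pos : 0 < st.2.length

theorem StateOK.join {N D : ℕ} {fr : List ℕ} {fs : List Factor} {G : List GCode}
    (h : StateOK N D (fs, G)) {i j : ℕ} (hp : Picked fs i j)
    (hl : ∃ x ∈ W fs i ∩ W fs j, x ∉ vars fr) : StateOK N D (joinState N fr fs G i j) := by
  have hle : G.length ≤ (joinState N fr fs G i j).2.length :=
    (qMerge_spec (X := fun _ => (0 : ℕ)) (ok := fun _ => True) (D := D) (N := N) (fr := fr)
      (fun s hs => ⟨(h.fac i hp.hi).gate s hs, trivial⟩) (h.fac j hp.hj).gate).1.length_le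
  refine ⟨facOK_replace h.fac hle (h.pos.trans_le hle) i j
    (facOK_qMerge (h.fac i hp.hi) (h.fac j hp.hj) _), ?_, h.pos.trans_le hle⟩
  exact h.ctl.replace hp rfl (Or.inl
    ⟨vars_joinRow (h.fac j hp.hj).patLength (h.fac i hp.hi).patLength,
      Picked.ne_zero_of_linked h.ctl hl⟩)

theorem StateOK.sum {N D : ℕ} {fr : List ℕ} {fs : List Factor} {G : List GCode}
    (h : StateOK N D (fs, G)) {i j : ℕ} (hp : Picked fs i j) :
    StateOK N D (sumState N fr fs G i j) := by
  have hs := sMerge_spec (X := fun _ => (0 : ℕ)) (ok := fun _ => True) (fr := fr)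
    (fun _ => trivial) (h.fac i hp.hi) (h.fac j hp.hj) (fun _ _ => trivial)
  have hle : G.length ≤ (sumState N fr fs G i j).2.length := hs.1.length_le
  refine ⟨facOK_replace h.fac hle (h.pos.trans_le hle) i j
    (facOK_sMerge (h.fac i hp.hi) (h.fac j hp.hj) _), ?_, h.pos.trans_le hle⟩
  exact h.ctl.replace (S := ∅) hp rfl (Or.inr ⟨rfl, hs.2.2.2.1⟩)

theorem StateOK.step {N D : ℕ} {fr : List ℕ} {st : List Factor × List GCode}
    (h : StateOK N D st) (hA : (act st.1).Nonempty) :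
    StateOK N D (step N fr st) ∧ (Alg.step N fr st).1.length = st.1.length ∧
      (act (Alg.step N fr st).1).card + 1 = (act st.1).card := by
  obtain ⟨fs, G⟩ := st
  obtain ⟨i, j, hp, ⟨hl, hs⟩ | ⟨hl, hs⟩⟩ := step_cases (fr := fr) h.fac h.ctl hA
  · rw [hs]
    refine ⟨h.join hp hl, length_replace .., ?_⟩
    have ha : act (joinState N fr fs G i j).1 = (act fs).erase i := act_replace hp rfl
    rw [ha]
    exact Finset.card_erase_add_one hp.mem_act
  · rw [hs]
    refine ⟨h.sum hp, length_replace .., ?_⟩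
    have ha : act (sumState N fr fs G i j).1 = (act fs).erase i := act_replace hp rfl
    rw [ha]
    exact Finset.card_erase_add_one hp.mem_act

variable {M : Type*} [CommSemiring M]

/-- The weights of the rows are the values of their gates, and the polynomial is `p`. -/
def HasPoly (X : ℕ → M) (N D : ℕ) (fr : List ℕ) (p : M) (st : List Factor × List GCode) : Prop :=
  gv X st.2 0 = 1 ∧ ∃ ω, HasWeights X fr st.1 st.2 ω ∧
    (tables st.1 ω).poly N D (vars fr) (Finset.range st.1.length) X = p

theorem HasPoly.step {X : ℕ → M} {N D : ℕ} {fr : List ℕ} {p : M}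
    {st : List Factor × List GCode} (hP : HasPoly X N D fr p st) (h : StateOK N D st)
    (hA : (act st.1).Nonempty) : HasPoly X N D fr p (Alg.step N fr st) := by
  obtain ⟨fs, G⟩ := st
  obtain ⟨hG1, ω, hω, hpoly⟩ := hP
  obtain ⟨i, j, hp, ⟨hl, hs⟩ | ⟨hl, hs⟩⟩ := step_cases (fr := fr) h.fac h.ctl hA
  · have hear : (tables fs ω).EarAt (Finset.range fs.length) i j := fun x hx =>
      (hp.ear x hx).imp_right fun h l hl => h l (Finset.mem_range.1 hl)
    have hg := (qMerge_spec (X := X) (ok := fun _ => True) (D := D) (N := N) (fr := fr)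
      (fun s hs => ⟨(h.fac i hp.hi).gate s hs, trivial⟩) (h.fac j hp.hj).gate).1
    obtain ⟨ω', hJ, hω'⟩ := qMerge_joinInto h.fac hω h.pos hG1 hp.hi hp.hj hp.ne (fac fs j).1
    rw [hs]
    refine ⟨(hg.gv_eq h.pos).trans hG1, ω', hω', ?_⟩
    rw [joinState, length_replace]
    rw [← hpoly]
    exact hJ.poly_eq X (valid_tables ω h.fac) (Finset.mem_range.2 hp.hi) (Finset.mem_range.2 hp.hj)
      hp.ne hear
  · have hear : (tables fs ω).EarAt (Finset.range fs.length) i j := fun x hx =>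
      (hp.ear x hx).imp_right fun h l hl => h l (Finset.mem_range.1 hl)
    have hg := (sMerge_spec (X := X) (ok := fun _ => True) (fr := fr)
      (fun _ => trivial) (h.fac i hp.hi) (h.fac j hp.hj) (fun _ _ => trivial)).1
    obtain ⟨ω', hJ, hω'⟩ := sMerge_sumInto h.fac hω h.pos hG1 hp.hi hp.hj hp.ne (fac fs j).1
    rw [hs]
    refine ⟨(hg.gv_eq h.pos).trans hG1, ω', hω', ?_⟩
    rw [sumState, length_replace]
    rw [← hpoly]
    exact hJ.poly_eq (valid_tables ω h.fac) (Finset.mem_range.2 hp.hi) (Finset.mem_range.2 hp.hj)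
      hp.ne hear hl

/-- When nothing is left, no table has variables, so there is exactly one answer, the empty one,
with monomial 1. Merged tables have weight 1, and the invariant polynomial is the weight of the row
of table 0. -/
theorem HasPoly.final {X : ℕ → M} {N D : ℕ} (hD : 0 < D) {fr : List ℕ} {p : M}
    {st : List Factor × List GCode} (hP : HasPoly X N D fr p st) (h : StateOK N D st)
    (hA : act st.1 = ∅) : resultGate st.1 < st.2.length ∧ gv X st.2 (resultGate st.1) = p := by
  obtain ⟨fs, G⟩ := st
  obtain ⟨hG1, ω, hω, rfl⟩ := hP
  have hW : ∀ l < fs.length, W fs l = ∅ := fun l hl => h.ctl.W_eq_empty hl (by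
    rw [show act fs = ∅ from hA]; simp)
  have hpos : 0 < fs.length := h.ctl.pos
  obtain ⟨g, hg⟩ : ∃ g, (Alg.fac fs 0).2.2 = [(zeros N, g)] := by
    have := h.ctl.rows_zero
    obtain ⟨r, hr, hr'⟩ := List.map_eq_singleton_iff.1 this
    exact ⟨r.2, by rw [hr, ← hr']⟩
  have hres : resultGate fs = g := by rw [resultGate, hg]; rfl
  have hgl : g < G.length := (h.fac 0 hpos).gate (zeros N, g) (by rw [hg]; simp)
  have hz := hω 0 hpos (zeros N, g) (by rw [hg]; simp)
  simp only at hz ⊢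
  rw [hres]
  refine ⟨hgl, ?_⟩
  have hother : ∀ l < fs.length, l ≠ 0 → Alg.fac fs l = trivialFactor N 0 := by
    intro l hl hl0
    refine (h.ctl.status l hl hl0).resolve_left fun h1 => ?_
    have : l ∈ act fs := Finset.mem_filter.2 ⟨Finset.mem_range.2 hl, h1⟩
    rw [show act fs = ∅ from hA] at this
    simp at this
  have halive : (tables fs ω).alive (vars fr) (Finset.range fs.length) = ∅ := by
    refine Set.eq_empty_iff_forall_notMem.2 ?_
    rintro x ⟨⟨l, hl, hx⟩, -⟩
    have : x ∈ W fs l := hx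
    rw [hW l (Finset.mem_range.1 hl)] at this
    exact this
  have hrow : ∀ l < fs.length, rows (Alg.fac fs l).2.2 = {0} := by
    intro l hl
    by_cases hl0 : l = 0
    · rw [hl0, hg]; exact rows_zeros N g
    · rw [hother l hl hl0]; exact rows_zeros N 0
  have hresult : (tables fs ω).res N D (vars fr) (Finset.range fs.length) = {0} := by
    ext a
    rw [Tables.mem_res, Finset.mem_singleton, halive]
    simp only [Set.indicator_empty]
    constructor
    · rintro ⟨b, -, -, rfl⟩; rfl
    · rintro rfl
      refine ⟨lift fun _ : Fin N => (⟨0, hD⟩ : Fin D), ?_, ?_, rfl⟩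
      · simp [total]
      · intro l hl
        have hl := Finset.mem_range.1 hl
        have : (tables fs ω).W l = ∅ := hW l hl
        rw [this, Set.indicator_empty]
        simp only [tables, hrow l hl]
        exact Finset.mem_singleton_self _
  rw [Tables.poly, hresult, Finset.sum_singleton, hz]
  have hmon : mon X N 0 = 1 := by simp [mon, varOf]
  rw [hmon, one_mul, Finset.prod_eq_single 0]
  · rw [fn_zeros]
    simp only [tables]
    congr 1
    simp
  · intro l hl hl0
    have hl := Finset.mem_range.1 hl
    have h1 := hω l hl (zeros N, 0) (by rw [hother l hl hl0]; simp [trivialFactor])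
    simp only [hG1, fn_zeros] at h1
    simp only [tables]
    rw [h1]
    congr 1
    simp
  · intro h0
    exact absurd (Finset.mem_range.2 hpos) h0

/-- Each round removes one active table, so there are as many admissible rounds as active tables at
the start. The property `P` is left open; it will be the polynomial, the stars, the shape of the
gate list, and the bound on the values. -/
theorem iterate_step {N D : ℕ} {fr : List ℕ} {st : List Factor × List GCode}
    (h : StateOK N D st) {P : List Factor × List GCode → Prop} (hP : P st)
    (hstep : ∀ st, StateOK N D st → (act st.1).Nonempty → P st → P (step N fr st)) :
    ∀ t ≤ (act st.1).card, StateOK N D ((step N fr)^[t] st) ∧ P ((step N fr)^[t] st) ∧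
      ((step N fr)^[t] st).1.length = st.1.length ∧
      (act ((step N fr)^[t] st).1).card + t = (act st.1).card := by
  intro t
  induction t with
  | zero => intro _; exact ⟨h, hP, rfl, rfl⟩
  | succ t ih =>
    intro ht
    obtain ⟨h1, h2, h3, h4⟩ := ih (by omega)
    have hne : (act ((step N fr)^[t] st).1).Nonempty := Finset.card_pos.1 (by omega)
    rw [Function.iterate_succ_apply']
    obtain ⟨g1, g2, g3⟩ := h1.step (fr := fr) hne
    exact ⟨g1, hstep _ h1 hne h2, g2.trans h3, by omega⟩

end Alg
end ACQ

/-! ### The initial tables of a query and the value of the final gate. -/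

namespace ACQ

theorem Red.image_val {ι α β : Type*} [DecidableEq ι] {W : ι → Set α} {A : Finset ι}
    (h : Red W A) {g : α → β} (hg : Function.Injective g) : Red (fun i => g '' W i) A := by
  induction h with
  | small h => exact .small h
  | ear i hi h _ ih =>
    obtain ⟨j, hj, hji, hl⟩ := h
    refine .ear i hi ⟨j, hj, hji, fun l hlA hli => ?_⟩ ih
    rw [← Set.image_inter hg]
    exact Set.image_mono (hl l hlA hli)

namespace Alg

variable (Φ : Query)

/-- The initial state. -/
def start (w : List ℕ) : List Factor × List GCode := (readAll w, [(0, (1, 0))])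

theorem run_eq : run Φ.encode =
    (step Φ.nVar (freeFlags Φ.encode))^[Φ.atoms.length] (start Φ.encode) := by
  rw [run, foldl_range_const, Φ.encode_three, Φ.encode_two]
  rfl

/-- The atom of the table `l`. -/
def atomAt (l : ℕ) (h : l < Φ.atoms.length) :
    Σ R : Fin Φ.nRel, Fin (Φ.arity R) → Fin Φ.nVar := Φ.atoms.reverse[l]'(by simpa using h)

theorem exists_atomAt {a : Σ R : Fin Φ.nRel, Fin (Φ.arity R) → Fin Φ.nVar} (ha : a ∈ Φ.atoms) :
    ∃ l h, atomAt Φ l h = a := by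
  obtain ⟨l, h, e⟩ := List.getElem_of_mem (List.mem_reverse.2 ha)
  exact ⟨l, by simpa using h, e⟩

theorem atomAt_mem (l : ℕ) (h : l < Φ.atoms.length) : atomAt Φ l h ∈ Φ.atoms :=
  List.mem_reverse.1 (List.getElem_mem _)

theorem readAll_spec : (readAll Φ.encode).length = Φ.atoms.length + 1 ∧
    fac (readAll Φ.encode) 0 = trivialFactor Φ.nVar 2 ∧
    ∀ l (h : l < Φ.atoms.length), AtomTable (atomAt Φ l h).2 (Φ.rel (atomAt Φ l h).1)
      (fac (readAll Φ.encode) (l + 1)) := by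
  obtain ⟨fs, h1, h2⟩ := Φ.readAll_encode
  have hlen : fs.length = Φ.atoms.length := by simpa using h2.length_eq.symm
  rw [h1]
  refine ⟨by simp [hlen], rfl, fun l h => ?_⟩
  have h3 := (List.forall₂_iff_get.1 h2).2 l (by simpa using h) (by omega)
  have : fac (trivialFactor Φ.nVar 2 :: fs) (l + 1) = fs[l]'(by omega) := by
    simp [fac, List.getD_eq_getElem?_getD, show l < fs.length by omega]
  rw [this]
  exact h3

theorem AtomTable.vars_eq {N D ar : ℕ} {v : Fin ar → Fin N}
    {rel : List (Fin ar → Fin D)} {f : Factor} (h : AtomTable v rel f) :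
    vars f.2.1 = Set.range fun q => (v q : ℕ) := by
  ext x
  exact h.pattern x

theorem AtomTable.facOK {N D ar : ℕ} {v : Fin ar → Fin N} {rel : List (Fin ar → Fin D)}
    {f : Factor} (h : AtomTable v rel f) {n : ℕ} (hn : 0 < n) : FacOK N D n f := by
  have key : ∀ r ∈ f.2.2, ∀ x, (fn r.1 x ≠ 0 ↔ x ∈ vars f.2.1) ∧ fn r.1 x ≤ D := by
    intro r hr x
    obtain ⟨b, -, hb⟩ := (h.rows _).1 (fn_mem_rows hr)
    rw [← hb, h.vars_eq]
    by_cases hx : x ∈ Set.range fun q => (v q : ℕ)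
    · rw [Set.indicator_of_mem hx]
      obtain ⟨q, rfl⟩ := hx
      rw [lift_val]
      have := (b (v q)).2
      exact ⟨iff_of_true (by omega) ⟨q, rfl⟩, by omega⟩
    · rw [Set.indicator_of_notMem hx]
      exact ⟨iff_of_false (by simp) hx, by omega⟩
  exact ⟨h.patLength, h.proper, fun r hr x => (key r hr x).1, fun r hr x => (key r hr x).2,
    fun r hr => by rw [h.gates r hr]; exact hn⟩

theorem W_start_succ (l : ℕ) (h : l < Φ.atoms.length) :
    W (start Φ.encode).1 (l + 1) = Fin.val '' Set.range (atomAt Φ l h).2 := by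
  rw [W, start, ((readAll_spec Φ).2.2 l h).vars_eq]
  ext x
  simp

theorem W_start_zero : W (start Φ.encode).1 0 = ∅ := by
  rw [W, start, (readAll_spec Φ).2.1]
  exact vars_zeros _

theorem act_start : act (start Φ.encode).1 =
    (Finset.univ : Finset (Fin Φ.atoms.length)).image
      fun l : Fin Φ.atoms.length => (l : ℕ) + 1 := by
  obtain ⟨h1, h2, h3⟩ := readAll_spec Φ
  ext l
  simp only [act, start, Finset.mem_filter, Finset.mem_range, Finset.mem_image, Finset.mem_univ,
    true_and, h1]
  constructor
  · rintro ⟨hl, hc⟩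
    cases l with
    | zero =>
      rw [h2] at hc
      simp [trivialFactor] at hc
    | succ l => exact ⟨⟨l, by omega⟩, rfl⟩
  · rintro ⟨k, rfl⟩
    exact ⟨by omega, (h3 k k.2).status⟩

theorem card_act_start : (act (start Φ.encode).1).card = Φ.atoms.length := by
  rw [act_start, Finset.card_image_of_injective _ (fun a b h => by
    refine Fin.ext ?_
    simpa using h)]
  simp

theorem stateOK_start (hΦ : Φ.IsAcyclic) : StateOK Φ.nVar Φ.nDom (start Φ.encode) := by
  obtain ⟨h1, h2, h3⟩ := readAll_spec Φ
  have hlen : (start Φ.encode).1.length = Φ.atoms.length + 1 := h1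
  refine ⟨?_, ⟨?_, ?_, W_start_zero Φ, ?_, ?_, ?_⟩, by simp [start]⟩
  · intro l hl
    cases l with
    | zero => rw [start, h2]; exact facOK_trivialFactor _ _ (by simp) 2
    | succ l => exact (h3 l (by omega)).facOK (by simp [start])
  · omega
  · rw [start, h2]; rfl
  · rw [start, h2]; rfl
  · intro l hl hl0
    obtain ⟨l, rfl⟩ := Nat.exists_eq_succ_of_ne_zero hl0
    exact Or.inl (h3 l (by simpa [hlen] using hl)).status
  · have hr := red_of_isAcyclic hΦ rfl (fun l : Fin Φ.atoms.length => Set.range (atomAt Φ l l.2).2)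
      (fun l => ⟨_, atomAt_mem Φ l l.2, rfl⟩) (by
        rintro f ⟨a, ha, rfl⟩
        obtain ⟨l, h, rfl⟩ := exists_atomAt Φ ha
        exact ⟨⟨l, h⟩, rfl⟩)
    have hr' := (hr.image_val Fin.val_injective).map (V := W (start Φ.encode).1)
      (fun l : Fin Φ.atoms.length => (l : ℕ) + 1)
      (fun a _ b _ h => Fin.ext (by simpa using h))
      (fun a _ b _ _ => by rw [W_start_succ Φ a a.2, W_start_succ Φ b b.2])
    rwa [← act_start] at hr'

theorem vars_freeFlags : vars (freeFlags Φ.encode) = Fin.val '' (Φ.free : Set (Fin Φ.nVar)) := by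
  ext x
  exact Φ.fn_freeFlags x

theorem sat_lift_iff {M : Type*} (ω : ℕ → (ℕ → ℕ) → M) (b : Fin Φ.nVar → Fin Φ.nDom) :
    (tables (start Φ.encode).1 ω).Sat (Finset.range (start Φ.encode).1.length) (lift b) ↔
      Φ.Satisfies b := by
  obtain ⟨h1, h2, h3⟩ := readAll_spec Φ
  have hlen : (start Φ.encode).1.length = Φ.atoms.length + 1 := h1
  have key : ∀ l (h : l < Φ.atoms.length),
      ((tables (start Φ.encode).1 ω).W (l + 1)).indicator (lift b) ∈
        (tables (start Φ.encode).1 ω).T (l + 1) ↔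
      (fun p => b ((atomAt Φ l h).2 p)) ∈ Φ.rel (atomAt Φ l h).1 := by
    intro l h
    have hW : (tables (start Φ.encode).1 ω).W (l + 1) =
      Set.range fun q => ((atomAt Φ l h).2 q : ℕ) := (h3 l h).vars_eq
    rw [hW]
    refine ((h3 l h).rows _).trans ⟨?_, fun hb => ⟨b, hb, rfl⟩⟩
    rintro ⟨b', hb', he⟩
    convert hb' using 1
    funext q
    have := congrFun he ((atomAt Φ l h).2 q)
    rw [Set.indicator_of_mem (Set.mem_range_self q), Set.indicator_of_mem (Set.mem_range_self q),
      lift_val, lift_val] at this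
    exact Fin.ext (by omega)
  constructor
  · intro h a ha
    obtain ⟨l, hl, rfl⟩ := exists_atomAt Φ ha
    exact (key l hl).1 (h (l + 1) (Finset.mem_range.2 (by omega)))
  · intro h l hl
    have hl := Finset.mem_range.1 hl
    cases l with
    | zero =>
      have hW : (tables (start Φ.encode).1 ω).W 0 = ∅ := W_start_zero Φ
      rw [hW, Set.indicator_empty]
      simp only [tables, start, h2]
      rw [trivialFactor, rows_zeros]
      exact Finset.mem_singleton_self _
    | succ l => exact (key l (by omega)).2 (h _ (atomAt_mem Φ l (by omega)))

/-- An answer as a partial assignment. -/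
noncomputable def answerFn (a : Φ.free → Fin Φ.nDom) : ℕ → ℕ := fun x =>
  if h : ∃ y : Φ.free, (y : ℕ) = x then a h.choose + 1 else 0

theorem answerFn_val (a : Φ.free → Fin Φ.nDom) (y : Φ.free) : answerFn Φ a (y : ℕ) = a y + 1 := by
  have h : ∃ y' : Φ.free, (y' : ℕ) = (y : ℕ) := ⟨y, rfl⟩
  have hy : h.choose = y := Subtype.ext (Fin.ext h.choose_spec)
  rw [answerFn, dif_pos h, hy]

theorem answerFn_eq_zero (a : Φ.free → Fin Φ.nDom) {x : ℕ} (h : x ∉ vars (freeFlags Φ.encode)) :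
    answerFn Φ a x = 0 := by
  rw [answerFn, dif_neg]
  rintro ⟨y, rfl⟩
  refine h ?_
  rw [vars_freeFlags]
  exact ⟨y.1, y.2, rfl⟩

theorem answerFn_eq (a : Φ.free → Fin Φ.nDom) (b : Fin Φ.nVar → Fin Φ.nDom) :
    (vars (freeFlags Φ.encode)).indicator (lift b) = answerFn Φ a ↔ ∀ x : Φ.free, b x = a x := by
  constructor
  · intro h x
    have := congrFun h (x : Fin Φ.nVar)
    rw [answerFn_val, Set.indicator_of_mem (by rw [vars_freeFlags]; exact ⟨x.1, x.2, rfl⟩),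
      lift_val] at this
    exact Fin.ext (by omega)
  · intro h
    funext x
    by_cases hx : x ∈ vars (freeFlags Φ.encode)
    · rw [Set.indicator_of_mem hx]
      rw [vars_freeFlags] at hx
      obtain ⟨y, hy, rfl⟩ := hx
      rw [lift_val, answerFn_val Φ a ⟨y, hy⟩, ← h ⟨y, hy⟩]
    · rw [Set.indicator_of_notMem hx, answerFn_eq_zero Φ a hx]

/-- With all weights 1 the invariant is the plain sum of monomials over the answers of the query,
once assignments of the free variables are identified with functions on ℕ that vanish elsewhere. -/
theorem hasPoly_start {M : Type*} [CommSemiring M] (X : ℕ → M) :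
    HasPoly X Φ.nVar Φ.nDom (freeFlags Φ.encode) (∑ a ∈ Φ.result, ∏ x : Φ.free, X (a x))
      (start Φ.encode) := by
  classical
  obtain ⟨h1, h2, h3⟩ := readAll_spec Φ
  have hlen : (start Φ.encode).1.length = Φ.atoms.length + 1 := h1
  have hg : gv X (start Φ.encode).2 0 = 1 := by
    simp [start, gv, gval]
  refine ⟨hg, fun _ _ => 1, ?_, ?_⟩
  · intro l hl r hr
    have : r.2 = 0 := by
      cases l with
      | zero =>
        rw [start, h2] at hr
        obtain rfl : r = (zeros Φ.nVar, 0) := by simpa [trivialFactor] using hr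
        rfl
      | succ l => exact (h3 l (by omega)).gates r hr
    rw [this, hg]
  · have halive : (tables (start Φ.encode).1 fun _ _ => (1 : M)).alive
        (vars (freeFlags Φ.encode)) (Finset.range (start Φ.encode).1.length) =
        vars (freeFlags Φ.encode) := by
      ext x
      refine ⟨fun h => h.2, fun h => ⟨?_, h⟩⟩
      rw [vars_freeFlags] at h
      obtain ⟨y, hy, rfl⟩ := h
      -- A free variable that occurs in no table would be missing from the monomials; this is the
      -- place where every free variable has to occur in an atom.
      obtain ⟨a, ha, p, hp⟩ := Φ.free_occurs y (by simpa [Query.free] using hy)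
      obtain ⟨l, hl, rfl⟩ := exists_atomAt Φ ha
      refine ⟨l + 1, Finset.mem_range.2 (by omega), ?_⟩
      have : (y : ℕ) ∈ W (start Φ.encode).1 (l + 1) := by
        rw [W_start_succ Φ l hl]
        exact ⟨y, ⟨p, hp⟩, rfl⟩
      exact this
    have hres : ∀ a, a ∈ (tables (start Φ.encode).1 fun _ _ => (1 : M)).res Φ.nVar Φ.nDom
        (vars (freeFlags Φ.encode)) (Finset.range (start Φ.encode).1.length) ↔
        ∃ a' ∈ Φ.result, answerFn Φ a' = a := by
      intro a
      rw [Tables.mem_res, halive]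
      simp only [Query.result, Finset.mem_filter, Finset.mem_univ, true_and]
      constructor
      · rintro ⟨b, hb, hsat, rfl⟩
        obtain ⟨b, -, rfl⟩ := Finset.mem_image.1 hb
        exact ⟨fun x => b x, ⟨b, fun _ => rfl, (sat_lift_iff Φ _ b).1 hsat⟩,
          ((answerFn_eq Φ _ b).2 fun _ => rfl).symm⟩
      · rintro ⟨a', ⟨b, hb, hsat⟩, rfl⟩
        exact ⟨lift b, Finset.mem_image.2 ⟨b, Finset.mem_univ _, rfl⟩, (sat_lift_iff Φ _ b).2 hsat,
          (answerFn_eq Φ a' b).2 hb⟩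
    rw [Tables.poly]
    symm
    refine Finset.sum_bij (fun a _ => answerFn Φ a) (fun a ha => (hres _).2 ⟨a, ha, rfl⟩) ?_ ?_ ?_
    · intro a _ b _ hab
      funext x
      have := congrFun hab (x : Fin Φ.nVar)
      rw [answerFn_val, answerFn_val] at this
      exact Fin.ext (by omega)
    · intro a ha
      obtain ⟨a', ha', rfl⟩ := (hres a).1 ha
      exact ⟨a', ha', rfl⟩
    · intro a _
      have e : ∏ l ∈ Finset.range (start Φ.encode).1.length,
          (tables (start Φ.encode).1 fun _ _ => (1 : M)).ω l
            (((tables (start Φ.encode).1 fun _ _ => (1 : M)).W l).indicator (answerFn Φ a)) = 1 :=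
        Finset.prod_eq_one fun _ _ => rfl
      have e2 := Finset.prod_coe_sort Φ.free fun x : Fin Φ.nVar => varOf X (answerFn Φ a x)
      rw [e, mul_one, mon, Finset.prod_range, ← Finset.prod_subset (Finset.subset_univ Φ.free),
        ← e2]
      · refine Finset.prod_congr rfl fun x _ => ?_
        rw [answerFn_val, varOf, if_neg (by omega), Nat.add_sub_cancel]
      · intro x _ hx
        rw [answerFn_eq_zero, varOf, if_pos rfl]
        rw [vars_freeFlags]
        rintro ⟨y, hy, hyx⟩
        exact hx (Fin.ext hyx ▸ hy)

/-- Valid for any `X` in any commutative semiring. The variables of a polynomial ring give the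
circuit, the constant 1 in ℕ gives the number of answers. -/
theorem run_spec {M : Type*} [CommSemiring M] (X : ℕ → M) (hΦ : Φ.IsAcyclic) :
    StateOK Φ.nVar Φ.nDom (run Φ.encode) ∧ resultGate (run Φ.encode).1 < (run Φ.encode).2.length ∧
      gv X (run Φ.encode).2 (resultGate (run Φ.encode).1) =
        ∑ a ∈ Φ.result, ∏ x : Φ.free, X (a x) := by
  obtain ⟨h1, h2, -, h4⟩ := iterate_step (fr := freeFlags Φ.encode) (stateOK_start Φ hΦ)
    (hasPoly_start Φ X) (fun st h hA hP => hP.step h hA) Φ.atoms.length (card_act_start Φ).ge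
  rw [← run_eq] at h1 h2 h4
  have hA : act (run Φ.encode).1 = ∅ := by
    rw [card_act_start] at h4
    exact Finset.card_eq_zero.1 (by omega)
  exact ⟨h1, h2.final Φ.nDom_pos h1 hA⟩

end Alg
end ACQ

namespace ACQ

/-! ### The number of rows -/

/-- The sets `e a` and `e b` share an element outside of `S`. -/
def Link (S : Set ℕ) (e : ℕ → Set ℕ) (a b : ℕ) : Prop := ∃ x, x ∈ e a ∧ x ∈ e b ∧ x ∉ S

/-- For a set `A` of tables with variables `W` and rows `T`, that arose from tables with variables
`e` and rows `T₀`, every table `l` has a star `Z l`: a set of pairs of a free variable `y` and an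
initial table that contains `y` and covers the part of `W l` around `y`. -/
structure Star (S : Set ℕ) (n : ℕ) (e : ℕ → Set ℕ) (T₀ : ℕ → Finset (ℕ → ℕ)) (A : Finset ℕ)
    (W : ℕ → Set ℕ) (T : ℕ → Finset (ℕ → ℕ)) (Z : ℕ → Finset (ℕ × ℕ)) : Prop where
  lt : ∀ l ∈ A, l < n
  sub : ∀ l ∈ A, e l ⊆ W l
  priv : ∀ l ∈ A, ∀ x ∈ W l, x ∉ e l → x ∈ S ∧ ∀ l' ∈ A, l' ≠ l → x ∉ W l'
  mem : ∀ l ∈ A, ∀ p ∈ Z l, p.2 < n ∧ p.1 ∈ e p.2 ∧ p.1 ∈ W l ∧ p.1 ∉ e l ∧ e p.2 ∩ S ⊆ W l ∧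
    Relation.TransGen (Link S e) l p.2
  cover : ∀ l ∈ A, ∀ x ∈ W l, x ∉ e l → ∃ p ∈ Z l, x ∈ e p.2
  indep : ∀ l ∈ A, ∀ p ∈ Z l, ∀ q ∈ Z l, ∀ f < n, p.1 ∈ e f → q.1 ∈ e f → p = q
  closed : ∀ l ∈ A, ∀ p ∈ Z l, ∀ f < n, p.1 ∈ e f → ∀ l' ∈ A, ∀ v ∈ e f, v ∈ e l' → v ∈ e p.2
  host : ∀ f < n, ∃ h ∈ A, ∀ x ∈ e f, ∀ l ∈ A, x ∈ W l → x ∈ W h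
  rows : ∀ l ∈ A, ∀ r ∈ T l, (e l).indicator r ∈ T₀ l ∧
    ∀ p ∈ Z l, ∃ t ∈ T₀ p.2, (e p.2 ∩ S).indicator r = S.indicator t

section

variable {S : Set ℕ} {n : ℕ} {e : ℕ → Set ℕ} {T₀ : ℕ → Finset (ℕ → ℕ)} {A : Finset ℕ}
  {W W' : ℕ → Set ℕ} {T T' : ℕ → Finset (ℕ → ℕ)} {Z : ℕ → Finset (ℕ × ℕ)}

theorem star_start (hT : ∀ l < n, ∀ r ∈ T₀ l, (e l).indicator r = r) :
    Star S n e T₀ (Finset.range n) e T₀ fun _ => ∅ := by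
  refine ⟨fun l hl => Finset.mem_range.1 hl, fun _ _ => subset_rfl, fun l _ x h h' => absurd h h',
    by simp, fun l _ x h h' => absurd h h', by simp, by simp, ?_, ?_⟩
  · intro f hf
    exact ⟨f, Finset.mem_range.2 hf, fun x hx _ _ _ => hx⟩
  · intro l hl r hr
    exact ⟨by rwa [hT l (Finset.mem_range.1 hl) r hr], by simp⟩

/-- The other tables keep their variables, rows and stars. Only the choice of the table that hosts
an initial edge may be affected: if it was `i`, then `j` takes over, because whatever `i` shares
with the others lies in `j`. -/
theorem Star.sum (h : Star S n e T₀ A W T Z) {i j : ℕ} (hj : j ∈ A) (hij : i ≠ j)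
    (hE : ∀ x ∈ W i, x ∈ W j ∨ ∀ l ∈ A, l ≠ i → x ∉ W l)
    (hW : ∀ l ∈ A, l ≠ i → W' l = W l) (hT : ∀ l ∈ A, l ≠ i → T' l = T l) :
    Star S n e T₀ (A.erase i) W' T' Z := by
  have hm : ∀ l ∈ A.erase i, l ∈ A ∧ W' l = W l ∧ T' l = T l := fun l hl => by
    obtain ⟨h1, h2⟩ := Finset.mem_erase.1 hl
    exact ⟨h2, hW l h2 h1, hT l h2 h1⟩
  refine ⟨fun l hl => h.lt l (hm l hl).1, ?_, ?_, ?_, ?_, fun l hl => h.indep l (hm l hl).1, ?_,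
    ?_, ?_⟩
  · intro l hl; rw [(hm l hl).2.1]; exact h.sub l (hm l hl).1
  · intro l hl x hx hxe
    rw [(hm l hl).2.1] at hx
    obtain ⟨h1, h2⟩ := h.priv l (hm l hl).1 x hx hxe
    refine ⟨h1, fun l' hl' hll => ?_⟩
    rw [(hm l' hl').2.1]
    exact h2 l' (hm l' hl').1 hll
  · intro l hl; rw [(hm l hl).2.1]; exact h.mem l (hm l hl).1
  · intro l hl; rw [(hm l hl).2.1]; exact h.cover l (hm l hl).1
  · intro l hl p hp f hf hpf l' hl'
    exact h.closed l (hm l hl).1 p hp f hf hpf l' (hm l' hl').1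
  · intro f hf
    obtain ⟨k, hk, hk'⟩ := h.host f hf
    by_cases hki : k = i
    · subst hki
      have hj' : j ∈ A.erase k := Finset.mem_erase.2 ⟨hij.symm, hj⟩
      refine ⟨j, hj', fun x hx l hl hxl => ?_⟩
      rw [(hm j hj').2.1]
      rw [(hm l hl).2.1] at hxl
      rcases hE x (hk' x hx l (hm l hl).1 hxl) with h1 | h1
      · exact h1
      · exact absurd hxl (h1 l (hm l hl).1 (Finset.ne_of_mem_erase hl))
    · have hk2 : k ∈ A.erase i := Finset.mem_erase.2 ⟨hki, hk⟩
      refine ⟨k, hk2, fun x hx l hl hxl => ?_⟩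
      rw [(hm k hk2).2.1]
      rw [(hm l hl).2.1] at hxl
      exact hk' x hx l (hm l hl).1 hxl
  · intro l hl; rw [(hm l hl).2.2]; exact h.rows l (hm l hl).1

/-- Table `j` inherits the star of `i`, and possibly one new pair: if a free variable of `e i`
outside `W j` is covered by none of the edges of the star of `i`, one such variable is added, paired
with `i`. The pair then covers all of `e i`. Variables acquired by a table are private to it
(`priv`), and an initial edge is visible to the remaining tables only through one of them (`host`);
together these keep variables from different sources out of a common edge. The condition `closed`
serves to separate the new variable from the old star of `i`. The links to the edges of the star run
through `i`, which shares with `j` a quantified variable that both had from the beginning. -/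
theorem Star.join (h : Star S n e T₀ A W T Z) {i j : ℕ} (hi : i ∈ A) (hj : j ∈ A) (hij : i ≠ j)
    (hE : ∀ x ∈ W i, x ∈ W j ∨ ∀ l ∈ A, l ≠ i → x ∉ W l)
    (hsupp : ∀ l ∈ A, ∀ r ∈ T l, ∀ x, r x ≠ 0 ↔ x ∈ W l)
    (hlink : ∃ x ∈ W i ∩ W j, x ∉ S)
    (hW : ∀ l ∈ A, l ≠ i → l ≠ j → W' l = W l) (hT : ∀ l ∈ A, l ≠ i → l ≠ j → T' l = T l)
    (hWj : W' j = W j ∪ (W i ∩ S))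
    (hTj : ∀ f ∈ T' j, ∃ r ∈ T j, ∃ s ∈ T i, CompatFn r s ∧ joinFn r (S.indicator s) = f) :
    ∃ Z', Star S n e T₀ (A.erase i) W' T' Z' := by
  classical
  -- the new pair, if needed
  obtain ⟨E, hE1, hE2⟩ : ∃ E : Finset (ℕ × ℕ), (∀ p ∈ E, p.2 = i ∧ p.1 ∈ e i ∧ p.1 ∈ S ∧
      p.1 ∉ W j ∧ (∀ q ∈ Z i, p.1 ∉ e q.2) ∧ E = {p}) ∧
      ∀ x ∈ e i, x ∈ S → x ∉ W j → ∃ p ∈ Z i ∪ E, x ∈ e p.2 := by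
    by_cases hc : ∃ y ∈ e i, y ∈ S ∧ y ∉ W j ∧ ∀ q ∈ Z i, y ∉ e q.2
    · obtain ⟨y, h1, h2, h3, h4⟩ := hc
      refine ⟨{(y, i)}, ?_, ?_⟩
      · intro p hp
        obtain rfl := Finset.mem_singleton.1 hp
        exact ⟨rfl, h1, h2, h3, h4, rfl⟩
      · intro x hx _ _
        exact ⟨(y, i), by simp, hx⟩
    · refine ⟨∅, by simp, ?_⟩
      intro x h1 h2 h3
      by_contra h4
      refine hc ⟨x, h1, h2, h3, fun q hq hxq => h4 ⟨q, by simpa using hq, hxq⟩⟩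
  have hpi : ∀ x ∈ W i, x ∉ W j → ∀ l ∈ A, l ≠ i → x ∉ W l := fun x hx hxj =>
    (hE x hx).resolve_left hxj
  have hlij : Link S e j i := by
    obtain ⟨x, ⟨hxi, hxj⟩, hxS⟩ := hlink
    refine ⟨x, ?_, ?_, hxS⟩
    · by_contra hc; exact hxS (h.priv j hj x hxj hc).1
    · by_contra hc; exact hxS (h.priv i hi x hxi hc).1
  -- the pairs coming from `i` are private to `i`
  have hZi : ∀ p ∈ Z i ∪ E, p.1 ∈ W i ∧ p.1 ∉ W j ∧ p.1 ∈ S ∧ p.1 ∈ e p.2 ∧ p.2 < n ∧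
      e p.2 ∩ S ⊆ W i ∧ Relation.TransGen (Link S e) j p.2 := by
    intro p hp
    rcases Finset.mem_union.1 hp with hp | hp
    · obtain ⟨h1, h2, h3, h4, h5, h6⟩ := h.mem i hi p hp
      obtain ⟨g1, g2⟩ := h.priv i hi _ h3 h4
      exact ⟨h3, g2 j hj hij.symm, g1, h2, h1, h5, Relation.TransGen.head hlij h6⟩
    · obtain ⟨h1, h2, h3, h4, h5, -⟩ := hE1 p hp
      rw [h1]
      exact ⟨h.sub i hi h2, h4, h3, h2, h.lt i hi, fun x hx => h.sub i hi hx.1,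
        Relation.TransGen.single hlij⟩
  have hm : ∀ l ∈ A.erase i, l ∈ A ∧ l ≠ i := fun l hl =>
    ⟨Finset.mem_of_mem_erase hl, Finset.ne_of_mem_erase hl⟩
  have hWsub : ∀ l ∈ A, l ≠ i → W l ⊆ W' l := by
    intro l hl hli
    by_cases hlj : l = j
    · rw [hlj, hWj]; exact Set.subset_union_left
    · rw [hW l hl hli hlj]
  have hold : ∀ l ∈ A, l ≠ i → ∀ x ∈ W' l, x ∈ W l ∨ l = j ∧ x ∈ W i ∧ x ∈ S ∧ x ∉ W j := by
    intro l hl hli x hx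
    by_cases hlj : l = j
    · rw [hlj, hWj] at hx
      rw [hlj]
      by_cases hxj : x ∈ W j
      · exact Or.inl hxj
      · rcases hx with hx | hx
        · exact Or.inl hx
        · exact Or.inr ⟨rfl, hx.1, hx.2, hxj⟩
    · rw [hW l hl hli hlj] at hx
      exact Or.inl hx
  -- An initial edge that contains a variable private to `i` must be hosted by `i`, so all its
  -- variables that are visible to remaining tables lie in `W i`.
  have hhost : ∀ f < n, ∀ x ∈ e f, x ∈ W i → x ∉ W j → ∀ y ∈ e f, ∀ l ∈ A, y ∈ W l → y ∈ W i := by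
    intro f hf x hx hxi hxj y hy l hl hyl
    obtain ⟨k, hk, hk'⟩ := h.host f hf
    have : k = i := by
      by_contra hki
      exact hpi x hxi hxj k hk hki (hk' x hx i hi hxi)
    subst this
    exact hk' y hy l hl hyl
  refine ⟨fun l => if l = j then Z j ∪ (Z i ∪ E) else Z l, fun l hl => h.lt l (hm l hl).1, ?_, ?_,
    ?_, ?_, ?_, ?_, ?_, ?_⟩
  · intro l hl
    exact (h.sub l (hm l hl).1).trans (hWsub l (hm l hl).1 (hm l hl).2)
  · intro l hl x hx hxe
    rcases hold l (hm l hl).1 (hm l hl).2 x hx with h1 | ⟨rfl, h1, h2, h3⟩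
    · obtain ⟨g1, g2⟩ := h.priv l (hm l hl).1 x h1 hxe
      refine ⟨g1, fun l' hl' hll hxl => ?_⟩
      rcases hold l' (hm l' hl').1 (hm l' hl').2 x hxl with h4 | ⟨-, h4, -, -⟩
      · exact g2 l' (hm l' hl').1 hll h4
      · exact g2 i hi (hm l hl).2.symm h4
    · refine ⟨h2, fun l' hl' hll hxl => ?_⟩
      rcases hold l' (hm l' hl').1 (hm l' hl').2 x hxl with h4 | ⟨h4, -⟩
      · exact hpi x h1 h3 l' (hm l' hl').1 (hm l' hl').2 h4
      · exact hll h4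
  · intro l hl p hp
    by_cases hlj : l = j
    · rw [if_pos hlj] at hp
      rw [hlj]
      rcases Finset.mem_union.1 hp with hp | hp
      · obtain ⟨h1, h2, h3, h4, h5, h6⟩ := h.mem j hj p hp
        exact ⟨h1, h2, hWsub j hj hij.symm h3, h4, h5.trans (hWsub j hj hij.symm), h6⟩
      · obtain ⟨h1, h2, h3, h4, h5, h6, h7⟩ := hZi p hp
        rw [hWj]
        exact ⟨h5, h4, Or.inr ⟨h1, h3⟩, fun hc => h2 (h.sub j hj hc),
          fun x hx => Or.inr ⟨h6 hx, hx.2⟩, h7⟩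
    · rw [if_neg hlj] at hp
      rw [hW l (hm l hl).1 (hm l hl).2 hlj]
      exact h.mem l (hm l hl).1 p hp
  · intro l hl x hx hxe
    rcases hold l (hm l hl).1 (hm l hl).2 x hx with h1 | ⟨rfl, h1, h2, h3⟩
    · obtain ⟨p, hp, hxp⟩ := h.cover l (hm l hl).1 x h1 hxe
      refine ⟨p, ?_, hxp⟩
      by_cases hlj : l = j
      · subst hlj; rw [if_pos rfl]; exact Finset.mem_union_left _ hp
      · rwa [if_neg hlj]
    · rw [if_pos rfl]
      by_cases hxi : x ∈ e i
      · obtain ⟨p, hp, hxp⟩ := hE2 x hxi h2 h3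
        exact ⟨p, Finset.mem_union_right _ hp, hxp⟩
      · obtain ⟨p, hp, hxp⟩ := h.cover i hi x h1 hxi
        exact ⟨p, Finset.mem_union_right _ (Finset.mem_union_left _ hp), hxp⟩
  · intro l hl p hp q hq f hf hpf hqf
    by_cases hlj : l = j
    · rw [if_pos hlj] at hp hq
      -- A variable from the star of `j` is private to `j`, one from the side of `i` is private to
      -- `i`. An edge with both would be hosted by `i` and force the former into `W i`.
      have hmix : ∀ p ∈ Z j, ∀ q ∈ Z i ∪ E, p.1 ∈ e f → q.1 ∈ e f → False := by
        intro p hp q hq hpf hqf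
        obtain ⟨-, -, g3, g4, -, -⟩ := h.mem j hj p hp
        obtain ⟨k1, k2, -⟩ := hZi q hq
        exact (h.priv j hj p.1 g3 g4).2 i hi hij (hhost f hf q.1 hqf k1 k2 p.1 hpf j hj g3)
      -- The new variable lies in `e i`. If it shared an edge with a variable of the star of `i`,
      -- then by `closed` the edge paired with that variable would cover it, against its choice.
      have hmix' : ∀ p ∈ Z i, ∀ q ∈ E, p.1 ∈ e f → q.1 ∈ e f → False := by
        intro p hp q hq hpf hqf
        obtain ⟨-, k2, -, -, k5, -⟩ := hE1 q hq
        exact k5 p hp (h.closed i hi p hp f hf hpf i hi q.1 hqf k2)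
      rcases Finset.mem_union.1 hp with hp | hp <;> rcases Finset.mem_union.1 hq with hq | hq
      · exact h.indep j hj p hp q hq f hf hpf hqf
      · exact (hmix p hp q hq hpf hqf).elim
      · exact (hmix q hq p hp hqf hpf).elim
      · rcases Finset.mem_union.1 hp with hp | hp <;> rcases Finset.mem_union.1 hq with hq | hq
        · exact h.indep i hi p hp q hq f hf hpf hqf
        · exact (hmix' p hp q hq hpf hqf).elim
        · exact (hmix' q hq p hp hqf hpf).elim
        · have := (hE1 p hp).2.2.2.2.2
          rw [this] at hq
          exact (Finset.mem_singleton.1 hq).symm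
    · rw [if_neg hlj] at hp hq
      exact h.indep l (hm l hl).1 p hp q hq f hf hpf hqf
  · intro l hl p hp f hf hpf l' hl' v hv hvl
    by_cases hlj : l = j
    · rw [if_pos hlj] at hp
      rcases Finset.mem_union.1 hp with hp | hp
      · exact h.closed j hj p hp f hf hpf l' (hm l' hl').1 v hv hvl
      · rcases Finset.mem_union.1 hp with hp | hp
        · exact h.closed i hi p hp f hf hpf l' (hm l' hl').1 v hv hvl
        · obtain ⟨k1, k2, k3, k4, -, -⟩ := hE1 p hp
          rw [k1]
          -- An edge containing the new variable is hosted by `i`, so `v` lies in `W i`. If `v` were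
          -- not in `e i`, it would have been acquired and hence be private to `i`, yet it belongs
          -- to `l'`.
          by_contra hvi
          have hvl' := h.sub l' (hm l' hl').1 hvl
          have hvW := hhost f hf p.1 hpf (h.sub i hi k2) k4 v hv l' (hm l' hl').1 hvl'
          exact (h.priv i hi v hvW hvi).2 l' (hm l' hl').1 (hm l' hl').2 hvl'
    · rw [if_neg hlj] at hp
      exact h.closed l (hm l hl).1 p hp f hf hpf l' (hm l' hl').1 v hv hvl
  · intro f hf
    obtain ⟨k, hk, hk'⟩ := h.host f hf
    have hj' : j ∈ A.erase i := Finset.mem_erase.2 ⟨hij.symm, hj⟩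
    by_cases hki : k = i
    · subst hki
      refine ⟨j, hj', fun x hx l hl hxl => ?_⟩
      rcases hold l (hm l hl).1 (hm l hl).2 x hxl with h1 | ⟨rfl, -⟩
      · rcases hE x (hk' x hx l (hm l hl).1 h1) with h2 | h2
        · exact hWsub j hj hij.symm h2
        · exact absurd h1 (h2 l (hm l hl).1 (hm l hl).2)
      · exact hxl
    · refine ⟨k, Finset.mem_erase.2 ⟨hki, hk⟩, fun x hx l hl hxl => ?_⟩
      rcases hold l (hm l hl).1 (hm l hl).2 x hxl with h1 | ⟨-, h1, -, h3⟩
      · exact hWsub k hk hki (hk' x hx l (hm l hl).1 h1)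
      · exact absurd (hk' x hx i hi h1) (hpi x h1 h3 k hk hki)
  · intro l hl f hf
    by_cases hlj : l = j
    · subst hlj
      rw [if_pos rfl]
      obtain ⟨r, hr, s, hs, hc, rfl⟩ := hTj f hf
      have hrx := hsupp l hj r hr
      have hsx := hsupp i hi s hs
      have e1 : ∀ x ∈ W l, joinFn r (S.indicator s) x = r x := by
        intro x hx
        rw [joinFn_apply, if_neg ((hrx x).2 hx)]
      have e2 : ∀ x ∈ W i, x ∈ S → joinFn r (S.indicator s) x = s x := by
        intro x hx hxS
        rw [joinFn_apply, Set.indicator_of_mem hxS]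
        split_ifs with h0
        · rfl
        · rcases hc x with h1 | h1 | h1
          · exact absurd h1 h0
          · exact absurd h1 ((hsx x).2 hx)
          · exact h1
      obtain ⟨r1, r2⟩ := h.rows l hj r hr
      obtain ⟨s1, s2⟩ := h.rows i hi s hs
      refine ⟨?_, fun p hp => ?_⟩
      · rw [Set.indicator_congr fun x hx => e1 x (h.sub l hj hx)]
        exact r1
      · rcases Finset.mem_union.1 hp with hp | hp
        · obtain ⟨t, ht, htr⟩ := r2 p hp
          refine ⟨t, ht, ?_⟩
          rw [← htr]
          exact Set.indicator_congr fun x hx => e1 x ((h.mem l hj p hp).2.2.2.2.1 hx)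
        · have e3 : (e p.2 ∩ S).indicator (joinFn r (S.indicator s)) =
              (e p.2 ∩ S).indicator s :=
            Set.indicator_congr fun x hx => e2 x ((hZi p hp).2.2.2.2.2.1 hx) hx.2
          rw [e3]
          rcases Finset.mem_union.1 hp with hp | hp
          · exact s2 p hp
          · rw [(hE1 p hp).1]
            refine ⟨_, s1, ?_⟩
            rw [Set.indicator_indicator, Set.inter_comm]
    · rw [if_neg hlj]
      rw [hT l (hm l hl).1 (hm l hl).2 hlj] at hf
      exact h.rows l (hm l hl).1 f hf

/-- The edges of the star and the initial edge of the table cover its variables, and acquired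
variables are free. So a row is determined by its restriction to `e l`, an initial row, and by one
projected initial row for each pair. -/
theorem Star.card_le (h : Star S n e T₀ A W T Z) {l : ℕ} (hl : l ∈ A)
    (hsupp : ∀ r ∈ T l, ∀ x, r x ≠ 0 ↔ x ∈ W l) {B : ℕ} (hB : ∀ a < n, (T₀ a).card ≤ B) :
    (T l).card ≤ B ^ (1 + (Z l).card) := by
  classical
  have hcard : (T l).card ≤ ((T₀ l) ×ˢ ((Z l).pi fun p => (T₀ p.2).image S.indicator)).card := by
    refine Finset.card_le_card_of_injOn
      (fun r => ((e l).indicator r, fun p _ => (e p.2 ∩ S).indicator r)) ?_ ?_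
    · intro r hr
      obtain ⟨h1, h2⟩ := h.rows l hl r hr
      refine Finset.mem_coe.2 (Finset.mem_product.2 ⟨h1, Finset.mem_pi.2 fun p hp => ?_⟩)
      obtain ⟨t, ht, htr⟩ := h2 p hp
      exact Finset.mem_image.2 ⟨t, ht, htr.symm⟩
    · intro r hr s hs hrs
      obtain ⟨h1, h2⟩ := Prod.ext_iff.1 hrs
      simp only at h1 h2
      funext x
      by_cases hx : x ∈ W l
      · by_cases hxe : x ∈ e l
        · have := congrFun h1 x
          rwa [Set.indicator_of_mem hxe, Set.indicator_of_mem hxe] at this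
        · obtain ⟨p, hp, hxp⟩ := h.cover l hl x hx hxe
          have hm : x ∈ e p.2 ∩ S := ⟨hxp, (h.priv l hl x hx hxe).1⟩
          have := congrFun (congrFun (congrFun h2 p) hp) x
          rwa [Set.indicator_of_mem hm, Set.indicator_of_mem hm] at this
      · have hr0 : r x = 0 := not_not.1 fun h0 => hx ((hsupp r hr x).1 h0)
        have hs0 : s x = 0 := not_not.1 fun h0 => hx ((hsupp s hs x).1 h0)
        rw [hr0, hs0]
  refine hcard.trans ?_
  rw [Finset.card_product, Finset.card_pi, pow_add, pow_one]
  refine Nat.mul_le_mul (hB l (h.lt l hl)) ?_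
  rw [← Finset.prod_const]
  exact Finset.prod_le_prod' fun p hp =>
    Finset.card_image_le.trans (hB p.2 (h.mem l hl p hp).1)

end

end ACQ

/-! ### Stars of tables are stars of the query hypergraph. -/

namespace ACQ
namespace Alg

variable (Φ : Query)

/-- The variables of the initial table `a`. -/
def edge (a : ℕ) : Set (Fin Φ.nVar) := {x | (x : ℕ) ∈ W (start Φ.encode).1 a}

theorem W_start_of_le {a : ℕ} (h : (start Φ.encode).1.length ≤ a) :
    W (start Φ.encode).1 a = ∅ := by
  have : fac (start Φ.encode).1 a = (0, ([], [])) := by simp [fac, h]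
  rw [W, this]
  ext x
  simp [vars, fn]

theorem edge_mem {a x : ℕ} (hx : x ∈ W (start Φ.encode).1 a) :
    edge Φ a ∈ Φ.hypergraph.edgeSet ∧ x ∈ Fin.val '' edge Φ a := by
  have hlen : (start Φ.encode).1.length = Φ.atoms.length + 1 := (readAll_spec Φ).1
  cases a with
  | zero => rw [W_start_zero] at hx; exact hx.elim
  | succ l =>
    have hl : l < Φ.atoms.length := by
      by_contra hc
      rw [W_start_of_le Φ (by omega)] at hx
      exact hx
    have he : edge Φ (l + 1) = Set.range (atomAt Φ l hl).2 := by
      ext y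
      simp only [edge, Set.mem_ofPred_eq, W_start_succ Φ l hl]
      exact Function.Injective.mem_set_image Fin.val_injective
    rw [W_start_succ Φ l hl] at hx
    rw [he]
    exact ⟨⟨_, atomAt_mem Φ l hl, rfl⟩, hx⟩

theorem mem_compl_free {x : Fin Φ.nVar} (hx : (x : ℕ) ∉ vars (freeFlags Φ.encode)) :
    x ∉ Φ.free := fun h => hx (by rw [vars_freeFlags]; exact ⟨x, h, rfl⟩)

/-- Consecutive edges of a chain of links share a quantified variable, so their parts outside the
free variables form a path in the induced hypergraph. -/
theorem path_of_transGen {a b : ℕ}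
    (h : Relation.TransGen (Link (vars (freeFlags Φ.encode)) (W (start Φ.encode).1)) a b) :
    ∃ p : List (Set (Fin Φ.nVar)),
      (∀ f ∈ p, f ∈ (induceVerts Φ.hypergraph (Φ.hypergraph.vertexSet \ Φ.free)).edgeSet) ∧
      p.head? = some (edge Φ a ∩ (Φ.hypergraph.vertexSet \ Φ.free)) ∧
      p.getLast? = some (edge Φ b ∩ (Φ.hypergraph.vertexSet \ Φ.free)) ∧
      p.IsChain fun e f => (e ∩ f).Nonempty := by
  have key : ∀ {a b : ℕ}, Link (vars (freeFlags Φ.encode)) (W (start Φ.encode).1) a b →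
      ((edge Φ a ∩ (Φ.hypergraph.vertexSet \ Φ.free)) ∩
        (edge Φ b ∩ (Φ.hypergraph.vertexSet \ Φ.free))).Nonempty ∧
      edge Φ a ∈ Φ.hypergraph.edgeSet ∧ edge Φ b ∈ Φ.hypergraph.edgeSet := by
    rintro a b ⟨x, hxa, hxb, hxS⟩
    obtain ⟨h1, y, hy, rfl⟩ := edge_mem Φ hxa
    obtain ⟨h2, z, hz, hzy⟩ := edge_mem Φ hxb
    obtain rfl := Fin.ext hzy
    have := mem_compl_free Φ hxS
    exact ⟨⟨z, ⟨hy, Set.mem_univ z, this⟩, hz, Set.mem_univ z, this⟩, h1, h2⟩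
  induction h using Relation.TransGen.head_induction_on with
  | single h =>
    rename_i a
    obtain ⟨h1, h2, h3⟩ := key h
    refine ⟨[_, _], ?_, rfl, rfl, by simpa using h1⟩
    intro f hf
    rcases List.mem_cons.1 hf with rfl | hf
    · exact ⟨_, h2, rfl, h1.mono Set.inter_subset_left⟩
    · rw [List.mem_singleton.1 hf]
      exact ⟨_, h3, rfl, h1.mono Set.inter_subset_right⟩
  | head h _ ih =>
    obtain ⟨p, p1, p2, p3, p4⟩ := ih
    obtain ⟨h1, h2, h3⟩ := key h
    refine ⟨_ :: p, ?_, rfl, ?_, ?_⟩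
    · intro f hf
      rcases List.mem_cons.1 hf with rfl | hf
      · exact ⟨_, h2, rfl, h1.mono Set.inter_subset_left⟩
      · exact p1 f hf
    · rw [List.getLast?_cons, p3]; rfl
    · refine List.isChain_cons.2 ⟨fun y hy => ?_, p4⟩
      rw [p2] at hy
      obtain rfl := Option.some_injective _ hy
      exact h1

/-- The tables that have not been merged. -/
def alive (fs : List Factor) : Finset ℕ := insert 0 (act fs)

/-- The first components of the pairs are distinct free variables, no two in a common edge by
`indep`. Their edges are linked through quantified variables to the edge of table `l`, so all lie in
the component of that edge. -/
theorem _root_.ACQ.Star.card_le_starSize {n : ℕ} {T₀ : ℕ → Finset (ℕ → ℕ)} {A : Finset ℕ}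
    {W' : ℕ → Set ℕ} {T : ℕ → Finset (ℕ → ℕ)} {Z : ℕ → Finset (ℕ × ℕ)}
    (h : Star (vars (freeFlags Φ.encode)) n (W (start Φ.encode).1) T₀ A W' T Z)
    (hn : (start Φ.encode).1.length ≤ n) {l : ℕ} (hl : l ∈ A) :
    (Z l).card ≤ Φ.quantifiedStarSize := by
  classical
  rcases (Z l).eq_empty_or_nonempty with h0 | ⟨p₀, hp₀⟩
  · simp [h0]
  have hcard : ((Z l).image Prod.fst).card = (Z l).card := by
    refine Finset.card_image_of_injOn fun p hp q hq hpq => ?_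
    have hpq : p.1 = q.1 := hpq
    obtain ⟨h1, h2, -⟩ := h.mem l hl p hp
    exact h.indep l hl p hp q hq p.2 h1 h2 (hpq ▸ h2)
  have hfree : ∀ p ∈ Z l, ∃ y ∈ Φ.free, (y : ℕ) = p.1 := by
    intro p hp
    obtain ⟨-, -, h3, h4, -, -⟩ := h.mem l hl p hp
    have := (h.priv l hl p.1 h3 h4).1
    rwa [vars_freeFlags] at this
  let Y : Finset (Fin Φ.nVar) := Φ.free.filter fun y => (y : ℕ) ∈ (Z l).image Prod.fst
  have hY : Y.card = (Z l).card := by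
    rw [← hcard, ← Finset.card_image_of_injective Y Fin.val_injective]
    congr 1
    ext x
    simp only [Y, Finset.mem_image, Finset.mem_filter]
    constructor
    · rintro ⟨y, ⟨-, hy⟩, rfl⟩; exact hy
    · rintro ⟨p, hp, rfl⟩
      obtain ⟨y, hy, hyp⟩ := hfree p hp
      exact ⟨y, ⟨hy, p, hp, hyp.symm⟩, hyp⟩
  -- Any edge that takes part in a link contains a quantified variable. This makes both ends of the
  -- chain edges that are not contained in the set of free variables, as the definition of a
  -- component requires.
  have hne : ∀ b, (∃ a, Link (vars (freeFlags Φ.encode)) (W (start Φ.encode).1) a b) ∨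
      (∃ c, Link (vars (freeFlags Φ.encode)) (W (start Φ.encode).1) b c) →
      edge Φ b ∈ Φ.hypergraph.edgeSet ∧ (edge Φ b \ Φ.free).Nonempty := by
    rintro b (⟨a, x, -, hx, hxS⟩ | ⟨a, x, hx, -, hxS⟩) <;>
    · obtain ⟨h1, y, hy, rfl⟩ := edge_mem Φ hx
      exact ⟨h1, y, hy, mem_compl_free Φ hxS⟩
  obtain ⟨hel, x₀, hx₀⟩ := hne l (Or.inr (by
    obtain ⟨c, hc, -⟩ := Relation.TransGen.head'_iff.1 (h.mem l hl p₀ hp₀).2.2.2.2.2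
    exact ⟨c, hc⟩))
  have hstar : HasStar Φ.hypergraph Φ.free (Z l).card := by
    refine ⟨edge Φ l, hel, fun hc => hx₀.2 (hc hx₀.1), Y, hY, ?_, ?_⟩
    · intro y hy
      obtain ⟨hyf, hyZ⟩ := Finset.mem_filter.1 (Finset.mem_coe.1 hy)
      refine ⟨?_, hyf⟩
      obtain ⟨p, hp, hpy⟩ := Finset.mem_image.1 hyZ
      obtain ⟨-, h2, -, -, -, h6⟩ := h.mem l hl p hp
      obtain ⟨he, z, hz⟩ := hne p.2 (Or.inl (by
        obtain ⟨c, -, hc⟩ := Relation.TransGen.tail'_iff.1 h6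
        exact ⟨c, hc⟩))
      refine Set.mem_sUnion.2 ⟨edge Φ p.2, ⟨he, fun hc => hz.2 (hc hz.1), x₀, hx₀, z, hz, ?_⟩, ?_⟩
      · obtain ⟨q, q1, q2, q3, q4⟩ := path_of_transGen Φ h6
        exact ⟨q, q1, ⟨_, q2, hx₀.1, Set.mem_univ _, hx₀.2⟩, ⟨_, q3, hz.1, Set.mem_univ _, hz.2⟩,
          q4⟩
      · show (y : ℕ) ∈ W (start Φ.encode).1 p.2
        rwa [← hpy]
    · rintro f ⟨a, ha, rfl⟩ y hy z hz
      obtain ⟨k, hk, rfl⟩ := exists_atomAt Φ ha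
      have hmem : ∀ y ∈ Set.range (atomAt Φ k hk).2, (y : ℕ) ∈ W (start Φ.encode).1 (k + 1) :=
        fun y hy => by rw [W_start_succ Φ k hk]; exact ⟨y, hy, rfl⟩
      obtain ⟨p, hp, hpy⟩ := Finset.mem_image.1 (Finset.mem_filter.1 (Finset.mem_coe.1 hy.2)).2
      obtain ⟨q, hq, hqz⟩ := Finset.mem_image.1 (Finset.mem_filter.1 (Finset.mem_coe.1 hz.2)).2
      have hlen : (start Φ.encode).1.length = Φ.atoms.length + 1 := (readAll_spec Φ).1
      have := h.indep l hl p hp q hq (k + 1) (by omega) (by rw [hpy]; exact hmem y hy.1)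
        (by rw [hqz]; exact hmem z hz.1)
      exact Fin.ext (by rw [← hpy, ← hqz, this])
  -- A supremum in ℕ only bounds its set if the set is bounded; a star has at most as many elements
  -- as there are variables.
  refine le_csSup ⟨Φ.nVar, ?_⟩ hstar
  rintro k ⟨_, -, -, Z, rfl, -⟩
  simpa using Finset.card_le_univ Z

/-- The tables of the state have stars. -/
def HasStars (st : List Factor × List GCode) : Prop :=
  st.1.length = (start Φ.encode).1.length ∧ ∃ Z, Star (vars (freeFlags Φ.encode)) st.1.length
    (W (start Φ.encode).1) (fun l => rows (fac (start Φ.encode).1 l).2.2) (alive st.1)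
    (W st.1) (fun l => rows (fac st.1 l).2.2) Z

theorem StateOK.supp {N D : ℕ} {st : List Factor × List GCode} (h : StateOK N D st) {l : ℕ}
    (hl : l < st.1.length) : ∀ r ∈ rows (Alg.fac st.1 l).2.2, ∀ x, r x ≠ 0 ↔ x ∈ W st.1 l := by
  intro r hr
  obtain ⟨q, hq, rfl⟩ := mem_rows.1 hr
  exact (h.fac l hl).supp q hq

theorem lt_of_mem_alive {N : ℕ} {fs : List Factor} (h : Ctl N fs) {l : ℕ} (hl : l ∈ alive fs) :
    l < fs.length := by
  rcases Finset.mem_insert.1 hl with rfl | hl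
  · exact h.pos
  · exact Finset.mem_range.1 (Finset.mem_filter.1 hl).1

theorem Picked.mem_alive {N : ℕ} {fs : List Factor} (hC : Ctl N fs) {i j : ℕ}
    (h : Picked fs i j) : i ∈ alive fs ∧ j ∈ alive fs ∧ i ≠ 0 := by
  refine ⟨Finset.mem_insert_of_mem h.mem_act, ?_, ?_⟩
  · by_cases h0 : j = 0
    · rw [h0]; exact Finset.mem_insert_self _ _
    · rcases hC.status j h.hj h0 with h1 | h1
      · exact Finset.mem_insert_of_mem (Finset.mem_filter.2 ⟨Finset.mem_range.2 h.hj, h1⟩)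
      · have := h.statusj
        rw [h1] at this
        exact absurd this (by simp [trivialFactor])
  · rintro rfl
    have := h.statusi
    rw [hC.status_zero] at this
    omega

theorem HasStars.step {st : List Factor × List GCode} (h : StateOK Φ.nVar Φ.nDom st)
    (hA : (act st.1).Nonempty) (hS : HasStars Φ st) :
    HasStars Φ (Alg.step Φ.nVar (freeFlags Φ.encode) st) := by
  obtain ⟨fs, G⟩ := st
  obtain ⟨hlen, Z, hZ⟩ := hS
  obtain ⟨i, j, hp, hc⟩ := step_cases (fr := freeFlags Φ.encode) h.fac h.ctl hA
  obtain ⟨hia, hja, hi0⟩ := hp.mem_alive h.ctl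
  have hlt : ∀ l ∈ alive fs, l < fs.length := fun l hl => lt_of_mem_alive h.ctl hl
  have hE : ∀ x ∈ W fs i, x ∈ W fs j ∨ ∀ l ∈ alive fs, l ≠ i → x ∉ W fs l := fun x hx =>
    (hp.ear x hx).imp_right fun h l hl => h l (hlt l hl)
  have hal : ∀ x : List ℕ × List TRow,
      alive (replace Φ.nVar fs i j ((Alg.fac fs j).1, x)) = (alive fs).erase i := fun x => by
    rw [alive, act_replace (fs := fs) (f := (_, x)) hp rfl, alive,
      Finset.erase_insert_of_ne hi0.symm]
  have hfl : ∀ f, ∀ l ∈ alive fs, l ≠ i → l ≠ j →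
      Alg.fac (replace Φ.nVar fs i j f) l = Alg.fac fs l := fun f l hl h1 h2 => by
    rw [fac_replace _ fs i j f (hlt l hl), if_neg h1, if_neg h2]
  have hfj : ∀ f, Alg.fac (replace Φ.nVar fs i j f) j = f := fun f => by
    rw [fac_replace _ fs i j f hp.hj, if_neg hp.ne.symm, if_pos rfl]
  rcases hc with ⟨hl, hs⟩ | ⟨hl, hs⟩
  · rw [hs, HasStars, joinState]
    simp only
    rw [length_replace, hal]
    refine ⟨hlen, hZ.join hia hja hp.ne hE (fun l hl => h.supp (hlt l hl)) hl ?_ ?_ ?_ ?_⟩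
    · intro l hl h1 h2; rw [W, hfl _ l hl h1 h2]; rfl
    · intro l hl h1 h2; rw [hfl _ l hl h1 h2]
    · rw [W, hfj]
      exact vars_joinRow (h.fac j hp.hj).patLength (h.fac i hp.hi).patLength
    · intro f hf
      rw [hfj] at hf
      obtain ⟨r, hr, s, hs, hc, rfl⟩ := ((qMerge_spec (X := fun _ => (0 : ℕ))
        (ok := fun _ => True) (D := 0) (N := Φ.nVar) (fr := freeFlags Φ.encode)
        (fun s hs => ⟨(h.fac i hp.hi).gate s hs, trivial⟩) (h.fac j hp.hj).gate).2.2.2.1 f).1 hf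
      have hr1 := (h.fac j hp.hj).proper.1 r hr
      exact ⟨_, fn_mem_rows hr, _, fn_mem_rows hs, (compat_iff hr1).1 hc,
        (fn_joinRow hr1 ((h.fac i hp.hi).proper.1 s hs)).symm⟩
  · rw [hs, HasStars, sumState]
    simp only
    rw [length_replace, hal]
    refine ⟨hlen, Z, hZ.sum hja hp.ne hE ?_ ?_⟩
    · intro l hl h1
      by_cases h2 : l = j
      · subst h2; rw [W, hfj]; rfl
      · rw [W, hfl _ l hl h1 h2]; rfl
    · intro l hl h1
      by_cases h2 : l = j
      · subst h2; rw [hfj]; exact rows_sMerge (h.fac i hp.hi) (h.fac l hp.hj)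
      · rw [hfl _ l hl h1 h2]

theorem hasStars_start (hΦ : Φ.IsAcyclic) : HasStars Φ (start Φ.encode) := by
  have h := stateOK_start Φ hΦ
  have hlen : (start Φ.encode).1.length = Φ.atoms.length + 1 := (readAll_spec Φ).1
  have hal : alive (start Φ.encode).1 = Finset.range (start Φ.encode).1.length := by
    ext l
    rw [alive, act_start, hlen]
    simp only [Finset.mem_insert, Finset.mem_image, Finset.mem_univ, true_and, Finset.mem_range]
    constructor
    · rintro (rfl | ⟨k, rfl⟩) <;> omega
    · intro hl
      cases l with
      | zero => exact Or.inl rfl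
      | succ l => exact Or.inr ⟨⟨l, by omega⟩, rfl⟩
  refine ⟨rfl, fun _ => ∅, ?_⟩
  rw [hal]
  refine star_start fun l hl r hr => funext fun x => ?_
  by_cases hx : x ∈ W (start Φ.encode).1 l
  · rw [Set.indicator_of_mem hx]
  · rw [Set.indicator_of_notMem hx]
    exact (not_not.1 fun h0 => hx ((h.supp hl r hr x).1 h0)).symm

/-- Merged tables have one row. For the others, every initial table has at most as many rows as its
relation has tuples, and at most 1 + k of them determine a row. -/
theorem HasStars.length_le {st : List Factor × List GCode} (h : StateOK Φ.nVar Φ.nDom st)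
    (hS : HasStars Φ st) {l : ℕ} (hl : l < st.1.length) :
    (fac st.1 l).2.2.length ≤ Φ.size ^ (1 + Φ.quantifiedStarSize) := by
  obtain ⟨hlen, Z, hZ⟩ := hS
  have hlen' : (start Φ.encode).1.length = Φ.atoms.length + 1 := (readAll_spec Φ).1
  have hpos : 1 ≤ Φ.size := by
    have := Φ.nDom_pos
    simp only [Query.size, Query.structSize]
    omega
  by_cases hla : l ∈ alive st.1
  · rw [← (h.fac l hl).proper.card_rows]
    refine (hZ.card_le hla (h.supp hl) (B := Φ.size) ?_).trans
      (Nat.pow_le_pow_right hpos (Nat.add_le_add_left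
        (hZ.card_le_starSize Φ hlen.ge hla) 1))
    intro a ha
    cases a with
    | zero =>
      rw [start, (readAll_spec Φ).2.1, trivialFactor, rows_zeros]
      simpa using hpos
    | succ a =>
      have ht := (readAll_spec Φ).2.2 a (by omega)
      refine (ht.proper.card_rows.trans_le ht.length).trans ?_
      have := Finset.single_le_sum (f := fun R => (Φ.rel R).length) (fun _ _ => Nat.zero_le _)
        (Finset.mem_univ (atomAt Φ a (by omega)).1)
      simp only [Query.size, Query.structSize]
      omega
  · have h0 : l ≠ 0 := fun h0 => hla (by rw [h0]; exact Finset.mem_insert_self _ _)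
    rcases h.ctl.status l hl h0 with h1 | h1
    · exact absurd (Finset.mem_insert_of_mem
        (Finset.mem_filter.2 ⟨Finset.mem_range.2 hl, h1⟩)) hla
    · rw [h1]
      exact Nat.one_le_pow _ _ hpos

end Alg
end ACQ

namespace ACQ
namespace Fn
open Alg

namespace Expr

/-! ### Bounds on the loops of the programs -/

variable {Γ : List Ty} {t u : Ty} {w : List ℕ} {L : ℕ}

/-- For loops that build up data: a size measure grows by at most `c` per round and can never exceed
`M`, so the inner loops, which run over these data, may be bounded in terms of `M`. -/
theorem foldBd_grow {α β : Type} {g : β → α → β} {B : β → α → Prop} (P : ℕ → β → Prop)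
    (c M : ℕ) : ∀ (l : List α) (b : β) (n : ℕ), P n b → n + l.length * c ≤ M →
      (∀ m b x, x ∈ l → m + c ≤ M → P m b → B b x ∧ P (m + c) (g b x)) →
      foldBd g B l b ∧ P (n + l.length * c) (l.foldl g b)
  | [], _, n, hb, _, _ => ⟨trivial, by simpa using hb⟩
  | x :: l, b, n, hb, hM, h => by
    have e : n + (x :: l).length * c = n + c + l.length * c := by
      rw [List.length_cons]; ring
    rw [e] at hM ⊢
    obtain ⟨h1, h2⟩ := h n b x (by simp) (by omega) hb
    obtain ⟨h3, h4⟩ := foldBd_grow P c M l (g b x) (n + c) h2 hM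
      fun m b y hy => h m b y (by simp [hy])
    exact ⟨⟨h1, h3⟩, h4⟩

theorem foldBd_of_forall {α β : Type} {g : β → α → β} {B : β → α → Prop} {l : List α}
    {b : β} (h : ∀ b, ∀ x ∈ l, B b x) : foldBd g B l b :=
  foldBd_of_inv (fun _ _ => True) l b 0 trivial fun _ b x hx _ _ => ⟨h b x hx, trivial⟩

theorem bd_fold {l : Expr Γ (.list t)} {a : Expr Γ u} {f : Expr (t :: u :: Γ) u} {env : Env Γ}
    (hl : l.Bd L w env) (ha : a.Bd L w env) (hL : (l.eval w env : List t.den).length ≤ L)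
    (h : ∀ x ∈ (l.eval w env : List t.den), ∀ b, f.Bd L w (x, b, env)) :
    (fold l a f).Bd L w env :=
  ⟨hl, ha, hL, foldBd_of_forall fun b x hx => h x hx b⟩

theorem bd_range {n : Expr Γ .nat} {env : Env Γ} (hn : n.Bd L w env)
    (hL : (n.eval w env : ℕ) ≤ L) : (range n).Bd L w env := ⟨hn, hL⟩

theorem bd_fold_range {n : Expr Γ .nat} {a : Expr Γ u} {f : Expr (.nat :: u :: Γ) u} {env : Env Γ}
    (hn : n.Bd L w env) (ha : a.Bd L w env) (hL : (n.eval w env : ℕ) ≤ L)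
    (h : ∀ x : ℕ, ∀ b, f.Bd L w (x, b, env)) : (fold (.range n) a f).Bd L w env :=
  bd_fold ⟨hn, hL⟩ ha (by simpa [eval] using hL) fun x _ b => h x b

theorem bd_anyL {l : Expr Γ (.list t)} {b : Expr (t :: .nat :: Γ) .nat} {env : Env Γ}
    (hl : l.Bd L w env) (hL : (l.eval w env : List t.den).length ≤ L)
    (h : ∀ x ∈ (l.eval w env : List t.den), ∀ a, b.Bd L w (x, a, env)) : (anyL l b).Bd L w env :=
  bd_fold hl trivial hL fun x hx a => ⟨trivial, h x hx a, trivial, trivial⟩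

theorem bd_allR {n : Expr Γ .nat} {b : Expr (.nat :: .nat :: Γ) .nat} {env : Env Γ}
    (hn : n.Bd L w env) (hL : (n.eval w env : ℕ) ≤ L)
    (h : ∀ x a : ℕ, b.Bd L w (x, a, env)) : (allL (.range n) b).Bd L w env :=
  bd_fold_range hn trivial hL fun x a => ⟨trivial, h x a, trivial, trivial⟩

theorem bd_anyR {n : Expr Γ .nat} {b : Expr (.nat :: .nat :: Γ) .nat} {env : Env Γ}
    (hn : n.Bd L w env) (hL : (n.eval w env : ℕ) ≤ L)
    (h : ∀ x a : ℕ, b.Bd L w (x, a, env)) : (anyL (.range n) b).Bd L w env :=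
  bd_fold_range hn trivial hL fun x a => ⟨trivial, h x a, trivial, trivial⟩

theorem bd_tabE {n : Expr Γ .nat} {b : Expr (.nat :: .list t :: Γ) t} {env : Env Γ}
    (hn : n.Bd L w env) (hL : (n.eval w env : ℕ) ≤ L)
    (h : ∀ (x : ℕ) a, b.Bd L w (x, a, env)) : (tabE n b).Bd L w env :=
  bd_fold_range hn trivial hL fun x a => ⟨h x a, trivial⟩

theorem bd_nth {l : Expr Γ .row} {i : Expr Γ .nat} {env : Env Γ} (hl : l.Bd L w env)
    (hi : i.Bd L w env) (hL : (l.eval w env : List ℕ).length ≤ L) : (nth l i).Bd L w env :=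
  ⟨⟨hl, hi⟩, bd_fold trivial ⟨trivial, trivial⟩ hL fun _ _ _ => by simp [Bd]⟩

theorem bd_facE {l : Expr Γ (.list .factor)} {i : Expr Γ .nat} {env : Env Γ} (hl : l.Bd L w env)
    (hi : i.Bd L w env) (hL : (l.eval w env : List Factor).length ≤ L) :
    (facE l i).Bd L w env :=
  ⟨⟨hl, hi⟩, bd_fold trivial (by simp [Bd]) hL fun _ _ _ => by simp [Bd]⟩

theorem bd_len {l : Expr Γ (.list t)} {env : Env Γ} (hl : l.Bd L w env)
    (hL : (l.eval w env : List t.den).length ≤ L) : (len l).Bd L w env :=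
  bd_fold hl trivial hL fun _ _ _ => by simp [Bd]

theorem bd_predE {n : Expr Γ .nat} {env : Env Γ} (hn : n.Bd L w env)
    (hL : (n.eval w env : ℕ) ≤ L) : (predE n).Bd L w env :=
  bd_fold_range hn trivial hL fun _ _ => by simp [Bd]

theorem bd_rev {l : Expr Γ (.list t)} {env : Env Γ} (hl : l.Bd L w env)
    (hL : (l.eval w env : List t.den).length ≤ L) : (rev l).Bd L w env :=
  bd_fold hl trivial hL fun _ _ _ => by simp [Bd]

theorem bd_zerosE {n : Expr Γ .nat} {env : Env Γ} (hn : n.Bd L w env)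
    (hL : (n.eval w env : ℕ) ≤ L) : (zerosE n).Bd L w env :=
  bd_tabE hn hL fun _ _ => trivial

theorem bd_trivE {n : Expr Γ .nat} {a : ℕ} {env : Env Γ} (hn : n.Bd L w env)
    (hL : (n.eval w env : ℕ) ≤ L) : (trivE n a).Bd L w env :=
  ⟨trivial, bd_zerosE hn hL, ⟨bd_zerosE hn hL, trivial⟩, trivial⟩

theorem bd_compatE {a : Expr Γ .nat} {b c : Expr Γ .row} {env : Env Γ} (ha : a.Bd L w env)
    (hb : b.Bd L w env) (hc : c.Bd L w env) (h1 : (a.eval w env : ℕ) ≤ L)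
    (h2 : (b.eval w env : List ℕ).length ≤ L) (h3 : (c.eval w env : List ℕ).length ≤ L) :
    (compatE a b c).Bd L w env :=
  ⟨⟨ha, hb, hc⟩, bd_allR trivial h1 fun x a => by
    repeat' first
      | exact trivial
      | exact bd_nth trivial trivial h2
      | exact bd_nth trivial trivial h3
      | apply And.intro⟩

theorem bd_eqRowE {a : Expr Γ .nat} {b c : Expr Γ .row} {env : Env Γ} (ha : a.Bd L w env)
    (hb : b.Bd L w env) (hc : c.Bd L w env) (h1 : (a.eval w env : ℕ) ≤ L)
    (h2 : (b.eval w env : List ℕ).length ≤ L) (h3 : (c.eval w env : List ℕ).length ≤ L) :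
    (eqRowE a b c).Bd L w env :=
  ⟨⟨ha, hb, hc⟩, bd_allR trivial h1 fun x a => by
    repeat' first
      | exact trivial
      | exact bd_nth trivial trivial h2
      | exact bd_nth trivial trivial h3
      | apply And.intro⟩

theorem bd_maskE {a : Expr Γ .nat} {b c : Expr Γ .row} {env : Env Γ} (ha : a.Bd L w env)
    (hb : b.Bd L w env) (hc : c.Bd L w env) (h1 : (a.eval w env : ℕ) ≤ L)
    (h2 : (b.eval w env : List ℕ).length ≤ L) (h3 : (c.eval w env : List ℕ).length ≤ L) :
    (maskE a b c).Bd L w env :=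
  ⟨⟨ha, hb, hc⟩, bd_tabE trivial h1 fun x a => by
    repeat' first
      | exact trivial
      | exact bd_nth trivial trivial h2
      | exact bd_nth trivial trivial h3
      | apply And.intro⟩

theorem bd_joinE {a : Expr Γ .nat} {b c d : Expr Γ .row} {env : Env Γ} (ha : a.Bd L w env)
    (hb : b.Bd L w env) (hc : c.Bd L w env) (hd : d.Bd L w env) (h1 : (a.eval w env : ℕ) ≤ L)
    (h2 : (b.eval w env : List ℕ).length ≤ L) (h3 : (c.eval w env : List ℕ).length ≤ L)
    (h4 : (d.eval w env : List ℕ).length ≤ L) :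
    (joinE a b c d).Bd L w env :=
  ⟨⟨ha, hb, hc, hd⟩, bd_tabE trivial h1 fun x a => by
    repeat' first
      | exact trivial
      | exact bd_nth trivial trivial h2
      | exact bd_nth trivial trivial h3
      | exact bd_nth trivial trivial h4
      | apply And.intro⟩

/-- The rows of a table have at most `L` entries. -/
def Short (L : ℕ) (T : List TRow) : Prop := ∀ r ∈ T, r.1.length ≤ L

theorem Short.ins {T : List TRow} {a : TRow} {N : ℕ} (h : Short L T) (ha : a.1.length ≤ L) :
    Short L (ins N a T) := by
  rw [Alg.ins]
  split_ifs
  · exact h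
  · intro r hr
    rcases List.mem_cons.1 hr with rfl | hr
    · exact ha
    · exact h r hr

theorem bd_insE {a : Expr Γ .nat} {b : Expr Γ .trow} {c : Expr Γ (.list .trow)} {env : Env Γ}
    (ha : a.Bd L w env) (hb : b.Bd L w env) (hc : c.Bd L w env) (h1 : (a.eval w env : ℕ) ≤ L)
    (h2 : (b.eval w env : TRow).1.length ≤ L) (h3 : (c.eval w env : List TRow).length ≤ L)
    (h4 : Short L (c.eval w env)) :
    (insE a b c).Bd L w env := by
  refine ⟨⟨ha, hb, hc⟩, trivial, bd_anyL trivial h3 fun x hx a => ?_, trivial, trivial, trivial⟩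
  refine bd_eqRowE trivial trivial trivial h1 (h4 x hx) h2

end Expr
end Fn
end ACQ

/-! ### Sizes of tables and gate lists during a merge. -/

namespace ACQ
namespace Fn
open Alg

namespace Expr

variable {Γ : List Ty} {t u : Ty} {w : List ℕ} {L : ℕ}

theorem bd_fold_grow {l : Expr Γ (.list t)} {a : Expr Γ u} {f : Expr (t :: u :: Γ) u}
    {env : Env Γ} (P : ℕ → u.den → Prop) (c M n : ℕ)
    (hl : l.Bd L w env) (ha : a.Bd L w env) (hL : (l.eval w env : List t.den).length ≤ L)
    (h0 : P n (a.eval w env)) (hM : n + (l.eval w env : List t.den).length * c ≤ M)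
    (h : ∀ m b, ∀ x ∈ (l.eval w env : List t.den), m + c ≤ M → P m b →
      f.Bd L w (x, b, env) ∧ P (m + c) (f.eval w (x, b, env))) :
    (fold l a f).Bd L w env ∧
      P (n + (l.eval w env : List t.den).length * c) ((fold l a f).eval w env) := by
  obtain ⟨h1, h2⟩ := foldBd_grow P c M (g := fun b x => f.eval w (x, b, env))
    (B := fun b x => f.Bd L w (x, b, env)) (l.eval w env) (a.eval w env) n h0 hM
    fun m b x hx => h m b x hx
  exact ⟨⟨hl, ha, hL, h1⟩, h2⟩

theorem ifle_cases {P : t.den → Prop} {a b : Expr Γ .nat} {p q : Expr Γ t} {env : Env Γ}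
    (hp : P (p.eval w env)) (hq : P (q.eval w env)) : P ((ifle a b p q).eval w env) := by
  show P (if _ then _ else _)
  split_ifs
  · exact hp
  · exact hq

/-- A state of a merge, of bounded size. -/
def Acc (L m : ℕ) (acc : List TRow × List GCode) : Prop :=
  acc.1.length ≤ m ∧ acc.2.length ≤ m ∧ Short L acc.1

theorem Acc.mono {m n : ℕ} {acc : List TRow × List GCode} (h : Acc L m acc) (hmn : m ≤ n) :
    Acc L n acc := ⟨h.1.trans hmn, h.2.1.trans hmn, h.2.2⟩

/-- An inner round adds at most one row and one gate, so a single number bounds both lengths; an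
outer round increases it by the number of rows of the first table. -/
theorem bd_qMergeP {N : ℕ} {fr : List ℕ} {Ti Tj : List TRow} {G : List GCode}
    (hN : N ≤ L) (hfr : fr.length ≤ L) (hi : Ti.length ≤ L) (hj : Tj.length ≤ L)
    (si : Short L Ti) (sj : Short L Tj) (hM : G.length + Tj.length * Ti.length ≤ L) :
    qMergeP.Bd L w ((N, fr, Ti, Tj, G), ()) ∧
      Acc L (G.length + Tj.length * Ti.length) (qMerge N fr Ti Tj G) := by
  rw [← eval_qMergeP w, qMergeP]
  refine bd_fold_grow (u := .prod (.list .trow) .gates) (Acc L) Ti.length L G.length trivial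
    ⟨trivial, trivial⟩ hj ⟨Nat.zero_le _, le_rfl, by simp [Short, eval]⟩ hM
    fun m acc r hr hm hacc => ?_
  rw [show m + Ti.length = m + Ti.length * 1 by rw [mul_one]] at hm ⊢
  refine bd_fold_grow (u := .prod (.list .trow) .gates) (Acc L) 1 L m trivial trivial hi hacc hm ?_
  intro k acc s hs hk hacc
  have hl1 : acc.1.length ≤ L := hacc.1.trans (by omega)
  have hl2 : acc.2.length ≤ L := hacc.2.1.trans (by omega)
  have hJ : (joinRow N fr r.1 s.1).length ≤ L := by simpa [joinRow] using hN
  refine ⟨⟨trivial, bd_compatE trivial trivial trivial hN (sj r hr) (si s hs),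
    ⟨bd_insE trivial ⟨bd_joinE trivial trivial trivial trivial hN hfr (sj r hr) (si s hs),
      bd_len trivial hl2⟩ trivial hN ?_ hl1 hacc.2.2, ⟨trivial, trivial, trivial⟩,
      trivial⟩, trivial⟩, ifle_cases (t := .prod (.list .trow) .gates) (P := Acc L (k + 1)) ?_
      (hacc.mono (Nat.le_succ k))⟩
  · simp only [eval, eval_joinE]
    exact hJ
  · simp only [eval, eval_insE, eval_joinE, eval_len]
    refine ⟨(length_ins_le _ _ _).trans (Nat.add_le_add_right hacc.1 1), ?_, hacc.2.2.ins hJ⟩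
    exact Nat.add_le_add_right hacc.2.1 1

/-- A table of bounded size. -/
def TAcc (L m : ℕ) (T : List TRow) : Prop := T.length ≤ m ∧ Short L T

/-- A list of gates of bounded length. -/
def GAcc (m : ℕ) (acc : ℕ × List GCode) : Prop := acc.2.length ≤ m

theorem bd_projP {N : ℕ} {fr : List ℕ} {Ti : List TRow} (hN : N ≤ L) (hfr : fr.length ≤ L)
    (hi : Ti.length ≤ L) (si : Short L Ti) : projP.Bd L w ((N, fr, Ti), ()) ∧
      (proj N fr Ti).length ≤ Ti.length ∧ Short L (proj N fr Ti) := by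
  suffices h : projP.Bd L w ((N, fr, Ti), ()) ∧ TAcc L (0 + Ti.length * 1) (proj N fr Ti) by
    simpa [TAcc] using h
  rw [← eval_projP w, projP]
  refine bd_fold_grow (u := .list .trow) (TAcc L) 1 L 0 trivial trivial hi
    ⟨le_rfl, by simp [Short, eval]⟩ (by simpa [eval] using hi) ?_
  intro m acc s hs hm hacc
  have hJ : (mask N fr s.1).length ≤ L := by simpa [mask] using hN
  refine ⟨bd_insE trivial ⟨bd_maskE trivial trivial trivial hN hfr (si s hs), trivial⟩ trivial hN
    ?_ (hacc.1.trans (by omega)) hacc.2, ?_⟩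
  · simp only [eval, eval_maskE]
    exact hJ
  · simp only [eval, eval_insE, eval_maskE]
    exact ⟨(length_ins_le _ _ _).trans (Nat.add_le_add_right hacc.1 1), hacc.2.ins hJ⟩

/-- The hypothesis on the entries is needed because the predecessor of an entry is computed by a
loop whose number of rounds is that entry. -/
theorem bd_monomP {N : ℕ} {W : List ℕ} {s : TRow} {G : List GCode} (hN : N ≤ L)
    (hW : W.length ≤ L) (hs : s.1.length ≤ L) (hv : ∀ x, s.1.getD x 0 ≤ L)
    (hM : G.length + N * 2 ≤ L) : monomP.Bd L w ((N, W, s, G), ()) ∧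
      GAcc (G.length + N * 2) (monom N W s G) := by
  rw [← eval_monomP w, monomP, show N * 2 = (List.range N).reverse.length * 2 by simp]
  refine bd_fold_grow (u := .prod .nat .gates) GAcc 2 L G.length (bd_range trivial hN)
    ⟨trivial, trivial⟩ (by simpa [eval] using hN) le_rfl (by simpa [eval] using hM) ?_
  intro m acc x hx hm hacc
  have hl : acc.2.length ≤ L := le_trans hacc (by omega)
  have hn1 : (nth (.fst (.fst (.snd (.snd v2)))) v0 : Expr [.nat, .prod .nat .gates,
      .prod .nat (.prod .row (.prod .trow .gates))] .nat).Bd L w (x, acc, (N, W, s, G), ()) :=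
    bd_nth trivial trivial hs
  refine ⟨⟨trivial, hn1, ⟨trivial, bd_nth trivial trivial hW, trivial,
    ⟨bd_len trivial hl, trivial⟩, ⟨trivial, trivial, bd_len trivial hl⟩, ⟨trivial,
      bd_predE hn1 ?_, trivial⟩, trivial⟩, trivial⟩, ?_⟩
  · rw [eval_nth]
    exact hv x
  · refine ifle_cases (t := .prod .nat .gates) (P := GAcc (m + 2))
      (ifle_cases (t := .prod .nat .gates) (P := GAcc (m + 2)) (le_trans hacc
        (Nat.le_add_right m 2)) ?_)
      (le_trans hacc (Nat.le_add_right m 2))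
    exact Nat.add_le_add_right hacc 2

/-- A compatible row costs two gates for each variable and one for the addition; the remaining gate
is the constant 0 at the start. -/
theorem bd_sSumP {N R : ℕ} {W : List ℕ} {P : List TRow} {r : TRow} {G : List GCode} (hN : N ≤ L)
    (hW : W.length ≤ L) (hP : P.length ≤ R) (hR : R ≤ L) (sP : Short L P) (sr : r.1.length ≤ L)
    (hv : ∀ s ∈ P, ∀ x, s.1.getD x 0 ≤ L)
    (hM : G.length + 1 + R * (N * 2 + 1) ≤ L) : sSumP.Bd L w ((N, W, P, r, G), ()) ∧
      GAcc (G.length + 1 + R * (N * 2 + 1)) (sSum N W P r G) := by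
  have hP' := Nat.mul_le_mul_right (N * 2 + 1) hP
  suffices h : sSumP.Bd L w ((N, W, P, r, G), ()) ∧
      GAcc (G.length + 1 + P.length * (N * 2 + 1)) (sSum N W P r G) from
    ⟨h.1, h.2.trans (Nat.add_le_add_left hP' _)⟩
  rw [← eval_sSumP w, sSumP]
  refine bd_fold_grow (u := .prod .nat .gates) GAcc (N * 2 + 1) L (G.length + 1) trivial
    ⟨bd_len trivial (show G.length ≤ L by omega), ⟨trivial, trivial, trivial⟩, trivial⟩
    (hP.trans hR) le_rfl (show G.length + 1 + P.length * (N * 2 + 1) ≤ L by omega) ?_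
  intro m acc s hs hm hacc
  have hacc : acc.2.length ≤ m := hacc
  obtain ⟨h1, h2⟩ := bd_monomP (w := w) (L := L) (s := s) (G := acc.2) hN hW (sP s hs) (hv s hs)
    (by omega)
  unfold GAcc at h2
  refine ⟨⟨trivial, bd_compatE trivial trivial trivial hN sr (sP s hs),
    ⟨⟨⟨trivial, trivial, trivial, trivial⟩, h1⟩, bd_len trivial ?_, ⟨trivial, trivial, trivial⟩,
      trivial⟩, trivial⟩, ifle_cases (t := .prod .nat .gates) (P := GAcc (m + (N * 2 + 1))) ?_
      (show acc.2.length ≤ _ by omega)⟩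
  · simp only [eval, eval_monomE]
    exact h2.trans (by omega)
  · simp only [eval, eval_monomE]
    show (monom N W s acc.2).2.length + 1 ≤ _
    omega

/-- Stated with one common bound `R` on the numbers of rows, so that the growth of a round does not
depend on which tables are merged. -/
theorem bd_sMergeP {N R : ℕ} {fr W : List ℕ} {Ti Tj : List TRow} {G : List GCode} (hN : N ≤ L)
    (hfr : fr.length ≤ L) (hW : W.length ≤ L) (hi : Ti.length ≤ R) (hR : R ≤ L)
    (hj : Tj.length ≤ R) (si : Short L Ti) (sj : Short L Tj)
    (hv : ∀ s ∈ proj N fr Ti, ∀ x, s.1.getD x 0 ≤ L)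
    (hM : G.length + R * (R * (N * 2 + 1) + 2) ≤ L) :
    sMergeP.Bd L w ((N, fr, W, Ti, Tj, G), ()) ∧
      Acc L (G.length + R * (R * (N * 2 + 1) + 2)) (sMerge N fr W Ti Tj G) := by
  have hj' := Nat.mul_le_mul_right (R * (N * 2 + 1) + 2) hj
  obtain ⟨p1, p2, p3⟩ := bd_projP (w := w) hN hfr (hi.trans hR) si
  suffices h : sMergeP.Bd L w ((N, fr, W, Ti, Tj, G), ()) ∧
      Acc L (G.length + Tj.length * (R * (N * 2 + 1) + 2)) (sMerge N fr W Ti Tj G) from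
    ⟨h.1, h.2.mono (Nat.add_le_add_left hj' _)⟩
  rw [← eval_sMergeP w, sMergeP, Bd, eval, eval_projE, and_assoc]
  refine ⟨⟨⟨trivial, trivial, trivial⟩, p1⟩, ?_⟩
  refine bd_fold_grow (u := .prod (.list .trow) .gates) (Acc L) (R * (N * 2 + 1) + 2) L G.length
    trivial ⟨trivial, trivial⟩ (hj.trans hR) ⟨Nat.zero_le _, le_rfl, by simp [Short, eval]⟩
    (show G.length + Tj.length * (R * (N * 2 + 1) + 2) ≤ L by omega) ?_
  intro m acc r hr hm hacc
  have hacc2 := hacc.2.1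
  obtain ⟨h1, h2⟩ := bd_sSumP (w := w) (L := L) (R := R) (r := r) (G := acc.2) hN hW (p2.trans hi)
    hR p3 (sj r hr) hv (by omega)
  unfold GAcc at h2
  refine ⟨⟨⟨⟨trivial, trivial, trivial, trivial, trivial⟩, h1⟩,
    ⟨⟨trivial, bd_len trivial ?_⟩, trivial⟩, ⟨trivial, trivial, trivial⟩, trivial⟩, ?_⟩
  · simp only [eval, eval_sSumE]
    exact h2.trans (by omega)
  · simp only [eval, eval_sSumE, eval_len]
    refine ⟨show acc.1.length + 1 ≤ _ by have := hacc.1; omega,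
      show (sSum N W (proj N fr Ti) r acc.2).2.length + 1 ≤ _ by omega, ?_⟩
    intro q hq
    rcases List.mem_cons.1 hq with rfl | hq
    · exact sj r hr
    · exact hacc.2.2 q hq

end Expr
end Fn
end ACQ

/-! ### Loop bounds for a round and for reading the input. -/

namespace ACQ
namespace Fn
open Alg

namespace Expr

variable {Γ : List Ty} {t u : Ty} {w : List ℕ} {L : ℕ}

/-- A table with at most `R` rows, whose rows and entries are bounded by `L`. -/
structure FacBd (L R : ℕ) (f : Factor) : Prop where
  pat : f.2.1.length ≤ L
  length : f.2.2.length ≤ R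
  short : Short L f.2.2
  le : ∀ r ∈ f.2.2, ∀ x, r.1.getD x 0 ≤ L

theorem FacBd.le_proj {N R : ℕ} {fr : List ℕ} {f : Factor} (h : FacBd L R f) :
    ∀ s ∈ proj N fr f.2.2, ∀ x, s.1.getD x 0 ≤ L := by
  intro s hs x
  obtain ⟨r, hr, rfl⟩ := (proj_spec N fr f.2.2).2.2.2 s hs
  have := h.le r hr x
  simp only [mask, getD_tab]
  split_ifs <;> omega

/-- A join adds at most `R` * `R` gates, which is less than the bound for summing out, so the latter
serves for both. -/
theorem bd_mergeP {N R : ℕ} {fr : List ℕ} {fi fj : Factor} {G : List GCode} (hN : N ≤ L)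
    (hfr : fr.length ≤ L) (hi : FacBd L R fi) (hj : FacBd L R fj) (hR : R ≤ L)
    (hM : G.length + R * (R * (N * 2 + 1) + 2) ≤ L) :
    mergeP.Bd L w ((N, fr, fi, fj, G), ()) ∧
      (merge N fr fi fj G).2.length ≤ G.length + R * (R * (N * 2 + 1) + 2) := by
  have hq : G.length + fj.2.2.length * fi.2.2.length ≤ G.length + R * (R * (N * 2 + 1) + 2) := by
    refine Nat.add_le_add_left (Nat.mul_le_mul hj.length (hi.length.trans ?_)) _
    nlinarith [Nat.zero_le (R * (N * 2))]
  obtain ⟨q1, q2⟩ := bd_qMergeP (w := w) hN hfr (hi.length.trans hR) (hj.length.trans hR)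
    hi.short hj.short (hq.trans hM)
  obtain ⟨s1, s2⟩ := bd_sMergeP (w := w) (W := fj.2.1) hN hfr hj.pat hi.length hR hj.length
    hi.short hj.short hi.le_proj hM
  refine ⟨⟨trivial, bd_anyR trivial hN fun x a => ⟨trivial, bd_nth trivial trivial hi.pat,
      ⟨trivial, bd_nth trivial trivial hj.pat, ⟨bd_nth trivial trivial hfr, trivial, trivial,
        trivial⟩, trivial⟩, trivial⟩,
    ⟨⟨⟨trivial, trivial, trivial, trivial, trivial⟩, q1⟩, ⟨trivial,
      bd_joinE trivial trivial trivial trivial hN hfr hj.pat hi.pat, trivial⟩, trivial⟩,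
    ⟨⟨trivial, trivial, trivial, trivial, trivial, trivial⟩, s1⟩, ⟨trivial, trivial, trivial⟩,
      trivial⟩, ?_⟩
  rw [merge]
  split_ifs
  · exact q2.2.1.trans hq
  · exact s2.2.1

theorem bd_goodP {N R : ℕ} {fs : List Factor} {i j : ℕ} (hN : N ≤ L)
    (hfs : fs.length ≤ L) (hf : ∀ l, FacBd L R (fac fs l)) :
    goodP.Bd L w ((N, fs, i, j), ()) := by
  have hp : ∀ {Γ : List Ty} (env : Env Γ) {l : Expr Γ (.list .factor)} {a x : Expr Γ .nat},
      l.Bd L w env → a.Bd L w env → x.Bd L w env → l.eval w env = fs →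
      (nth (.fst (.snd (facE l a))) x).Bd L w env := by
    intro Γ env l a x hl ha hx e
    refine bd_nth (bd_facE hl ha (by rw [e]; exact hfs)) hx ?_
    simp only [eval, eval_facE, e]
    exact (hf _).pat
  have hlen : (Expr.eval w (len (.fst (.snd v0)) : Expr [.prod .nat (.prod (.list .factor)
      (.prod .nat .nat))] .nat) ((N, fs, i, j), ()) : ℕ) ≤ L := by
    rw [eval_len]; exact hfs
  have h1 := fun x : Expr [.prod .nat (.prod (.list .factor) (.prod .nat .nat))] .nat =>
    bd_facE (w := w) (L := L) (env := ((N, fs, i, j), ())) (l := .fst (.snd v0)) (i := x) trivial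
  refine ⟨trivial, h1 _ trivial hfs, ⟨h1 _ trivial hfs, trivial, ⟨trivial, h1 _ trivial hfs,
    ⟨trivial, trivial, ⟨trivial, trivial, trivial, ?_⟩, ?_⟩, trivial⟩, trivial⟩, trivial⟩
  -- An `ifeq` contains its second branch twice, so the same obligation appears twice, here and
  -- again for the inner test.
  all_goals
    refine bd_allR trivial hN fun x a => ⟨hp _ trivial trivial trivial rfl, trivial, trivial,
      trivial, hp _ trivial trivial trivial rfl, trivial, ?_⟩
    refine bd_allR (bd_len trivial hfs) (by rw [eval_len]; exact hfs) fun l b =>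
      ⟨trivial, trivial, ⟨trivial, trivial, trivial, ?_⟩, ?_⟩
    all_goals exact ⟨hp _ trivial trivial trivial rfl, trivial, trivial, trivial⟩

theorem bd_pickP {N R : ℕ} {fs : List Factor} (hN : N ≤ L)
    (hfs : fs.length ≤ L) (hf : ∀ l, FacBd L R (fac fs l)) :
    pickP.Bd L w ((N, fs), ()) := by
  refine bd_fold_range (bd_len trivial hfs) ⟨trivial, trivial⟩ (by rw [eval_len]; exact hfs)
    fun i b => bd_fold_range (bd_len trivial hfs) trivial (by rw [eval_len]; exact hfs)
    fun j c => ⟨trivial, ⟨⟨trivial, trivial, trivial, trivial⟩, bd_goodP hN hfs hf⟩,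
      ⟨trivial, trivial⟩, trivial⟩

theorem bd_replaceP {N : ℕ} {fs : List Factor} {i j : ℕ} {f : Factor} (hN : N ≤ L)
    (hfs : fs.length ≤ L) : replaceP.Bd L w ((N, fs, i, j, f), ()) := by
  refine bd_tabE (bd_len trivial hfs) (by rw [eval_len]; exact hfs) fun l b => ?_
  repeat' first
    | exact trivial
    | exact bd_trivE trivial hN
    | exact bd_facE trivial trivial hfs
    | apply And.intro

theorem bd_stepP {N R : ℕ} {fr : List ℕ} {fs : List Factor} {G : List GCode} (hN : N ≤ L)
    (hfr : fr.length ≤ L) (hfs : fs.length ≤ L) (hf : ∀ l, FacBd L R (fac fs l)) (hR : R ≤ L)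
    (hM : G.length + R * (R * (N * 2 + 1) + 2) ≤ L) :
    stepP.Bd L w ((N, fr, fs, G), ()) ∧
      (step N fr (fs, G)).2.length ≤ G.length + R * (R * (N * 2 + 1) + 2) := by
  obtain ⟨h1, h2⟩ := bd_mergeP (w := w) hN hfr (hf (pick N fs).1) (hf (pick N fs).2) hR hM
  refine ⟨⟨⟨⟨trivial, trivial⟩, bd_pickP hN hfs hf⟩, ⟨⟨trivial, trivial,
    bd_facE trivial trivial hfs, bd_facE trivial trivial hfs, trivial⟩, ?_⟩,
    ⟨⟨trivial, trivial, trivial, trivial, trivial⟩, bd_replaceP hN hfs⟩, trivial⟩, h2⟩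
  simp only [eval, eval_pickE, eval_facE]
  exact h1

theorem bd_parseRowP {N ar p pos : ℕ} (hN : N ≤ L) (har : ar ≤ L) :
    parseRowP.Bd L w ((N, ar, p, pos), ()) := by
  refine bd_tabE trivial hN fun x b => bd_fold_range trivial trivial har fun q c => ?_
  repeat' first | exact trivial | apply And.intro

theorem bd_parseStepP {N ar p : ℕ} {acc : ℕ × List TRow} (hN : N ≤ L) (har : ar ≤ L)
    (hacc : acc.2.length ≤ L) (hs : Short L acc.2) :
    parseStepP.Bd L w ((N, ar, p, acc), ()) := by
  have hr : (Expr.eval w (parseRowE (.fst v0) (.fst (.snd v0)) (.fst (.snd (.snd v0)))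
      (.fst (.snd (.snd (.snd v0)))) : Expr [.prod .nat (.prod .nat (.prod .nat
        (.prod .nat (.list .trow))))] .row) ((N, ar, p, acc), ()) : List ℕ).length ≤ L := by
    rw [eval_parseRowE, parseRow, length_tab]
    exact hN
  refine ⟨⟨⟨trivial, trivial, trivial, trivial⟩, bd_parseRowP hN har⟩, ⟨trivial, trivial⟩,
    trivial, bd_allR trivial har fun x a => ?_,
    bd_insE trivial ⟨trivial, trivial⟩ trivial hN hr hacc hs, trivial⟩
  repeat' first
    | exact trivial
    | exact bd_nth trivial ⟨⟨trivial, trivial⟩, trivial⟩ hr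
    | apply And.intro

theorem bd_parseAtomP {N ar p pos cnt : ℕ} (hN : N ≤ L) (har : ar ≤ L) (hcnt : cnt ≤ L) :
    parseAtomP.Bd L w ((N, ar, p, pos, cnt), ()) := by
  refine ⟨trivial, bd_tabE trivial hN fun x a => bd_anyR trivial har fun q b => ?_, ?_⟩
  · repeat' first | exact trivial | apply And.intro
  have hlen : (List.range cnt).reverse.length = cnt := by simp
  refine And.left (bd_fold_grow (u := .prod .nat (.list .trow)) (fun m (acc : ℕ × List TRow) =>
    TAcc L m acc.2) 1 L 0 ?_ ?_ ?_ ?_ ?_ fun m acc x _ hm hacc => ?_)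
  · exact bd_range trivial hcnt
  · exact ⟨trivial, trivial⟩
  · exact hlen.trans_le hcnt
  · exact ⟨le_rfl, by simp [Short, eval]⟩
  · simpa [eval] using hcnt
  have hl := hacc.1
  refine ⟨⟨⟨trivial, trivial, trivial, trivial⟩,
    bd_parseStepP hN har (show acc.2.length ≤ L by omega) hacc.2⟩, ?_⟩
  rw [eval_parseStepE]
  show TAcc L (m + 1) (if _ then _ else _)
  split_ifs
  · refine ⟨(length_ins_le _ _ _).trans (Nat.add_le_add_right hl 1), hacc.2.ins ?_⟩
    rw [parseRow, length_tab]
    exact hN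
  · exact ⟨hl.trans (Nat.le_succ m), hacc.2⟩

end Expr
end Fn
end ACQ

/-! ### Loop bounds in terms of the size of the query. -/

namespace ACQ

namespace Query

variable (Φ : Query)

theorem arity_le_size {a : Σ R : Fin Φ.nRel, Fin (Φ.arity R) → Fin Φ.nVar} (ha : a ∈ Φ.atoms) :
    Φ.arity a.1 ≤ Φ.size := by
  have := List.single_le_sum (l := Φ.atoms.map fun a => 1 + Φ.arity a.1) (by simp) _
    (List.mem_map_of_mem ha)
  simp only [size, formulaSize]
  omega

theorem length_rel_le_size (R : Fin Φ.nRel) : (Φ.rel R).length ≤ Φ.size := by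
  have := Finset.single_le_sum (f := fun R => (Φ.rel R).length) (fun _ _ => Nat.zero_le _)
    (Finset.mem_univ R)
  simp only [size, structSize]
  omega

theorem length_atoms_lt_size : Φ.atoms.length < Φ.size := by
  have h : Φ.atoms.length ≤ (Φ.atoms.map fun a => 1 + Φ.arity a.1).sum := by
    induction Φ.atoms with
    | nil => simp
    | cons a l ih => simp only [List.length_cons, List.map_cons, List.sum_cons]; omega
  have := Φ.nDom_pos
  simp only [size, formulaSize, structSize]
  omega

theorem nDom_le_size : Φ.nDom ≤ Φ.size := by
  simp only [size, structSize]
  omega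

/-- Quantified variables are paid for by their quantifiers, free variables by their occurrences in
atoms. -/
theorem nVar_le_size : Φ.nVar ≤ Φ.size := by
  have h1 : ∀ l : List (Σ R : Fin Φ.nRel, Fin (Φ.arity R) → Fin Φ.nVar),
      {x | ∃ a ∈ l, ∃ p, a.2 p = x}.ncard ≤ (l.map fun a => 1 + Φ.arity a.1).sum := by
    intro l
    induction l with
    | nil => simp
    | cons a l ih =>
      have e : {x | ∃ b ∈ a :: l, ∃ p, b.2 p = x} =
          Set.range a.2 ∪ {x | ∃ b ∈ l, ∃ p, b.2 p = x} := by
        ext x; simp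
      have h2 : (Set.range a.2).ncard ≤ Φ.arity a.1 := by
        rw [← Set.image_univ]
        refine (Set.ncard_image_le Set.finite_univ).trans ?_
        simp [Set.ncard_univ]
      rw [e, List.map_cons, List.sum_cons]
      have := Set.ncard_union_le (Set.range a.2) {x | ∃ b ∈ l, ∃ p, b.2 p = x}
      omega
  have h2 : (Φ.quantifiedᶜ).card ≤ {x | ∃ a ∈ Φ.atoms, ∃ p, a.2 p = x}.ncard := by
    rw [← Set.ncard_coe_finset]
    exact Set.ncard_le_ncard (fun x hx => Φ.free_occurs x (by simpa using hx)) (Set.toFinite _)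
  have h3 := Finset.card_add_card_compl Φ.quantified
  rw [Fintype.card_fin] at h3
  have := h1 Φ.atoms
  simp only [size, formulaSize]
  omega

end Query

namespace Fn
open Alg

namespace Expr

variable {Γ : List Ty} {L : ℕ} (Φ : Query)

theorem bd_readAllE (env : Env Γ) (hL : Φ.size ≤ L) :
    (readAllE : Expr Γ (.list .factor)).Bd L Φ.encode env := by
  have hN : (Φ.encode.getD 2 0) ≤ L := by rw [Φ.encode_two]; exact Φ.nVar_le_size.trans hL
  have hm : (Φ.encode.getD 3 0) ≤ L := by
    rw [Φ.encode_three]; exact Φ.length_atoms_lt_size.le.trans hL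
  have hm' : (List.range (Φ.encode.getD 3 0)).reverse.length = Φ.atoms.length := by
    rw [Φ.encode_three]; simp
  refine ⟨bd_fold_range trivial (by simp [Bd, atomPosE]) hm fun _ _ => by
      simp [Bd, nextPosE, relPosE],
    bd_trivE trivial hN, ⟨trivial, hm⟩, ⟨by simp [Bd, atomPosE], trivial⟩, ?_, ?_⟩
  · exact (hm'.trans_le (Φ.length_atoms_lt_size.le.trans hL))
  -- The positions must be followed exactly: the numbers read from the word are an arity and a
  -- number of tuples, and thus bounded by the size, only if the reading position is the beginning
  -- of an atom.
  refine foldBd_of_inv (fun j (acc : ℕ × List Factor) => acc.1 =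
    Φ.atomsPos + ((Φ.atoms.take j).flatMap Φ.atomCode).length) _ _ 0 ?_ ?_
  · show atomPos Φ.encode = _
    rw [Φ.atomPos_encode]
    simp
  intro j acc x _ hj hacc
  have hj' : j < Φ.atoms.length := by
    rw [Nat.zero_add] at hj
    exact hj.trans_eq hm'
  have hsplit : Φ.atoms = Φ.atoms.take j ++ Φ.atoms[j] :: Φ.atoms.drop (j + 1) := by simp
  have i0 := Φ.encode_relInfo Φ.atoms[j].1 (q := 0) (by omega)
  have i1 := Φ.encode_relInfo Φ.atoms[j].1 (q := 1) (by omega)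
  rw [← Φ.relPos_encode hsplit, ← hacc] at i0 i1
  refine ⟨⟨by simp [Bd, nextPosE, relPosE], ⟨by simp [Bd, relPosE], bd_parseAtomP hN ?_ ?_⟩,
    trivial⟩, ?_⟩
  · refine (le_of_eq i0).trans ((Φ.arity_le_size (List.getElem_mem hj')).trans hL)
  · refine (le_of_eq i1).trans ((Φ.length_rel_le_size _).trans hL)
  · show nextPos Φ.encode acc.1 = _
    rw [hacc, Φ.nextPos_encode hsplit, ← List.take_succ_eq_append_getElem hj']

theorem bd_freeE (env : Env Γ) (hL : Φ.size ≤ L) :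
    (freeE : Expr Γ .row).Bd L Φ.encode env := by
  have hN : (Φ.encode.getD 2 0) ≤ L := by rw [Φ.encode_two]; exact Φ.nVar_le_size.trans hL
  exact bd_tabE trivial hN fun x a => by simp [Bd]

/-- A bound for the number of gates that one round adds. -/
noncomputable def growth : ℕ :=
  Φ.size ^ (1 + Φ.quantifiedStarSize) *
    (Φ.size ^ (1 + Φ.quantifiedStarSize) * (Φ.nVar * 2 + 1) + 2)

theorem facBd_of_hasStars {st : List Factor × List GCode} (h : StateOK Φ.nVar Φ.nDom st)
    (hS : HasStars Φ st) (hL : Φ.size ≤ L) (l : ℕ) :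
    FacBd L (Φ.size ^ (1 + Φ.quantifiedStarSize)) (fac st.1 l) := by
  by_cases hl : l < st.1.length
  · have hf := h.fac l hl
    refine ⟨hf.patLength.trans_le (Φ.nVar_le_size.trans hL), hS.length_le Φ h hl, fun r hr => ?_,
      fun r hr x => ?_⟩
    · exact (hf.proper.1 r hr).trans_le (Φ.nVar_le_size.trans hL)
    · exact (hf.le r hr x).trans (Φ.nDom_le_size.trans hL)
  · have : fac st.1 l = (0, ([], [])) := by
      rw [fac, List.getD_eq_default _ _ (by omega)]
    rw [this]
    exact ⟨Nat.zero_le _, Nat.zero_le _, by simp [Short], by simp⟩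

/-- The bound on the rows holds in every round with the same value, thanks to the stars. So each
round adds at most `growth Φ` gates, and the number of gates is linear in the number of rounds. -/
theorem bd_iterate_step (hΦ : Φ.IsAcyclic) (hL : Φ.size ≤ L)
    (hR : Φ.size ^ (1 + Φ.quantifiedStarSize) ≤ L) (hM : 1 + Φ.atoms.length * growth Φ ≤ L)
    (t : ℕ) (ht : t ≤ Φ.atoms.length) :
    ((Alg.step Φ.nVar (freeFlags Φ.encode))^[t] (start Φ.encode)).2.length ≤ 1 + t * growth Φ ∧
      (t < Φ.atoms.length → stepP.Bd L Φ.encode ((Φ.nVar, freeFlags Φ.encode,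
        (Alg.step Φ.nVar (freeFlags Φ.encode))^[t] (start Φ.encode)), ())) := by
  have hN := Φ.nVar_le_size.trans hL
  have hfr : (freeFlags Φ.encode).length ≤ L := by
    rw [freeFlags, length_tab, Φ.encode_two]; exact hN
  have key : ∀ t < Φ.atoms.length,
      ((Alg.step Φ.nVar (freeFlags Φ.encode))^[t] (start Φ.encode)).2.length ≤ 1 + t * growth Φ →
      stepP.Bd L Φ.encode ((Φ.nVar, freeFlags Φ.encode,
        (Alg.step Φ.nVar (freeFlags Φ.encode))^[t] (start Φ.encode)), ()) ∧
      ((Alg.step Φ.nVar (freeFlags Φ.encode))^[t + 1] (start Φ.encode)).2.length ≤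
        1 + (t + 1) * growth Φ := by
    intro t ht hG
    obtain ⟨h1, h2, h3, -⟩ := iterate_step (fr := freeFlags Φ.encode) (stateOK_start Φ hΦ)
      (hasStars_start Φ hΦ) (fun st h hA hP => hP.step Φ h hA) t
      (ht.le.trans (card_act_start Φ).ge)
    have hlen : (start Φ.encode).1.length = Φ.atoms.length + 1 := (readAll_spec Φ).1
    have hm := Φ.length_atoms_lt_size
    have hg : (t + 1) * growth Φ ≤ Φ.atoms.length * growth Φ := Nat.mul_le_mul_right _ ht
    rw [Function.iterate_succ_apply']
    generalize (Alg.step Φ.nVar (freeFlags Φ.encode))^[t] (start Φ.encode) = st at *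
    obtain ⟨fs, G⟩ := st
    rw [Nat.add_mul, one_mul] at hg ⊢
    simp only at hG h3
    obtain ⟨g1, g2⟩ := bd_stepP (w := Φ.encode) (fr := freeFlags Φ.encode) (G := G) hN hfr
      (h3.trans_le (hlen.trans_le (by omega))) (facBd_of_hasStars Φ h1 h2 hL) hR
      (show G.length + growth Φ ≤ L by omega)
    exact ⟨g1, g2.trans (show G.length + growth Φ ≤ _ by omega)⟩
  have hG : ∀ t ≤ Φ.atoms.length,
      ((Alg.step Φ.nVar (freeFlags Φ.encode))^[t] (start Φ.encode)).2.length
        ≤ 1 + t * growth Φ := by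
    intro t
    induction t with
    | zero => intro _; simp [start]
    | succ t ih => intro ht; exact (key t ht (ih (by omega))).2
  exact ⟨hG t ht, fun h => (key t h (hG t ht)).1⟩

theorem bd_runE (hΦ : Φ.IsAcyclic) (env : Env Γ) (hL : Φ.size ≤ L)
    (hR : Φ.size ^ (1 + Φ.quantifiedStarSize) ≤ L) (hM : 1 + Φ.atoms.length * growth Φ ≤ L) :
    (runE : Expr Γ (.prod (.list .factor) .gates)).Bd L Φ.encode env := by
  have hm' : (List.range (Φ.encode.getD 3 0)).reverse.length = Φ.atoms.length := by
    rw [Φ.encode_three]; simp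
  refine ⟨bd_freeE Φ env hL, ⟨trivial, ?_⟩, ⟨bd_readAllE Φ _ hL, ⟨trivial, trivial, trivial⟩,
    trivial⟩, ?_, ?_⟩
  · show Φ.encode.getD 3 0 ≤ L
    rw [Φ.encode_three]; exact Φ.length_atoms_lt_size.le.trans hL
  · exact hm'.trans_le (Φ.length_atoms_lt_size.le.trans hL)
  refine foldBd_of_inv (fun j st => st =
    (Alg.step Φ.nVar (freeFlags Φ.encode))^[j] (start Φ.encode)) _ _ 0 ?_ ?_
  · simp only [eval, eval_readAllE]
    rfl
  intro j st x _ hj hst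
  have hj' : j < Φ.atoms.length := by
    rw [Nat.zero_add] at hj
    exact hj.trans_eq hm'
  have e : Expr.eval Φ.encode (.read (.lit 2) : Expr Γ .nat) env = Φ.nVar := Φ.encode_two
  refine ⟨⟨⟨trivial, trivial, trivial⟩, ?_⟩, ?_⟩
  · have := (bd_iterate_step Φ hΦ hL hR hM j hj'.le).2 hj'
    rw [← hst, ← Φ.encode_two] at this
    simp only [eval, eval_freeE]
    exact this
  · rw [Function.iterate_succ_apply', ← hst, eval_stepE]
    simp only [eval, eval_freeE]
    rw [← Φ.encode_two]

theorem length_run_le (hΦ : Φ.IsAcyclic) :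
    (run Φ.encode).2.length ≤ 1 + Φ.atoms.length * growth Φ := by
  rw [run_eq]
  -- The claim does not mention `L`; any number above the three required bounds will do.
  exact (bd_iterate_step Φ (L := Φ.size + Φ.size ^ (1 + Φ.quantifiedStarSize) +
    (1 + Φ.atoms.length * growth Φ)) hΦ (by omega) (by omega) (by omega) _ le_rfl).1

theorem bd_run_fac (hΦ : Φ.IsAcyclic) (hL : Φ.size ≤ L)
    (hR : Φ.size ^ (1 + Φ.quantifiedStarSize) ≤ L) : (run Φ.encode).1.length ≤ L ∧
      (fac (run Φ.encode).1 0).2.2.length ≤ L := by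
  obtain ⟨h1, h2, h3, -⟩ := iterate_step (fr := freeFlags Φ.encode) (stateOK_start Φ hΦ)
    (hasStars_start Φ hΦ) (fun st h hA hP => hP.step Φ h hA) Φ.atoms.length
    (card_act_start Φ).ge
  rw [← run_eq] at h1 h2 h3
  have hlen : (start Φ.encode).1.length = Φ.atoms.length + 1 := (readAll_spec Φ).1
  have hm := Φ.length_atoms_lt_size
  exact ⟨by omega, (facBd_of_hasStars Φ h1 h2 le_rfl 0).length.trans hR⟩

theorem bd_resultGateE {l : Expr Γ (.list .factor)} {env : Env Γ} {w : List ℕ}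
    (hl : l.Bd L w env) (h1 : (l.eval w env : List Factor).length ≤ L)
    (h2 : (fac (l.eval w env) 0).2.2.length ≤ L) : (resultGateE l).Bd L w env := by
  refine bd_fold (bd_facE hl trivial h1) trivial ?_ fun _ _ _ => trivial
  simp only [eval, eval_facE]
  exact h2

theorem length_useAll (g : ℕ) (G : List GCode) : (useAll g G).length = 3 * G.length + 1 := by
  have key : ∀ (l : List ℕ) (acc : ℕ × List GCode),
      (l.foldl (useStep G.length) acc).2.length = acc.2.length + 2 * l.length := by
    intro l
    induction l with
    | nil => simp
    | cons x l ih =>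
      intro acc
      rw [List.foldl_cons, ih]
      simp only [useStep, List.length_cons]
      omega
  rw [useAll, key]
  simp
  omega

theorem bd_useAllP {w : List ℕ} {g : ℕ} {G : List GCode} (h : 3 * G.length + 1 ≤ L) :
    useAllP.Bd L w ((g, G), ()) := by
  have hlen : Expr.eval w (len (.snd v0) : Expr [.prod .nat .gates] .nat) ((g, G), ()) =
      G.length := eval_len w _ _
  refine And.left (bd_fold_grow (u := .prod .nat .gates) GAcc 2 L (G.length + 1) ?_ ?_ ?_ ?_ ?_
    fun m acc x _ hm hacc => ?_)
  · exact ⟨bd_len trivial (show G.length ≤ L by omega), hlen.trans_le (show G.length ≤ L by omega)⟩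
  · exact ⟨trivial, ⟨trivial, trivial, trivial⟩, trivial⟩
  · simp only [eval, hlen, List.length_reverse, List.length_range]
    omega
  · exact le_rfl
  · simp only [eval, hlen, List.length_reverse, List.length_range]
    omega
  · have hl : acc.2.length ≤ L := le_trans hacc (by omega)
    refine ⟨⟨⟨bd_len trivial hl, trivial⟩, ⟨trivial, trivial, bd_len trivial hl⟩, ⟨trivial,
      bd_len trivial (show G.length ≤ L by omega), trivial⟩, trivial⟩, ?_⟩
    exact Nat.add_le_add_right hacc 2

theorem bd_circuitE (hΦ : Φ.IsAcyclic) (hL : Φ.size ≤ L)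
    (hR : Φ.size ^ (1 + Φ.quantifiedStarSize) ≤ L)
    (hM : 3 * (1 + Φ.atoms.length * growth Φ) + 1 ≤ L) : circuitE.Bd L Φ.encode () := by
  have hG := length_run_le Φ hΦ
  have hr := bd_run_fac Φ hΦ hL hR
  refine ⟨bd_runE Φ hΦ _ hL hR (by omega), ⟨⟨?_, trivial⟩, ?_⟩, trivial, ?_, ?_⟩
  · refine bd_resultGateE trivial ?_ ?_ <;> simp only [eval, eval_runE]
    · exact hr.1
    · exact hr.2
  · rw [eval_runE]
    exact bd_useAllP (by simp only [eval, Var.get]; omega)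
  · simp only [eval, eval_useAllE, eval_runE]
    refine (length_useAll _ _).trans_le (by simp only [Var.get]; omega)
  · exact foldBd_of_forall fun _ _ _ => by simp [Bd]

theorem bd_mulNatP {w : List ℕ} {B a b : ℕ} (hB : B ≤ L) : mulNatP.Bd L w ((B, a, b), ()) := by
  have h : (List.foldl (fun acc _ => powStep acc) ((1, a), []) (List.range B).reverse).2.length
      = B := by
    rw [foldl_range_const]
    induction B with
    | zero => rfl
    | succ B ih =>
      rw [Function.iterate_succ_apply', powStep]
      simp [ih (by omega)]
  refine bd_fold (bd_fold_range trivial ⟨⟨trivial, trivial⟩, trivial⟩ hB fun _ _ => by simp [Bd])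
    ⟨trivial, trivial⟩ (h.trans_le hB) fun _ _ _ => by simp [Bd]

theorem length_gateVals_fold (B : ℕ) (l : List GCode) (vs : List ℕ) :
    (l.foldl (fun vs g => (gateVal B vs g :: vs.reverse).reverse) vs).length =
      vs.length + l.length := by
  induction l generalizing vs with
  | nil => simp
  | cons g l ih => rw [List.foldl_cons, ih]; simp; omega

theorem bd_gateValsP {w : List ℕ} {G : List GCode} (h : G.length ≤ L) :
    gateValsP.Bd L w (G, ()) := by
  have e : (Expr.eval w (rev v0 : Expr [.gates] .gates) (G, ()) : List GCode) = G.reverse :=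
    eval_rev w _ _
  refine And.left (bd_fold_grow (u := .row) (fun m (vs : List ℕ) => vs.length ≤ m) 1 L 0 ?_ ?_ ?_
    ?_ ?_ fun m vs g _ hm hvs => ?_)
  · exact bd_rev trivial h
  · exact trivial
  · rw [e, List.length_reverse]; exact h
  · exact le_rfl
  · rw [e, List.length_reverse]; omega
  · have hl : vs.length ≤ L := le_trans hvs (by omega)
    have hb : ∀ i : Expr [.prod .nat (.prod .row .gate)] .nat,
        i.Bd L w ((G.length, vs, g), ()) →
        (nth (.fst (.snd v0)) i).Bd L w ((G.length, vs, g), ()) := fun i hi =>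
      bd_nth trivial hi hl
    have hg : gateValP.Bd L w ((G.length, vs, g), ()) :=
      ⟨trivial, trivial, trivial, trivial, trivial, trivial, trivial, trivial,
        ⟨hb _ trivial, hb _ trivial⟩, ⟨trivial, hb _ trivial, hb _ trivial⟩, bd_mulNatP h⟩
    refine ⟨bd_rev ⟨⟨⟨bd_len trivial h, trivial, trivial⟩, ?_⟩, bd_rev trivial hl⟩ ?_, ?_⟩
    · simp only [eval, eval_len]
      exact hg
    · simp only [eval, eval_rev, List.length_cons, List.length_reverse]
      exact le_trans (Nat.add_le_add_right hvs 1) hm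
    · simp only [eval, eval_rev, List.length_cons, List.length_reverse]
      exact Nat.add_le_add_right hvs 1

theorem bd_countE (hΦ : Φ.IsAcyclic) (hL : Φ.size ≤ L)
    (hR : Φ.size ^ (1 + Φ.quantifiedStarSize) ≤ L)
    (hM : 3 * (1 + Φ.atoms.length * growth Φ) + 1 ≤ L) : countE.Bd L Φ.encode () := by
  have hG := length_run_le Φ hΦ
  have hr := bd_run_fac Φ hΦ hL hR
  refine ⟨bd_runE Φ hΦ _ hL hR (by omega), bd_nth ⟨trivial, ?_⟩ ?_ ?_, trivial⟩
  · rw [eval_runE]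
    exact bd_gateValsP (by simp only [eval, Var.get]; omega)
  · refine bd_resultGateE trivial ?_ ?_ <;> simp only [eval, eval_runE]
    · exact hr.1
    · exact hr.2
  · simp only [eval_gateValsE, eval, eval_runE, gateVals, Var.get]
    rw [length_gateVals_fold]
    simp
    omega

end Expr
end Fn
end ACQ

namespace ACQ
namespace Alg

/-! ### The output -/

theorem getD_map_range {β : Type*} (f : ℕ → β) (d : β) {n k : ℕ} (hk : k < n) :
    ((List.range n).map f).getD k d = f k := by
  simp [List.getD_eq_getElem?_getD, hk]

section
variable {M : Type*} [CommSemiring M] {X : ℕ → M} {ok : M → Prop} {D : ℕ}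

/-- The gate list has the latest gate first, and `gv` looks values up by recursion, while circuits
and the counting program collect values in a list from the front. This translates one into the
other, for any evaluation `F` that is right on admissible gates whose second factor, if any, is
`ok`. -/
theorem Grow.foldl_eq {F : List M → GCode → M}
    (hF : ∀ G g, GateOK D G.length g → (g.1 = 3 → ok (gv X G g.2.2)) →
      F ((List.range G.length).map (gv X G)) g = gval X (gv X G) g) {H : List GCode}
    (h : Grow X ok D [] H) :
    H.reverse.foldl (fun vs g => vs ++ [F vs g]) [] = (List.range H.length).map (gv X H) := by
  induction h with
  | refl => rfl
  | @cons G g h hg hm ih =>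
    rw [List.reverse_cons, List.foldl_append, ih, List.foldl_cons, List.foldl_nil, hF G g hg hm,
      List.length_cons, List.range_succ, List.map_append, List.map_singleton, gv_cons_length]
    congr 1
    exact List.map_congr_left fun k hk => (gv_cons_lt g (List.mem_range.1 hk)).symm

end

/-- The gate with a given code. -/
def toGate (D : ℕ) (g : GCode) : Gate ℕ D :=
  if g.1 = 0 then .const g.2.1 else if g.1 = 1 then
    if h : g.2.1 < D then .var ⟨g.2.1, h⟩ else .const 0
  else if g.1 = 2 then .add g.2.1 g.2.2 else .mul g.2.1 g.2.2

theorem GateOK.children_lt {D n : ℕ} {g : GCode} (h : GateOK D n g) :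
    ∀ j ∈ (toGate D g).children, j < n := by
  rcases h with h | ⟨h, h'⟩ | ⟨h | h, h1, h2⟩ <;> simp [toGate, Gate.children, *]

theorem GateOK.emitStep {D n : ℕ} {g : GCode} (h : GateOK D n g) (l : List ℕ) :
    emitStep l g = (toGate D g).encode ++ l := by
  rcases h with h | ⟨h, h'⟩ | ⟨h | h, h1, h2⟩ <;> simp [toGate, Alg.emitStep, Gate.encode, *]

/-- The variables as polynomials. -/
noncomputable def polyVar (F : Type*) [CommSemiring F] (D d : ℕ) : MvPolynomial (Fin D) F :=
  if h : d < D then MvPolynomial.X ⟨d, h⟩ else 0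

section
variable {D : ℕ} {H : List GCode}

theorem Grow.values_eq (F : Type*) [CommSemiring F]
    (h : Grow (polyVar F D) (fun _ => True) D [] H) :
    Circuit.values ((H.reverse.map (toGate D)).map (Gate.map (Nat.cast : ℕ → F))) =
      (List.range H.length).map (gv (polyVar F D) H) := by
  rw [Circuit.values, List.map_map, List.foldl_map]
  refine Grow.foldl_eq (F := fun vs g => (Gate.map Nat.cast (toGate D g)).eval vs) ?_ h
  intro G g hg _
  rcases hg with h | ⟨h, h'⟩ | ⟨h | h, h1, h2⟩
  · simp [toGate, gval, h, Gate.map, Gate.eval]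
  · simp [toGate, gval, h, Gate.map, Gate.eval, polyVar, h']
  all_goals
    simp only [toGate, gval, h, Gate.map, Gate.eval]
    simp [h1, h2]

variable {M : Type*} [CommSemiring M] {X : ℕ → M}

theorem Grow.children_lt (h : Grow X (fun _ => True) D [] H) :
    ∀ i (hi : i < (H.reverse.map (toGate D)).length),
      ∀ j ∈ ((H.reverse.map (toGate D))[i]).children, j < i := by
  induction h with
  | refl => intro i hi; simp at hi
  | @cons G g h hg hm ih =>
    intro i hi j hj
    simp only [List.reverse_cons, List.map_append, List.getElem_append] at hj
    split_ifs at hj with h1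
    · exact ih i h1 j hj
    · have hi' : i = G.length := by
        simp only [List.length_map, List.length_reverse, List.length_cons] at hi h1
        omega
      rw [hi']
      exact hg.children_lt j (by simpa using hj)

theorem Grow.emit (h : Grow X (fun _ => True) D [] H) (l : List ℕ) :
    H.foldl emitStep l = (H.reverse.map (toGate D)).flatMap Gate.encode ++ l := by
  induction h generalizing l with
  | refl => simp
  | @cons G g h hg hm ih =>
    rw [List.foldl_cons, ih, hg.emitStep]
    simp

/-- The gate `k` is used by a gate of the list. -/
def Used (H : List GCode) (k : ℕ) : Prop :=
  ∃ g ∈ H, 2 ≤ g.1 ∧ (k = g.2.1 ∨ k = g.2.2)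

theorem Used.mono {k : ℕ} (h : Used H k) (g : GCode) : Used (g :: H) k :=
  h.imp fun _ h => ⟨List.mem_cons_of_mem _ h.1, h.2⟩

theorem Used.exists_gate {k : ℕ} (h : Used H k) :
    ∃ g ∈ H.reverse.map (toGate D), k ∈ g.children := by
  obtain ⟨g, hg, h2, hk⟩ := h
  refine ⟨toGate D g, List.mem_map_of_mem (List.mem_reverse.2 hg), ?_⟩
  rw [toGate, if_neg (by omega), if_neg (by omega)]
  split_ifs <;> simpa [Gate.children] using hk

/-- After the gates of `l` have been treated, a gate without successor can only be the current
output, the constant 0, or an old gate that is not in `l`. The constant 0 gets a successor with the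
first treated gate, hence the separate clause for nonempty `l`. -/
theorem foldl_useStep_spec {G : List GCode} {g : ℕ} (hg : g < G.length) (l : List ℕ)
    (hl : ∀ j ∈ l, j < G.length) :
    let R := l.foldl (useStep G.length) (g, (0, (0, 0)) :: G)
    Grow X (fun _ => True) D G R.2 ∧ R.1 < R.2.length ∧ G.length < R.2.length ∧
      gv X R.2 R.1 = gv X G g ∧ gv X R.2 G.length = 0 ∧
      (l ≠ [] → R.1 + 1 = R.2.length ∧ Used R.2 G.length) ∧
      ∀ k < R.2.length, k = R.1 ∨ Used R.2 k ∨ k = G.length ∨ k < G.length ∧ k ∉ l := by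
  induction l using List.reverseRecOn with
  | nil =>
    refine ⟨.cons _ .refl (Or.inl rfl) (by simp), ?_⟩
    simp only [List.foldl_nil, List.length_cons]
    refine ⟨by omega, by omega, gv_cons_lt _ hg, ?_, by simp, fun k hk => ?_⟩
    · rw [gv_cons_length]; simp [gval]
    · rcases Nat.lt_succ_iff_lt_or_eq.1 hk with h | h
      · exact Or.inr (Or.inr (Or.inr ⟨h, by simp⟩))
      · exact Or.inr (Or.inr (Or.inl h))
  | append_singleton l j ih =>
    have ih := ih fun i hi => hl i (by simp [hi])
    have hj := hl j (by simp)
    simp only [List.foldl_append, List.foldl_cons, List.foldl_nil] at ih ⊢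
    generalize List.foldl (useStep G.length) (g, (0, (0, 0)) :: G) l = R at ih ⊢
    obtain ⟨c, H⟩ := R
    obtain ⟨h1, h2, h3, h4, h5, -, h7⟩ := ih
    simp only at h1 h2 h3 h4 h5 h7
    simp only [useStep, List.length_cons]
    have hu : ∀ k, Used H k → Used ((2, (c, H.length)) :: (3, (G.length, j)) :: H) k :=
      fun k hk => (hk.mono _).mono _
    refine ⟨?_, by omega, by omega, ?_, ?_, fun _ => ⟨trivial, ?_⟩, fun k hk => ?_⟩
    · refine .cons _ (.cons _ h1 (Or.inr (Or.inr ⟨Or.inr rfl, h3, ?_⟩)) fun _ => trivial)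
        (Or.inr (Or.inr ⟨Or.inl rfl, ?_, ?_⟩)) fun _ => trivial
      · show j < H.length
        omega
      · show c < H.length + 1
        omega
      · simp
    · have e : H.length + 1 = ((3, (G.length, j)) :: H : List GCode).length := by simp
      rw [e, gv_cons_length]
      simp only [gval]
      rw [if_neg (by simp), if_neg (by simp), if_pos trivial, gv_cons_lt _ h2, gv_cons_length, h4]
      simp [gval, h5]
    · rw [gv_cons_lt _ (by simp; omega), gv_cons_lt _ h3, h5]
    · exact ⟨(3, (G.length, j)), by simp, by simp, Or.inl rfl⟩
    · rcases Nat.lt_succ_iff_lt_or_eq.1 hk with hk | hk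
      · rcases Nat.lt_succ_iff_lt_or_eq.1 hk with hk | hk
        · rcases h7 k hk with h | h | h | ⟨h, h'⟩
          · exact Or.inr (Or.inl ⟨(2, (c, H.length)), by simp, by simp, Or.inl h⟩)
          · exact Or.inr (Or.inl (hu k h))
          · exact Or.inr (Or.inr (Or.inl h))
          · by_cases hkj : k = j
            · exact Or.inr (Or.inl ⟨(3, (G.length, j)), by simp, by simp, Or.inr hkj⟩)
            · exact Or.inr (Or.inr (Or.inr ⟨h, by simp [h', hkj]⟩))
        · exact Or.inr (Or.inl ⟨(2, (c, H.length)), by simp, by simp, Or.inr hk⟩)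
      · exact Or.inl hk

theorem useAll_spec {G : List GCode} {g : ℕ} (hg : g < G.length) :
    Grow X (fun _ => True) D G (useAll g G) ∧ 0 < (useAll g G).length ∧
      gv X (useAll g G) ((useAll g G).length - 1) = gv X G g ∧
      ∀ k, k + 1 < (useAll g G).length → Used (useAll g G) k := by
  obtain ⟨h1, h2, -, h4, -, h6, h7⟩ := foldl_useStep_spec (X := X) (D := D) hg
    (List.range G.length).reverse (by simp)
  obtain ⟨h8, h9⟩ := h6 (by rw [Ne, List.reverse_eq_nil_iff, List.range_eq_nil]; omega)
  refine ⟨h1, by rw [useAll]; omega, ?_, fun k hk => ?_⟩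
  · rw [useAll, ← h8, Nat.add_sub_cancel]
    exact h4
  · rw [useAll] at hk ⊢
    rcases h7 k (by omega) with h | h | h | ⟨h, h'⟩
    · omega
    · exact h
    · rw [h]; exact h9
    · exact absurd (by simpa using h) h'

end

variable (Φ : Query)

/-- The gates are produced one after the other. -/
theorem grow_run {M : Type*} [CommSemiring M] (X : ℕ → M) (hΦ : Φ.IsAcyclic) :
    Grow X (fun _ => True) Φ.nDom [] (run Φ.encode).2 := by
  rw [run_eq]
  refine (iterate_step (fr := freeFlags Φ.encode) (stateOK_start Φ hΦ)
    (P := fun st => Grow X (fun _ => True) Φ.nDom [] st.2)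
    (.cons _ .refl (Or.inl rfl) (by simp)) ?_ Φ.atoms.length (card_act_start Φ).ge).2.1
  rintro ⟨fs, G⟩ h hA hP
  obtain ⟨i, j, hp, ⟨hl, hs⟩ | ⟨hl, hs⟩⟩ := step_cases (fr := freeFlags Φ.encode) h.fac h.ctl hA
  · rw [hs]
    exact hP.trans (qMerge_spec (fun s hs => ⟨(h.fac i hp.hi).gate s hs, trivial⟩)
      (h.fac j hp.hj).gate).1
  · rw [hs]
    exact hP.trans (sMerge_spec (fun _ => trivial) (h.fac i hp.hi) (h.fac j hp.hj)
      fun _ _ => trivial).1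

/-- The gate list is produced without reference to a field, and its constants are natural numbers.
Evaluating the same list over each field separately gives the polynomial over that field. -/
theorem exists_circuit (hΦ : Φ.IsAcyclic) : ∃ C : Circuit ℕ Φ.nDom,
    circuitOut Φ.encode = C.encode ∧
      ∀ (F : Type*) [Field F], (C.map (Nat.cast : ℕ → F)).poly = Φ.Q F := by
  set G := useAll (resultGate (run Φ.encode).1) (run Φ.encode).2 with hG
  -- The shape of the circuit does not depend on the semiring, so its structural properties are
  -- taken from an arbitrary one.
  have hr := (run_spec Φ (fun _ => (0 : ℕ)) hΦ).2.1
  obtain ⟨u1, u2, -, u4⟩ := useAll_spec (X := fun _ => (0 : ℕ)) (D := Φ.nDom) hr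
  have g1 := (grow_run Φ _ hΦ).trans u1
  refine ⟨⟨G.reverse.map (toGate Φ.nDom), ?_, g1.children_lt, ?_⟩, ?_, ?_⟩
  · rw [Ne, List.map_eq_nil_iff, List.reverse_eq_nil_iff]
    exact List.length_pos_iff.1 u2
  · intro j hj
    exact (u4 j (by simpa using hj)).exists_gate
  · rw [circuitOut, g1.emit]
    simp [Circuit.encode]
    rfl
  · intro F _
    obtain ⟨v1, v2, v3, -⟩ := useAll_spec (X := polyVar F Φ.nDom) (D := Φ.nDom) hr
    rw [Circuit.poly, Circuit.map]
    simp only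
    rw [((grow_run Φ _ hΦ).trans v1).values_eq F]
    simp only [List.length_map, List.length_reverse]
    rw [getD_map_range _ _ (show G.length - 1 < G.length from Nat.sub_lt v2 one_pos), v3,
      (run_spec Φ (polyVar F Φ.nDom) hΦ).2.2, Query.Q]
    refine Finset.sum_congr rfl fun a _ => Finset.prod_congr rfl fun x _ => ?_
    simp [polyVar]

end Alg
end ACQ

namespace ACQ
namespace Alg

/-! ### Counting -/

/-- The list contains the pairs (2^i, 2^i * a) for `i < B`, the greatest first. Subtracting powers
greedily, in the form of adding them up as long as `b` is not exceeded, reads off the binary digits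
of `b`; the second components add up to the product. -/
theorem mulNat_eq {B a b : ℕ} (hb : b < 2 ^ B) : mulNat B a b = a * b := by
  have key : ∀ n : ℕ, (powStep^[n] ((1, a), [])).1 = (2 ^ n, 2 ^ n * a) ∧
      ∀ u b : ℕ, u ≤ b → b < u + 2 ^ n → (powStep^[n] ((1, a), [])).2.foldl
        (fun acc p => if acc.1 + p.1 ≤ b then (acc.1 + p.1, acc.2 + p.2) else acc) (u, u * a) =
          (b, b * a) := by
    intro n
    induction n with
    | zero =>
      refine ⟨by simp, fun u b h1 h2 => ?_⟩
      obtain rfl : u = b := by rw [pow_zero] at h2; omega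
      rfl
    | succ n ih =>
      rw [Function.iterate_succ_apply', powStep, ih.1]
      refine ⟨by simp only [Prod.mk.injEq]; constructor <;> ring, fun u b h1 h2 => ?_⟩
      rw [List.foldl_cons]
      simp only
      rw [pow_succ] at h2
      split_ifs with h
      · rw [← Nat.add_mul]
        exact ih.2 _ b h (by omega)
      · exact ih.2 _ b h1 (by omega)
  have := (key B).2 0 b (Nat.zero_le _) (by omega)
  rw [Nat.zero_mul] at this
  rw [mulNat, foldl_range_const, this, mul_comm]

/-- Multiplication by doubling is run with as many rounds as there are gates, so it is correct for
gates whose second factor is below 2 to that number. This is the condition `ok` carried by `Grow`.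
-/
theorem gateVals_eq {D : ℕ} {G : List GCode}
    (h : Grow (fun _ => 1) (fun v : ℕ => v < 2 ^ G.length) D [] G) :
    gateVals G = (List.range G.length).map (gv (fun _ => 1) G) := by
  refine Eq.trans ?_ (Grow.foldl_eq (F := gateVal G.length) ?_ h)
  · rw [gateVals]
    simp only [List.reverse_cons, List.reverse_reverse]
  · intro H g hg hm
    rcases hg with h | ⟨h, h'⟩ | ⟨h | h, h1, h2⟩
    · simp [gateVal, gval, h]
    · simp [gateVal, gval, h]
    · simp [gateVal, gval, h, h1, h2]
    · simp only [gateVal, gval, h, getD_map_range _ _ h1, getD_map_range _ _ h2]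
      simp [mulNat_eq (hm h)]

/-- At the all-ones point the monomials are 1, so this is a sum of as many terms as there are
compatible rows, and a number is at most 2 to itself. -/
theorem sumVal_le {N b : ℕ} {W : List ℕ} {P : List TRow} {G : List GCode}
    (hP : ∀ p ∈ P, gv (fun _ => 1) G p.2 ≤ 2 ^ b) (r : List ℕ) :
    sumVal (fun _ => (1 : ℕ)) N W P G r ≤
      2 ^ ((P.filter fun p => Compat N r p.1).length + b) := by
  have h1 : ∀ n, varOf (fun _ => (1 : ℕ)) n = 1 := fun n => by cases n <;> rfl
  simp only [sumVal, h1, ite_self, Finset.prod_const_one, mul_one]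
  refine (List.sum_le_card_nsmul _ (2 ^ b) ?_).trans ?_
  · intro v hv
    obtain ⟨p, hp, rfl⟩ := List.mem_map.1 hv
    exact hP p (List.mem_of_mem_filter hp)
  · rw [List.length_map, smul_eq_mul, pow_add]
    exact Nat.mul_le_mul_right _ (Nat.lt_two_pow_self).le

/-- The values of the gates at the all-ones point are bounded. -/
structure Potential (D B : ℕ) (st : List Factor × List GCode) : Prop where
  one : gv (fun _ => (1 : ℕ)) st.2 0 = 1
  grow : st.2.length ≤ B → Grow (fun _ => 1) (fun v : ℕ => v < 2 ^ B) D [] st.2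
  bound : ∃ β : ℕ → ℕ, ∑ l ∈ Finset.range st.1.length, β l < st.2.length ∧
    ∀ l < st.1.length, ∀ r ∈ (fac st.1 l).2.2, gv (fun _ => (1 : ℕ)) st.2 r.2 ≤ 2 ^ β l

/-- The exponents of all tables add up to less than the number of gates. Merging moves the exponent
of `i` to `j`, and an increase by `d` is covered by at least `d` new gates. -/
theorem bound_replace {N D : ℕ} {fs : List Factor} {G G' : List GCode} {ok : ℕ → Prop} {i j : ℕ}
    (h : StateOK N D (fs, G)) (hp : Picked fs i j)
    (hg : Grow (fun _ => (1 : ℕ)) ok D G G') (h1 : gv (fun _ => (1 : ℕ)) G 0 = 1)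
    {β : ℕ → ℕ} (hβ : ∑ l ∈ Finset.range fs.length, β l < G.length)
    (hv : ∀ l < fs.length, ∀ r ∈ (fac fs l).2.2, gv (fun _ => (1 : ℕ)) G r.2 ≤ 2 ^ β l)
    {f : Factor} {d : ℕ} (hd : G.length + d ≤ G'.length)
    (hf : ∀ r ∈ f.2.2, gv (fun _ => (1 : ℕ)) G' r.2 ≤ 2 ^ (β j + (d + β i))) :
    ∃ β' : ℕ → ℕ, ∑ l ∈ Finset.range (replace N fs i j f).length, β' l < G'.length ∧
      ∀ l < (replace N fs i j f).length, ∀ r ∈ (fac (replace N fs i j f) l).2.2,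
        gv (fun _ => (1 : ℕ)) G' r.2 ≤ 2 ^ β' l := by
  refine ⟨Function.update (Function.update β j (β j + (d + β i))) i 0, ?_, ?_⟩
  · rw [length_replace]
    have hi : i ∈ Finset.range fs.length := Finset.mem_range.2 hp.hi
    have hj : j ∈ (Finset.range fs.length).erase i :=
      Finset.mem_erase.2 ⟨hp.ne.symm, Finset.mem_range.2 hp.hj⟩
    rw [← Finset.add_sum_erase _ _ hi, ← Finset.add_sum_erase _ _ hj] at hβ ⊢
    rw [Function.update_self, Function.update_of_ne hp.ne.symm, Function.update_self]
    rw [Finset.sum_congr rfl (g := fun l => β l) fun l hl => ?_]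
    · omega
    · rw [Function.update_of_ne (Finset.ne_of_mem_erase (Finset.mem_of_mem_erase hl)),
        Function.update_of_ne (Finset.ne_of_mem_erase hl)]
  · intro l hl r hr
    rw [length_replace] at hl
    rw [fac_replace N fs i j f hl] at hr
    by_cases hli : l = i
    · rw [if_pos hli] at hr
      obtain rfl : r = (zeros N, 0) := by simpa [trivialFactor] using hr
      rw [hg.gv_eq h.pos]
      exact h1.trans_le (Nat.one_le_two_pow)
    · rw [if_neg hli] at hr
      rw [Function.update_of_ne hli]
      by_cases hlj : l = j
      · rw [if_pos hlj] at hr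
        rw [hlj, Function.update_self]
        exact hf r hr
      · rw [if_neg hlj] at hr
        rw [Function.update_of_ne hlj, hg.gv_eq ((h.fac l hl).gate r hr)]
        exact hv l hl r hr

/-- In a join the values multiply, so the exponents add. In a sum the exponent grows by at most the
number of compatible rows, and each of these rows has produced a gate. Since exponents stay below
the number of gates, all second factors are below 2^B as long as there are at most `B` gates; `B`
will be the final number. -/
theorem Potential.step {N D B : ℕ} {fr : List ℕ} {st : List Factor × List GCode}
    (h : StateOK N D st) (hA : (act st.1).Nonempty) (hP : Potential D B st) :
    Potential D B (step N fr st) := by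
  obtain ⟨fs, G⟩ := st
  obtain ⟨h1, hG, β, hβ, hv⟩ := hP
  simp only at h1 hG hβ hv
  obtain ⟨i, j, hp, ⟨hl, hs⟩ | ⟨hl, hs⟩⟩ := step_cases (fr := fr) h.fac h.ctl hA
  all_goals
    have hβi : β i < G.length := (Finset.single_le_sum (fun _ _ => Nat.zero_le _)
      (Finset.mem_range.2 hp.hi)).trans_lt hβ
    have hpos : 0 < G.length := h.pos
    have fi : FacOK N D G.length (Alg.fac fs i) := h.fac i hp.hi
    have fj : FacOK N D G.length (Alg.fac fs j) := h.fac j hp.hj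
    rw [hs]
  · have hq : ∀ B, G.length ≤ B → _ := fun B hB => qMerge_spec (X := fun _ => (1 : ℕ))
      (ok := fun v => v < 2 ^ B) (D := D) (N := N) (fr := fr)
      (fun s hs => ⟨fi.gate s hs, (hv i hp.hi s hs).trans_lt
        (Nat.pow_lt_pow_right one_lt_two (hβi.trans_le hB))⟩) fj.gate
    obtain ⟨q1, -, -, -, q5⟩ := hq G.length le_rfl
    refine ⟨(q1.gv_eq hpos).trans h1, fun hB => ?_, ?_⟩
    · have hB' := q1.length_le.trans hB
      exact (hG hB').trans (hq B hB').1
    · refine bound_replace h hp q1 h1 hβ hv (d := 0) q1.length_le fun q hq => ?_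
      obtain ⟨-, r, hr, s, hs, -, -, e⟩ := q5 q hq
      refine (le_of_eq e).trans ?_
      rw [Nat.zero_add, pow_add]
      exact Nat.mul_le_mul (hv j hp.hj r hr) (hv i hp.hi s hs)
  · have hsum := sumVal_le (N := N) (W := (Alg.fac fs j).2.1) (P := proj N fr (Alg.fac fs i).2.2)
      (G := G) (b := β i) fun p hp' => by
        obtain ⟨s, hs, rfl⟩ := (proj_spec N fr (Alg.fac fs i).2.2).2.2.2 p hp'
        exact hv i hp.hi s hs
    have hT := sMerge_spec (X := fun _ => (1 : ℕ)) (ok := fun _ => True) (fr := fr)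
      (fun _ => trivial) fi fj (fun _ _ => trivial)
    obtain ⟨s1, -, s3, -, s5⟩ := hT
    have hle := s1.length_le
    refine ⟨(s1.gv_eq hpos).trans h1, fun hB => ?_, ?_⟩
    · have hB' := hle.trans hB
      refine (hG hB').trans (sMerge_spec (X := fun _ => (1 : ℕ)) (fr := fr) (fun _ => ?_)
        fi fj fun r hr => ?_).1
      · exact Nat.one_lt_two_pow (by omega)
      · refine (hsum r.1).trans_lt (Nat.pow_lt_pow_right one_lt_two ?_)
        have := s3 r hr
        have hB2 : (sMerge N fr (Alg.fac fs j).2.1 (Alg.fac fs i).2.2 (Alg.fac fs j).2.2 G).2.length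
          ≤ B := hB
        omega
    · refine bound_replace h hp s1 h1 hβ hv
        -- The number of new gates in the whole round serves as `d`: it is an upper bound on the
        -- number of compatible rows for every row of `j` at once.
        (d := (sMerge N fr (Alg.fac fs j).2.1 (Alg.fac fs i).2.2 (Alg.fac fs j).2.2 G).2.length -
          G.length) (by omega) fun q hq => ?_
      obtain ⟨-, r, hr, -, e⟩ := s5 q hq
      rw [e, pow_add]
      refine Nat.mul_le_mul (hv j hp.hj r hr) ((hsum r.1).trans
        (Nat.pow_le_pow_right two_pos ?_))
      have := s3 r hr
      omega

theorem potential_start (Φ : Query) (B : ℕ) : Potential Φ.nDom B (start Φ.encode) := by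
  have hv : ∀ k, gv (fun _ => (1 : ℕ)) (start Φ.encode).2 k ≤ 1 := by
    intro k
    simp only [start, gv, gval]
    split_ifs <;> simp
  refine ⟨by simp [start, gv, gval], fun _ => .cons _ .refl (Or.inl rfl) (by simp),
    fun _ => 0, by simp [start], fun l _ r _ => by simpa using hv r.2⟩

theorem countOut_encode (Φ : Query) (hΦ : Φ.IsAcyclic) :
    countOut Φ.encode = [Φ.result.card] := by
  obtain ⟨-, h2, -, -⟩ := iterate_step (fr := freeFlags Φ.encode) (stateOK_start Φ hΦ)
    (potential_start Φ (run Φ.encode).2.length) (fun st h hA hP => hP.step h hA) Φ.atoms.length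
    (card_act_start Φ).ge
  rw [← run_eq] at h2
  obtain ⟨-, r2, r3⟩ := run_spec Φ (fun _ => (1 : ℕ)) hΦ
  rw [countOut, gateVals_eq (h2.grow le_rfl), getD_map_range _ _ r2, r3]
  simp

end Alg
end ACQ

/-! ### The running time as a power of the size. -/

namespace ACQ

open Alg Fn.Expr in
/-- A program runs in time polynomial in the bound of its loops. -/
theorem outputsWithin_program (e : Fn.Expr [] (.list .nat)) (Φ : Query) (hΦ : Φ.IsAcyclic)
    (hBd : ∀ L, Φ.size ≤ L → Φ.size ^ (1 + Φ.quantifiedStarSize) ≤ L →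
      3 * (1 + Φ.atoms.length * growth Φ) + 1 ≤ L →
      e.Bd L Φ.encode () ∧ (e.eval Φ.encode () : List ℕ).length ≤ 3 * L) :
    RAM.OutputsWithin (Fn.program e) Φ.encode
      (Φ.size ^ ((11 * e.wt + 16) * max Φ.quantifiedStarSize 1)) (e.eval Φ.encode ()) := by
  -- A tree has a node and its label is an edge, so an acyclic query has an atom. Hence the size is
  -- at least 2, which allows constants to be absorbed into powers of the size.
  have hm : 0 < Φ.atoms.length := by
    obtain ⟨m, T, lam, hT, h1, -, -⟩ := hΦ
    obtain ⟨t⟩ := hT.1.nonempty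
    obtain ⟨a, ha, -⟩ := h1 t
    exact List.length_pos_of_mem ha
  have hms := Φ.length_atoms_lt_size
  have hN := Φ.nVar_le_size
  have hs : 2 ≤ Φ.size := by omega
  simp only [growth] at hBd
  generalize Φ.size = s at *
  generalize Φ.quantifiedStarSize = k at *
  generalize Φ.atoms.length = m at *
  generalize Φ.nVar = N at *
  have hpow : ∀ {a b : ℕ}, a ≤ b → s ^ a ≤ s ^ b := fun h => Nat.pow_le_pow_right (by omega) h
  have hsR : s ≤ s ^ (1 + k) := by simpa using hpow (show 1 ≤ 1 + k by omega)
  -- With R = s^(1+k), one round adds at most R * R * s^3 gates; a factor `s` covers the number of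
  -- rounds and the initial gate, and s^2 ≥ 4 covers the factor 3 and the last summand. Altogether
  -- this is s^(2k+8).
  obtain ⟨h1, h2⟩ := hBd (s ^ (2 * k + 8)) (by simpa using hpow (show 1 ≤ 2 * k + 8 by omega))
    (hpow (by omega)) (by
      have e1 : s ^ (2 * k + 8) = s ^ (1 + k) * s ^ (1 + k) * s ^ 3 * s * s ^ 2 := by ring
      rw [e1]
      generalize s ^ (1 + k) = R at *
      have h3 : R * (N * 2 + 1) + 2 ≤ R * s ^ 3 := by
        have : N * 2 + 1 + 1 ≤ s ^ 3 := by nlinarith [Nat.mul_le_mul hs hs]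
        calc R * (N * 2 + 1) + 2 ≤ R * (N * 2 + 1) + R := by omega
          _ = R * (N * 2 + 1 + 1) := by ring
          _ ≤ _ := Nat.mul_le_mul_left _ this
      have h4 : R * (R * (N * 2 + 1) + 2) ≤ R * R * s ^ 3 := by
        rw [mul_assoc]; exact Nat.mul_le_mul_left _ h3
      generalize R * (R * (N * 2 + 1) + 2) = g at h4
      have h5 : 1 ≤ R * R * s ^ 3 :=
        Nat.mul_pos (Nat.mul_pos (by omega) (by omega)) (Nat.pow_pos (by omega))
      generalize R * R * s ^ 3 = x at h4 h5
      have h6 : 1 + m * g ≤ x * s := by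
        obtain ⟨s', rfl⟩ : ∃ s', s = s' + 1 := ⟨s - 1, by omega⟩
        nlinarith [Nat.mul_le_mul (show m ≤ s' by omega) h4]
      have h7 : 1 ≤ x * s := by omega
      have h8 : 4 ≤ s ^ 2 := by nlinarith
      nlinarith [Nat.mul_le_mul h6 h8])
  refine Fn.program_correct e Φ.encode _ ?_
  have hcost : e.cost Φ.encode () ≤ s ^ ((2 * k + 9) * e.wt) := by
    refine (Fn.Expr.cost_le _ _ e () h1).trans ?_
    rw [pow_mul]
    refine Nat.pow_le_pow_left ?_ _
    have : 2 ≤ s ^ (2 * k + 8) := hs.trans (by simpa using hpow (show 1 ≤ 2 * k + 8 by omega))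
    -- The summand 2 in the base L + 2 is absorbed by one more factor `s`.
    rw [show 2 * k + 9 = 2 * k + 8 + 1 by ring, pow_succ s (2 * k + 8)]
    have := Nat.mul_le_mul_left (s ^ (2 * k + 8)) hs
    omega
  have hout : 7 * (e.eval Φ.encode () : List ℕ).length + 2 ≤ s ^ (2 * k + 13) := by
    have h3 : 2 ^ 5 ≤ s ^ 5 := Nat.pow_le_pow_left hs 5
    have h4 : 1 ≤ s ^ (2 * k + 8) := Nat.one_le_pow _ _ (by omega)
    rw [show 2 * k + 13 = 2 * k + 8 + 5 by ring, pow_add]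
    have := Nat.mul_le_mul_left (s ^ (2 * k + 8)) h3
    omega
  rw [add_assoc]
  -- It remains to compare exponents: 2k + 9 ≤ 11 max(k, 1) for the cost, and 2k + 13 + 1 ≤ 16
  -- max(k, 1) for the output loop and the addition. The maximum with 1 is what absorbs the
  -- constants when k = 0.
  refine (Fn.Expr.add_le_pow hs hcost hout).trans (hpow ?_)
  have h3 : 2 * k + 9 ≤ 11 * max k 1 := by omega
  have h4 := Nat.mul_le_mul_right e.wt h3
  have h5 : (11 * e.wt + 16) * max k 1 = 11 * max k 1 * e.wt + 16 * max k 1 := by ring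
  omega

theorem Alg.length_emit_le (H : List Alg.GCode) (l : List ℕ) :
    (H.foldl Alg.emitStep l).length ≤ l.length + 3 * H.length := by
  induction H generalizing l with
  | nil => simp
  | cons g H ih =>
    rw [List.foldl_cons]
    refine (ih _).trans ?_
    simp only [Alg.emitStep, List.length_cons]
    split_ifs <;> simp only [List.length_cons] <;> omega

theorem Fn.Expr.length_eval_circuitE_le (Φ : Query) (hΦ : Φ.IsAcyclic) {L : ℕ}
    (hM : 3 * (1 + Φ.atoms.length * growth Φ) + 1 ≤ L) :
    (circuitE.eval Φ.encode () : List ℕ).length ≤ 3 * L := by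
  rw [eval_circuitE, Alg.circuitOut]
  refine (Alg.length_emit_le _ _).trans ?_
  rw [length_useAll]
  have := length_run_le Φ hΦ
  simp only [List.length_nil]
  omega

end ACQ

theorem theorem3 :
    (∃ (P : ACQ.RAM.Program) (c : ℕ), ∀ Φ : ACQ.Query, Φ.IsAcyclic →
      ∃ C : ACQ.Circuit ℕ Φ.nDom,
        ACQ.RAM.OutputsWithin P Φ.encode (Φ.size ^ (c * max Φ.quantifiedStarSize 1)) C.encode ∧
        ∀ (F : Type*) [Field F], (C.map (Nat.cast : ℕ → F)).poly = Φ.Q F) ∧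
    (∃ (P : ACQ.RAM.Program) (c : ℕ), ∀ Φ : ACQ.Query, Φ.IsAcyclic →
      ACQ.RAM.OutputsWithin P Φ.encode (Φ.size ^ (c * max Φ.quantifiedStarSize 1))
        [Φ.result.card]) := by
  constructor
  · refine ⟨ACQ.Fn.program ACQ.Fn.Expr.circuitE, 11 * ACQ.Fn.Expr.circuitE.wt + 16, fun Φ hΦ => ?_⟩
    obtain ⟨C, hC, hQ⟩ := ACQ.Alg.exists_circuit Φ hΦ
    refine ⟨C, ?_, hQ⟩
    rw [← hC, ← ACQ.Fn.Expr.eval_circuitE]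
    exact ACQ.outputsWithin_program ACQ.Fn.Expr.circuitE Φ hΦ fun L h1 h2 h3 =>
      ⟨ACQ.Fn.Expr.bd_circuitE Φ hΦ h1 h2 h3, ACQ.Fn.Expr.length_eval_circuitE_le Φ hΦ h3⟩
  · refine ⟨ACQ.Fn.program ACQ.Fn.Expr.countE, 11 * ACQ.Fn.Expr.countE.wt + 16, fun Φ hΦ => ?_⟩
    rw [← ACQ.Alg.countOut_encode Φ hΦ, ← ACQ.Fn.Expr.eval_countE]
    refine ACQ.outputsWithin_program ACQ.Fn.Expr.countE Φ hΦ fun L h1 h2 h3 =>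
      ⟨ACQ.Fn.Expr.bd_countE Φ hΦ h1 h2 h3, ?_⟩
    rw [ACQ.Fn.Expr.eval_countE, ACQ.Alg.countOut_encode Φ hΦ]
    simp only [List.length_singleton]
    omega
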